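/- Let $N\ge 2$ and let $C_N$ be the cyclic quiver with vertex set $I=\mathbb Z/N\mathbb Z$ and exactly one arrow $k\to k+1$ for each $k\in I$. **Roots and $\mathfrak n^{\epsilon}(C_N)$.** Let $e$ be the Euler form on $\mathbb Z[I]$, $e(i,j)=\delta_{ij}-\#\{\text{arrows } i\to j\}$, let $\langle\alpha,\beta\rangle=e(\alpha,\beta)+e(\beta,\alpha)$, $\epsilon(\alpha,\beta)=(-1)^{e(\alpha,\beta)}$, and $\delta=(1,\dots,1)$. The positive real roots are the $\alpha\in\mathbb Z_+[I]$ with $\langle\alpha,\alpha\rangle=2$; the positive imaginary roots are the $n\delta$, $n\ge1$; $R_+$ is the set of all of these. For $i\in I$ and $l\ge 1$ with $N\nmid l$ let $\alpha_{i,l}\in\mathbb Z_+[I]$ be the vector whose $k$-th coordinate is the number of $m\in\{0,\dots,l-1\}$ with $i+m\equiv k \pmod N$. The space $\mathfrak n^{\epsilon}(C_N)$ has one basis vector $\tilde e_\alpha$ for every positive real root $\alpha$ and a copy $\mathfrak n^\epsilon_{n\delta}$ of $\mathbb C[I]/\mathbb C\delta$ for every $n\ge 1$; the image in $\mathfrak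 n^\epsilon_{n\delta}$ of $h\in\mathbb C[I]$ is denoted $h(n)$. Its bracket is $$[\tilde e_\alpha,\tilde e_\beta]=\begin{cases}\epsilon(\alpha,\beta)\tilde e_{\alpha+\beta}&\text{if }\alpha+\beta\text{ is a real root},\\ \epsilon(\alpha,\beta)\,\alpha(k)&\text{if }\alpha+\beta=k\delta,\\ 0&\text{otherwise},\end{cases}\qquad [h(n),\tilde e_\alpha]=-[\tilde e_\alpha,h(n)]=\epsilon(n\delta,\alpha)\langle h,\alpha\rangle\tilde e_{\alpha+n\delta},\qquad [h(n),h'(m)]=0 .$$ **Hall algebra and $\mathfrak n^*(C_N)$.** Let $E_\alpha^{nil}$ be the variety of nilpotent representations of $C_N$ on $\mathbb C^\alpha$ (those on which all sufficiently long oriented paths act by $0$), and let $\mathcal L(C_N)=\bigoplus_{\alpha\in\mathbb Z_+[I]}\mathcal L_\alpha$, where $\mathcal L_\alpha$ is the space of constructible functions $E_\alpha^{nil}\to\mathbb C$ that are constant on isomorphism classes. It carries the product $$(f_\alpha * g_\beta)(x)=\sum_{c\in\mathbb C}c\;\chi_c\bigl\{W\subset(\mathbb C^{\alpha+\beta},x)\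 \text{a subobject}:\ \dim W=\alpha,\ f_\alpha(W)\,g_\beta(\mathbb C^{\alpha+\beta}/W)=c\bigr\},$$ where $\chi_c$ is the Euler characteristic with compact support of a constructible subset of a product of Grassmannians, and the bracket $[f,g]=f*g-g*f$. Let $E_i$ be the characteristic function of the simple representation at $i$, and let $\mathfrak n^*(C_N)\subset\mathcal L(C_N)$ be the Lie subalgebra generated by the $E_i$, $i\in I$. **The map $\Xi$.** Let $\mathfrak n(C_N)$ be the complex Lie algebra with generators $e_i$, $i\in I$, and the Serre relations $\mathrm{ad}(e_i)^{1-\langle i,j\rangle}e_j=0$, $i\ne j$. There are a surjective homomorphism $\Xi^\epsilon:\mathfrak n(C_N)\to\mathfrak n^\epsilon(C_N)$ with $e_i\mapsto\tilde e_i$, a homomorphism $\Xi^*:\mathfrak n(C_N)\to\mathfrak n^*(C_N)$ with $e_i\mapsto E_i$, and a unique linear map $\Xi_{C_N}:\mathfrak n^\epsilon(C_N)\to\mathfrak n^*(C_N)$ with $\Xi_{C_N}\circ\Xi^\epsilon=\Xi^*$ (that is, $\Xi_{C_N}=\Xi^*\circ(\Xi^\epsilon)^{-1}$). It is a surjective homomorphism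 of Lie algebras. **Indecomposables and signs.** For $l\ge1$ let $P_{i,l}$ be the nilpotent representation with basis $b_0,\dots,b_{l-1}$, $b_m$ at the vertex $i+m$, on which the arrows act by $b_m\mapsto b_{m+1}$, $b_{l-1}\mapsto0$. It is indecomposable, of dimension $\alpha_{i,l}$ if $N\nmid l$ and $n\delta$ if $l=nN$. Every positive real root is $\alpha_{i,l}$ for exactly one pair $(i,l)$ with $N\nmid l$, and the set $\mathcal T_{n\delta}$ of isomorphism classes of indecomposable nilpotent representations of dimension $n\delta$ consists of the $N$ distinct classes $[P_{i,nN}]$, $i\in I$. For $\alpha\in R_+$ put $\xi(\alpha)=(-1)^{1+\dim\mathrm{Hom}(P,P)}$, where $P$ is any indecomposable nilpotent representation of dimension $\alpha$; this does not depend on $P$, and $\xi(\alpha_{i,l})=(-1)^{[l/N]}$, $\xi(n\delta)=(-1)^{n+1}$. Let $E_{i,l}\in\mathcal L(C_N)$ be the characteristic function of $[P_{i,l}]$, and put $\tilde E_{i,l}=\xi(\dim P_{i,l})\,E_{i,l}$. **Theorem.** For all $i\in I$: $$\Xi_{C_N}(\tilde e_{\alpha_{i,l}})=\tilde E_{i,l}=(-1)^{[l/N]}E_{i,l}\quad(l\ge1,\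 N\nmid l),\qquad \Xi_{C_N}(\alpha_{i,1}(n))=\tilde E_{i,nN}-\tilde E_{i+1,nN}\quad(n\ge1).$$ Consequently, for every $n\ge1$, $$\Xi_{C_N}(\mathfrak n^\epsilon_{n\delta})=\Bigl\{f:\mathcal T_{n\delta}\to\mathbb C\ \Bigm|\ \sum_{i\in I}f([P_{i,nN}])=0\Bigr\},$$ where a function on $\mathcal T_{n\delta}$ is regarded as a function of degree $n\delta$ that vanishes on decomposable representations. -/

import Mathlib

open scoped Topology

noncomputable section

/-! # Euler characteristic with compact support -/

namespace AlexanderSpanier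

variable (X : Type) [TopologicalSpace X]

/-- Complex-valued Alexander–Spanier cochains of degree `p`: arbitrary functions on `X^(p+1)`. -/
abbrev Cochain (X : Type) (p : ℕ) : Type := (Fin (p + 1) → X) → ℂ

/-- `φ` vanishes on `U^(p+1)` for some neighbourhood `U` of `x`, i.e. `x` is outside the support
of `φ`. -/
def LocallyZeroAt {X : Type} [TopologicalSpace X] {p : ℕ} (φ : Cochain X p) (x : X) : Prop :=
  ∃ U ∈ 𝓝 x, ∀ v : Fin (p + 1) → X, (∀ k, v k ∈ U) → φ v = 0

/-- The cochains with empty support. -/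
def locallyZero (p : ℕ) : Submodule ℂ (Cochain X p) where
  carrier := {φ | ∀ x, LocallyZeroAt φ x}
  zero_mem' := fun _ => ⟨Set.univ, Filter.univ_mem, fun _ _ => rfl⟩
  add_mem' := by
    intro φ ψ hφ hψ x
    obtain ⟨U, hU, h⟩ := hφ x
    obtain ⟨U', hU', h'⟩ := hψ x
    refine ⟨U ∩ U', Filter.inter_mem hU hU', fun v hv => ?_⟩
    simp [h v fun k => (hv k).1, h' v fun k => (hv k).2]
  smul_mem' := by
    intro c φ hφ x
    obtain ⟨U, hU, h⟩ := hφ x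
    exact ⟨U, hU, fun v hv => by simp [h v hv]⟩

/-- The cochains with compact support. -/
def compactSupp (p : ℕ) : Submodule ℂ (Cochain X p) where
  carrier := {φ | ∃ K : Set X, IsCompact K ∧ ∀ x, x ∉ K → LocallyZeroAt φ x}
  zero_mem' := ⟨∅, isCompact_empty, fun _ _ => ⟨Set.univ, Filter.univ_mem, fun _ _ => rfl⟩⟩
  add_mem' := by
    rintro φ ψ ⟨K, hK, h⟩ ⟨K', hK', h'⟩
    refine ⟨K ∪ K', hK.union hK', fun x hx => ?_⟩
    obtain ⟨U, hU, h⟩ := h x fun hk => hx (Or.inl hk)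
    obtain ⟨U', hU', h'⟩ := h' x fun hk => hx (Or.inr hk)
    refine ⟨U ∩ U', Filter.inter_mem hU hU', fun v hv => ?_⟩
    simp [h v fun k => (hv k).1, h' v fun k => (hv k).2]
  smul_mem' := by
    rintro c φ ⟨K, hK, h⟩
    refine ⟨K, hK, fun x hx => ?_⟩
    obtain ⟨U, hU, h⟩ := h x hx
    exact ⟨U, hU, fun v hv => by simp [h v hv]⟩

/-- The coboundary `(dφ)(x₀, …, x_{p+1}) = ∑ (-1)^k φ(x₀, …, x̂ₖ, …, x_{p+1})`. -/
def coboundary (p : ℕ) : Cochain X p →ₗ[ℂ] Cochain X (p + 1) where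
  toFun φ v := ∑ k : Fin (p + 2), (-1 : ℂ) ^ (k : ℕ) * φ fun j => v (k.succAbove j)
  map_add' φ ψ := by
    funext v
    simp [mul_add, Finset.sum_add_distrib]
  map_smul' c φ := by
    funext v
    simp [Finset.mul_sum, mul_left_comm]

/-- Compactly supported cochains that are cocycles modulo locally zero cochains. -/
def cocycles (p : ℕ) : Submodule ℂ (Cochain X p) :=
  compactSupp X p ⊓ (locallyZero X (p + 1)).comap (coboundary X p)

/-- Locally zero cochains plus coboundaries of compactly supported cochains. -/
def coboundaries : (p : ℕ) → Submodule ℂ (Cochain X p)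
  | 0 => locallyZero X 0
  | p + 1 => locallyZero X (p + 1) ⊔ (compactSupp X p).map (coboundary X p)

/-- Alexander–Spanier cohomology with compact supports and complex coefficients. For the locally
compact, second countable Hausdorff spaces it is used for, it is the usual `H_c^p(X; ℂ)`. -/
abbrev Cohomology (p : ℕ) : Type :=
  cocycles X p ⧸ (coboundaries X p).comap (cocycles X p).subtype

/-- `χ_c(X) = ∑ (-1)^p dim H_c^p(X; ℂ)` for a locally compact space `X`. -/
def eulerChar : ℤ := ∑ᶠ p : ℕ, (-1 : ℤ) ^ p * (Module.finrank ℂ (Cohomology X p) : ℤ)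

end AlexanderSpanier

section ConstructibleEuler

variable {X : Type} [TopologicalSpace X]

/-- The points of `S` at which `S` is not locally closed in `X`. It is empty iff `S` is locally
closed. -/
def nonLocallyClosedPart (S : Set X) : Set X := S ∩ closure (closure S \ S)

/-- Euler characteristic with compact support of a constructible set `S`, extended additively from
locally closed sets by means of the canonical partition of `S` into the locally closed sets
`S_k \ S_(k+1)`, where `S_0 = S` and `S_(k+1)` consists of the points where `S_k` is not locally
closed. If `S` is locally closed this is `χ_c(S)`. -/
def eulerCharC (S : Set X) : ℤ :=
  ∑ᶠ k : ℕ, AlexanderSpanier.eulerChar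
    ↥(nonLocallyClosedPart^[k] S \ nonLocallyClosedPart^[k + 1] S)

end ConstructibleEuler

/-- The Grassmannian of `d`-dimensional subspaces of `V`. -/
def Gr (d : ℕ) (V : Type) [AddCommGroup V] [Module ℂ V] : Type :=
  {W : Submodule ℂ V // Module.finrank ℂ W = d}

/-- The span of a linearly independent `d`-tuple, as a point of the Grassmannian. -/
def Gr.ofFrame (d : ℕ) (V : Type) [AddCommGroup V] [Module ℂ V]
    (b : {b : Fin d → V // LinearIndependent ℂ b}) : Gr d V :=
  ⟨Submodule.span ℂ (Set.range b.1), by simpa using finrank_span_eq_card b.2⟩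

/-- The classical topology of the Grassmannian: the quotient topology from the space of linearly
independent `d`-tuples. -/
instance (d : ℕ) (V : Type) [AddCommGroup V] [Module ℂ V] [TopologicalSpace V] :
    TopologicalSpace (Gr d V) :=
  TopologicalSpace.coinduced (Gr.ofFrame d V) inferInstance

/-! # Representations of a quiver -/

/-- A finite-dimensional complex representation of the quiver `I`. -/
structure QRep (I : Type) [Quiver.{0} I] where
  V : I → Type
  [addCommGroup : ∀ i, AddCommGroup (V i)]
  [module : ∀ i, Module ℂ (V i)]
  [finite : ∀ i, FiniteDimensional ℂ (V i)]
  map : ∀ {a b : I}, (a ⟶ b) → V a →ₗ[ℂ] V b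

attribute [instance] QRep.addCommGroup QRep.module QRep.finite

namespace QRep

variable {I : Type} [Quiver.{0} I]

/-- The composite of the structure maps along an oriented path. -/
def act (M : QRep I) {a : I} : {b : I} → Quiver.Path a b → (M.V a →ₗ[ℂ] M.V b)
  | _, .nil => LinearMap.id
  | _, .cons p h => M.map h ∘ₗ act M p

/-- All sufficiently long paths act by zero. -/
def IsNilp (M : QRep I) : Prop :=
  ∃ n : ℕ, ∀ (a b : I) (p : Quiver.Path a b), p.length = n → M.act p = 0

def dim (M : QRep I) : I → ℕ := fun i => Module.finrank ℂ (M.V i)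

/-- Existence of an isomorphism of representations. -/
def IsIso (M M' : QRep I) : Prop :=
  ∃ φ : ∀ i, M.V i ≃ₗ[ℂ] M'.V i,
    ∀ (a b : I) (h : a ⟶ b) (v : M.V a), φ b (M.map h v) = M'.map h (φ a v)

/-- A graded subspace stable under the structure maps, i.e. a subobject. -/
def IsStable (M : QRep I) (W : ∀ i, Submodule ℂ (M.V i)) : Prop :=
  ∀ (a b : I) (h : a ⟶ b), W a ≤ (W b).comap (M.map h)

def sub (M : QRep I) (W : ∀ i, Submodule ℂ (M.V i)) (hW : M.IsStable W) : QRep I where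
  V i := ↥(W i)
  map {a b} h := (M.map h).restrict (hW a b h)

def quot (M : QRep I) (W : ∀ i, Submodule ℂ (M.V i)) (hW : M.IsStable W) : QRep I where
  V i := M.V i ⧸ W i
  map {a b} h := (W a).mapQ (W b) (M.map h) (hW a b h)

/-- Nonzero, and not the direct sum of two nonzero subobjects. -/
def IsIndec (M : QRep I) : Prop :=
  M.dim ≠ 0 ∧ ∀ U W : ∀ i, Submodule ℂ (M.V i), M.IsStable U → M.IsStable W →
    (∀ i, IsCompl (U i) (W i)) → (∀ i, U i = ⊥) ∨ (∀ i, W i = ⊥)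

/-- The space of endomorphisms of a representation. -/
def endSpace (M : QRep I) : Submodule ℂ (∀ i, Module.End ℂ (M.V i)) where
  carrier := {φ | ∀ (a b : I) (h : a ⟶ b) (v : M.V a), φ b (M.map h v) = M.map h (φ a v)}
  zero_mem' := by intro a b h v; simp
  add_mem' := by
    intro φ ψ hφ hψ a b h v
    simp [hφ a b h v, hψ a b h v]
  smul_mem' := by
    intro c φ hφ a b h v
    simp [hφ a b h v]

/-- The sign `(-1)^(1 + dim Hom(M, M))`. -/
def xiSign (M : QRep I) : ℂ := (-1) ^ (1 + Module.finrank ℂ M.endSpace)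

/-- The simple representation at the vertex `i`. -/
def simple (i : I) : QRep I where
  V j := PLift (j = i) → ℂ
  map _ := 0

end QRep

/-! # Constructible functions and the convolution product -/

section Hall

variable (I : Type) [Quiver.{0} I]

/-- The affine space `E_α = ⊕_h Hom(ℂ^(α_Out(h)), ℂ^(α_In(h)))`. -/
abbrev RepSpace (α : I → ℕ) : Type :=
  ∀ a b : I, (a ⟶ b) → ((Fin (α a) → ℂ) →ₗ[ℂ] (Fin (α b) → ℂ))

variable {I}

/-- The representation `(ℂ^α, x)`. -/
def stdRep {α : I → ℕ} (x : RepSpace I α) : QRep I where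
  V i := Fin (α i) → ℂ
  map {a b} h := x a b h

/-- The nilpotent locus `E_α^nil`. -/
def NilSpace (α : I → ℕ) : Type := {x : RepSpace I α // (stdRep x).IsNilp}

def NilSpace.rep {α : I → ℕ} (x : NilSpace α) : QRep I := stdRep x.1

/-- The matrix entries of a point of `E_α`. -/
def entries {α : I → ℕ} (x : RepSpace I α) :
    (Σ a b : I, (a ⟶ b) × Fin (α b) × Fin (α a)) → ℂ :=
  fun s => x s.1 s.2.1 s.2.2.1 (Pi.single s.2.2.2.2 1) s.2.2.2.1

/-- Constructible subsets of the affine space `E_α`: the Boolean algebra of sets generated by the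
zero sets of polynomials in the matrix entries. -/
def IsConstructibleSet {α : I → ℕ} (S : Set (RepSpace I α)) : Prop :=
  S ∈ BooleanSubalgebra.closure
    {Z : Set (RepSpace I α) | ∃ p : MvPolynomial (Σ a b : I, (a ⟶ b) × Fin (α b) × Fin (α a)) ℂ,
      Z = {x | MvPolynomial.eval (entries x) p = 0}}

variable (I) in
/-- Families, indexed by `α`, of functions on `E_α^nil`. -/
abbrev HallFun : Type := ∀ α : I → ℕ, NilSpace (I := I) α → ℂ

variable (I) in
/-- `𝓛(Q) = ⊕_α M_{G_α}(E_α^nil)`: families with finitely many nonzero members, each of them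
constructible and `G_α`-invariant (that is, constant on isomorphism classes). -/
def hallSpace : Set (HallFun I) :=
  {f | {α | f α ≠ 0}.Finite ∧
    (∀ (α : I → ℕ) (x y : NilSpace α), x.rep.IsIso y.rep → f α x = f α y) ∧
    (∀ α : I → ℕ, (Set.range (f α)).Finite ∧
      ∀ c : ℂ, ∃ S : Set (RepSpace I α), IsConstructibleSet S ∧
        ∀ x : NilSpace α, f α x = c ↔ x.1 ∈ S)}

open Classical in
/-- The characteristic function of the isomorphism class of `M`. -/
def charFun (M : QRep I) : HallFun I := fun _ x => if x.rep.IsIso M then 1 else 0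

/-- For `x ∈ E_γ^nil`: the set of subobjects `W` of `(ℂ^γ, x)` of dimension `α`, with quotient of
dimension `β`, such that `f(W) g(ℂ^γ / W) = c`, as a subset of a product of Grassmannians. -/
def hallFiber (f g : HallFun I) (α β : I → ℕ) {γ : I → ℕ} (x : NilSpace γ) (c : ℂ) :
    Set (∀ i, Gr (α i) (Fin (γ i) → ℂ)) :=
  {W | ∃ hW : (stdRep x.1).IsStable (fun i => (W i).1), ∃ (y : NilSpace α) (z : NilSpace β),
    y.rep.IsIso ((stdRep x.1).sub _ hW) ∧ z.rep.IsIso ((stdRep x.1).quot _ hW) ∧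
      f α y * g β z = c}

variable [Fintype I] [DecidableEq I]

/-- The convolution product: in degree `γ` it is the sum over `γ = α + β` of the push-forward
`x ↦ ∑_c c · χ({W | f(W) g(ℂ^γ / W) = c})`. -/
def hallMul (f g : HallFun I) : HallFun I := fun γ x =>
  ∑ α ∈ Finset.Iic γ, ∑ᶠ c : ℂ, c * (eulerCharC (hallFiber f g α (γ - α) x c) : ℂ)

def hallBracket (f g : HallFun I) : HallFun I := hallMul f g - hallMul g f

variable (I) in
/-- `𝔫*(Q)`, the Lie subalgebra generated by the `E_i`: the smallest linear subspace that contains the functions `E_i` and is closed under the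
bracket. -/
def nStar : Submodule ℂ (HallFun I) :=
  sInf {S | (∀ i, charFun (QRep.simple i) ∈ S) ∧ ∀ f ∈ S, ∀ g ∈ S, hallBracket f g ∈ S}

/-- `E_i` as an element of `𝔫*(Q)`. -/
def nStar.gen (i : I) : nStar I :=
  ⟨charFun (QRep.simple i), by
    simp only [nStar, Submodule.mem_sInf]
    exact fun S hS => hS.1 i⟩

/-- Isomorphism classes of indecomposable nilpotent representations of dimension `α`. -/
def IndecClass (α : I → ℕ) : Type :=
  Quot fun x y : {x : NilSpace α // x.rep.IsIndec} => x.1.rep.IsIso y.1.rep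

open Classical in
/-- A function on the isomorphism classes of indecomposables of dimension `α`, viewed as a function
that vanishes on decomposables and in all degrees other than `α`. -/
def extendIndec (α : I → ℕ) (φ : IndecClass α → ℂ) : HallFun I := fun β x =>
  if h : ∃ e : β = α, (e ▸ x : NilSpace α).rep.IsIndec then φ (Quot.mk _ ⟨h.1 ▸ x, h.2⟩) else 0

end Hall

/-! # Euler form and the Lie algebra given by the Serre relations -/

section Serre

variable (I : Type) [Quiver.{0} I] [Fintype I] [DecidableEq I] [∀ a b : I, Fintype (a ⟶ b)]

/-- `e(i, j) = δ_ij - #{arrows from i to j}`. -/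
def eulerMatrix (i j : I) : ℤ := (if i = j then 1 else 0) - (Fintype.card (i ⟶ j) : ℤ)

variable {I} in
/-- The Euler form. -/
def eulerForm (α β : I → ℕ) : ℤ := ∑ i, ∑ j, (α i : ℤ) * eulerMatrix I i j * (β j : ℤ)

/-- The Cartan matrix `⟨i, j⟩ = e(i, j) + e(j, i)`. For a quiver without loops it is `2` on the
diagonal and minus the number of edges joining `i` and `j` off the diagonal. -/
def cartan (i j : I) : ℤ := eulerMatrix I i j + eulerMatrix I j i

variable {I} in
/-- The Cartan form. -/
def cartanForm (α β : I → ℕ) : ℤ := ∑ i, ∑ j, (α i : ℤ) * cartan I i j * (β j : ℤ)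

/-- The ideal generated by the Serre relations `ad(e_i)^(1 - a_ij) e_j = 0`, `i ≠ j`. -/
def serreIdeal : LieIdeal ℂ (FreeLieAlgebra ℂ I) :=
  LieSubmodule.lieSpan ℂ (FreeLieAlgebra ℂ I)
    {z | ∃ i j : I, i ≠ j ∧ z = ((LieAlgebra.ad ℂ (FreeLieAlgebra ℂ I) (FreeLieAlgebra.of ℂ i)) ^
      (1 - cartan I i j).toNat) (FreeLieAlgebra.of ℂ j)}

/-- The Lie algebra `𝔫(Q)`. -/
abbrev NSerre : Type := FreeLieAlgebra ℂ I ⧸ serreIdeal I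

variable {I} in
/-- The generator `e_i` of `𝔫(Q)`. -/
def NSerre.gen (i : I) : NSerre I := LieSubmodule.Quotient.mk (FreeLieAlgebra.of ℂ i)

end Serre

/-! # The cyclic quiver -/

namespace CyclicQuiver

/-- The cyclic quiver `C_N`: vertices `ℤ/N`, and one arrow `k → k + 1` for each `k`. -/
instance quiver (N : ℕ) : Quiver.{0} (ZMod N) where
  Hom i j := PLift (j = i + 1)

instance (N : ℕ) (i j : ZMod N) : Fintype (i ⟶ j) :=
  inferInstanceAs (Fintype (PLift (j = i + 1)))

theorem card_hom (N : ℕ) (i j : ZMod N) : Fintype.card (i ⟶ j) = if j = i + 1 then 1 else 0 := by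
  change Fintype.card (PLift (j = i + 1)) = _
  split_ifs with h
  · exact Fintype.card_eq_one_iff.2 ⟨⟨h⟩, fun _ => rfl⟩
  · exact Fintype.card_eq_zero_iff.2 ⟨fun x => h x.down⟩

/-- The vector counting the elements of `i, i + 1, …, i + l - 1` modulo `N`; it is the root
`α_{i,l}` when `N ∤ l`, and `nδ` when `l = nN`. -/
def arc {N : ℕ} (i : ZMod N) (l : ℕ) : ZMod N → ℕ :=
  fun k => ((Finset.range l).filter fun m : ℕ => i + (m : ZMod N) = k).card

/-- The indecomposable `P_{i,l}`: a basis `b_0, …, b_{l-1}` with `b_m` in degree `i + m`, and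
`x b_m = b_{m+1}`, `x b_{l-1} = 0` (a single nilpotent Jordan block). -/
def P {N : ℕ} (i : ZMod N) (l : ℕ) : QRep (ZMod N) where
  V j := {m : Fin l // i + ((m : ℕ) : ZMod N) = j} → ℂ
  map {a b} h :=
    { toFun := fun v m =>
        if hm : 0 < (m.1 : ℕ) then
          v ⟨⟨(m.1 : ℕ) - 1, by have := m.1.2; omega⟩, by
            have h1 : b = a + 1 := h.down
            have h2 := m.2
            have h3 : (((m.1 : ℕ) - 1 : ℕ) : ZMod N) = ((m.1 : ℕ) : ZMod N) - 1 := by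
              rw [Nat.cast_sub hm, Nat.cast_one]
            simp only [h3]
            rw [← add_sub_assoc, h2, h1, add_sub_cancel_right]⟩
        else 0
      map_add' := by
        intro u v
        funext m
        simp only [Pi.add_apply]
        split_ifs <;> simp
      map_smul' := by
        intro c v
        funext m
        simp only [Pi.smul_apply, RingHom.id_apply]
        split_ifs <;> simp }

/-- `E_{i,l}`, the characteristic function of `[P_{i,l}]`. -/
def E {N : ℕ} (i : ZMod N) (l : ℕ) : HallFun (ZMod N) := charFun (P i l)

/-- `Ẽ_{i,l}`, i.e. `E_{i,l}` times the sign `ξ`. -/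
def ETilde {N : ℕ} (i : ZMod N) (l : ℕ) : HallFun (ZMod N) := (P i l).xiSign • E i l

variable (N : ℕ) [NeZero N]

/-- The vector `nδ`, with `δ = (1, …, 1)`. -/
def imag (n : ℕ) : ZMod N → ℕ := fun _ => n

variable {N} in
/-- Positive real roots. -/
def IsRealRoot (α : ZMod N → ℕ) : Prop := cartanForm α α = 2

/-- `h ↦ ⟨h, β⟩` for `h ∈ ℂ[I]`. -/
def cartanLin (β : ZMod N → ℕ) : (ZMod N → ℂ) →ₗ[ℂ] ℂ :=
  ∑ i, (∑ j, (cartan (ZMod N) i j : ℂ) * (β j : ℂ)) • LinearMap.proj i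

/-- `ℂδ ⊂ ℂ[I]`. -/
def deltaLine : Submodule ℂ (ZMod N → ℂ) := ℂ ∙ (fun _ => (1 : ℂ))

theorem sum_cartan (j : ZMod N) : ∑ i, cartan (ZMod N) i j = 0 := by
  have h : ∀ i : ZMod N, (j = i + 1) = (i = j - 1) := fun i => by
    rw [eq_sub_iff_add_eq, eq_comm (a := j)]
  simp [cartan, eulerMatrix, card_hom, Finset.sum_add_distrib, h]

theorem deltaLine_le_ker (β : ZMod N → ℕ) : deltaLine N ≤ LinearMap.ker (cartanLin N β) := by
  rw [deltaLine, Submodule.span_singleton_le_iff_mem, LinearMap.mem_ker, cartanLin]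
  simp only [LinearMap.sum_apply, LinearMap.smul_apply, LinearMap.proj_apply, smul_eq_mul, mul_one]
  rw [Finset.sum_comm]
  refine Finset.sum_eq_zero fun j _ => ?_
  rw [← Finset.sum_mul]
  have := congrArg (Int.cast : ℤ → ℂ) (sum_cartan N j)
  push_cast at this
  rw [this, zero_mul]

/-- The underlying space of `𝔫^ε(C_N)`: one basis vector `ẽ_α` for each positive real root `α`, and
a copy of `ℂ[I]/ℂδ` for each positive imaginary root `nδ`, `n ≥ 1`. -/
abbrev NEps : Type :=
  ({α : ZMod N → ℕ // IsRealRoot α} →₀ ℂ) × (ℕ+ →₀ ((ZMod N → ℂ) ⧸ deltaLine N))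

open Classical in
/-- `ẽ_α` if `α` is a positive real root, and `0` otherwise. -/
def eTil (α : ZMod N → ℕ) : NEps N :=
  if h : IsRealRoot α then (Finsupp.single ⟨α, h⟩ 1, 0) else 0

/-- The inclusion of `ℂ[I]/ℂδ` as the component of degree `nδ`. -/
def imagIncl (n : ℕ+) : ((ZMod N → ℂ) ⧸ deltaLine N) →ₗ[ℂ] NEps N :=
  LinearMap.inr ℂ _ _ ∘ₗ Finsupp.lsingle n

/-- The element `h(n)`, for `h ∈ ℂ[I]`. -/
def hEl (h : ZMod N → ℂ) (n : ℕ+) : NEps N := imagIncl N n (Submodule.Quotient.mk h)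

/-- The Euler cocycle. -/
def eps (α β : ZMod N → ℕ) : ℂ := (-1) ^ eulerForm α β

open Classical in
/-- `[ẽ_α, ẽ_β]`. -/
def bracketEE (α β : ZMod N → ℕ) : NEps N :=
  if IsRealRoot (α + β) then eps N α β • eTil N (α + β)
  else if h : ∃ k : ℕ+, α + β = imag N k then eps N α β • hEl N (fun i => (α i : ℂ)) h.choose
  else 0

/-- `[h(n), ẽ_β] = ε(nδ, β) ⟨h, β⟩ ẽ_{β + nδ}`. -/
def bracketHE (n : ℕ+) (h : (ZMod N → ℂ) ⧸ deltaLine N) (β : ZMod N → ℕ) : NEps N :=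
  (eps N (imag N n) β * (deltaLine N).liftQ (cartanLin N β) (deltaLine_le_ker N β) h) •
    eTil N (β + imag N n)

/-- The bracket of `𝔫^ε(C_N)`. -/
def bracketEps (x y : NEps N) : NEps N :=
  (x.1.sum fun α a => y.1.sum fun β b => (a * b) • bracketEE N α.1 β.1) +
  (x.2.sum fun n h => y.1.sum fun β b => b • bracketHE N n h β.1) -
  (y.2.sum fun n h => x.1.sum fun α a => a • bracketHE N n h α.1)

end CyclicQuiver

end

/-! Both Lie algebras are compared with matrices of size N over ℂ[X]. Let u_{i,l} = X^l E_{i+l,i}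
(`unit`), with rows and columns indexed by ℤ/N. These matrices multiply like concatenated arcs:
u_{i,l} u_{j,m} is u_{j,l+m} if i = j + m, and 0 otherwise.

On the side of 𝔫^ε, send ẽ_{α_{i,l}} to (-1)^{[l/N]} u_{i,l} and h(n) to (-1)^{n+1} X^{nN} diag(h_k
- h_{k-1}). This map `loopMap` is injective and carries the bracket to the commutator
(`loopMap_injective`, `loopMap_bracketEps`). The point is that the cocycle ε on two composable arcs
is an expression in integer parts (`eps_arc_of_end`, `eps_arc_of_start`) which the signs
(-1)^{[l/N]} trivialise. The u_{i,1} satisfy the Serre relations and generate the image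
(`ad_pow_unit`, `unit_mem_range_rho`); this gives Ξ^ε and its surjectivity.

On the Hall side, u_{i,l} ↦ E_{i,l} respects brackets (`hallMap_lie`). To see this, evaluate the
product of two combinations of the E_{i,l} at a nilpotent x, so that only subobjects W ≅ P_{i,l}
with quotient ≅ P_{j,m} count. If x ≅ P_{k,n}, there is one subobject of each length, and the
product is a coefficient of a matrix product (`hallMul_comb_uniserial`). If x is not uniserial and
has such a W, then x is a sum of two cyclic subobjects P_{a,p} and P_{b,q} with q ≤ p
(`IsExt.exists_cyclicPair`). The W are then of three types (`CyclicPair.classify`): W ≅ P_{a,p} with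
quotient P_{b,q}; W ≅ P_{b,q} with quotient P_{a,p}; and, when b = a + k with 0 < k < p - q, W ≅
P_{b,p-k} with quotient P_{a,q+k}. Unless the two summands are isomorphic, the first two types form
affine spaces and the third an affine space minus a hyperplane, so the Euler characteristics are 1,
1 and 0. The answer is symmetric under exchanging sub and quotient, hence the commutator vanishes at
x. For isomorphic summands both factors are evaluated at the same class, and symmetry is immediate
(`hallMul_comb_comm`).

The Euler characteristics rest on Alexander–Spanier cohomology: the long exact sequence of a closed
subspace, the identification of relative cohomology with that of the open complement (`relEquiv`),
and the vanishing for X × [0,∞) (`subsingleton_prod_halfLine`). The sets of subobjects are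
identified with their parameter spaces by normalising a generator of W (`hasChi_extSet_of_family`).

Ξ is the composite `hallMap` ∘ `loopMap`. Its values are read off from u_{i,l} ↦ E_{i,l}; the signs
ξ match because dim End(P_{i,l}) is the dimension of P_{i,l} at i, the least integer ≥ l/N. The last
statement holds because the functions h_i - h_{i-1} on ℤ/N are exactly those with sum zero. -/

noncomputable section

namespace AlexanderSpanier

/-! ## The alternating coboundary and the prism operator -/

section Prism

variable {X Y : Type}

/-- The alternating sum over the faces of a tuple. -/
def altSum {n : ℕ} (φ : (Fin n → X) → ℂ) (v : Fin (n + 1) → X) : ℂ :=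
  ∑ k : Fin (n + 1), (-1 : ℂ) ^ (k : ℕ) * φ fun j => v (k.succAbove j)

/-- Only the face that omits x loses it; all other faces keep x in front and change sign because the
index moves by one. This recursion on the first vertex lets d² = 0 and the prism formula be proved
by induction, without manipulating double sums. -/
theorem altSum_cons {n : ℕ} (φ : (Fin (n + 1) → X) → ℂ) (x : X) (v : Fin (n + 1) → X) :
    altSum φ (Fin.cons x v) = φ v - altSum (fun w => φ (Fin.cons x w)) v := by
  unfold altSum
  rw [Fin.sum_univ_succ, sub_eq_add_neg, ← Finset.sum_neg_distrib]
  congr 1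
  · simp
  · refine Finset.sum_congr rfl fun k _ => ?_
    have : (fun j => (Fin.cons x v : Fin (n + 2) → X) (k.succ.succAbove j)) =
        Fin.cons x fun j => v (k.succAbove j) := by
      funext j
      refine Fin.cases ?_ (fun j => ?_) j <;> simp
    rw [this, Fin.val_succ, pow_succ]
    ring

theorem altSum_sub {n : ℕ} (φ ψ : (Fin n → X) → ℂ) (v : Fin (n + 1) → X) :
    altSum (fun w => φ w - ψ w) v = altSum φ v - altSum ψ v := by
  simp [altSum, mul_sub, Finset.sum_sub_distrib]

theorem altSum_altSum {n : ℕ} (φ : (Fin n → X) → ℂ) (v : Fin (n + 2) → X) :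
    altSum (altSum φ) v = 0 := by
  induction n with
  | zero =>
    have h2 : ∀ f g : Fin 0 → X, φ f = φ g := fun f g => by
      congr 1; funext j; exact j.elim0
    simp only [altSum, Fin.sum_univ_succ]
    simp [h2 _ (fun j => j.elim0)]
  | succ n ih =>
    rw [← Fin.cons_self_tail v, altSum_cons]
    have : (fun w => altSum φ (Fin.cons (v 0) w : Fin (n + 2) → X)) =
        fun w => φ w - altSum (fun u => φ (Fin.cons (v 0) u)) w := by
      funext w; rw [altSum_cons]
    rw [this, altSum_sub, ih]
    ring

/-- The prism operator between two maps of sets. -/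
def prism (f g : X → Y) : {n : ℕ} → ((Fin (n + 1) → Y) → ℂ) → (Fin n → X) → ℂ
  | 0, _, _ => 0
  | _ + 1, φ, v => φ (Fin.cons (f (v 0)) (g ∘ v)) -
      prism f g (fun w => φ (Fin.cons (f (v 0)) w)) (Fin.tail v)

theorem prism_cons (f g : X → Y) {n : ℕ} (φ : (Fin (n + 2) → Y) → ℂ) (x : X) (v : Fin n → X) :
    prism f g φ (Fin.cons x v) = φ (Fin.cons (f x) (Fin.cons (g x) (g ∘ v))) -
      prism f g (fun w => φ (Fin.cons (f x) w)) v := by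
  rw [prism]
  simp only [Fin.cons_zero, Fin.tail_cons]
  congr 3
  funext j
  refine Fin.cases ?_ (fun j => ?_) j <;> simp

theorem prism_sub (f g : X → Y) {n : ℕ} (φ ψ : (Fin (n + 1) → Y) → ℂ) (v : Fin n → X) :
    prism f g (fun w => φ w - ψ w) v = prism f g φ v - prism f g ψ v := by
  induction n with
  | zero => simp [prism]
  | succ n ih => simp only [prism, ih]; ring

/-- The prism evaluates φ only on tuples (f v₀, …, f v_r, g v_r, …, g v_n). Two features of these
tuples matter later: they contain no other points, which controls their diameter, and every v_j
leaves a trace in them, which controls supports. -/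
theorem prism_eq_zero (f g : X → Y) {n : ℕ} (φ : (Fin (n + 1) → Y) → ℂ) (v : Fin n → X)
    (h : ∀ w : Fin (n + 1) → Y, (∀ k, ∃ j, w k = f (v j) ∨ w k = g (v j)) →
      (∀ j, ∃ k, w k = f (v j) ∨ w k = g (v j)) → φ w = 0) : prism f g φ v = 0 := by
  induction n with
  | zero => rfl
  | succ n ih =>
    rw [prism, h, ih, sub_zero]
    · intro w h1 h2
      refine h _ (fun k => ?_) fun j => ?_
      · refine Fin.cases ⟨0, by simp⟩ (fun k => ?_) k
        obtain ⟨j, hj⟩ := h1 k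
        exact ⟨j.succ, hj⟩
      · refine Fin.cases ⟨0, by simp⟩ (fun j => ?_) j
        obtain ⟨k, hk⟩ := h2 j
        exact ⟨k.succ, hk⟩
    · intro k
      refine Fin.cases ⟨0, by simp⟩ (fun k => ⟨k, by simp⟩) k
    · exact fun j => ⟨j.succ, by simp⟩

/-- The prism operator is a homotopy between the two pullbacks. -/
theorem altSum_prism (f g : X → Y) {n : ℕ} (φ : (Fin (n + 1) → Y) → ℂ) (v : Fin (n + 1) → X) :
    altSum (prism f g φ) v + prism f g (altSum φ) v = φ (g ∘ v) - φ (f ∘ v) := by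
  have hfv : ∀ {m : ℕ} (h : X → Y) (x : X) (u : Fin m → X),
      h ∘ (Fin.cons x u : Fin (m + 1) → X) = Fin.cons (h x) (h ∘ u) := by
    intro m h x u
    funext j
    refine Fin.cases ?_ (fun j => ?_) j <;> simp
  induction n with
  | zero =>
    rw [← Fin.cons_self_tail v]
    generalize v 0 = x
    generalize Fin.tail v = u
    rw [prism_cons, altSum_cons, hfv, hfv]
    have h1 : f ∘ u = g ∘ u := funext fun j => j.elim0
    simp [altSum, prism, Function.comp_def]
    congr 2
    funext j
    exact j.elim0
  | succ n ih =>
    rw [← Fin.cons_self_tail v]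
    generalize v 0 = x
    generalize Fin.tail v = u
    rw [altSum_cons, prism_cons, altSum_cons, hfv, hfv]
    have h1 : (fun w => prism f g φ (Fin.cons x w : Fin (n + 1) → X)) =
        fun w => φ (Fin.cons (f x) (Fin.cons (g x) (g ∘ w))) -
          prism f g (fun w => φ (Fin.cons (f x) w)) w := by
      funext w; rw [prism_cons]
    have h2 : (fun w => altSum φ (Fin.cons (f x) w : Fin (n + 3) → Y)) =
        fun w => φ w - altSum (fun u => φ (Fin.cons (f x) u)) w := by
      funext w; rw [altSum_cons]
    rw [h1, h2, altSum_sub, prism_sub, altSum_cons]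
    have h3 := ih (fun w => φ (Fin.cons (f x) w)) u
    have h4 : altSum (fun w => φ (Fin.cons (f x) (Fin.cons (g x) (g ∘ w)))) u =
        altSum (fun w => φ (Fin.cons (f x) (Fin.cons (g x) w))) (g ∘ u) := rfl
    rw [h4]
    linear_combination h3

end Prism

/-! ### Coboundaries, pullbacks and supports of cochains -/

section Basic

variable {X Y : Type}

theorem coboundary_apply {p : ℕ} (φ : Cochain X p) (v : Fin (p + 2) → X) :
    coboundary X p φ v = altSum φ v := rfl

theorem coboundary_coboundary {p : ℕ} (φ : Cochain X p) :
    coboundary X (p + 1) (coboundary X p φ) = 0 := by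
  funext v
  exact altSum_altSum φ v

/-- Pullback of cochains along a map of sets. -/
def pull (f : X → Y) (p : ℕ) : Cochain Y p →ₗ[ℂ] Cochain X p where
  toFun φ v := φ (f ∘ v)
  map_add' _ _ := rfl
  map_smul' _ _ := rfl

theorem pull_apply (f : X → Y) {p : ℕ} (φ : Cochain Y p) (v : Fin (p + 1) → X) :
    pull f p φ v = φ (f ∘ v) := rfl

theorem pull_coboundary (f : X → Y) {p : ℕ} (φ : Cochain Y p) :
    pull f (p + 1) (coboundary Y p φ) = coboundary X p (pull f p φ) := rfl

variable [TopologicalSpace X]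

theorem LocallyZeroAt.coboundary {p : ℕ} {φ : Cochain X p} {x : X} (h : LocallyZeroAt φ x) :
    LocallyZeroAt (coboundary X p φ) x := by
  obtain ⟨U, hU, h⟩ := h
  refine ⟨U, hU, fun v hv => ?_⟩
  rw [coboundary_apply, altSum]
  refine Finset.sum_eq_zero fun k _ => ?_
  rw [h _ fun j => hv _, mul_zero]

theorem LocallyZeroAt.add {p : ℕ} {φ ψ : Cochain X p} {x : X} (hφ : LocallyZeroAt φ x)
    (hψ : LocallyZeroAt ψ x) : LocallyZeroAt (φ + ψ) x := by
  obtain ⟨U, hU, h⟩ := hφ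
  obtain ⟨U', hU', h'⟩ := hψ
  refine ⟨U ∩ U', Filter.inter_mem hU hU', fun v hv => ?_⟩
  simp [h v fun k => (hv k).1, h' v fun k => (hv k).2]

theorem coboundary_mem_locallyZero {p : ℕ} {φ : Cochain X p} (h : φ ∈ locallyZero X p) :
    coboundary X p φ ∈ locallyZero X (p + 1) := fun x => (h x).coboundary

theorem coboundary_mem_compactSupp {p : ℕ} {φ : Cochain X p} (h : φ ∈ compactSupp X p) :
    coboundary X p φ ∈ compactSupp X (p + 1) := by
  obtain ⟨K, hK, h⟩ := h
  exact ⟨K, hK, fun x hx => (h x hx).coboundary⟩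

theorem locallyZero_le_compactSupp (p : ℕ) : locallyZero X p ≤ compactSupp X p :=
  fun _ h => ⟨∅, isCompact_empty, fun x _ => h x⟩

end Basic
end AlexanderSpanier

end

noncomputable section

/-! ## Subquotients and long exact sequences -/

section Subquotient

variable {V V' V'' : Type} [AddCommGroup V] [Module ℂ V] [AddCommGroup V'] [Module ℂ V']
  [AddCommGroup V''] [Module ℂ V'']

/-- The subquotient `Z / (Z ∩ B)`. -/
abbrev Subquot (Z B : Submodule ℂ V) : Type := ↥Z ⧸ B.comap Z.subtype

/-- The map of subquotients induced by a linear map. -/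
def Subquot.map {Z B : Submodule ℂ V} {Z' B' : Submodule ℂ V'} (f : V →ₗ[ℂ] V')
    (hZ : ∀ z ∈ Z, f z ∈ Z') (hB : ∀ z ∈ Z, z ∈ B → f z ∈ B') : Subquot Z B →ₗ[ℂ] Subquot Z' B' :=
  Submodule.mapQ _ _ (f.restrict hZ)
    (show Submodule.comap Z.subtype B ≤ _ from fun z hz => hB z.1 z.2 hz)

theorem Subquot.map_mk {Z B : Submodule ℂ V} {Z' B' : Submodule ℂ V'} (f : V →ₗ[ℂ] V')
    (hZ : ∀ z ∈ Z, f z ∈ Z') (hB : ∀ z ∈ Z, z ∈ B → f z ∈ B') (z : Z) :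
    Subquot.map f hZ hB (Submodule.Quotient.mk z : Subquot Z B) =
      (Submodule.Quotient.mk ⟨f z, hZ z.1 z.2⟩ : Subquot Z' B') := rfl

theorem Subquot.mk_eq_zero {Z B : Submodule ℂ V} (z : Z) :
    (Submodule.Quotient.mk z : Subquot Z B) = 0 ↔ z.1 ∈ B := by
  rw [Submodule.Quotient.mk_eq_zero]
  rfl

variable {Z B : Submodule ℂ V} {Z' B' : Submodule ℂ V'} {Z'' B'' : Submodule ℂ V''}

theorem Subquot.map_injective {f : V →ₗ[ℂ] V'} {hZ : ∀ z ∈ Z, f z ∈ Z'}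
    {hB : ∀ z ∈ Z, z ∈ B → f z ∈ B'} (h : ∀ z ∈ Z, f z ∈ B' → z ∈ B) :
    Function.Injective (Subquot.map f hZ hB) := by
  rw [← LinearMap.ker_eq_bot, Submodule.eq_bot_iff]
  intro x hx
  obtain ⟨z, rfl⟩ := Submodule.Quotient.mk_surjective _ x
  rw [LinearMap.mem_ker, Subquot.map_mk, Subquot.mk_eq_zero] at hx
  exact (Subquot.mk_eq_zero _).2 (h z.1 z.2 hx)

theorem Subquot.map_surjective {f : V →ₗ[ℂ] V'} {hZ : ∀ z ∈ Z, f z ∈ Z'}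
    {hB : ∀ z ∈ Z, z ∈ B → f z ∈ B'} (h : ∀ z' ∈ Z', ∃ z ∈ Z, z' - f z ∈ B') :
    Function.Surjective (Subquot.map f hZ hB) := by
  intro x
  obtain ⟨z', rfl⟩ := Submodule.Quotient.mk_surjective _ x
  obtain ⟨z, hz, h⟩ := h z'.1 z'.2
  refine ⟨Submodule.Quotient.mk ⟨z, hz⟩, ?_⟩
  rw [Subquot.map_mk, eq_comm, Submodule.Quotient.eq]
  exact h

theorem Subquot.map_exact {f : V →ₗ[ℂ] V'} {hZ : ∀ z ∈ Z, f z ∈ Z'}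
    {hB : ∀ z ∈ Z, z ∈ B → f z ∈ B'} {g : V' →ₗ[ℂ] V''} {hZ' : ∀ z ∈ Z', g z ∈ Z''}
    {hB' : ∀ z ∈ Z', z ∈ B' → g z ∈ B''} (h1 : ∀ z ∈ Z, g (f z) ∈ B'')
    (h2 : ∀ z' ∈ Z', g z' ∈ B'' → ∃ z ∈ Z, z' - f z ∈ B') :
    Function.Exact (Subquot.map f hZ hB) (Subquot.map g hZ' hB') := by
  intro x
  obtain ⟨z', rfl⟩ := Submodule.Quotient.mk_surjective _ x
  constructor
  · intro hx
    rw [Subquot.map_mk, Subquot.mk_eq_zero] at hx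
    obtain ⟨z, hz, h⟩ := h2 z'.1 z'.2 hx
    refine ⟨Submodule.Quotient.mk ⟨z, hz⟩, ?_⟩
    rw [Subquot.map_mk, eq_comm, Submodule.Quotient.eq]
    exact h
  · rintro ⟨y, hy⟩
    obtain ⟨z, rfl⟩ := Submodule.Quotient.mk_surjective _ y
    rw [← hy, Subquot.map_mk, Subquot.map_mk, Subquot.mk_eq_zero]
    exact h1 z.1 z.2

end Subquotient

section EulerSequence

/-- A sequence of vector spaces that are finite-dimensional and almost all zero. -/
structure FinGraded (H : ℕ → Type) [∀ p, AddCommGroup (H p)] [∀ p, Module ℂ (H p)] : Prop where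
  finite : ∀ p, FiniteDimensional ℂ (H p)
  bounded : ∃ n, ∀ p, n ≤ p → Subsingleton (H p)

/-- The alternating sum of the dimensions. -/
def altDim (H : ℕ → Type) [∀ p, AddCommGroup (H p)] [∀ p, Module ℂ (H p)] : ℤ :=
  ∑ᶠ p : ℕ, (-1 : ℤ) ^ p * (Module.finrank ℂ (H p) : ℤ)

variable {H H' H'' : ℕ → Type} [∀ p, AddCommGroup (H p)] [∀ p, Module ℂ (H p)]
  [∀ p, AddCommGroup (H' p)] [∀ p, Module ℂ (H' p)] [∀ p, AddCommGroup (H'' p)]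
  [∀ p, Module ℂ (H'' p)]

theorem altDim_eq_sum {n : ℕ} (h : ∀ p, n ≤ p → Subsingleton (H p)) :
    altDim H = ∑ p ∈ Finset.range n, (-1 : ℤ) ^ p * (Module.finrank ℂ (H p) : ℤ) := by
  refine finsum_eq_sum_of_support_subset _ fun p hp => ?_
  by_contra hn
  have := h p (by simpa using hn)
  exact hp (by simp [Module.finrank_zero_of_subsingleton])

theorem altDim_congr (e : ∀ p, H p ≃ₗ[ℂ] H' p) : altDim H = altDim H' := by
  simp only [altDim, fun p => (e p).finrank_eq]

theorem FinGraded.congr (h : FinGraded H) (e : ∀ p, H p ≃ₗ[ℂ] H' p) : FinGraded H' := by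
  obtain ⟨n, hn⟩ := h.bounded
  refine ⟨fun p => ?_, n, fun p hp => ?_⟩
  · have := h.finite p
    exact (e p).finiteDimensional
  · have := hn p hp
    exact (e p).symm.injective.subsingleton

theorem finite_of_exact {A B C : Type} [AddCommGroup A] [Module ℂ A] [AddCommGroup B] [Module ℂ B]
    [AddCommGroup C] [Module ℂ C] [FiniteDimensional ℂ A] [FiniteDimensional ℂ C]
    {f : A →ₗ[ℂ] B} {g : B →ₗ[ℂ] C} (h : Function.Exact f g) : FiniteDimensional ℂ B := by
  have h1 : FiniteDimensional ℂ (B ⧸ LinearMap.ker g) :=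
    g.quotKerEquivRange.symm.finiteDimensional
  have h2 : FiniteDimensional ℂ (LinearMap.ker g) := by
    rw [LinearMap.exact_iff.1 h]
    infer_instance
  exact Module.Finite.of_submodule_quotient (LinearMap.ker g)

theorem subsingleton_of_exact {A B C : Type} [AddCommGroup A] [Module ℂ A] [AddCommGroup B]
    [Module ℂ B] [AddCommGroup C] [Module ℂ C] [Subsingleton A] [Subsingleton C]
    {f : A →ₗ[ℂ] B} {g : B →ₗ[ℂ] C} (h : Function.Exact f g) : Subsingleton B := by
  refine subsingleton_of_forall_eq 0 fun b => ?_
  obtain ⟨a, rfl⟩ := (h b).1 (Subsingleton.elim _ _)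
  rw [Subsingleton.elim a 0, map_zero]

variable {a : ∀ p, H p →ₗ[ℂ] H' p} {b : ∀ p, H' p →ₗ[ℂ] H'' p} {c : ∀ p, H'' p →ₗ[ℂ] H (p + 1)}

theorem FinGraded.middle (hab : ∀ p, Function.Exact (a p) (b p)) (h : FinGraded H)
    (h'' : FinGraded H'') : FinGraded H' := by
  obtain ⟨n, hn⟩ := h.bounded
  obtain ⟨m, hm⟩ := h''.bounded
  refine ⟨fun p => ?_, max n m, fun p hp => ?_⟩
  · have := h.finite p
    have := h''.finite p
    exact finite_of_exact (hab p)
  · have := hn p (le_trans (le_max_left _ _) hp)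
    have := hm p (le_trans (le_max_right _ _) hp)
    exact subsingleton_of_exact (hab p)

theorem FinGraded.left (ha : Function.Injective (a 0)) (hca : ∀ p, Function.Exact (c p) (a (p + 1)))
    (h' : FinGraded H') (h'' : FinGraded H'') : FinGraded H := by
  obtain ⟨n, hn⟩ := h'.bounded
  obtain ⟨m, hm⟩ := h''.bounded
  refine ⟨fun p => ?_, max n m + 1, fun p hp => ?_⟩
  · cases p with
    | zero =>
      have := h'.finite 0
      exact FiniteDimensional.of_injective _ ha
    | succ p =>
      have := h'.finite (p + 1)
      have := h''.finite p
      exact finite_of_exact (hca p)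
  · obtain ⟨p, rfl⟩ : ∃ q, p = q + 1 := ⟨p - 1, by omega⟩
    have := hn (p + 1) (by omega)
    have := hm p (by omega)
    exact subsingleton_of_exact (hca p)

/-- Rank–nullity at each term writes the three dimensions through the ranks of a, b, c; in the
alternating sum the ranks cancel. -/
theorem altDim_add (ha : Function.Injective (a 0)) (hab : ∀ p, Function.Exact (a p) (b p))
    (hbc : ∀ p, Function.Exact (b p) (c p)) (hca : ∀ p, Function.Exact (c p) (a (p + 1)))
    (h : FinGraded H) (h' : FinGraded H') (h'' : FinGraded H'') :
    altDim H' = altDim H + altDim H'' := by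
  have := h.finite
  have := h'.finite
  have := h''.finite
  obtain ⟨n, hn⟩ := h.bounded
  obtain ⟨n', hn'⟩ := h'.bounded
  obtain ⟨n'', hn''⟩ := h''.bounded
  set m := n + n' + n'' with hm
  rw [altDim_eq_sum (n := m) fun p hp => hn p (by omega),
    altDim_eq_sum (n := m) fun p hp => hn' p (by omega),
    altDim_eq_sum (n := m) fun p hp => hn'' p (by omega)]
  have h1 : ∀ p, (Module.finrank ℂ (H' p) : ℤ) =
      Module.finrank ℂ (LinearMap.range (a p)) + Module.finrank ℂ (LinearMap.range (b p)) := by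
    intro p
    have h1 := LinearMap.finrank_range_add_finrank_ker (b p)
    rw [LinearMap.exact_iff.1 (hab p)] at h1
    omega
  have h2 : ∀ p, (Module.finrank ℂ (H'' p) : ℤ) =
      Module.finrank ℂ (LinearMap.range (b p)) + Module.finrank ℂ (LinearMap.range (c p)) := by
    intro p
    have h1 := LinearMap.finrank_range_add_finrank_ker (c p)
    rw [LinearMap.exact_iff.1 (hbc p)] at h1
    omega
  have h3 : ∀ p, (Module.finrank ℂ (H (p + 1)) : ℤ) =
      Module.finrank ℂ (LinearMap.range (c p)) + Module.finrank ℂ (LinearMap.range (a (p + 1))) := by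
    intro p
    have h1 := LinearMap.finrank_range_add_finrank_ker (a (p + 1))
    rw [LinearMap.exact_iff.1 (hca p)] at h1
    omega
  have h4 : (Module.finrank ℂ (H 0) : ℤ) = Module.finrank ℂ (LinearMap.range (a 0)) := by
    rw [LinearMap.finrank_range_of_inj ha]
  -- Truncating at m leaves the part of H_m not accounted for by the rank of a_m. This error is zero
  -- once H_m = 0.
  have key : ∀ m, ∑ p ∈ Finset.range m, (-1 : ℤ) ^ p * (Module.finrank ℂ (H' p) : ℤ) =
      ∑ p ∈ Finset.range m, (-1 : ℤ) ^ p * (Module.finrank ℂ (H p) : ℤ) +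
      ∑ p ∈ Finset.range m, (-1 : ℤ) ^ p * (Module.finrank ℂ (H'' p) : ℤ) +
      (-1) ^ m * (Module.finrank ℂ (H m) - Module.finrank ℂ (LinearMap.range (a m))) := by
    intro m
    induction m with
    | zero => simp [h4]
    | succ m ih =>
      rw [Finset.sum_range_succ, Finset.sum_range_succ, Finset.sum_range_succ, ih, h1 m, h2 m, h3 m,
        pow_succ]
      ring
  rw [key]
  have := hn m (by omega)
  have : Subsingleton (LinearMap.range (a m)) := by
    refine ⟨fun x y => ?_⟩
    obtain ⟨x, x', rfl⟩ := x
    obtain ⟨y, y', rfl⟩ := y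
    simp [Subsingleton.elim x' y']
  simp [Module.finrank_zero_of_subsingleton]

end EulerSequence

end

noncomputable section

namespace AlexanderSpanier

/-! ## Alexander–Spanier complexes with supports -/

section Restriction

variable {X : Type}

/-- Restriction of cochains to a subspace. -/
def res (Z : Set X) (p : ℕ) : Cochain X p →ₗ[ℂ] Cochain Z p := pull Subtype.val p

theorem res_apply (Z : Set X) {p : ℕ} (φ : Cochain X p) (v : Fin (p + 1) → Z) :
    res Z p φ v = φ fun k => (v k : X) := rfl

theorem res_coboundary (Z : Set X) {p : ℕ} (φ : Cochain X p) :
    res Z (p + 1) (coboundary X p φ) = coboundary Z p (res Z p φ) := rfl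

open Classical in
/-- Extension of cochains by zero. -/
def extend (Z : Set X) (p : ℕ) : Cochain Z p →ₗ[ℂ] Cochain X p where
  toFun ψ v := if h : ∀ k, v k ∈ Z then ψ fun k => ⟨v k, h k⟩ else 0
  map_add' φ ψ := by
    funext v
    by_cases h : ∀ k, v k ∈ Z <;> simp [h]
  map_smul' c φ := by
    funext v
    by_cases h : ∀ k, v k ∈ Z <;> simp [h]

theorem extend_of_forall {Z : Set X} {p : ℕ} (ψ : Cochain Z p) {v : Fin (p + 1) → X}
    (h : ∀ k, v k ∈ Z) : extend Z p ψ v = ψ fun k => ⟨v k, h k⟩ := dif_pos h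

theorem extend_of_not {Z : Set X} {p : ℕ} (ψ : Cochain Z p) {v : Fin (p + 1) → X} {k : Fin (p + 1)}
    (h : v k ∉ Z) : extend Z p ψ v = 0 := dif_neg fun h' => h (h' k)

theorem res_extend (Z : Set X) {p : ℕ} (ψ : Cochain Z p) : res Z p (extend Z p ψ) = ψ := by
  funext v
  rw [res_apply, extend_of_forall _ fun k => (v k).2]

end Restriction

section Supports

variable {X Y : Type} [TopologicalSpace X] [TopologicalSpace Y]

/-- Cocycles, modulo locally zero cochains, satisfying a support condition. -/
def cyc (A : ∀ p, Submodule ℂ (Cochain X p)) (p : ℕ) : Submodule ℂ (Cochain X p) :=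
  A p ⊓ (locallyZero X (p + 1)).comap (coboundary X p)

/-- Coboundaries of cochains satisfying a support condition, plus locally zero cochains. -/
def bdry (A : ∀ p, Submodule ℂ (Cochain X p)) : ∀ p, Submodule ℂ (Cochain X p)
  | 0 => locallyZero X 0
  | p + 1 => locallyZero X (p + 1) ⊔ (A p).map (coboundary X p)

/-- Cohomology with a support condition. -/
abbrev HH (A : ∀ p, Submodule ℂ (Cochain X p)) (p : ℕ) : Type := Subquot (cyc A p) (bdry A p)

theorem locallyZero_le_bdry (A : ∀ p, Submodule ℂ (Cochain X p)) (p : ℕ) :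
    locallyZero X p ≤ bdry A p := by
  cases p
  · exact le_rfl
  · exact le_sup_left

theorem mem_bdry_succ {A : ∀ p, Submodule ℂ (Cochain X p)} {p : ℕ} {φ : Cochain X (p + 1)} :
    φ ∈ bdry A (p + 1) ↔ ∃ ψ ∈ A p, φ - coboundary X p ψ ∈ locallyZero X (p + 1) := by
  rw [bdry, Submodule.mem_sup]
  constructor
  · rintro ⟨η, hη, _, ⟨ψ, hψ, rfl⟩, rfl⟩
    exact ⟨ψ, hψ, by simpa using hη⟩
  · rintro ⟨ψ, hψ, h⟩
    exact ⟨_, h, _, ⟨ψ, hψ, rfl⟩, by simp⟩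

/-- Compactly supported cohomology as cohomology with a support condition. -/
def cohomologyEquiv (X : Type) [TopologicalSpace X] (p : ℕ) :
    HH (compactSupp X) p ≃ₗ[ℂ] Cohomology X p :=
  Submodule.quotEquivOfEq _ _ (by cases p <;> rfl)

theorem LocallyZeroAt.pull {p : ℕ} {φ : Cochain Y p} {f : X → Y} {x : X}
    (hf : ContinuousAt f x) (h : LocallyZeroAt φ (f x)) : LocallyZeroAt (pull f p φ) x := by
  obtain ⟨U, hU, h⟩ := h
  exact ⟨f ⁻¹' U, hf hU, fun v hv => h _ hv⟩

theorem pull_mem_locallyZero {p : ℕ} {φ : Cochain Y p} {f : X → Y} (hf : Continuous f)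
    (h : φ ∈ locallyZero Y p) : pull f p φ ∈ locallyZero X p :=
  fun x => (h (f x)).pull hf.continuousAt

theorem res_mem_locallyZero (Z : Set X) {p : ℕ} {φ : Cochain X p} (h : φ ∈ locallyZero X p) :
    res Z p φ ∈ locallyZero Z p := pull_mem_locallyZero continuous_subtype_val h

theorem res_mem_compactSupp {Z : Set X} (hZ : IsClosed Z) {p : ℕ} {φ : Cochain X p}
    (h : φ ∈ compactSupp X p) : res Z p φ ∈ compactSupp Z p := by
  obtain ⟨K, hK, h⟩ := h
  refine ⟨Subtype.val ⁻¹' K, hZ.isClosedEmbedding_subtypeVal.isCompact_preimage hK, fun x hx => ?_⟩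
  exact (h _ hx).pull continuous_subtype_val.continuousAt

theorem extend_locallyZeroAt {Z : Set X} (hZ : IsClosed Z) {p : ℕ} {ψ : Cochain Z p} {x : X}
    (h : ∀ hx : x ∈ Z, LocallyZeroAt ψ ⟨x, hx⟩) : LocallyZeroAt (extend Z p ψ) x := by
  by_cases hx : x ∈ Z
  · obtain ⟨U, hU, h⟩ := h hx
    obtain ⟨U', hU', hs⟩ := mem_nhds_subtype _ _ _ |>.1 hU
    refine ⟨U', hU', fun v hv => ?_⟩
    by_cases hv' : ∀ k, v k ∈ Z
    · rw [extend_of_forall _ hv']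
      exact h _ fun k => hs (hv k)
    · push Not at hv'
      obtain ⟨k, hk⟩ := hv'
      exact extend_of_not _ hk
  · exact ⟨Zᶜ, hZ.isOpen_compl.mem_nhds hx, fun v hv => extend_of_not _ (hv 0)⟩

theorem extend_mem_compactSupp {Z : Set X} (hZ : IsClosed Z) {p : ℕ} {ψ : Cochain Z p}
    (h : ψ ∈ compactSupp Z p) : extend Z p ψ ∈ compactSupp X p := by
  obtain ⟨K, hK, h⟩ := h
  refine ⟨Subtype.val '' K, hK.image continuous_subtype_val, fun x hx => ?_⟩
  exact extend_locallyZeroAt hZ fun hxZ => h _ fun hK => hx ⟨_, hK, rfl⟩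

theorem extend_mem_locallyZero {Z : Set X} (hZ : IsClosed Z) {p : ℕ} {ψ : Cochain Z p}
    (h : ψ ∈ locallyZero Z p) : extend Z p ψ ∈ locallyZero X p :=
  fun x => extend_locallyZeroAt hZ fun hx => h ⟨x, hx⟩

/-- Compactly supported cochains whose restriction to `Z` is locally zero. -/
def relSupp (Z : Set X) (p : ℕ) : Submodule ℂ (Cochain X p) :=
  compactSupp X p ⊓ (locallyZero Z p).comap (res Z p)

theorem locallyZero_le_relSupp (Z : Set X) (p : ℕ) : locallyZero X p ≤ relSupp Z p :=
  fun _ h => ⟨locallyZero_le_compactSupp p h, res_mem_locallyZero Z h⟩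

/-- Cochains with compact support contained in `U`. -/
def openSupp (U : Set X) (p : ℕ) : Submodule ℂ (Cochain X p) where
  carrier := {φ | ∃ K : Set X, IsCompact K ∧ K ⊆ U ∧ ∀ x, x ∉ K → LocallyZeroAt φ x}
  zero_mem' := ⟨∅, isCompact_empty, Set.empty_subset _,
    fun _ _ => ⟨Set.univ, Filter.univ_mem, fun _ _ => rfl⟩⟩
  add_mem' := by
    rintro φ ψ ⟨K, hK, hU, h⟩ ⟨K', hK', hU', h'⟩
    exact ⟨K ∪ K', hK.union hK', Set.union_subset hU hU', fun x hx =>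
      (h x fun hk => hx (Or.inl hk)).add (h' x fun hk => hx (Or.inr hk))⟩
  smul_mem' := by
    rintro c φ ⟨K, hK, hU, h⟩
    refine ⟨K, hK, hU, fun x hx => ?_⟩
    obtain ⟨U, hU, h⟩ := h x hx
    exact ⟨U, hU, fun v hv => by simp [h v hv]⟩

theorem locallyZero_le_openSupp (U : Set X) (p : ℕ) : locallyZero X p ≤ openSupp U p :=
  fun _ h => ⟨∅, isCompact_empty, Set.empty_subset _, fun x _ => h x⟩

theorem openSupp_le_compactSupp (U : Set X) (p : ℕ) : openSupp U p ≤ compactSupp X p :=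
  fun _ ⟨K, hK, _, h⟩ => ⟨K, hK, h⟩

theorem coboundary_mem_openSupp {U : Set X} {p : ℕ} {φ : Cochain X p} (h : φ ∈ openSupp U p) :
    coboundary X p φ ∈ openSupp U (p + 1) := by
  obtain ⟨K, hK, hU, h⟩ := h
  exact ⟨K, hK, hU, fun x hx => (h x hx).coboundary⟩

theorem openSupp_le_relSupp {Z : Set X} (p : ℕ) : openSupp Zᶜ p ≤ relSupp Z p := by
  intro φ hφ
  refine ⟨openSupp_le_compactSupp _ _ hφ, ?_⟩
  obtain ⟨K, hK, hU, h⟩ := hφ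
  exact fun x => (h x fun hx => hU hx x.2).pull continuous_subtype_val.continuousAt

theorem mem_of_sub_mem_locallyZero {A : ∀ p, Submodule ℂ (Cochain X p)}
    (hA : ∀ p, locallyZero X p ≤ A p) {p : ℕ} {φ ψ : Cochain X p}
    (h : φ - ψ ∈ locallyZero X p) (hφ : φ ∈ A p) : ψ ∈ A p := by
  simpa using (A p).sub_mem hφ (hA p h)

theorem cyc_of_sub_mem_locallyZero {A : ∀ p, Submodule ℂ (Cochain X p)}
    (hA : ∀ p, locallyZero X p ≤ A p) {p : ℕ} {φ ψ : Cochain X p}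
    (h : φ - ψ ∈ locallyZero X p) (hφ : φ ∈ cyc A p) : ψ ∈ cyc A p := by
  refine ⟨mem_of_sub_mem_locallyZero hA h hφ.1, ?_⟩
  have := (locallyZero X (p + 1)).sub_mem hφ.2 (coboundary_mem_locallyZero h)
  simpa using this

/-! ### The long exact sequence of a closed subspace -/

section Closed

variable {Z : Set X} (hZ : IsClosed Z)

/-- `H(X, Z) → H(X)`. -/
def relToAbs (Z : Set X) (p : ℕ) : HH (relSupp Z) p →ₗ[ℂ] HH (compactSupp X) p :=
  Subquot.map LinearMap.id (fun _ h => ⟨h.1.1, h.2⟩) fun z _ h => by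
    cases p
    · exact h
    · obtain ⟨ψ, hψ, h⟩ := mem_bdry_succ.1 h
      exact mem_bdry_succ.2 ⟨ψ, hψ.1, h⟩

include hZ in
theorem res_mem_cyc {p : ℕ} {φ : Cochain X p} (h : φ ∈ cyc (compactSupp X) p) :
    res Z p φ ∈ cyc (compactSupp Z) p :=
  ⟨res_mem_compactSupp hZ h.1, res_mem_locallyZero Z h.2⟩

include hZ in
theorem res_mem_bdry {p : ℕ} {φ : Cochain X p} (h : φ ∈ bdry (compactSupp X) p) :
    res Z p φ ∈ bdry (compactSupp Z) p := by
  cases p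
  · exact res_mem_locallyZero Z h
  · obtain ⟨ψ, hψ, h⟩ := mem_bdry_succ.1 h
    exact mem_bdry_succ.2 ⟨_, res_mem_compactSupp hZ hψ, res_mem_locallyZero Z h⟩

-- Extension by zero is a section of restriction but does not commute with the coboundary. The
-- coboundary of the extension of a cocycle on Z is locally zero on Z, hence a relative cocycle:
-- this is the connecting homomorphism.
include hZ in
theorem coboundary_extend_mem_cyc {p : ℕ} {ψ : Cochain Z p} (h : ψ ∈ cyc (compactSupp Z) p) :
    coboundary X p (extend Z p ψ) ∈ cyc (relSupp Z) (p + 1) := by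
  refine ⟨⟨coboundary_mem_compactSupp (extend_mem_compactSupp hZ h.1), ?_⟩, ?_⟩
  · rw [SetLike.mem_coe, Submodule.mem_comap, res_coboundary, res_extend]
    exact h.2
  · rw [SetLike.mem_coe, Submodule.mem_comap, coboundary_coboundary]
    exact Submodule.zero_mem _

include hZ in
theorem coboundary_extend_mem_bdry {p : ℕ} {ψ : Cochain Z p} (h : ψ ∈ bdry (compactSupp Z) p) :
    coboundary X p (extend Z p ψ) ∈ bdry (relSupp Z) (p + 1) := by
  cases p with
  | zero =>
    exact locallyZero_le_bdry _ _ (coboundary_mem_locallyZero (extend_mem_locallyZero hZ h))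
  | succ p =>
    obtain ⟨η, hη, h⟩ := mem_bdry_succ.1 h
    -- With ψ = dη up to a locally zero cochain, this difference has the same coboundary as the
    -- extension of ψ and is locally zero on Z, so it is an admissible relative primitive.
    refine mem_bdry_succ.2 ⟨extend Z _ ψ - coboundary X p (extend Z p η), ⟨?_, ?_⟩, ?_⟩
    · have h1 := extend_mem_locallyZero hZ h
      rw [map_sub] at h1
      have h2 := locallyZero_le_compactSupp _ h1
      have h3 : extend Z (p + 1) (coboundary Z p η) ∈ compactSupp X (p + 1) :=
        extend_mem_compactSupp hZ (coboundary_mem_compactSupp hη)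
      have h4 := coboundary_mem_compactSupp (extend_mem_compactSupp hZ hη)
      have := (compactSupp X (p + 1)).sub_mem ((compactSupp X (p + 1)).add_mem h2 h3) h4
      simpa using this
    · rw [SetLike.mem_coe, Submodule.mem_comap, map_sub, res_extend, res_coboundary, res_extend]
      exact h
    · rw [map_sub, coboundary_coboundary]
      simp

/-- `H(X) → H(Z)`. -/
def absToClosed (p : ℕ) : HH (compactSupp X) p →ₗ[ℂ] HH (compactSupp Z) p :=
  Subquot.map (res Z p) (fun _ h => res_mem_cyc hZ h) fun _ _ h => res_mem_bdry hZ h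

/-- The connecting map `H(Z) → H(X, Z)`. -/
def connecting (p : ℕ) : HH (compactSupp Z) p →ₗ[ℂ] HH (relSupp Z) (p + 1) :=
  Subquot.map (coboundary X p ∘ₗ extend Z p) (fun _ h => coboundary_extend_mem_cyc hZ h)
    fun _ _ h => coboundary_extend_mem_bdry hZ h

theorem relToAbs_zero_injective : Function.Injective (relToAbs Z 0) :=
  Subquot.map_injective fun _ _ h => h

theorem exact_relToAbs (p : ℕ) : Function.Exact (relToAbs Z p) (absToClosed hZ p) := by
  refine Subquot.map_exact (fun φ h => locallyZero_le_bdry _ _ h.1.2) fun φ hφ h => ?_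
  cases p with
  | zero => exact ⟨φ, ⟨⟨hφ.1, h⟩, hφ.2⟩, by simp⟩
  | succ p =>
    obtain ⟨ψ, hψ, h⟩ := mem_bdry_succ.1 h
    refine ⟨φ - coboundary X p (extend Z p ψ), ⟨⟨?_, ?_⟩, ?_⟩, ?_⟩
    · exact (compactSupp X _).sub_mem hφ.1 (coboundary_mem_compactSupp (extend_mem_compactSupp hZ hψ))
    · rw [SetLike.mem_coe, Submodule.mem_comap, map_sub, res_coboundary, res_extend]
      exact h
    · rw [SetLike.mem_coe, Submodule.mem_comap, map_sub, coboundary_coboundary, sub_zero]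
      exact hφ.2
    · exact mem_bdry_succ.2 ⟨_, extend_mem_compactSupp hZ hψ, by simp⟩

theorem exact_absToClosed (p : ℕ) : Function.Exact (absToClosed hZ p) (connecting hZ p) := by
  refine Subquot.map_exact (fun φ h => ?_) fun ψ hψ h => ?_
  · refine mem_bdry_succ.2 ⟨extend Z p (res Z p φ) - φ, ⟨?_, ?_⟩, ?_⟩
    · exact (compactSupp X _).sub_mem (extend_mem_compactSupp hZ (res_mem_compactSupp hZ h.1)) h.1
    · rw [SetLike.mem_coe, Submodule.mem_comap, map_sub, res_extend, sub_self]
      exact Submodule.zero_mem _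
    · simpa using h.2
  · obtain ⟨κ, hκ, h⟩ := mem_bdry_succ.1 h
    refine ⟨extend Z p ψ - κ, ⟨?_, ?_⟩, ?_⟩
    · exact (compactSupp X _).sub_mem (extend_mem_compactSupp hZ hψ.1) hκ.1
    · rw [SetLike.mem_coe, Submodule.mem_comap, map_sub]
      exact h
    · rw [map_sub, res_extend, sub_sub_cancel]
      exact locallyZero_le_bdry _ _ hκ.2

theorem exact_connecting (p : ℕ) : Function.Exact (connecting hZ p) (relToAbs Z (p + 1)) := by
  refine Subquot.map_exact (fun ψ h => ?_) fun φ hφ h => ?_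
  · exact mem_bdry_succ.2 ⟨_, extend_mem_compactSupp hZ h.1, by simp⟩
  · obtain ⟨κ, hκ, h⟩ := mem_bdry_succ.1 h
    refine ⟨res Z p κ, ⟨res_mem_compactSupp hZ hκ, ?_⟩, ?_⟩
    · have h1 := (locallyZero Z (p + 1)).sub_mem hφ.1.2 (res_mem_locallyZero Z h)
      simpa [res_coboundary] using h1
    · refine mem_bdry_succ.2 ⟨κ - extend Z p (res Z p κ), ⟨?_, ?_⟩, ?_⟩
      · exact (compactSupp X _).sub_mem hκ (extend_mem_compactSupp hZ (res_mem_compactSupp hZ hκ))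
      · rw [SetLike.mem_coe, Submodule.mem_comap, map_sub, res_extend, sub_self]
        exact Submodule.zero_mem _
      · rw [map_sub]
        simpa using h

end Closed

end Supports

end AlexanderSpanier

end

noncomputable section

namespace AlexanderSpanier

/-! ### Uniform estimates in metric spaces -/

section Uniform

variable {X : Type} [PseudoMetricSpace X]

/-- A Lebesgue number for the neighbourhoods on which φ vanishes, taken on the compact set L,
suffices for all tuples, because a tuple on which φ is nonzero has a vertex in L. -/
theorem exists_uniform {p : ℕ} {φ : Cochain X p} {L : Set X} (hL : IsCompact L)
    (hφ : ∀ v, φ v ≠ 0 → ∃ k, v k ∈ L) (h : φ ∈ locallyZero X p) :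
    ∃ δ > 0, ∀ v : Fin (p + 1) → X, (∀ j k, dist (v j) (v k) < δ) → φ v = 0 := by
  choose U hU h using h
  obtain ⟨δ, hδ, H⟩ := lebesgue_number_lemma_of_metric hL (c := fun x => interior (U x))
    (fun x => isOpen_interior) fun x _ => Set.mem_iUnion.2 ⟨x, mem_interior_iff_mem_nhds.2 (hU x)⟩
  refine ⟨δ, hδ, fun v hv => ?_⟩
  by_contra hne
  obtain ⟨k, hk⟩ := hφ v hne
  obtain ⟨x, hx⟩ := H _ hk
  exact hne (h x v fun j => interior_subset (hx (hv j k)))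

theorem mem_locallyZero_of_uniform {p : ℕ} {φ : Cochain X p} {δ : ℝ} (hδ : 0 < δ)
    (h : ∀ v : Fin (p + 1) → X, (∀ j k, dist (v j) (v k) < δ) → φ v = 0) : φ ∈ locallyZero X p := by
  intro x
  refine ⟨Metric.ball x (δ / 2), Metric.ball_mem_nhds _ (half_pos hδ), fun v hv => h v fun j k => ?_⟩
  have h1 := Metric.mem_ball.1 (hv j)
  have h2 := Metric.mem_ball'.1 (hv k)
  linarith [dist_triangle (v j) x (v k)]

end Uniform

theorem coboundary_ne_zero {X : Type} {p : ℕ} {φ : Cochain X p} {L : Set X}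
    (hφ : ∀ v, φ v ≠ 0 → ∃ k, v k ∈ L) (v : Fin (p + 2) → X) (h : coboundary X p φ v ≠ 0) :
    ∃ k, v k ∈ L := by
  rw [coboundary_apply, altSum] at h
  obtain ⟨k, -, hk⟩ := Finset.exists_ne_zero_of_sum_ne_zero h
  obtain ⟨j, hj⟩ := hφ _ (right_ne_zero_of_mul hk)
  exact ⟨_, hj⟩

/-- Deleting the values on tuples that leave a compact neighbourhood of the support changes φ only
by a locally zero cochain. Afterwards φ vanishes on every tuple with a vertex outside L, not only on
small ones; pullbacks and prisms need this because they are applied along maps that need not be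
continuous. -/
theorem exists_strict_support {X : Type} [TopologicalSpace X] [LocallyCompactSpace X] {p : ℕ}
    {φ : Cochain X p} {U : Set X} (hU : IsOpen U) (hφ : φ ∈ openSupp U p) :
    ∃ (φ' : Cochain X p) (L : Set X), IsCompact L ∧ L ⊆ U ∧ φ - φ' ∈ locallyZero X p ∧
      ∀ v, φ' v ≠ 0 → ∀ k, v k ∈ L := by
  classical
  obtain ⟨K, hK, hKU, h⟩ := hφ
  obtain ⟨L, hL, hKL, hLU⟩ := exists_compact_between hK hU hKU
  refine ⟨fun v => if ∀ k, v k ∈ L then φ v else 0, L, hL, hLU, fun x => ?_, fun v hv => ?_⟩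
  · by_cases hx : x ∈ interior L
    · refine ⟨interior L, isOpen_interior.mem_nhds hx, fun v hv => ?_⟩
      have : ∀ k, v k ∈ L := fun k => interior_subset (hv k)
      simp [this]
    · obtain ⟨V, hV, h⟩ := h x fun hxK => hx (hKL hxK)
      refine ⟨V, hV, fun v hv => ?_⟩
      simp [h v hv]
  · by_contra hn
    exact hv (if_neg hn)

theorem mem_openSupp_of_strict {X : Type} [TopologicalSpace X] [T2Space X] {p : ℕ}
    {φ : Cochain X p} {U L : Set X} (hL : IsCompact L) (hLU : L ⊆ U)
    (h : ∀ v, φ v ≠ 0 → ∀ k, v k ∈ L) : φ ∈ openSupp U p :=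
  ⟨L, hL, hLU, fun _ hx => ⟨Lᶜ, hL.isClosed.isOpen_compl.mem_nhds hx, fun v hv => by
    by_contra hne
    exact hv 0 (h v hne 0)⟩⟩

theorem compactSupp_eq_openSupp {X : Type} [TopologicalSpace X] :
    compactSupp X = openSupp Set.univ := by
  funext p
  refine le_antisymm (fun φ ⟨K, hK, h⟩ => ⟨K, hK, Set.subset_univ _, h⟩) (openSupp_le_compactSupp _ p)

/-! ### Homotopies between nearby maps -/

section Pullback

variable {X : Type}

theorem prism_strict {n : ℕ} {φ : (Fin (n + 1) → X) → ℂ} {f g : X → X} {L L' : Set X}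
    (hφ : ∀ v, φ v ≠ 0 → ∀ k, v k ∈ L) (hL : ∀ x, x ∉ L' → f x ∉ L ∧ g x ∉ L)
    (v : Fin n → X) (hv : prism f g φ v ≠ 0) (k : Fin n) : v k ∈ L' := by
  by_contra hk
  refine hv (prism_eq_zero _ _ _ _ fun w _ h2 => ?_)
  by_contra hne
  obtain ⟨i, hi | hi⟩ := h2 k
  · exact (hL _ hk).1 (hi ▸ hφ w hne i)
  · exact (hL _ hk).2 (hi ▸ hφ w hne i)

theorem sub_pull_eq {p : ℕ} (φ : Cochain X (p + 1)) (f g : X → X) :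
    pull g (p + 1) φ - pull f (p + 1) φ = coboundary X p (prism f g φ) +
      (prism f g (coboundary X (p + 1) φ) : Cochain X (p + 1)) := by
  funext v
  exact (altSum_prism f g φ v).symm

theorem sub_pull_zero_eq (φ : Cochain X 0) (f g : X → X) :
    pull g 0 φ - pull f 0 φ = (prism f g (coboundary X 0 φ) : Cochain X 0) := by
  funext v
  have := (altSum_prism f g φ v).symm
  have h0 : altSum (prism f g φ) v = 0 :=
    Finset.sum_eq_zero fun k _ => mul_eq_zero_of_right _ rfl
  rw [h0] at this
  exact this.trans (zero_add _)

end Pullback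

section Nearby

variable {X : Type} [MetricSpace X]

theorem prism_uniform {p : ℕ} {φ : Cochain X (p + 1)} {f : X → X} {δ ε : ℝ} (hε : 4 * ε ≤ δ)
    (hf : ∀ x, dist x (f x) < ε)
    (hφ : ∀ v : Fin (p + 2) → X, (∀ j k, dist (v j) (v k) < δ) → φ v = 0)
    (v : Fin (p + 1) → X) (hv : ∀ j k, dist (v j) (v k) < ε) : prism f id φ v = 0 := by
  have hε0 : 0 < ε := lt_of_le_of_lt dist_nonneg (hf (v 0))
  refine prism_eq_zero _ _ _ _ fun w h1 _ => hφ w fun j k => ?_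
  have key : ∀ k, ∃ i, dist (w k) (v i) < ε := fun k => by
    obtain ⟨i, hi | hi⟩ := h1 k
    · exact ⟨i, by rw [hi, dist_comm]; exact hf _⟩
    · exact ⟨i, by simpa [hi] using hε0⟩
  obtain ⟨i, hi⟩ := key j
  obtain ⟨i', hi'⟩ := key k
  rw [dist_comm] at hi'
  linarith [dist_triangle4 (w j) (v i) (v i') (w k), hv i i']

end Nearby

/-! ### Tautness -/

section Taut

variable {X : Type} [MetricSpace X] {Z : Set X}

open Classical in
/-- A map of sets that moves the points close to `Z` into `Z`. -/
def nearMap (Z : Set X) (ε : ℝ) (x : X) : X :=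
  if x ∈ Z then x else if h : ∃ z ∈ Z, dist x z < ε then h.choose else x

theorem nearMap_of_mem {ε : ℝ} {x : X} (h : x ∈ Z) : nearMap Z ε x = x := if_pos h

theorem nearMap_mem {ε : ℝ} {x : X} (h : ∃ z ∈ Z, dist x z < ε) : nearMap Z ε x ∈ Z := by
  by_cases hx : x ∈ Z
  · rwa [nearMap_of_mem hx]
  · rw [nearMap, if_neg hx, dif_pos h]
    exact h.choose_spec.1

theorem dist_nearMap {ε : ℝ} (hε : 0 < ε) (x : X) : dist x (nearMap Z ε x) < ε := by
  by_cases hx : x ∈ Z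
  · rwa [nearMap_of_mem hx, dist_self]
  · rw [nearMap, if_neg hx]
    split_ifs with h
    · exact h.choose_spec.2
    · rwa [dist_self]

/-- Close to Z all vertices are moved into Z, where φ vanishes on small tuples. Hence the pullback
is supported at distance at least ε/2 from every point of Z. -/
theorem pull_nearMap_mem_openSupp {p : ℕ} {φ : Cochain X p} {L L' : Set X} {δ ε : ℝ} (hε : 0 < ε)
    (hδ : 4 * ε ≤ δ) (hL' : IsCompact L') (hLL' : ∀ x, x ∉ L' → ∀ y, dist x y < ε → y ∉ L)
    (hφ : ∀ v, φ v ≠ 0 → ∀ k, v k ∈ L)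
    (hZ : ∀ v : Fin (p + 1) → X, (∀ k, v k ∈ Z) → (∀ j k, dist (v j) (v k) < δ) → φ v = 0) :
    pull (nearMap Z ε) p φ ∈ openSupp Zᶜ p := by
  refine ⟨L' ∩ ⋂ z ∈ Z, {x | ε / 2 ≤ dist x z}, hL'.inter_right ?_, ?_, fun x hx => ?_⟩
  · exact isClosed_biInter fun z _ => isClosed_le continuous_const (continuous_id.dist continuous_const)
  · rintro x ⟨-, hx⟩ hxZ
    have := Set.mem_iInter₂.1 hx x hxZ
    simp only [Set.mem_ofPred_eq, dist_self] at this
    linarith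
  · by_cases hxL : x ∈ L'
    · obtain ⟨z, hz, hxz⟩ : ∃ z ∈ Z, dist x z < ε / 2 := by
        by_contra hcon
        push Not at hcon
        exact hx ⟨hxL, Set.mem_iInter₂.2 hcon⟩
      refine ⟨Metric.ball z (ε / 2), Metric.isOpen_ball.mem_nhds hxz, fun v hv => ?_⟩
      have hv' : ∀ k, dist (v k) z < ε / 2 := hv
      refine hZ _ (fun k => nearMap_mem ⟨z, hz, by linarith [hv' k]⟩) fun j k => ?_
      have h1 := dist_nearMap (Z := Z) hε (v j)
      have h2 := dist_nearMap (Z := Z) hε (v k)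
      have h3 := hv' j
      have h4 := hv' k
      rw [dist_comm] at h1 h4
      simp only [Function.comp_apply]
      linarith [dist_triangle4 (nearMap Z ε (v j)) (v j) (v k) (nearMap Z ε (v k)),
        dist_triangle (v j) z (v k)]
    · refine ⟨L'ᶜ, hL'.isClosed.isOpen_compl.mem_nhds hxL, fun v hv => ?_⟩
      by_contra hne
      exact hLL' _ (hv 0) _ (dist_nearMap hε _) (hφ _ hne 0)

theorem exists_thicken [LocallyCompactSpace X] {L U : Set X} (hL : IsCompact L) (hU : IsOpen U)
    (hLU : L ⊆ U) : ∃ δ > 0, ∀ ε ≤ δ, ∃ L' : Set X, IsCompact L' ∧ L' ⊆ U ∧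
      ∀ x, x ∉ L' → ∀ y, dist x y < ε → y ∉ L := by
  obtain ⟨δ, hδ, h⟩ := hL.exists_isCompact_cthickening
  obtain ⟨δ', hδ', h'⟩ := hL.exists_cthickening_subset_open hU hLU
  refine ⟨min δ δ', lt_min hδ hδ', fun ε hε => ⟨Metric.cthickening (min δ δ') L, ?_, ?_, ?_⟩⟩
  · exact h.of_isClosed_subset Metric.isClosed_cthickening
      (Metric.cthickening_mono (min_le_left _ _) _)
  · exact (Metric.cthickening_mono (min_le_right _ _) _).trans h'
  · intro x hx y hxy hy
    exact hx (Metric.mem_cthickening_of_dist_le x y _ L hy (hxy.le.trans hε))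

theorem res_uniform {p : ℕ} {φ : Cochain X p} {L : Set X} (hZ : IsClosed Z) (hL : IsCompact L)
    (hφ : ∀ v, φ v ≠ 0 → ∀ k, v k ∈ L) (h : res Z p φ ∈ locallyZero Z p) :
    ∃ δ > 0, ∀ v : Fin (p + 1) → X, (∀ k, v k ∈ Z) → (∀ j k, dist (v j) (v k) < δ) → φ v = 0 := by
  obtain ⟨δ, hδ, h⟩ := exists_uniform (X := Z) (L := Subtype.val ⁻¹' L)
    (hZ.isClosedEmbedding_subtypeVal.isCompact_preimage hL)
    (fun v hv => ⟨0, hφ _ hv 0⟩) h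
  exact ⟨δ, hδ, fun v hvZ hv => h (fun k => ⟨v k, hvZ k⟩) hv⟩

theorem mem_compactSupp_of_strict {p : ℕ} {φ : Cochain X p} {L : Set X} (hL : IsCompact L)
    (h : ∀ v, φ v ≠ 0 → ∀ k, v k ∈ L) : φ ∈ compactSupp X p :=
  openSupp_le_compactSupp _ _ (mem_openSupp_of_strict hL (Set.subset_univ L) h)

theorem pull_uniform {p : ℕ} {φ : Cochain X p} {f : X → X} {δ ε : ℝ} (hε : 4 * ε ≤ δ)
    (hf : ∀ x, dist x (f x) < ε)
    (hφ : ∀ v : Fin (p + 1) → X, (∀ j k, dist (v j) (v k) < δ) → φ v = 0)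
    (v : Fin (p + 1) → X) (hv : ∀ j k, dist (v j) (v k) < ε) : pull f p φ v = 0 := by
  have hε0 : 0 < ε := lt_of_le_of_lt dist_nonneg (hf (v 0))
  refine hφ _ fun j k => ?_
  have h1 := hf (v j)
  rw [dist_comm] at h1
  simp only [Function.comp_apply]
  linarith [dist_triangle4 (f (v j)) (v j) (v k) (f (v k)), hf (v k), hv j k]

variable [LocallyCompactSpace X]

/-- Pulling back along `nearMap` pushes the support off Z. Although this map is not continuous, it
moves points by less than ε, so the prism gives a homotopy to the identity up to locally zero
cochains. -/
theorem taut_surjective (hZ : IsClosed Z) {p : ℕ} {φ : Cochain X p} (hφ : φ ∈ cyc (relSupp Z) p) :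
    ∃ φ' ∈ cyc (openSupp Zᶜ) p, φ - φ' ∈ bdry (relSupp Z) p := by
  obtain ⟨φ₁, L, hL, -, hφφ₁, hs⟩ := exists_strict_support (U := Set.univ) isOpen_univ
    (compactSupp_eq_openSupp (X := X) ▸ hφ.1.1 : φ ∈ openSupp Set.univ p)
  have hφ₁ : φ₁ ∈ cyc (relSupp Z) p :=
    cyc_of_sub_mem_locallyZero (locallyZero_le_relSupp Z) hφφ₁ hφ
  obtain ⟨δ₁, hδ₁, h1⟩ := exists_uniform hL (coboundary_ne_zero fun v hv => ⟨0, hs v hv 0⟩) hφ₁.2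
  obtain ⟨δ₂, hδ₂, h2⟩ := res_uniform hZ hL hs hφ₁.1.2
  obtain ⟨δ₃, hδ₃, h3⟩ := exists_thicken hL isOpen_univ (Set.subset_univ L)
  set ε := min (min δ₁ δ₂) δ₃ / 4 with hε
  have hε0 : 0 < ε := by positivity
  have hm1 : 4 * ε ≤ δ₁ := by
    have : min (min δ₁ δ₂) δ₃ ≤ δ₁ := (min_le_left _ _).trans (min_le_left _ _)
    linarith
  have hm2 : 4 * ε ≤ δ₂ := by
    have : min (min δ₁ δ₂) δ₃ ≤ δ₂ := (min_le_left _ _).trans (min_le_right _ _)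
    linarith
  have hm3 : ε ≤ δ₃ := by
    have : min (min δ₁ δ₂) δ₃ ≤ δ₃ := min_le_right _ _
    linarith
  obtain ⟨L', hL', -, hLL'⟩ := h3 ε hm3
  have hr : ∀ x, dist x (nearMap Z ε x) < ε := dist_nearMap hε0
  have hP : ∀ x, x ∉ L' → nearMap Z ε x ∉ L ∧ id x ∉ L := fun x hx =>
    ⟨hLL' x hx _ (hr x), hLL' x hx _ (by simpa using hε0)⟩
  have hpull : pull (nearMap Z ε) p φ₁ ∈ openSupp Zᶜ p :=
    pull_nearMap_mem_openSupp hε0 hm2 hL' hLL' hs h2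
  refine ⟨pull (nearMap Z ε) p φ₁, ⟨hpull, ?_⟩, ?_⟩
  · exact mem_locallyZero_of_uniform hε0 (pull_uniform hm1 hr h1)
  · have hD := mem_locallyZero_of_uniform hε0
      (prism_uniform (φ := coboundary X p φ₁) hm1 hr h1)
    have hkey : φ₁ - pull (nearMap Z ε) p φ₁ ∈ bdry (relSupp Z) p := by
      cases p with
      | zero =>
        have := sub_pull_zero_eq φ₁ (nearMap Z ε) id
        rw [show pull id 0 φ₁ = φ₁ from rfl] at this
        rw [this]
        exact hD
      | succ p =>
        have := sub_pull_eq φ₁ (nearMap Z ε) id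
        rw [show pull id (p + 1) φ₁ = φ₁ from rfl] at this
        rw [this]
        refine mem_bdry_succ.2 ⟨prism (nearMap Z ε) id φ₁, ⟨?_, ?_⟩, ?_⟩
        · exact mem_compactSupp_of_strict hL' (prism_strict hs hP)
        -- `nearMap` fixes Z, so on tuples in Z the prism evaluates φ₁ on tuples made of the same
        -- points; therefore it is again locally zero on Z.
        · refine mem_locallyZero_of_uniform (hδ₂) fun v hv => ?_
          refine prism_eq_zero _ _ _ _ fun w hw _ => ?_
          have hw' : ∀ k, ∃ j, w k = v j := fun k => by
            obtain ⟨j, hj | hj⟩ := hw k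
            · exact ⟨j, hj.trans (nearMap_of_mem (v j).2)⟩
            · exact ⟨j, hj⟩
          choose i hi using hw'
          refine h2 w (fun k => hi k ▸ (v (i k)).2) fun j k => ?_
          rw [hi, hi]
          exact hv _ _
        · rw [add_sub_cancel_left]
          exact hD
    have := (bdry (relSupp Z) p).add_mem (locallyZero_le_bdry _ p hφφ₁) hkey
    simpa using this

/-- A relative primitive ψ of φ is moved off Z by the same pullback. This gives a primitive of the
pullback of φ, and the prism of φ, whose support stays in the complement of Z, corrects it to a
primitive of φ. -/
theorem taut_injective (hZ : IsClosed Z) {p : ℕ} {φ : Cochain X p} (hφ : φ ∈ cyc (openSupp Zᶜ) p)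
    (h : φ ∈ bdry (relSupp Z) p) : φ ∈ bdry (openSupp Zᶜ) p := by
  cases p with
  | zero => exact h
  | succ p =>
    obtain ⟨ψ, hψ, h⟩ := mem_bdry_succ.1 h
    obtain ⟨φ₁, L, hL, hLU, hφφ₁, hs⟩ := exists_strict_support hZ.isOpen_compl hφ.1
    obtain ⟨ψ₁, M, hM, -, hψψ₁, ht⟩ := exists_strict_support (U := Set.univ) isOpen_univ
      (compactSupp_eq_openSupp (X := X) ▸ hψ.1 : ψ ∈ openSupp Set.univ p)
    have hφ₁ : φ₁ ∈ cyc (openSupp Zᶜ) (p + 1) :=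
      cyc_of_sub_mem_locallyZero (locallyZero_le_openSupp _) hφφ₁ hφ
    have hψ₁ : ψ₁ ∈ relSupp Z p := mem_of_sub_mem_locallyZero (locallyZero_le_relSupp Z) hψψ₁ hψ
    have hη : φ₁ - coboundary X p ψ₁ ∈ locallyZero X (p + 1) := by
      have := (locallyZero X (p + 1)).add_mem
        ((locallyZero X (p + 1)).sub_mem h hφφ₁) (coboundary_mem_locallyZero hψψ₁)
      convert this using 1
      rw [map_sub]
      abel
    obtain ⟨δ₁, hδ₁, h1⟩ := exists_uniform hL (coboundary_ne_zero fun v hv => ⟨0, hs v hv 0⟩) hφ₁.2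
    obtain ⟨δ₂, hδ₂, h2⟩ := res_uniform hZ hM ht hψ₁.2
    obtain ⟨δ₃, hδ₃, h3⟩ := exists_thicken hL hZ.isOpen_compl hLU
    obtain ⟨δ₄, hδ₄, h4⟩ := exists_thicken hM isOpen_univ (Set.subset_univ M)
    obtain ⟨δ₅, hδ₅, h5⟩ := exists_uniform (hL.union hM) (φ := φ₁ - coboundary X p ψ₁) (fun v hv => by
      by_cases hv1 : φ₁ v = 0
      · have h6 : coboundary X p ψ₁ v ≠ 0 := fun h0 => hv (by simp [hv1, h0])
        obtain ⟨k, hk⟩ := coboundary_ne_zero (fun v hv => ⟨0, ht v hv 0⟩) v h6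
        exact ⟨k, Or.inr hk⟩
      · exact ⟨0, Or.inl (hs v hv1 0)⟩) hη
    -- One ε has to serve five estimates: dφ₁ = 0 and φ₁ = dψ₁ on small tuples, ψ₁ = 0 on small
    -- tuples in Z, and room around the two compact supports.
    obtain ⟨ε, hε0, hm1, hm2, hm3, hm4, hm5⟩ : ∃ ε > 0, 4 * ε ≤ δ₁ ∧ 4 * ε ≤ δ₂ ∧ ε ≤ δ₃ ∧
        ε ≤ δ₄ ∧ 4 * ε ≤ δ₅ := by
      refine ⟨min δ₁ (min δ₂ (min δ₃ (min δ₄ δ₅))) / 4, by positivity, ?_⟩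
      set μ := min δ₁ (min δ₂ (min δ₃ (min δ₄ δ₅)))
      have e1 : μ ≤ δ₁ := min_le_left _ _
      have e1' : μ ≤ min δ₂ (min δ₃ (min δ₄ δ₅)) := min_le_right _ _
      have e2 := e1'.trans (min_le_left _ _)
      have e2' := e1'.trans (min_le_right _ _)
      have e3 := e2'.trans (min_le_left _ _)
      have e3' := e2'.trans (min_le_right _ _)
      have e4 := e3'.trans (min_le_left _ _)
      have e5 := e3'.trans (min_le_right _ _)
      have e0 : 0 < μ := by positivity
      refine ⟨?_, ?_, ?_, ?_, ?_⟩ <;> linarith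
    obtain ⟨L', hL', hLU', hLL'⟩ := h3 ε hm3
    obtain ⟨M', hM', -, hMM'⟩ := h4 ε hm4
    have hr : ∀ x, dist x (nearMap Z ε x) < ε := dist_nearMap hε0
    have hP : ∀ x, x ∉ L' → nearMap Z ε x ∉ L ∧ id x ∉ L := fun x hx =>
      ⟨hLL' x hx _ (hr x), hLL' x hx _ (by simpa using hε0)⟩
    have hD := mem_locallyZero_of_uniform hε0
      (prism_uniform (φ := coboundary X (p + 1) φ₁) hm1 hr h1)
    have hpullη := mem_locallyZero_of_uniform hε0 (pull_uniform hm5 hr h5)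
    have hid := sub_pull_eq φ₁ (nearMap Z ε) id
    rw [show pull id (p + 1) φ₁ = φ₁ from rfl] at hid
    refine mem_bdry_succ.2 ⟨pull (nearMap Z ε) p ψ₁ + prism (nearMap Z ε) id φ₁,
      (openSupp Zᶜ p).add_mem (pull_nearMap_mem_openSupp hε0 hm2 hM' hMM' ht h2)
        (mem_openSupp_of_strict hL' hLU' (prism_strict hs hP)), ?_⟩
    have := (locallyZero X (p + 1)).add_mem hφφ₁ ((locallyZero X (p + 1)).add_mem hpullη hD)
    convert this using 1
    rw [map_sub, map_add, pull_coboundary]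
    linear_combination (exp := 1) hid

end Taut

end AlexanderSpanier

end

noncomputable section

namespace AlexanderSpanier

/-! ### Restriction to an open subspace -/

section Open

variable {X : Type} [TopologicalSpace X] {U : Set X}

theorem mem_locallyZero_of_res (hU : IsOpen U) {p : ℕ} {φ : Cochain X p} (hφ : φ ∈ openSupp U p)
    (h : res U p φ ∈ locallyZero U p) : φ ∈ locallyZero X p := by
  obtain ⟨K, hK, hKU, hφ⟩ := hφ
  intro x
  by_cases hx : x ∈ U
  · obtain ⟨V, hV, h⟩ := h ⟨x, hx⟩
    refine ⟨Subtype.val '' V, hU.isOpenMap_subtype_val.image_mem_nhds hV, fun v hv => ?_⟩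
    choose w hw hwv using hv
    obtain rfl : (fun k => (w k : X)) = v := funext hwv
    exact h w hw
  · exact hφ x fun hxK => hx (hKU hxK)

theorem res_mem_compactSupp_of_openSupp {p : ℕ} {φ : Cochain X p} (hφ : φ ∈ openSupp U p) :
    res U p φ ∈ compactSupp U p := by
  obtain ⟨K, hK, hKU, hφ⟩ := hφ
  refine ⟨Subtype.val ⁻¹' K, ?_, fun x hx => (hφ _ hx).pull continuous_subtype_val.continuousAt⟩
  rw [Subtype.isCompact_iff, Subtype.image_preimage_coe, Set.inter_eq_right.2 hKU]
  exact hK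

theorem exists_openSupp_res [T2Space X] [LocallyCompactSpace X] (hU : IsOpen U) {p : ℕ}
    {ψ : Cochain U p} (hψ : ψ ∈ compactSupp U p) :
    ∃ φ ∈ openSupp U p, ψ - res U p φ ∈ locallyZero U p := by
  have := hU.locallyCompactSpace
  obtain ⟨ψ₁, L, hL, -, h, hs⟩ := exists_strict_support (U := Set.univ) isOpen_univ
    (compactSupp_eq_openSupp (X := U) ▸ hψ : ψ ∈ openSupp Set.univ p)
  refine ⟨extend U p ψ₁, mem_openSupp_of_strict (hL.image continuous_subtype_val) ?_ ?_, ?_⟩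
  · exact Subtype.coe_image_subset U L
  · intro v hv k
    by_cases hvU : ∀ k, v k ∈ U
    · rw [extend_of_forall _ hvU] at hv
      exact ⟨_, hs _ hv k, rfl⟩
    · push Not at hvU
      obtain ⟨j, hj⟩ := hvU
      exact absurd (extend_of_not _ hj) hv
  · rwa [res_extend]

/-- `H_c(U)` as cohomology of `X` with supports in `U`. -/
def openSuppEquiv [T2Space X] [LocallyCompactSpace X] (hU : IsOpen U) (p : ℕ) :
    HH (openSupp U) p ≃ₗ[ℂ] HH (compactSupp U) p :=
  LinearEquiv.ofBijective
    (Subquot.map (Z := cyc (openSupp U) p) (B := bdry (openSupp U) p)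
      (Z' := cyc (compactSupp U) p) (B' := bdry (compactSupp U) p) (res U p)
      (fun _ h => ⟨res_mem_compactSupp_of_openSupp h.1, res_mem_locallyZero U h.2⟩)
      fun _ _ h => by
        cases p
        · exact res_mem_locallyZero U h
        · obtain ⟨ψ, hψ, h⟩ := mem_bdry_succ.1 h
          exact mem_bdry_succ.2 ⟨_, res_mem_compactSupp_of_openSupp hψ, res_mem_locallyZero U h⟩)
    ⟨Subquot.map_injective fun φ hφ h => by
      cases p
      · exact mem_locallyZero_of_res hU hφ.1 h
      · obtain ⟨ψ, hψ, h⟩ := mem_bdry_succ.1 h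
        obtain ⟨κ, hκ, h'⟩ := exists_openSupp_res hU hψ
        refine mem_bdry_succ.2 ⟨κ, hκ, mem_locallyZero_of_res hU
          ((openSupp U _).sub_mem hφ.1 (coboundary_mem_openSupp hκ)) ?_⟩
        have := (locallyZero U _).add_mem h (coboundary_mem_locallyZero h')
        convert this using 1
        rw [map_sub, map_sub, res_coboundary]
        abel,
    Subquot.map_surjective fun ψ hψ => by
      obtain ⟨φ, hφ, h⟩ := exists_openSupp_res hU hψ.1
      refine ⟨φ, ⟨hφ, mem_locallyZero_of_res hU (coboundary_mem_openSupp hφ) ?_⟩,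
        locallyZero_le_bdry _ _ h⟩
      have := (locallyZero U _).sub_mem hψ.2 (coboundary_mem_locallyZero h)
      simpa [res_coboundary] using this⟩

end Open

/-- `H_c(X, Z) = H_c(X \ Z)`. -/
def relEquiv {X : Type} [MetricSpace X] [LocallyCompactSpace X] {Z : Set X} (hZ : IsClosed Z)
    (p : ℕ) : HH (openSupp Zᶜ) p ≃ₗ[ℂ] HH (relSupp Z) p :=
  LinearEquiv.ofBijective
    (Subquot.map (Z := cyc (openSupp Zᶜ) p) (B := bdry (openSupp Zᶜ) p)
      (Z' := cyc (relSupp Z) p) (B' := bdry (relSupp Z) p) LinearMap.id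
      (fun _ h => ⟨openSupp_le_relSupp _ h.1, h.2⟩) fun _ _ h => by
      cases p
      · exact h
      · obtain ⟨ψ, hψ, h⟩ := mem_bdry_succ.1 h
        exact mem_bdry_succ.2 ⟨_, openSupp_le_relSupp _ hψ, h⟩)
    ⟨Subquot.map_injective fun _ hφ h => taut_injective hZ hφ h,
    Subquot.map_surjective fun _ hφ => taut_surjective hZ hφ⟩

/-! ### Homeomorphisms -/

section Homeo

variable {X Y : Type} [TopologicalSpace X] [TopologicalSpace Y] (e : X ≃ₜ Y)

theorem pull_mem_compactSupp {p : ℕ} {φ : Cochain Y p} (h : φ ∈ compactSupp Y p) :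
    pull e p φ ∈ compactSupp X p := by
  obtain ⟨K, hK, h⟩ := h
  exact ⟨e ⁻¹' K, e.isCompact_preimage.2 hK, fun x hx => (h _ hx).pull e.continuous.continuousAt⟩

theorem pull_mem_cyc {p : ℕ} {φ : Cochain Y p} (h : φ ∈ cyc (compactSupp Y) p) :
    pull e p φ ∈ cyc (compactSupp X) p :=
  ⟨pull_mem_compactSupp e h.1, pull_mem_locallyZero e.continuous h.2⟩

theorem pull_mem_bdry {p : ℕ} {φ : Cochain Y p} (h : φ ∈ bdry (compactSupp Y) p) :
    pull e p φ ∈ bdry (compactSupp X) p := by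
  cases p
  · exact pull_mem_locallyZero e.continuous h
  · obtain ⟨ψ, hψ, h⟩ := mem_bdry_succ.1 h
    exact mem_bdry_succ.2 ⟨_, pull_mem_compactSupp e hψ, pull_mem_locallyZero e.continuous h⟩

/-- Invariance of compactly supported cohomology under homeomorphisms. -/
def homeoEquiv (p : ℕ) : HH (compactSupp Y) p ≃ₗ[ℂ] HH (compactSupp X) p :=
  LinearEquiv.ofBijective
    (Subquot.map (pull e p) (fun _ h => pull_mem_cyc e h) fun _ _ h => pull_mem_bdry e h)
    ⟨Subquot.map_injective fun φ _ h => by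
      convert pull_mem_bdry e.symm h
      funext v
      simp [pull_apply, Function.comp_def],
    Subquot.map_surjective fun φ h => ⟨_, pull_mem_cyc e.symm h, by
      convert Submodule.zero_mem _
      funext v
      simp [pull_apply, Function.comp_def]⟩⟩

end Homeo

/-! ### Vanishing for `X × [0, ∞)` -/

section HalfLine

open scoped NNReal

variable {X : Type}

/-- Translation along the second factor. -/
def shift (s : ℝ≥0) (y : X × ℝ≥0) : X × ℝ≥0 := (y.1, y.2 + s)

theorem shift_shift (s t : ℝ≥0) (y : X × ℝ≥0) : shift s (shift t y) = shift (t + s) y := by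
  simp [shift, add_assoc]

variable [MetricSpace X]

theorem dist_shift_shift (s : ℝ≥0) (y z : X × ℝ≥0) : dist (shift s y) (shift s z) = dist y z := by
  simp [shift, Prod.dist_eq, NNReal.dist_eq]

theorem dist_shift (s : ℝ≥0) (y : X × ℝ≥0) : dist y (shift s y) = s := by
  simp [shift, Prod.dist_eq, NNReal.dist_eq]

/-- A translation by c < ε is homotopic to the identity by the prism; n such translations compose.
Translating increases the second coordinate, so a point outside the box K × [0, T] is moved to a
point outside it, and the hypotheses persist. -/
theorem sub_pull_shift_mem_bdry {p : ℕ} {K : Set X} {T : ℝ≥0} {δ ε : ℝ} {c : ℝ≥0}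
    (hK : IsCompact K) (hc : c < ε) (hε : 4 * ε ≤ δ) (n : ℕ) :
    ∀ φ : Cochain (X × ℝ≥0) p, (∀ v, φ v ≠ 0 → ∀ k, v k ∈ K ×ˢ Set.Icc 0 T) →
    (∀ v : Fin (p + 2) → X × ℝ≥0, (∀ j k, dist (v j) (v k) < δ) → coboundary _ p φ v = 0) →
    φ - pull (shift (n * c)) p φ ∈ bdry (compactSupp (X × ℝ≥0)) p := by
  have hε0 : 0 < ε := lt_of_le_of_lt c.2 hc
  induction n with
  | zero =>
    intro φ _ _
    convert Submodule.zero_mem _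
    funext v
    have : shift (X := X) 0 = id := by funext y; simp [shift]
    simp [pull_apply, this]
  | succ n ih =>
    intro φ hs hd
    have hr : ∀ x : X × ℝ≥0, dist x (shift c x) < ε := fun x => by rwa [dist_shift]
    have hbox : ∀ x : X × ℝ≥0, x ∉ K ×ˢ Set.Icc 0 T →
        shift c x ∉ K ×ˢ Set.Icc 0 T ∧ id x ∉ K ×ˢ Set.Icc 0 T := by
      refine fun x hx => ⟨fun h => hx ⟨h.1, zero_le, ?_⟩, hx⟩
      exact le_trans (le_add_of_nonneg_right zero_le) h.2.2
    have h1 : φ - pull (shift c) p φ ∈ bdry (compactSupp (X × ℝ≥0)) p := by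
      have hD := mem_locallyZero_of_uniform hε0
        (prism_uniform (φ := coboundary _ p φ) hε hr hd)
      cases p with
      | zero =>
        have := sub_pull_zero_eq φ (shift c) id
        rw [show pull id 0 φ = φ from rfl] at this
        rw [this]
        exact hD
      | succ p =>
        have := sub_pull_eq φ (shift c) id
        rw [show pull id (p + 1) φ = φ from rfl] at this
        rw [this]
        refine mem_bdry_succ.2 ⟨prism (shift c) id φ, ?_, ?_⟩
        · exact mem_compactSupp_of_strict (hK.prod isCompact_Icc) (prism_strict hs hbox)
        · rw [add_sub_cancel_left]
          exact hD
    have h2 := ih (pull (shift c) p φ) (fun v hv k => ?_) fun v hv => ?_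
    · have := Submodule.add_mem _ h1 h2
      convert this using 1
      have : pull (shift (n * c)) p (pull (shift c) p φ) = pull (shift ((n + 1 : ℕ) * c)) p φ := by
        funext v
        rw [pull_apply, pull_apply, pull_apply]
        congr 1
        funext k
        simp [shift_shift, add_mul]
      rw [this]
      abel
    · by_contra hk
      exact (hbox _ hk).1 (hs _ hv k)
    · exact hd (shift c ∘ v) fun j k => (dist_shift_shift c _ _).trans_lt (hv j k)

/-- A cocycle with compact support is cohomologous to its pullback under a long translation, and the
pullback vanishes as soon as the translation carries everything beyond the support. -/
theorem subsingleton_prod_halfLine [LocallyCompactSpace X] (p : ℕ) :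
    Subsingleton (HH (compactSupp (X × ℝ≥0)) p) := by
  refine subsingleton_of_forall_eq 0 fun x => ?_
  obtain ⟨⟨φ, hφ⟩, rfl⟩ := Submodule.Quotient.mk_surjective _ x
  rw [Subquot.mk_eq_zero]
  change φ ∈ _
  obtain ⟨φ₁, L, hL, -, hφφ₁, hs⟩ := exists_strict_support (U := Set.univ) isOpen_univ
    (compactSupp_eq_openSupp (X := X × ℝ≥0) ▸ hφ.1 : φ ∈ openSupp Set.univ p)
  have hφ₁ : φ₁ ∈ cyc (compactSupp _) p :=
    cyc_of_sub_mem_locallyZero locallyZero_le_compactSupp hφφ₁ hφ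
  obtain ⟨δ, hδ, h1⟩ := exists_uniform hL (coboundary_ne_zero fun v hv => ⟨0, hs v hv 0⟩) hφ₁.2
  obtain ⟨T, hT⟩ := (hL.image continuous_snd).bddAbove
  have hs' : ∀ v, φ₁ v ≠ 0 → ∀ k, v k ∈ (Prod.fst '' L) ×ˢ Set.Icc 0 T := fun v hv k =>
    ⟨⟨_, hs v hv k, rfl⟩, zero_le, hT ⟨_, hs v hv k, rfl⟩⟩
  -- The step must be smaller than ε = δ/4, which in turn must satisfy 4ε ≤ δ; n is then chosen so
  -- that nc exceeds the height T of the support.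
  set c : ℝ≥0 := ⟨δ / 8, by positivity⟩ with hc
  have hc0 : 0 < c := by
    rw [← NNReal.coe_pos]
    change 0 < δ / 8
    positivity
  obtain ⟨n, hn⟩ := Archimedean.arch (T + 1) hc0
  rw [nsmul_eq_mul] at hn
  have h2 := sub_pull_shift_mem_bdry (c := c) (ε := δ / 4) (δ := δ)
    (hL.image continuous_fst) (by change δ / 8 < δ / 4; linarith) (by linarith) n φ₁ hs' h1
  have h3 : pull (shift (n * c)) p φ₁ = 0 := by
    funext v
    by_contra hne
    have := (hs' _ hne 0).2.2
    simp only [shift, Function.comp_apply] at this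
    have h4 : T + 1 ≤ T := hn.trans (le_trans (le_add_of_nonneg_left zero_le) this)
    exact absurd h4 (not_le.2 (lt_add_of_pos_right T one_pos))
  rw [h3, sub_zero] at h2
  have := Submodule.add_mem _ (locallyZero_le_bdry _ p hφφ₁) h2
  simpa using this

end HalfLine

end AlexanderSpanier

end

noncomputable section

namespace AlexanderSpanier

/-! ### Spaces with known Euler characteristic -/

/-- `X` is a locally compact metrizable space with finite-dimensional compactly supported
cohomology and Euler characteristic `n`. -/
structure HasChi (X : Type) [TopologicalSpace X] (n : ℤ) : Prop where
  locallyCompact : LocallyCompactSpace X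
  metrizable : TopologicalSpace.MetrizableSpace X
  fin : FinGraded (HH (compactSupp X))
  chi : altDim (HH (compactSupp X)) = n

section HasChi

variable {X Y : Type} [TopologicalSpace X] [TopologicalSpace Y] {n m : ℤ}

theorem HasChi.eulerChar_eq (h : HasChi X n) : eulerChar X = n :=
  (altDim_congr (H := HH (compactSupp X)) (H' := Cohomology X) (cohomologyEquiv X)).symm.trans h.chi

theorem HasChi.congr (h : HasChi X n) (e : X ≃ₜ Y) : HasChi Y n where
  locallyCompact := by
    have := h.locallyCompact
    exact e.symm.isClosedEmbedding.locallyCompactSpace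
  metrizable := by
    have := h.metrizable
    exact e.symm.isEmbedding.metrizableSpace
  fin := h.fin.congr (H' := HH (compactSupp Y)) (homeoEquiv e.symm)
  chi := (altDim_congr (H := HH (compactSupp X)) (H' := HH (compactSupp Y))
    (homeoEquiv e.symm)).symm.trans h.chi

/-- Additivity of χ_c from the long exact sequence of Z, in which relative cohomology is that of the
complement. The finiteness of the third term is deduced here too; `HasChi.of_compl` is the same
argument with X as the unknown. -/
theorem HasChi.compl {Z : Set X} (hZ : IsClosed Z) (hX : HasChi X n) (h : HasChi Z m) :
    HasChi ↥Zᶜ (n - m) := by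
  have := hX.locallyCompact
  have := hX.metrizable
  let _ := TopologicalSpace.metrizableSpaceMetric X
  have hrel : FinGraded (HH (relSupp Z)) :=
    FinGraded.left (H' := HH (compactSupp X)) (H'' := HH (compactSupp Z)) (a := relToAbs Z)
      relToAbs_zero_injective (exact_connecting hZ) hX.fin h.fin
  have key := altDim_add (H := HH (relSupp Z)) (H' := HH (compactSupp X))
    (H'' := HH (compactSupp Z)) (a := relToAbs Z) relToAbs_zero_injective (exact_relToAbs hZ) (exact_absToClosed hZ)
    (exact_connecting hZ) hrel hX.fin h.fin
  have e := fun p => (relEquiv hZ p).symm.trans (openSuppEquiv hZ.isOpen_compl p)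
  refine ⟨hZ.isOpen_compl.locallyCompactSpace, inferInstance, hrel.congr (H' := HH (compactSupp ↥Zᶜ)) e, ?_⟩
  rw [← altDim_congr (H := HH (relSupp Z)) (H' := HH (compactSupp ↥Zᶜ)) e, ← hX.chi, ← h.chi, key]
  ring

theorem HasChi.of_compl [LocallyCompactSpace X] [TopologicalSpace.MetrizableSpace X] {Z : Set X}
    (hZ : IsClosed Z) (hU : HasChi ↥Zᶜ n) (h : HasChi Z m) : HasChi X (n + m) := by
  let _ := TopologicalSpace.metrizableSpaceMetric X
  have e := fun p => (relEquiv hZ p).symm.trans (openSuppEquiv hZ.isOpen_compl p)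
  have hrel : FinGraded (HH (relSupp Z)) := hU.fin.congr (H' := HH (relSupp Z)) fun p => (e p).symm
  have hX : FinGraded (HH (compactSupp X)) := FinGraded.middle (H := HH (relSupp Z))
    (H'' := HH (compactSupp Z)) (exact_relToAbs hZ) hrel h.fin
  have key := altDim_add (H := HH (relSupp Z)) (H' := HH (compactSupp X))
    (H'' := HH (compactSupp Z)) (a := relToAbs Z) relToAbs_zero_injective (exact_relToAbs hZ) (exact_absToClosed hZ)
    (exact_connecting hZ) hrel hX h.fin
  refine ⟨inferInstance, inferInstance, hX, ?_⟩
  rw [key, h.chi, altDim_congr (H := HH (relSupp Z)) (H' := HH (compactSupp ↥Zᶜ)) e, hU.chi]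

theorem finGraded_of_subsingleton {H : ℕ → Type} [∀ p, AddCommGroup (H p)] [∀ p, Module ℂ (H p)]
    (h : ∀ p, Subsingleton (H p)) : FinGraded H :=
  ⟨fun _ => inferInstance, 0, fun p _ => h p⟩

theorem altDim_of_subsingleton {H : ℕ → Type} [∀ p, AddCommGroup (H p)] [∀ p, Module ℂ (H p)]
    (h : ∀ p, Subsingleton (H p)) : altDim H = 0 := by
  rw [altDim_eq_sum (n := 0) fun p _ => h p]
  simp

theorem hasChi_of_isEmpty [IsEmpty X] : HasChi X 0 := by
  have h : ∀ p, Subsingleton (HH (compactSupp X) p) := by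
    intro p
    refine subsingleton_of_forall_eq 0 fun x => ?_
    obtain ⟨φ, rfl⟩ := Submodule.Quotient.mk_surjective _ x
    rw [Subquot.mk_eq_zero]
    exact locallyZero_le_bdry _ _ fun x => isEmptyElim x
  have : DiscreteTopology X := ⟨Subsingleton.elim _ _⟩
  exact ⟨inferInstance, inferInstance, finGraded_of_subsingleton h, altDim_of_subsingleton h⟩

theorem hasChi_of_unique [Unique X] : HasChi X 1 := by
  have : DiscreteTopology X := ⟨Subsingleton.elim _ _⟩
  have hcpt : ∀ {p : ℕ} (φ : Cochain X p), φ ∈ compactSupp X p := fun φ =>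
    ⟨Set.univ, isCompact_univ, fun x hx => absurd (Set.mem_univ x) hx⟩
  have hlz : ∀ {p : ℕ} (φ : Cochain X p), φ ∈ locallyZero X p ↔ φ = 0 := by
    intro p φ
    refine ⟨fun h => ?_, fun h => h ▸ Submodule.zero_mem _⟩
    obtain ⟨U, hU, h⟩ := h default
    funext v
    refine h v fun k => ?_
    rw [Subsingleton.elim (v k) default]
    exact mem_of_mem_nhds hU
  -- All p + 2 faces coincide, so the coboundary is multiplication by 0 or 1 according to the parity
  -- of p.
  have hd : ∀ {p : ℕ} (φ : Cochain X p) v,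
      coboundary X p φ v = (if Even p then 0 else 1) * φ (fun _ => default) := by
    intro p φ v
    rw [coboundary_apply, altSum]
    have : ∀ k : Fin (p + 2), (fun j => v (k.succAbove j)) = fun _ => default := fun k =>
      funext fun j => Subsingleton.elim _ _
    simp only [this, ← Finset.sum_mul]
    congr 1
    rw [Fin.sum_univ_eq_sum_range (fun k => (-1 : ℂ) ^ k), neg_one_geom_sum]
    simp [Nat.even_add_one]
  have h0 : HH (compactSupp X) 0 ≃ₗ[ℂ] ℂ := by
    have hz : ∀ φ : Cochain X 0, φ ∈ cyc (compactSupp X) 0 := fun φ =>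
      ⟨hcpt φ, (hlz _).2 (funext fun v => by rw [hd]; simp)⟩
    let f : ℂ →ₗ[ℂ] HH (compactSupp X) 0 :=
      { toFun := fun c => Submodule.Quotient.mk ⟨fun _ => c, hz _⟩
        map_add' := fun _ _ => rfl
        map_smul' := fun _ _ => rfl }
    refine (LinearEquiv.ofBijective f ⟨?_, ?_⟩).symm
    · rw [← LinearMap.ker_eq_bot, Submodule.eq_bot_iff]
      intro c hc
      have h1 := (Subquot.mk_eq_zero _).1 (LinearMap.mem_ker.1 hc)
      exact congrFun ((hlz (fun _ => c : Cochain X 0)).1 h1) fun _ => default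
    · intro x
      obtain ⟨⟨φ, hφ⟩, rfl⟩ := Submodule.Quotient.mk_surjective _ x
      refine ⟨φ fun _ => default, ?_⟩
      change (Submodule.Quotient.mk _ : HH (compactSupp X) 0) = _
      congr 2
      funext v
      congr 1
      funext j
      exact Subsingleton.elim _ _
  have hs : ∀ p, Subsingleton (HH (compactSupp X) (p + 1)) := by
    intro p
    refine subsingleton_of_forall_eq 0 fun x => ?_
    obtain ⟨⟨φ, hφ⟩, rfl⟩ := Submodule.Quotient.mk_surjective _ x
    rw [Subquot.mk_eq_zero]
    change φ ∈ _
    have hφ' : ∀ v : Fin (p + 2) → X, φ v = φ fun _ => default := fun v => by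
      congr 1
      funext j
      exact Subsingleton.elim _ _
    by_cases hp : Even p
    · have h1 := congrFun ((hlz _).1 hφ.2) fun _ => default
      rw [hd, if_neg (by simpa [Nat.even_add_one] using hp)] at h1
      refine locallyZero_le_bdry _ _ ((hlz _).2 (funext fun v => ?_))
      rw [hφ' v]
      simpa using h1
    · refine mem_bdry_succ.2 ⟨fun _ => φ fun _ => default, hcpt _, (hlz _).2 (funext fun v => ?_)⟩
      rw [Pi.sub_apply, hd, if_neg hp]
      simp [hφ' v]
  refine ⟨inferInstance, inferInstance, ⟨fun p => ?_, 1, fun p hp => ?_⟩, ?_⟩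
  · cases p with
    | zero => exact h0.symm.finiteDimensional
    | succ p =>
      have := hs p
      infer_instance
  · obtain ⟨q, rfl⟩ : ∃ q, p = q + 1 := ⟨p - 1, by omega⟩
    exact hs q
  · rw [altDim_eq_sum (n := 1) fun p hp => by
      obtain ⟨q, rfl⟩ : ∃ q, p = q + 1 := ⟨p - 1, by omega⟩
      exact hs q]
    simp [h0.finrank_eq]

-- Via the logarithm, X × ℝ is the complement of X × {0} in X × [0,∞). The latter has no cohomology,
-- so the Euler characteristic is 0 - n.
open scoped NNReal in
theorem HasChi.prod_real (h : HasChi X n) : HasChi (X × ℝ) (-n) := by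
  have := h.locallyCompact
  have := h.metrizable
  let _ := TopologicalSpace.metrizableSpaceMetric X
  have h1 : HasChi (X × ℝ≥0) 0 :=
    ⟨inferInstance, inferInstance, finGraded_of_subsingleton subsingleton_prod_halfLine,
      altDim_of_subsingleton subsingleton_prod_halfLine⟩
  set Z : Set (X × ℝ≥0) := {y | y.2 = 0} with hZ
  have hZc : IsClosed Z := isClosed_eq continuous_snd continuous_const
  have e1 : X ≃ₜ Z :=
    { toFun := fun x => ⟨(x, 0), rfl⟩
      invFun := fun y => y.1.1
      left_inv := fun x => rfl
      right_inv := fun ⟨y, hy⟩ => Subtype.ext (Prod.ext rfl hy.symm)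
      continuous_toFun := by fun_prop
      continuous_invFun := by fun_prop }
  have hpos : ∀ y : ↥Zᶜ, ((y.1.2 : ℝ≥0) : ℝ) ≠ 0 := fun y h0 => y.2 (NNReal.coe_eq_zero.1 h0)
  have e2 : ↥Zᶜ ≃ₜ X × ℝ :=
    { toFun := fun y => (y.1.1, Real.log y.1.2)
      invFun := fun x => ⟨(x.1, ⟨Real.exp x.2, (Real.exp_pos _).le⟩), fun h0 =>
        (Real.exp_pos x.2).ne' (congrArg NNReal.toReal h0)⟩
      left_inv := fun y => Subtype.ext (Prod.ext rfl (NNReal.eq (by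
        have h2 := lt_of_le_of_ne y.1.2.2 (hpos y).symm
        exact Real.exp_log h2)))
      right_inv := fun x => Prod.ext rfl (Real.log_exp _)
      continuous_toFun := by
        refine Continuous.prodMk (by fun_prop) (Continuous.log ?_ hpos)
        fun_prop
      continuous_invFun := by
        refine Continuous.subtype_mk (Continuous.prodMk (by fun_prop) ?_) _
        exact Continuous.subtype_mk (by fun_prop) _ }
  have := (HasChi.compl hZc h1 (h.congr e1)).congr e2
  rwa [zero_sub] at this

theorem HasChi.prod_complex (h : HasChi X n) : HasChi (X × ℂ) n := by
  have h1 := h.prod_real.prod_real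
  rw [neg_neg] at h1
  exact h1.congr ((Homeomorph.prodAssoc X ℝ ℝ).trans
    ((Homeomorph.refl X).prodCongr Complex.equivRealProdCLM.toHomeomorph.symm))

theorem HasChi.prod_units (h : HasChi X n) : HasChi (X × {z : ℂ // z ≠ 0}) 0 := by
  set Z : Set (X × ℂ) := {y | y.2 = 0} with hZ
  have hZc : IsClosed Z := isClosed_eq continuous_snd continuous_const
  have e1 : X ≃ₜ Z :=
    { toFun := fun x => ⟨(x, 0), rfl⟩
      invFun := fun y => y.1.1
      left_inv := fun x => rfl
      right_inv := fun ⟨y, hy⟩ => Subtype.ext (Prod.ext rfl hy.symm)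
      continuous_toFun := by fun_prop
      continuous_invFun := by fun_prop }
  have e2 : ↥Zᶜ ≃ₜ X × {z : ℂ // z ≠ 0} :=
    { toFun := fun y => (y.1.1, ⟨y.1.2, y.2⟩)
      invFun := fun x => ⟨(x.1, x.2.1), x.2.2⟩
      left_inv := fun y => rfl
      right_inv := fun x => rfl
      continuous_toFun := by fun_prop
      continuous_invFun := by fun_prop }
  have := (HasChi.compl hZc h.prod_complex (h.congr e1)).congr e2
  rwa [sub_self] at this

theorem hasChi_pi_complex (ι : Type) [Finite ι] : HasChi (ι → ℂ) 1 := by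
  classical
  have := Fintype.ofFinite ι
  induction hk : Fintype.card ι generalizing ι with
  | zero =>
    have := Fintype.card_eq_zero_iff.1 hk
    exact hasChi_of_unique
  | succ k ih =>
    obtain ⟨i⟩ : Nonempty ι := Fintype.card_pos_iff.1 (by omega)
    have h := ih {j // j ≠ i} inferInstance (by simp [Fintype.card_subtype_compl, hk])
    exact h.prod_complex.congr ((Homeomorph.prodComm _ _).trans (Homeomorph.funSplitAt ℂ i).symm)

theorem hasChi_pi_units {ι : Type} [Finite ι] (i : ι) : HasChi {z : ι → ℂ // z i ≠ 0} 0 := by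
  classical
  have h := (hasChi_pi_complex {j // j ≠ i}).prod_units
  refine h.congr
    { toFun := fun x => ⟨(Homeomorph.funSplitAt ℂ i).symm (x.2.1, x.1), by simpa using x.2.2⟩
      invFun := fun z => ((Homeomorph.funSplitAt ℂ i z.1).2, ⟨z.1 i, z.2⟩)
      left_inv := fun x => by
        refine Prod.ext ?_ (Subtype.ext ?_)
        · simp
        · simp
      right_inv := fun z => Subtype.ext (by
        apply (Homeomorph.funSplitAt ℂ i).injective
        rw [Homeomorph.apply_symm_apply]
        rfl)
      continuous_toFun := by fun_prop
      continuous_invFun := by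
        refine Continuous.prodMk ?_ (Continuous.subtype_mk
          ((continuous_apply i).comp continuous_subtype_val) _)
        exact continuous_snd.comp ((Homeomorph.funSplitAt ℂ i).continuous.comp continuous_subtype_val) }

end HasChi

end AlexanderSpanier

end

noncomputable section

/-! ## Euler characteristics of locally closed sets and of disjoint unions -/

section LocallyClosed

open AlexanderSpanier

variable {X : Type} [TopologicalSpace X]

theorem nonLocallyClosedPart_eq_empty {S : Set X} (h : IsLocallyClosed S) :
    nonLocallyClosedPart S = ∅ := by
  have h1 : IsClosed (closure S \ S) := by
    have := isLocallyClosed_iff_isOpen_coborder.1 h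
    rwa [coborder, isOpen_compl_iff] at this
  rw [nonLocallyClosedPart, h1.closure_eq]
  ext x
  simp

theorem eulerChar_of_isEmpty (X : Type) [TopologicalSpace X] [IsEmpty X] : eulerChar X = 0 :=
  hasChi_of_isEmpty.eulerChar_eq

/-- For a locally closed set only the piece k = 0 of the canonical partition is nonempty. All sets
met below are of this kind, apart from one case in which no value is needed. -/
theorem eulerCharC_of_hasChi {S : Set X} {n : ℤ} (h : IsLocallyClosed S) (hS : HasChi S n) :
    eulerCharC S = n := by
  have h0 : ∀ k, nonLocallyClosedPart^[k + 1] S = ∅ := by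
    intro k
    rw [Function.iterate_succ_apply, nonLocallyClosedPart_eq_empty h]
    induction k with
    | zero => rfl
    | succ k ih =>
      rw [Function.iterate_succ_apply,
        nonLocallyClosedPart_eq_empty isOpen_empty.isLocallyClosed, ih]
  rw [eulerCharC, finsum_eq_single _ 0]
  · have h1 : S = nonLocallyClosedPart^[0] S \ nonLocallyClosedPart^[0 + 1] S := by
      rw [h0]
      simp
    exact (hS.congr (Homeomorph.setCongr h1)).eulerChar_eq
  · intro k hk
    obtain ⟨j, rfl⟩ : ∃ j, k = j + 1 := ⟨k - 1, by omega⟩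
    have : IsEmpty ↥(nonLocallyClosedPart^[j + 1] S \ nonLocallyClosedPart^[j + 1 + 1] S) := by
      rw [h0 j]
      simp
    exact eulerChar_of_isEmpty _

theorem eulerCharC_empty : eulerCharC (∅ : Set X) = 0 :=
  eulerCharC_of_hasChi isOpen_empty.isLocallyClosed hasChi_of_isEmpty

-- The separating open sets make both pieces open and closed in the union, which is therefore the
-- topological sum. Metrizability and local compactness of the union are obtained from this sum, and
-- then additivity applies.
attribute [local instance] Metric.metricSpaceSum in
theorem AlexanderSpanier.HasChi.union {A B O O' : Set X} {n m : ℤ} (hO : IsOpen O)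
    (hO' : IsOpen O') (hA : A ⊆ O) (hB : B ⊆ O') (hAO : Disjoint A O') (hBO : Disjoint B O)
    (h : HasChi A n) (h' : HasChi B m) : HasChi ↥(A ∪ B) (n + m) := by
  have := h.locallyCompact
  have := h.metrizable
  have := h'.locallyCompact
  have := h'.metrizable
  let i : A → ↥(A ∪ B) := fun x => ⟨x.1, Or.inl x.2⟩
  let j : B → ↥(A ∪ B) := fun x => ⟨x.1, Or.inr x.2⟩
  have hri : Set.range i = Subtype.val ⁻¹' O := by
    ext ⟨x, hx⟩
    constructor
    · rintro ⟨y, hy⟩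
      cases hy
      exact hA y.2
    · intro hxO
      rcases hx with hx | hx
      · exact ⟨⟨x, hx⟩, rfl⟩
      · exact absurd hxO (Set.disjoint_left.1 hBO hx)
  have hrj : Set.range j = Subtype.val ⁻¹' O' := by
    ext ⟨x, hx⟩
    constructor
    · rintro ⟨y, hy⟩
      cases hy
      exact hB y.2
    · intro hxO
      rcases hx with hx | hx
      · exact absurd hxO (Set.disjoint_left.1 hAO hx)
      · exact ⟨⟨x, hx⟩, rfl⟩
  have hi : Topology.IsOpenEmbedding i := ⟨Topology.IsEmbedding.inclusion Set.subset_union_left,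
    hri ▸ hO.preimage continuous_subtype_val⟩
  have hj : Topology.IsOpenEmbedding j := ⟨Topology.IsEmbedding.inclusion Set.subset_union_right,
    hrj ▸ hO'.preimage continuous_subtype_val⟩
  have hc : (Set.range i)ᶜ = Set.range j := by
    rw [hri, hrj]
    ext ⟨x, hx⟩
    simp only [Set.mem_compl_iff, Set.mem_preimage]
    rcases hx with hx | hx
    · exact iff_of_false (fun h => h (hA hx)) (Set.disjoint_left.1 hAO hx)
    · exact iff_of_true (Set.disjoint_left.1 hBO hx) (hB hx)
  have hclosed : IsClosed (Set.range i) := by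
    rw [← isOpen_compl_iff, hc]
    exact hj.isOpen_range
  have hbij : Function.Bijective (Sum.elim i j) := by
    constructor
    · refine Function.Injective.sumElim hi.injective hj.injective fun a b hab => ?_
      have : i a ∈ (Set.range i)ᶜ := by
        rw [hc, hab]
        exact ⟨b, rfl⟩
      exact this ⟨a, rfl⟩
    · intro x
      by_cases hx : x ∈ Set.range i
      · obtain ⟨a, rfl⟩ := hx
        exact ⟨Sum.inl a, rfl⟩
      · rw [← Set.mem_compl_iff, hc] at hx
        obtain ⟨b, rfl⟩ := hx
        exact ⟨Sum.inr b, rfl⟩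
  have e : A ⊕ B ≃ₜ ↥(A ∪ B) := (Equiv.ofBijective _ hbij).toHomeomorphOfContinuousOpen
    (hi.continuous.sumElim hj.continuous) (isOpenMap_sum.2 ⟨hi.isOpenMap, hj.isOpenMap⟩)
  have hmet : TopologicalSpace.MetrizableSpace ↥(A ∪ B) := by
    let _ := TopologicalSpace.metrizableSpaceMetric A
    let _ := TopologicalSpace.metrizableSpaceMetric B
    exact e.symm.isEmbedding.metrizableSpace
  have hw : WeaklyLocallyCompactSpace ↥(A ∪ B) := by
    refine ⟨fun x => ?_⟩
    obtain ⟨y, rfl⟩ := hbij.2 x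
    rcases y with a | b
    · obtain ⟨K, hK, hKa⟩ := exists_compact_mem_nhds a
      exact ⟨i '' K, hK.image hi.continuous, hi.isOpenMap.image_mem_nhds hKa⟩
    · obtain ⟨K, hK, hKa⟩ := exists_compact_mem_nhds b
      exact ⟨j '' K, hK.image hj.continuous, hj.isOpenMap.image_mem_nhds hKa⟩
  have h2 : HasChi ↥(Set.range i)ᶜ m := by
    rw [hc]
    exact h'.congr hj.isEmbedding.toHomeomorph
  rw [add_comm]
  exact h2.of_compl hclosed (h.congr hi.isEmbedding.toHomeomorph)

theorem hasChi_biUnion {ι : Type} [DecidableEq ι] (s : Finset ι) (F O : ι → Set X) (n : ι → ℤ)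
    (hO : ∀ i, IsOpen (O i)) (hF : ∀ i, F i ⊆ O i) (hd : ∀ i j, i ≠ j → Disjoint (F i) (O j))
    (h : ∀ i ∈ s, HasChi (F i) (n i)) : HasChi ↥(⋃ i ∈ s, F i) (∑ i ∈ s, n i) := by
  induction s using Finset.induction_on with
  | empty =>
    have : IsEmpty ↥(⋃ i ∈ (∅ : Finset ι), F i) := by simp
    simpa using hasChi_of_isEmpty (X := ↥(⋃ i ∈ (∅ : Finset ι), F i))
  | insert i s hi ih =>
    rw [Finset.sum_insert hi, Finset.set_biUnion_insert]
    refine HasChi.union (O := O i) (O' := ⋃ j ∈ s, O j) (hO i) (isOpen_biUnion fun j _ => hO j)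
      (hF i) (Set.iUnion₂_mono fun j _ => hF j) ?_ ?_ (h i (Finset.mem_insert_self i s))
      (ih fun j hj => h j (Finset.mem_insert_of_mem hj))
    · refine Set.disjoint_iUnion₂_right.2 fun j hj => hd i j ?_
      rintro rfl
      exact hi hj
    · refine Set.disjoint_iUnion₂_left.2 fun j hj => hd j i ?_
      rintro rfl
      exact hi hj

end LocallyClosed

/-! ## Topology of Grassmannians -/

section Grassmannian

variable {d n : ℕ}

theorem isOpen_frames (d n : ℕ) : IsOpen {b : Fin d → Fin n → ℂ | LinearIndependent ℂ b} :=
  isOpen_setOfPred_linearIndependent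

theorem continuous_frame (r : Fin d) :
    Continuous fun b : {b : Fin d → Fin n → ℂ // LinearIndependent ℂ b} => b.1 r :=
  (continuous_apply r).comp continuous_subtype_val

theorem Gr.ofFrame_val (b : {b : Fin d → Fin n → ℂ // LinearIndependent ℂ b}) :
    (Gr.ofFrame d (Fin n → ℂ) b).1 = Submodule.span ℂ (Set.range b.1) := rfl

theorem Gr.ofFrame_surjective : Function.Surjective (Gr.ofFrame d (Fin n → ℂ)) := by
  rintro ⟨W, hW⟩
  let b := Module.finBasisOfFinrankEq ℂ W hW
  refine ⟨⟨fun k => b k, b.linearIndependent.map' W.subtype W.ker_subtype⟩, Subtype.ext ?_⟩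
  rw [Gr.ofFrame_val]
  have : Set.range (fun k => (b k : Fin n → ℂ)) = W.subtype '' Set.range b := by
    rw [← Set.range_comp]; rfl
  rw [this, ← Submodule.map_span, b.span_eq, Submodule.map_subtype_top]

/-- For openness, let b' ∈ O span the same subspace as b, and let g express b' in terms of b.
Applying the constant matrix g to a frame c near b gives a tuple near b', hence a frame in O, and it
has the span of c. -/
theorem Gr.isOpenQuotientMap_ofFrame : IsOpenQuotientMap (Gr.ofFrame d (Fin n → ℂ)) := by
  have hq : Continuous (Gr.ofFrame d (Fin n → ℂ)) := continuous_coinduced_rng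
  refine ⟨Gr.ofFrame_surjective, hq, fun O hO => ?_⟩
  rw [isOpen_coinduced, isOpen_iff_mem_nhds]
  rintro b ⟨b', hb', hbb'⟩
  have hspan : Submodule.span ℂ (Set.range b'.1) = Submodule.span ℂ (Set.range b.1) :=
    congrArg Subtype.val hbb'
  have hg : ∀ r, ∃ g : Fin d → ℂ, ∑ s, g s • b.1 s = b'.1 r := fun r =>
    Submodule.mem_span_range_iff_exists_fun ℂ |>.1 (hspan ▸ Submodule.subset_span ⟨r, rfl⟩)
  choose g hg using hg
  let G : {b : Fin d → Fin n → ℂ // LinearIndependent ℂ b} → Fin d → Fin n → ℂ :=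
    fun c r => ∑ s, g r s • c.1 s
  have hGc : Continuous G := continuous_pi fun r => continuous_finsetSum _ fun s _ =>
    (continuous_const_smul (g r s)).comp (continuous_frame s)
  have hGb : G b = b'.1 := funext hg
  have hO' : IsOpen (Subtype.val '' O) := (isOpen_frames d n).isOpenMap_subtype_val O hO
  have hmem : G ⁻¹' (Subtype.val '' O) ∈ 𝓝 b := by
    refine hGc.continuousAt (hO'.mem_nhds ?_)
    rw [hGb]
    exact ⟨b', hb', rfl⟩
  refine Filter.mem_of_superset hmem ?_
  rintro c ⟨c', hc', hcc'⟩
  refine ⟨c', hc', Subtype.ext ?_⟩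
  refine Submodule.eq_of_le_of_finrank_eq ?_
    ((Gr.ofFrame d _ c').2.trans (Gr.ofFrame d _ c).2.symm)
  rw [Gr.ofFrame_val, Gr.ofFrame_val, Submodule.span_le]
  rintro _ ⟨r, rfl⟩
  rw [hcc']
  exact Submodule.sum_mem _ fun s _ => Submodule.smul_mem _ _ (Submodule.subset_span ⟨s, rfl⟩)

theorem Gr.continuous_ofFrame {Y : Type} [TopologicalSpace Y] {b : Y → Fin d → Fin n → ℂ}
    (hb : Continuous b) (hli : ∀ y, LinearIndependent ℂ (b y)) :
    Continuous fun y => Gr.ofFrame d (Fin n → ℂ) ⟨b y, hli y⟩ :=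
  Gr.isOpenQuotientMap_ofFrame.continuous.comp (hb.subtype_mk hli)

theorem Gr.isOpen_exists_ne_zero {m : ℕ} (f : (Fin n → ℂ) →ₗ[ℂ] (Fin m → ℂ)) :
    IsOpen {W : Gr d (Fin n → ℂ) | ∃ w ∈ W.1, f w ≠ 0} := by
  rw [← Gr.isOpenQuotientMap_ofFrame.isQuotientMap.isOpen_preimage]
  have h : (Gr.ofFrame d (Fin n → ℂ)) ⁻¹' {W | ∃ w ∈ W.1, f w ≠ 0} = ⋃ r, {b | f (b.1 r) ≠ 0} := by
    ext b
    simp only [Set.mem_preimage, Set.mem_ofPred_eq, Set.mem_iUnion, Gr.ofFrame_val]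
    constructor
    · rintro ⟨w, hw, hfw⟩
      by_contra hcon
      push Not at hcon
      have : Submodule.span ℂ (Set.range b.1) ≤ LinearMap.ker f := by
        rw [Submodule.span_le]
        rintro _ ⟨r, rfl⟩
        exact hcon r
      exact hfw (this hw)
    · rintro ⟨r, hr⟩
      exact ⟨_, Submodule.subset_span ⟨r, rfl⟩, hr⟩
  rw [h]
  refine isOpen_iUnion fun r => ?_
  have hf := f.continuous_of_finiteDimensional
  exact isOpen_ne_fun (hf.comp (continuous_frame r)) continuous_const

theorem Gr.isOpen_notMem (y : Fin n → ℂ) : IsOpen {W : Gr d (Fin n → ℂ) | y ∉ W.1} := by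
  rw [← Gr.isOpenQuotientMap_ofFrame.isQuotientMap.isOpen_preimage]
  have h : (Gr.ofFrame d (Fin n → ℂ)) ⁻¹' {W | y ∉ W.1} =
      (fun b => (Fin.cons y b.1 : Fin (d + 1) → Fin n → ℂ)) ⁻¹' {b | LinearIndependent ℂ b} := by
    ext b
    simp only [Set.mem_preimage, Set.mem_ofPred_eq, Gr.ofFrame_val]
    rw [linearIndependent_finCons]
    exact ⟨fun h => ⟨b.2, h⟩, fun h => h.2⟩
  rw [h]
  refine (isOpen_frames _ _).preimage (continuous_pi fun k => ?_)
  refine Fin.cases ?_ (fun k => ?_) k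
  · simpa using continuous_const
  · simpa using continuous_frame k

variable {I : Type} {α γ : I → ℕ}

/-- On frames, failure of the inclusion means that the image of some basis vector of W_a is
independent of the frame of W_b, and linear independence is an open condition. -/
theorem Gr.isClosed_map_le {a b : I} (f : (Fin (γ a) → ℂ) →ₗ[ℂ] (Fin (γ b) → ℂ)) :
    IsClosed {W : ∀ i, Gr (α i) (Fin (γ i) → ℂ) | (W a).1 ≤ (W b).1.comap f} := by
  have hq : IsOpenQuotientMap (Pi.map fun i => Gr.ofFrame (α i) (Fin (γ i) → ℂ)) :=
    .piMap fun i => Gr.isOpenQuotientMap_ofFrame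
  rw [← isOpen_compl_iff, ← hq.isQuotientMap.isOpen_preimage]
  have h : (Pi.map fun i => Gr.ofFrame (α i) (Fin (γ i) → ℂ)) ⁻¹'
      {W : ∀ i, Gr (α i) (Fin (γ i) → ℂ) | (W a).1 ≤ (W b).1.comap f}ᶜ = ⋃ r,
      (fun c => (Fin.cons (f ((c a).1 r)) (c b).1 : Fin (α b + 1) → Fin (γ b) → ℂ)) ⁻¹'
        {b | LinearIndependent ℂ b} := by
    ext c
    simp only [Set.mem_preimage, Set.mem_compl_iff, Set.mem_ofPred_eq, Pi.map_apply, Gr.ofFrame_val,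
      Set.mem_iUnion, linearIndependent_finCons, Submodule.span_le]
    constructor
    · intro hc
      by_contra hcon
      push Not at hcon
      refine hc ?_
      rintro _ ⟨r, rfl⟩
      exact hcon r (c b).2
    · rintro ⟨r, -, hr⟩ hc
      exact hr (hc ⟨r, rfl⟩)
  rw [h]
  have hf := f.continuous_of_finiteDimensional
  refine isOpen_iUnion fun r => (isOpen_frames _ _).preimage (continuous_pi fun k => ?_)
  refine Fin.cases ?_ (fun k => ?_) k
  · simpa [Function.comp_def] using hf.comp ((continuous_frame r).comp (continuous_apply a))
  · simpa [Function.comp_def] using (continuous_frame k).comp (continuous_apply b)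

/-- The subspaces that `π` maps injectively. -/
def Gr.chart (π : (Fin n → ℂ) →ₗ[ℂ] (Fin d → ℂ)) : Set (Gr d (Fin n → ℂ)) :=
  {W | ∀ w ∈ W.1, π w = 0 → w = 0}

/-- On the chart, W has a unique vector with prescribed image under π. In terms of a frame it is
given by Cramer's rule, so it depends continuously on the frame wherever the determinant is nonzero;
continuity descends along the open quotient map from frames. Off the chart σ is arbitrary. -/
theorem Gr.exists_section (π : (Fin n → ℂ) →ₗ[ℂ] (Fin d → ℂ)) (y : Fin d → ℂ) :
    ∃ σ : Gr d (Fin n → ℂ) → Fin n → ℂ, ∀ W ∈ Gr.chart π,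
      ContinuousAt σ W ∧ σ W ∈ W.1 ∧ π (σ W) = y := by
  classical
  have hex : ∀ W ∈ Gr.chart π, ∃ w ∈ W.1, π w = y := by
    intro W hW
    have hinj : Function.Injective (π ∘ₗ W.1.subtype) := by
      rw [← LinearMap.ker_eq_bot, Submodule.eq_bot_iff]
      intro w hw
      exact Subtype.ext (hW w.1 w.2 hw)
    have hfin : Module.finrank ℂ W.1 = Module.finrank ℂ (Fin d → ℂ) := by rw [W.2]; simp
    obtain ⟨w, hw⟩ := (LinearMap.injective_iff_surjective_of_finrank_eq_finrank hfin).1 hinj y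
    exact ⟨w.1, w.2, hw⟩
  let σ : Gr d (Fin n → ℂ) → Fin n → ℂ := fun W =>
    if h : ∃ w ∈ W.1, π w = y then h.choose else 0
  have hσ : ∀ W ∈ Gr.chart π, σ W ∈ W.1 ∧ π (σ W) = y := by
    intro W hW
    simp only [σ, dif_pos (hex W hW)]
    exact (hex W hW).choose_spec
  refine ⟨σ, fun W hW => ⟨?_, hσ W hW⟩⟩
  obtain ⟨b, rfl⟩ := Gr.ofFrame_surjective W
  rw [← Gr.isOpenQuotientMap_ofFrame.continuousAt_comp_iff]
  let A : {b : Fin d → Fin n → ℂ // LinearIndependent ℂ b} → Matrix (Fin d) (Fin d) ℂ :=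
    fun c => Matrix.of fun s r => π (c.1 r) s
  have hπ := π.continuous_of_finiteDimensional
  have hA : Continuous A := by
    refine continuous_matrix fun s r => ?_
    exact (continuous_apply s).comp (hπ.comp (continuous_frame r))
  have hAmul : ∀ c (u : Fin d → ℂ), (A c).mulVec u = π (∑ r, u r • c.1 r) := by
    intro c u
    funext s
    simp [A, Matrix.mulVec, dotProduct, mul_comm]
  have hdet : ∀ c, Gr.ofFrame d (Fin n → ℂ) c ∈ Gr.chart π → (A c).det ≠ 0 := by
    intro c hc h0
    obtain ⟨u, hu, hAu⟩ := Matrix.exists_mulVec_eq_zero_iff.2 h0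
    rw [hAmul] at hAu
    have h1 := hc _ (Submodule.sum_mem _ fun r _ => Submodule.smul_mem _ _
      (Submodule.subset_span ⟨r, rfl⟩)) hAu
    exact hu (funext (Fintype.linearIndependent_iff.1 c.2 u h1))
  have hform : ∀ c, (A c).det ≠ 0 → σ (Gr.ofFrame d _ c) =
      ∑ r, ((A c)⁻¹.mulVec y) r • c.1 r := by
    intro c hc
    have hc' : Gr.ofFrame d (Fin n → ℂ) c ∈ Gr.chart π := by
      intro w hw h0
      obtain ⟨u, rfl⟩ := Submodule.mem_span_range_iff_exists_fun ℂ |>.1 hw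
      rw [← hAmul] at h0
      rw [Matrix.eq_zero_of_mulVec_eq_zero hc h0]
      simp
    have h1 := hσ _ hc'
    refine sub_eq_zero.1 (hc' _ (Submodule.sub_mem _ h1.1 (Submodule.sum_mem _ fun r _ =>
      Submodule.smul_mem _ _ (Submodule.subset_span ⟨r, rfl⟩))) ?_)
    rw [map_sub, h1.2, ← hAmul, Matrix.mulVec_mulVec,
      Matrix.mul_nonsing_inv _ (isUnit_iff_ne_zero.2 hc), Matrix.one_mulVec, sub_self]
  have hb := hdet b hW
  have hdetc : Continuous fun c => (A c).det := hA.matrix_det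
  have hev : (σ ∘ Gr.ofFrame d _) =ᶠ[𝓝 b]
      fun c => ∑ r, ((A c).det⁻¹ • ((A c).adjugate.mulVec y)) r • c.1 r := by
    filter_upwards [hdetc.continuousAt.eventually_ne hb] with c hc
    rw [Function.comp_apply, hform c hc, Matrix.inv_def, Matrix.smul_mulVec, Ring.inverse_eq_inv']
  refine ContinuousAt.congr ?_ hev.symm
  have h1 : ContinuousAt (fun c => (A c).det⁻¹) b := hdetc.continuousAt.inv₀ hb
  have h2 : Continuous fun c => (A c).adjugate.mulVec y := hA.matrix_adjugate.matrix_mulVec continuous_const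
  have h3 : ContinuousAt (fun c => (A c).det⁻¹ • ((A c).adjugate.mulVec y)) b := h1.smul h2.continuousAt
  refine tendsto_finsetSum _ fun r _ => ?_
  exact ((continuousAt_pi.1 h3) r).smul
    ((continuous_apply r).comp continuous_subtype_val).continuousAt

end Grassmannian

end

noncomputable section

/-! ## Representations of the cyclic quiver as graded spaces with a shift -/

namespace QRep

section Iso

variable {I : Type} [Quiver.{0} I]

theorem IsIso.refl (M : QRep I) : M.IsIso M := ⟨fun _ => LinearEquiv.refl ℂ _, fun _ _ _ _ => rfl⟩

theorem IsIso.symm {M M' : QRep I} : M.IsIso M' → M'.IsIso M := by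
  rintro ⟨φ, h⟩
  refine ⟨fun i => (φ i).symm, fun a b e v => ?_⟩
  apply (φ b).injective
  rw [h, LinearEquiv.apply_symm_apply, LinearEquiv.apply_symm_apply]

theorem IsIso.trans {M M' M'' : QRep I} : M.IsIso M' → M'.IsIso M'' → M.IsIso M'' := by
  rintro ⟨φ, h⟩ ⟨ψ, h'⟩
  refine ⟨fun i => (φ i).trans (ψ i), fun a b e v => ?_⟩
  simp [h, h']

theorem IsIso.dim_eq {M M' : QRep I} : M.IsIso M' → M.dim = M'.dim := by
  rintro ⟨φ, -⟩
  exact funext fun i => (φ i).finrank_eq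

end Iso

variable {N : ℕ}

/-- The sum of all structure maps, acting on the total space. -/
def tot (M : QRep (ZMod N)) : Module.End ℂ (∀ k, M.V k) :=
  LinearMap.pi fun b => M.map (a := b - 1) ⟨(sub_add_cancel b 1).symm⟩ ∘ₗ LinearMap.proj (b - 1)

theorem tot_single (M : QRep (ZMod N)) {a b : ZMod N} (h : a ⟶ b) (v : M.V a) :
    M.tot (Pi.single a v) = Pi.single b (M.map h v) := by
  obtain ⟨rfl⟩ := h
  funext c
  by_cases hc : c = a + 1
  · subst hc
    rw [Pi.single_eq_same]
    change M.map _ (Pi.single a v (a + 1 - 1)) = _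
    -- The source vertex a + 1 - 1 is only propositionally equal to a, so the claim is generalised
    -- to a variable vertex before substituting.
    have key : ∀ (a' : ZMod N) (h : a' = a) (e : a' ⟶ a + 1),
        M.map e (Pi.single (M := fun k => M.V k) a v a') = M.map (⟨rfl⟩ : a ⟶ a + 1) v := by
      rintro a' rfl ⟨e⟩
      rw [Pi.single_eq_same]
    exact key _ (add_sub_cancel_right a 1) _
  · rw [Pi.single_eq_of_ne hc]
    change M.map _ (Pi.single a v (c - 1)) = _
    rw [Pi.single_eq_of_ne (fun h => hc (by rw [← h, sub_add_cancel])), map_zero]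

theorem tot_pow_single_act (M : QRep (ZMod N)) {a b : ZMod N} (p : Quiver.Path a b) (v : M.V a) :
    (M.tot ^ p.length) (Pi.single a v) = Pi.single b (M.act p v) := by
  induction p with
  | nil => rfl
  | cons p h ih =>
    rw [Quiver.Path.length_cons, pow_succ', Module.End.mul_apply, ih, tot_single M h]
    rfl

theorem exists_path (a : ZMod N) (r : ℕ) : ∃ p : Quiver.Path a (a + (r : ZMod N)), p.length = r := by
  induction r with
  | zero =>
    rw [Nat.cast_zero, add_zero]
    exact ⟨Quiver.Path.nil, rfl⟩
  | succ r ih =>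
    obtain ⟨p, hp⟩ := ih
    exact ⟨p.cons ⟨by push_cast; ring⟩, by rw [Quiver.Path.length_cons, hp]⟩

theorem tot_pow_single (M : QRep (ZMod N)) (a : ZMod N) (r : ℕ) (v : M.V a) :
    ∃ w, (M.tot ^ r) (Pi.single a v) = Pi.single (a + (r : ZMod N)) w := by
  obtain ⟨p, hp⟩ := exists_path a r
  exact ⟨_, hp ▸ tot_pow_single_act M p v⟩

theorem isNilp_iff [NeZero N] (M : QRep (ZMod N)) : M.IsNilp ↔ IsNilpotent M.tot := by
  constructor
  · rintro ⟨n, h⟩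
    refine ⟨n, LinearMap.ext fun y => ?_⟩
    rw [← Finset.univ_sum_single y, map_sum]
    refine Finset.sum_eq_zero fun a _ => ?_
    obtain ⟨p, hp⟩ := exists_path a n
    rw [← hp, tot_pow_single_act, h _ _ p hp]
    simp
  · rintro ⟨n, h⟩
    refine ⟨n, fun a b p hp => LinearMap.ext fun v => ?_⟩
    apply Pi.single_injective (M := fun k => M.V k) b
    rw [← tot_pow_single_act, hp, h]
    simp

theorem finrank_tot [NeZero N] (M : QRep (ZMod N)) :
    Module.finrank ℂ (∀ k, M.V k) = ∑ k, M.dim k := Module.finrank_pi_fintype ℂ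

/-- The total map of a family of linear maps. -/
def totMap {M M' : QRep (ZMod N)} (φ : ∀ k, M.V k →ₗ[ℂ] M'.V k) :
    (∀ k, M.V k) →ₗ[ℂ] ∀ k, M'.V k := LinearMap.pi fun k => φ k ∘ₗ LinearMap.proj k

theorem totMap_single {M M' : QRep (ZMod N)} (φ : ∀ k, M.V k →ₗ[ℂ] M'.V k) (k : ZMod N)
    (v : M.V k) : totMap φ (Pi.single k v) = Pi.single k (φ k v) := by
  funext j
  change φ j (Pi.single k v j) = _
  by_cases h : j = k
  · subst h; simp
  · rw [Pi.single_eq_of_ne h, Pi.single_eq_of_ne h, map_zero]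

theorem totMap_tot {M M' : QRep (ZMod N)} {φ : ∀ k, M.V k →ₗ[ℂ] M'.V k}
    (h : ∀ (a b : ZMod N) (e : a ⟶ b) (v : M.V a), φ b (M.map e v) = M'.map e (φ a v))
    (y : ∀ k, M.V k) : totMap φ (M.tot y) = M'.tot (totMap φ y) := by
  funext b
  exact h _ _ _ _

theorem totMap_tot_pow {M M' : QRep (ZMod N)} {φ : ∀ k, M.V k →ₗ[ℂ] M'.V k}
    (h : ∀ (a b : ZMod N) (e : a ⟶ b) (v : M.V a), φ b (M.map e v) = M'.map e (φ a v))
    (r : ℕ) (y : ∀ k, M.V k) : totMap φ ((M.tot ^ r) y) = (M'.tot ^ r) (totMap φ y) := by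
  induction r generalizing y with
  | zero => rfl
  | succ r ih => rw [pow_succ', pow_succ', Module.End.mul_apply, Module.End.mul_apply,
      totMap_tot h, ih]

/-- Coordinates of a homomorphism to the uniserial representation `P i l`. -/
structure Coord (M : QRep (ZMod N)) (i : ZMod N) (l : ℕ) where
  U : ℕ → (∀ k, M.V k) →ₗ[ℂ] ℂ
  zero_of_le : ∀ (s : ℕ) y, l ≤ s → U s y = 0
  zero : ∀ y, U 0 (M.tot y) = 0
  succ : ∀ (s : ℕ) y, s + 1 < l → U (s + 1) (M.tot y) = U s y
  hom : ∀ (s : ℕ) k v, k ≠ i + (s : ZMod N) → U s (Pi.single k v) = 0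

variable {M : QRep (ZMod N)} {i : ZMod N} {l : ℕ}

theorem Coord.pow_of_lt (c : Coord M i l) {r s : ℕ} (h : s < r) (y : ∀ k, M.V k) :
    c.U s ((M.tot ^ r) y) = 0 := by
  induction s generalizing r y with
  | zero =>
    obtain ⟨r, rfl⟩ : ∃ q, r = q + 1 := ⟨r - 1, by omega⟩
    rw [pow_succ', Module.End.mul_apply, c.zero]
  | succ s ih =>
    obtain ⟨r, rfl⟩ : ∃ q, r = q + 1 := ⟨r - 1, by omega⟩
    rw [pow_succ', Module.End.mul_apply]
    by_cases hs : s + 1 < l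
    · rw [c.succ _ _ hs, ih (by omega)]
    · exact c.zero_of_le _ _ (by omega)

theorem Coord.pow (c : Coord M i l) {r s : ℕ} (h : r + s < l) (y : ∀ k, M.V k) :
    c.U (r + s) ((M.tot ^ r) y) = c.U s y := by
  induction r generalizing y with
  | zero => simp
  | succ r ih =>
    rw [pow_succ', Module.End.mul_apply, show r + 1 + s = r + s + 1 by ring,
      c.succ _ _ (by omega), ih (by omega)]

theorem Coord.pow_of_le (c : Coord M i l) {r s : ℕ} (h : r ≤ s) (hs : s < l) (y : ∀ k, M.V k) :
    c.U s ((M.tot ^ r) y) = c.U (s - r) y := by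
  obtain ⟨s, rfl⟩ := Nat.exists_eq_add_of_le h
  rw [c.pow hs, Nat.add_sub_cancel_left]

theorem Coord.hom_apply [NeZero N] (c : Coord M i l) (s : ℕ) (y : ∀ k, M.V k) :
    c.U s y = c.U s (Pi.single (i + (s : ZMod N)) (y (i + (s : ZMod N)))) := by
  conv_lhs => rw [← Finset.univ_sum_single y, map_sum]
  refine Finset.sum_eq_single _ (fun k _ hk => c.hom _ _ _ hk) (by simp)

/-- Transport of coordinates along a morphism. -/
def Coord.comap {M' : QRep (ZMod N)} (c : Coord M' i l) (φ : ∀ k, M.V k →ₗ[ℂ] M'.V k)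
    (h : ∀ (a b : ZMod N) (e : a ⟶ b) (v : M.V a), φ b (M.map e v) = M'.map e (φ a v)) :
    Coord M i l where
  U s := c.U s ∘ₗ totMap φ
  zero_of_le s y := c.zero_of_le s _
  zero y := by rw [LinearMap.comp_apply, totMap_tot h, c.zero]
  succ s y hs := by rw [LinearMap.comp_apply, totMap_tot h, c.succ _ _ hs, LinearMap.comp_apply]
  hom s k v hk := by rw [LinearMap.comp_apply, totMap_single, c.hom _ _ _ hk]

/-- Coordinates dual to the iterates of a homogeneous element of maximal order. -/
theorem exists_coord [NeZero N] {u : M.V i} (hl : 0 < l) (h0 : M.tot ^ l = 0)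
    (hu : (M.tot ^ (l - 1)) (Pi.single i u) ≠ 0) :
    ∃ c : Coord M i l, ∀ r s, r < l → s < l →
      c.U s ((M.tot ^ r) (Pi.single i u)) = if r = s then 1 else 0 := by
  classical
  have hli : LinearIndependent ℂ fun r : Fin l => (M.tot ^ (r : ℕ)) (Pi.single i u) := by
    rw [Fintype.linearIndependent_iff]
    intro g hg
    by_contra hcon
    push Not at hcon
    -- In a relation take the first nonzero coefficient g_r: applying t^(l-1-r) kills all later
    -- terms and leaves g_r t^(l-1) u ≠ 0.
    obtain ⟨r, hr, hmin⟩ : ∃ r : Fin l, g r ≠ 0 ∧ ∀ s < r, g s = 0 := by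
      obtain ⟨r, hr, hmin⟩ := WellFounded.has_min (wellFounded_lt (α := Fin l)) {r | g r ≠ 0} hcon
      exact ⟨r, hr, fun s hs => by
        by_contra h
        exact hmin s h hs⟩
    have h1 := congrArg (M.tot ^ (l - 1 - r)) hg
    rw [map_sum, map_zero, Finset.sum_eq_single r] at h1
    · rw [map_smul, ← Module.End.mul_apply, ← pow_add,
        show l - 1 - r + r = l - 1 by omega] at h1
      exact (smul_ne_zero hr hu) h1
    · intro s _ hs
      rcases lt_or_gt_of_ne hs with h | h
      · rw [hmin s h, zero_smul, map_zero]
      · rw [map_smul, ← Module.End.mul_apply, ← pow_add]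
        have : l - 1 - r + s = (l - 1 - r + s - l) + l := by omega
        rw [this, pow_add, h0, mul_zero, LinearMap.zero_apply, smul_zero]
    · simp
  obtain ⟨lam', hlam'⟩ : ∃ f : (∀ k, M.V k) →ₗ[ℂ] ℂ, ∀ r : Fin l,
      f ((M.tot ^ (r : ℕ)) (Pi.single i u)) = if (r : ℕ) = l - 1 then 1 else 0 := by
    let b := Module.Basis.extend hli.linearIndepOn_id
    refine ⟨b.constr ℂ fun x => if (x : ∀ k, M.V k) = (M.tot ^ (l - 1)) (Pi.single i u) then 1 else 0,
      fun r => ?_⟩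
    have hr : (M.tot ^ (r : ℕ)) (Pi.single i u) ∈
        hli.linearIndepOn_id.extend (Set.subset_univ _) :=
      hli.linearIndepOn_id.subset_extend _ ⟨r, rfl⟩
    have hb : b ⟨_, hr⟩ = (M.tot ^ (r : ℕ)) (Pi.single i u) := Module.Basis.extend_apply_self _ _
    rw [← hb, Module.Basis.constr_basis]
    have : ((M.tot ^ (r : ℕ)) (Pi.single i u) = (M.tot ^ (l - 1)) (Pi.single i u)) ↔
        (r : ℕ) = l - 1 := by
      refine ⟨fun h => ?_, fun h => by rw [h]⟩
      have := hli.injective (a₁ := r) (a₂ := ⟨l - 1, by omega⟩) h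
      exact congrArg Fin.val this
    simp only [this]
  let k₀ : ZMod N := i + ((l - 1 : ℕ) : ZMod N)
  -- Keeping only the component of the form in the degree of t^(l-1) u makes the coordinates built
  -- from it homogeneous.
  let lam : (∀ k, M.V k) →ₗ[ℂ] ℂ := lam' ∘ₗ LinearMap.single ℂ _ k₀ ∘ₗ LinearMap.proj k₀
  have hlam_hom : ∀ k v, k ≠ k₀ → lam (Pi.single k v) = 0 := by
    intro k v hk
    simp only [lam, LinearMap.comp_apply, LinearMap.proj_apply, Pi.single_eq_of_ne hk.symm, map_zero]
  have hlam_same : ∀ v, lam (Pi.single k₀ v) = lam' (Pi.single k₀ v) := by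
    intro v
    simp [lam]
  have hlam : ∀ r, r < l → lam ((M.tot ^ r) (Pi.single i u)) = if r = l - 1 then 1 else 0 := by
    intro r hr
    have h1 := hlam' ⟨r, hr⟩
    simp only at h1
    obtain ⟨w, hw⟩ := tot_pow_single M i r u
    rw [hw] at h1 ⊢
    by_cases hk : i + (r : ZMod N) = k₀
    · have : ∀ k (h : k = k₀) (w : M.V k), lam (Pi.single k w) = lam' (Pi.single k w) := by
        rintro _ rfl w
        exact hlam_same w
      rw [this _ hk, h1]
    · rw [hlam_hom _ _ hk, if_neg]
      rintro rfl
      exact hk rfl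
  -- A single form determines all coordinates: U_s = λ ∘ t^(l-1-s). The relation U_(s+1) ∘ t = U_s
  -- is then automatic, and t^l = 0 gives U_0 ∘ t = 0.
  refine ⟨⟨fun s => if s < l then lam ∘ₗ (M.tot ^ (l - 1 - s)) else 0, ?_, ?_, ?_, ?_⟩, ?_⟩
  · intro s y hs
    simp [not_lt.2 hs]
  · intro y
    simp only [hl, if_true, LinearMap.comp_apply]
    rw [← Module.End.mul_apply, ← pow_succ, show l - 1 - 0 + 1 = l by omega, h0]
    simp
  · intro s y hs
    simp only [hs, if_true, show s < l by omega, LinearMap.comp_apply]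
    rw [← Module.End.mul_apply, ← pow_succ, show l - 1 - (s + 1) + 1 = l - 1 - s by omega]
  · intro s k v hk
    split_ifs with hs
    · obtain ⟨w, hw⟩ := tot_pow_single M k (l - 1 - s) v
      rw [LinearMap.comp_apply, hw, hlam_hom]
      intro h
      apply hk
      have h2 : ((l - 1 : ℕ) : ZMod N) = ((l - 1 - s : ℕ) : ZMod N) + (s : ZMod N) := by
        rw [← Nat.cast_add]
        congr 1
        omega
      simp only [k₀, h2] at h
      have h3 := congrArg (fun x => x - ((l - 1 - s : ℕ) : ZMod N)) h
      simp only [add_sub_cancel_right] at h3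
      rw [h3]
      ring
    · rfl
  · intro r s hr hs
    simp only [hs, if_true, LinearMap.comp_apply]
    rw [← Module.End.mul_apply, ← pow_add]
    by_cases h : l - 1 - s + r < l
    · rw [hlam _ h]
      congr 1
      apply propext
      omega
    · rw [show l - 1 - s + r = (l - 1 - s + r - l) + l by omega, pow_add, h0, if_neg (by omega)]
      simp

end QRep

end

/-! ### Dual coordinates, and the endomorphisms they define -/

noncomputable section

set_option linter.unusedSectionVars false

namespace QRep

variable {N : ℕ}

section Coordinates

variable [NeZero N] {M : QRep (ZMod N)} {i : ZMod N} {l : ℕ}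

theorem tot_pow_finrank (h : M.IsNilp) : M.tot ^ Module.finrank ℂ (∀ k, M.V k) = 0 := by
  have h1 := (isNilp_iff M).1 h
  have h2 := LinearMap.aeval_self_charpoly M.tot
  rw [IsNilpotent.charpoly_eq_X_pow_finrank h1] at h2
  simpa using h2

/-- The coordinates are dual to the iterates of `u`. -/
def Coord.IsDual (c : Coord M i l) (u : ∀ k, M.V k) : Prop :=
  ∀ r s, r < l → s < l → c.U s ((M.tot ^ r) u) = if r = s then 1 else 0

/-- The coordinates determine the vector. -/
def Coord.Inj (c : Coord M i l) : Prop := ∀ y, (∀ s, s < l → c.U s y = 0) → y = 0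

/-- All coordinates at once. -/
def Coord.toPi (c : Coord M i l) : (∀ k, M.V k) →ₗ[ℂ] (Fin l → ℂ) :=
  LinearMap.pi fun s => c.U s

theorem Coord.toPi_injective {c : Coord M i l} : c.Inj ↔ Function.Injective c.toPi := by
  rw [← LinearMap.ker_eq_bot, Submodule.eq_bot_iff]
  refine forall_congr' fun y => ?_
  rw [LinearMap.mem_ker]
  refine imp_congr_left ⟨fun h => funext fun s => h s s.2, fun h s hs => congrFun h ⟨s, hs⟩⟩

theorem Coord.IsDual.toPi_surjective {c : Coord M i l} {u : ∀ k, M.V k} (h : c.IsDual u) :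
    Function.Surjective c.toPi := by
  intro g
  refine ⟨∑ r : Fin l, g r • (M.tot ^ (r : ℕ)) u, funext fun s => ?_⟩
  change c.U s _ = _
  rw [map_sum, Finset.sum_eq_single s]
  · rw [map_smul, h _ _ s.2 s.2, if_pos rfl, smul_eq_mul, mul_one]
  · intro r _ hr
    rw [map_smul, h _ _ r.2 s.2, if_neg (fun h => hr (Fin.ext h)), smul_zero]
  · simp

/-- Dual coordinates always map onto ℂ^l. Hence recognising a uniserial representation comes down to
a dimension count. -/
theorem Coord.IsDual.inj_iff {c : Coord M i l} {u : ∀ k, M.V k} (h : c.IsDual u) :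
    c.Inj ↔ Module.finrank ℂ (∀ k, M.V k) = l := by
  rw [Coord.toPi_injective]
  constructor
  · intro hi
    have := (LinearEquiv.ofBijective c.toPi ⟨hi, h.toPi_surjective⟩).finrank_eq
    simpa using this
  · intro hf
    exact (LinearMap.injective_iff_surjective_of_finrank_eq_finrank (by simpa using hf)).2
      h.toPi_surjective

/-- The endomorphism `y ↦ ∑ U_s(y) t^s w`. -/
def Coord.lift (c : Coord M i l) (w : ∀ k, M.V k) : Module.End ℂ (∀ k, M.V k) :=
  ∑ s ∈ Finset.range l, (c.U s).smulRight ((M.tot ^ s) w)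

theorem Coord.lift_apply (c : Coord M i l) (w y : ∀ k, M.V k) :
    c.lift w y = ∑ s ∈ Finset.range l, c.U s y • (M.tot ^ s) w := by
  simp [Coord.lift]

/-- The shift of the index leaves one boundary term, t^l w, which is zero by hypothesis. When w is
dual to the coordinates, this endomorphism is a projection onto the cyclic subobject generated by w,
and its kernel is a complement. -/
theorem Coord.lift_tot (c : Coord M i l) {w : ∀ k, M.V k} (hw : (M.tot ^ l) w = 0)
    (y : ∀ k, M.V k) : c.lift w (M.tot y) = M.tot (c.lift w y) := by
  rw [c.lift_apply, c.lift_apply, map_sum]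
  cases l with
  | zero => simp
  | succ l =>
    rw [Finset.sum_range_succ', Finset.sum_range_succ, c.zero, zero_smul, add_zero, map_smul,
      ← Module.End.mul_apply M.tot, ← pow_succ', hw, smul_zero, add_zero]
    refine Finset.sum_congr rfl fun s hs => ?_
    rw [c.succ _ _ (by simpa using hs), map_smul, ← Module.End.mul_apply M.tot, ← pow_succ']

theorem Coord.lift_tot_pow (c : Coord M i l) {w : ∀ k, M.V k} (hw : (M.tot ^ l) w = 0) (r : ℕ)
    (y : ∀ k, M.V k) : c.lift w ((M.tot ^ r) y) = (M.tot ^ r) (c.lift w y) := by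
  induction r generalizing y with
  | zero => rfl
  | succ r ih => rw [pow_succ', Module.End.mul_apply, Module.End.mul_apply, c.lift_tot hw, ih]

theorem Coord.lift_single (c : Coord M i l) (w : M.V i) (a : ZMod N) (v : M.V a) :
    ∃ v', c.lift (Pi.single i w) (Pi.single a v) = Pi.single a v' := by
  have : c.lift (Pi.single i w) (Pi.single a v) ∈ LinearMap.range (LinearMap.single ℂ M.V a) := by
    rw [c.lift_apply]
    refine Submodule.sum_mem _ fun s _ => ?_
    by_cases h : a = i + (s : ZMod N)
    · subst h
      obtain ⟨w', hw'⟩ := tot_pow_single M i s w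
      rw [hw']
      exact Submodule.smul_mem _ _ ⟨w', rfl⟩
    · rw [c.hom _ _ _ h, zero_smul]
      exact Submodule.zero_mem _
  obtain ⟨v', hv'⟩ := this
  exact ⟨v', hv'.symm⟩

theorem Coord.IsDual.U_lift {c : Coord M i l} {u : ∀ k, M.V k} (h : c.IsDual u) {s : ℕ}
    (hs : s < l) (y : ∀ k, M.V k) : c.U s (c.lift u y) = c.U s y := by
  rw [c.lift_apply, map_sum, Finset.sum_eq_single s]
  · rw [map_smul, h _ _ hs hs, if_pos rfl, smul_eq_mul, mul_one]
  · intro r hr hrs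
    rw [map_smul, h _ _ (Finset.mem_range.1 hr) hs, if_neg hrs, smul_zero]
  · intro hn
    exact absurd (Finset.mem_range.2 hs) hn

theorem Coord.IsDual.lift_eq_self {c : Coord M i l} {u : ∀ k, M.V k} (h : c.IsDual u) (hi : c.Inj)
    (y : ∀ k, M.V k) : c.lift u y = y := by
  rw [← sub_eq_zero]
  refine hi _ fun s hs => ?_
  rw [map_sub, h.U_lift hs, sub_self]

theorem Coord.Inj.pow_eq_zero {c : Coord M i l} (hi : c.Inj) : M.tot ^ l = 0 :=
  LinearMap.ext fun y => hi _ fun _ hs => c.pow_of_lt hs y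

/-- The iterate t^(l-1) sees only the leading coordinate U_0, which lives at the vertex i. So i is
determined by the isomorphism class. -/
theorem Coord.Inj.eq_of_ne_zero {c : Coord M i l} (hi : c.Inj) {j : ZMod N} {z : M.V j}
    (h : (M.tot ^ (l - 1)) (Pi.single j z) ≠ 0) : j = i := by
  by_contra hj
  refine h (hi _ fun s hs => ?_)
  rcases lt_or_ge s (l - 1) with h1 | h1
  · exact c.pow_of_lt h1 _
  · rw [c.pow_of_le h1 hs, show s - (l - 1) = 0 by omega]
    exact c.hom _ _ _ (by simpa using hj)

end Coordinates

end QRep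

/-! ### The uniserial representations -/

namespace CyclicQuiver

open QRep

variable {N : ℕ}

theorem P_apply {i : ZMod N} {l : ℕ} (y : ∀ k, (P i l).V k) (k : ZMod N)
    (m : {m : Fin l // i + ((m : ℕ) : ZMod N) = k}) :
    y k m = y (i + ((m.1 : ℕ) : ZMod N)) ⟨m.1, rfl⟩ := by
  obtain ⟨m, rfl⟩ := m
  rfl

theorem P_map_apply {i : ZMod N} {l : ℕ} {a b : ZMod N} (h : a ⟶ b) (v : (P i l).V a)
    (m : {m : Fin l // i + ((m : ℕ) : ZMod N) = b})
    (hm : 0 < (m.1 : ℕ) → i + (((m.1 : ℕ) - 1 : ℕ) : ZMod N) = a) :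
    (P i l).map h v m = if h : 0 < (m.1 : ℕ) then
      v ⟨⟨(m.1 : ℕ) - 1, by have := m.1.2; omega⟩, hm h⟩ else 0 := rfl

theorem P_map_zero {i : ZMod N} {l : ℕ} {a b : ZMod N} (h : a ⟶ b) (v : (P i l).V a) (hm : 0 < l)
    (hb : i + ((0 : ℕ) : ZMod N) = b) : (P i l).map h v ⟨⟨0, hm⟩, hb⟩ = 0 := by
  refine (P_map_apply h v ⟨⟨0, hm⟩, hb⟩ fun h => absurd h (lt_irrefl 0)).trans ?_
  exact dif_neg (lt_irrefl 0)

theorem P_map_succ {i : ZMod N} {l : ℕ} {a b : ZMod N} (h : a ⟶ b) (v : (P i l).V a) {m : ℕ}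
    (hm : m + 1 < l) (hb : i + ((m + 1 : ℕ) : ZMod N) = b) (ha : i + (m : ZMod N) = a) :
    (P i l).map h v ⟨⟨m + 1, hm⟩, hb⟩ = v ⟨⟨m, by omega⟩, ha⟩ := by
  refine (P_map_apply h v ⟨⟨m + 1, hm⟩, hb⟩ fun _ => ha).trans ?_
  exact dif_pos (Nat.succ_pos m)

/-- The tautological coordinates of `P i l`. -/
def PCoord (i : ZMod N) (l : ℕ) : Coord (P i l) i l where
  U s := if h : s < l then
    LinearMap.proj (R := ℂ) (φ := fun _ : {m : Fin l // i + ((m : ℕ) : ZMod N) = i + (s : ZMod N)} => ℂ)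
      ⟨⟨s, h⟩, rfl⟩ ∘ₗ LinearMap.proj (i + (s : ZMod N)) else 0
  zero_of_le s y h := by rw [dif_neg (not_lt.2 h)]; rfl
  zero y := by
    split_ifs with h
    · exact P_map_zero (i := i) (a := i + ((0 : ℕ) : ZMod N) - 1) ⟨(sub_add_cancel _ 1).symm⟩ (y _) h rfl
    · rfl
  succ s y h := by
    rw [dif_pos h, dif_pos (by omega)]
    refine (P_map_succ (i := i) (a := i + ((s + 1 : ℕ) : ZMod N) - 1) ⟨(sub_add_cancel _ 1).symm⟩
      (y _) h rfl ?_).trans ?_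
    · push_cast
      ring
    · exact P_apply y _ _
  hom s k v h := by
    split_ifs with hs
    · change Pi.single k v (i + (s : ZMod N)) _ = 0
      rw [Pi.single_eq_of_ne h.symm]
      rfl
    · rfl

theorem PCoord_U {i : ZMod N} {l : ℕ} {s : ℕ} (hs : s < l) (y : ∀ k, (P i l).V k) :
    (PCoord i l).U s y = y (i + (s : ZMod N)) ⟨⟨s, hs⟩, rfl⟩ := by
  change (dite _ _ _ : (∀ k, (P i l).V k) →ₗ[ℂ] ℂ) y = _
  rw [dif_pos hs]
  rfl

theorem PCoord_inj [NeZero N] (i : ZMod N) (l : ℕ) : (PCoord i l).Inj := by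
  intro y hy
  funext k
  change y k = fun _ => 0
  funext m
  exact (P_apply y k m).trans ((PCoord_U m.1.2 y).symm.trans (hy _ m.1.2))

/-- The generator of `P i l`. -/
def PGen (i : ZMod N) (l : ℕ) : (P i l).V i :=
  fun m : {m : Fin l // i + ((m : ℕ) : ZMod N) = i} => if (m.1 : ℕ) = 0 then 1 else 0

theorem PCoord_isDual [NeZero N] (i : ZMod N) (l : ℕ) :
    (PCoord i l).IsDual (Pi.single i (PGen i l)) := by
  have h0 : ∀ s, s < l → (PCoord i l).U s (Pi.single i (PGen i l)) = if s = 0 then 1 else 0 := by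
    intro s hs
    rw [PCoord_U hs]
    by_cases h : i + (s : ZMod N) = i
    · have key : ∀ k (hk : k = i) (m : {m : Fin l // i + ((m : ℕ) : ZMod N) = k}),
          (Pi.single i (PGen i l) : ∀ k, (P i l).V k) k m = if (m.1 : ℕ) = 0 then 1 else 0 := by
        rintro _ rfl m
        rw [Pi.single_eq_same]
        rfl
      exact key _ h _
    · rw [Pi.single_eq_of_ne h, if_neg]
      · rfl
      · rintro rfl
        simp at h
  intro r s hr hs
  rcases lt_or_ge s r with h | h
  · rw [(PCoord i l).pow_of_lt h, if_neg (by omega)]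
  · rw [(PCoord i l).pow_of_le h hs, h0 _ (by omega)]
    congr 1
    apply propext
    omega

theorem finrank_tot_P [NeZero N] (i : ZMod N) (l : ℕ) :
    Module.finrank ℂ (∀ k, (P i l).V k) = l := (PCoord_isDual i l).inj_iff.1 (PCoord_inj i l)

theorem P_dim (i : ZMod N) (l : ℕ) : (P i l).dim = arc i l := by
  funext k
  change Module.finrank ℂ ({m : Fin l // i + ((m : ℕ) : ZMod N) = k} → ℂ) = _
  rw [Module.finrank_fintype_fun_eq_card, Fintype.card_subtype, arc]
  refine Finset.card_bij (fun m _ => (m : ℕ)) ?_ ?_ ?_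
  · intro m hm
    simpa using hm
  · intro a _ b _ h
    exact Fin.ext h
  · intro m hm
    simp only [Finset.mem_filter, Finset.mem_range] at hm
    exact ⟨⟨m, hm.1⟩, by simpa using hm.2, rfl⟩

theorem sum_arc [NeZero N] (i : ZMod N) (l : ℕ) : ∑ k, arc i l k = l := by
  rw [← P_dim, ← finrank_tot, finrank_tot_P]

theorem P_isNilp [NeZero N] (i : ZMod N) (l : ℕ) : (P i l).IsNilp :=
  (isNilp_iff _).2 ⟨l, (PCoord_inj i l).pow_eq_zero⟩

theorem PGen_ne_zero [NeZero N] (i : ZMod N) {l : ℕ} (hl : 0 < l) :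
    ((P i l).tot ^ (l - 1)) (Pi.single i (PGen i l)) ≠ 0 := by
  intro h
  have := PCoord_isDual i l (l - 1) (l - 1) (by omega) (by omega)
  rw [h, map_zero, if_pos rfl] at this
  exact zero_ne_one this

end CyclicQuiver

namespace QRep

open CyclicQuiver

variable {N : ℕ} [NeZero N] {M M' : QRep (ZMod N)} {i : ZMod N} {l : ℕ}

theorem isIso_P_of_coord (c : Coord M i l) (hi : c.Inj)
    (hl : Module.finrank ℂ (∀ k, M.V k) = l) : M.IsIso (P i l) := by
  let φ : ∀ k, M.V k →ₗ[ℂ] (P i l).V k := fun k =>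
    LinearMap.pi (R := ℂ) (φ := fun _ : {m : Fin l // i + ((m : ℕ) : ZMod N) = k} => ℂ)
      fun m => c.U m.1 ∘ₗ LinearMap.single ℂ M.V k
  have hφ : ∀ k v (m : {m : Fin l // i + ((m : ℕ) : ZMod N) = k}),
      φ k v m = c.U m.1 (Pi.single k v) := fun _ _ _ => rfl
  have hinj : ∀ k, Function.Injective (φ k) := by
    intro k
    rw [← LinearMap.ker_eq_bot, Submodule.eq_bot_iff]
    intro v hv
    rw [LinearMap.mem_ker] at hv
    apply Pi.single_injective (M := fun k => M.V k) k
    rw [Pi.single_zero]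
    refine hi _ fun s hs => ?_
    by_cases h : k = i + (s : ZMod N)
    · exact (hφ k v ⟨⟨s, hs⟩, h.symm⟩).symm.trans (congrFun hv _)
    · exact c.hom _ _ _ h
  have hle : ∀ k, Module.finrank ℂ (M.V k) ≤ Module.finrank ℂ ((P i l).V k) := fun k =>
    LinearMap.finrank_le_finrank_of_injective (hinj k)
  have heq : ∀ k, Module.finrank ℂ (M.V k) = Module.finrank ℂ ((P i l).V k) := by
    have h1 : ∑ k, M.dim k = ∑ k, (P i l).dim k := by
      rw [← finrank_tot, ← finrank_tot, hl, finrank_tot_P]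
    exact fun k => (Finset.sum_eq_sum_iff_of_le fun k _ => hle k).1 h1 k (Finset.mem_univ k)
  refine ⟨fun k => LinearEquiv.ofInjectiveOfFinrankEq (φ k) (hinj k) (heq k), fun a b h v => ?_⟩
  change φ b (M.map h v) = (P i l).map h (φ a v)
  funext m
  rw [hφ, ← tot_single M h]
  obtain ⟨⟨m, hm⟩, hmb⟩ := m
  cases m with
  | zero => exact (c.zero _).trans (P_map_zero h _ hm hmb).symm
  | succ m =>
    refine (c.succ _ _ hm).trans ?_
    have ha : i + (m : ZMod N) = a := by
      have h1 : b = a + 1 := h.down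
      have h2 : i + ((m + 1 : ℕ) : ZMod N) = b := hmb
      rw [h1] at h2
      push_cast at h2
      exact add_right_cancel ((add_assoc _ _ _).trans h2)
    exact (P_map_succ h (φ a v) hm hmb ha).symm

theorem IsIso.isNilp (h : M.IsIso M') (hM : M.IsNilp) : M'.IsNilp := by
  obtain ⟨n, hn⟩ := (isNilp_iff M).1 hM
  obtain ⟨φ, hφ⟩ := h.symm
  rw [isNilp_iff]
  refine ⟨n, LinearMap.ext fun y => ?_⟩
  have h1 := totMap_tot_pow (φ := fun k => (φ k).toLinearMap) hφ n y
  rw [hn] at h1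
  funext k
  apply (φ k).injective
  rw [LinearMap.zero_apply, Pi.zero_apply, map_zero]
  exact congrFun h1 k

theorem IsIso.exists_pow_ne_zero (h : M'.IsIso M) {r : ℕ} {u : M'.V i}
    (hu : (M'.tot ^ r) (Pi.single i u) ≠ 0) : ∃ w : M.V i, (M.tot ^ r) (Pi.single i w) ≠ 0 := by
  obtain ⟨φ, hφ⟩ := h
  refine ⟨φ i u, fun h0 => hu ?_⟩
  have h1 := totMap_tot_pow (φ := fun k => (φ k).toLinearMap) hφ r (Pi.single i u)
  rw [totMap_single] at h1
  have h2 := h1.trans h0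
  funext k
  apply (φ k).injective
  rw [Pi.zero_apply, map_zero]
  exact congrFun h2 k

/-- A vector z with t^(l-1) z ≠ 0 in an l-dimensional nilpotent space generates it. In this form,
being isomorphic to P_{i,l} is, for fixed dimension, the nonvanishing of some matrix entry of
t^(l-1). This is used for openness in Grassmannians and for constructibility. -/
theorem isIso_P_iff (hM : M.IsNilp) (hl : 0 < l) : M.IsIso (P i l) ↔
    Module.finrank ℂ (∀ k, M.V k) = l ∧ ∃ u : M.V i, (M.tot ^ (l - 1)) (Pi.single i u) ≠ 0 := by
  constructor
  · intro h
    refine ⟨?_, h.symm.exists_pow_ne_zero (PGen_ne_zero i hl)⟩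
    rw [finrank_tot, h.dim_eq, ← finrank_tot, finrank_tot_P]
  · rintro ⟨hf, u, hu⟩
    have h0 := tot_pow_finrank hM
    rw [hf] at h0
    obtain ⟨c, hc⟩ := exists_coord hl h0 hu
    exact isIso_P_of_coord c ((Coord.IsDual.inj_iff hc).2 hf) hf

/-- A representation isomorphic to `P i l` has dual coordinates and a generator. -/
theorem exists_gen_of_isIso_P (h : M.IsIso (P i l)) (hl : 0 < l) :
    ∃ (u : M.V i) (c : Coord M i l), c.IsDual (Pi.single i u) ∧ c.Inj := by
  have hM : M.IsNilp := h.symm.isNilp (P_isNilp i l)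
  obtain ⟨hf, u, hu⟩ := (isIso_P_iff hM hl).1 h
  have h0 := tot_pow_finrank hM
  rw [hf] at h0
  obtain ⟨c, hc⟩ := exists_coord hl h0 hu
  exact ⟨u, c, hc, (Coord.IsDual.inj_iff hc).2 hf⟩

theorem eq_of_isIso_P {j : ZMod N} {m : ℕ} (hl : 0 < l) (h : M.IsIso (P i l))
    (h' : M.IsIso (P j m)) : i = j ∧ l = m := by
  have hlm : l = m := by
    rw [← finrank_tot_P i l, finrank_tot, ← h.dim_eq, h'.dim_eq, ← finrank_tot, finrank_tot_P]
  subst hlm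
  obtain ⟨w, hw⟩ := (h.symm.trans h').exists_pow_ne_zero (PGen_ne_zero i hl)
  exact ⟨(PCoord_inj j l).eq_of_ne_zero hw, rfl⟩

/-- An endomorphism is determined by the image of the generator, and since t^l = 0 every vector of
degree i occurs. So End(M) is isomorphic to M_i. -/
theorem finrank_endSpace (h : M.IsIso (P i l)) (hl : 0 < l) :
    Module.finrank ℂ M.endSpace = arc i l i := by
  obtain ⟨u, c, hc, hi⟩ := exists_gen_of_isIso_P h hl
  let f : M.endSpace →ₗ[ℂ] M.V i :=
    { toFun := fun φ => φ.1 i u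
      map_add' := fun _ _ => rfl
      map_smul' := fun _ _ => rfl }
  have hinj : Function.Injective f := by
    rw [← LinearMap.ker_eq_bot, Submodule.eq_bot_iff]
    rintro ⟨φ, hφ⟩ h0
    have h0' : φ i u = 0 := h0
    have h1 : ∀ y, totMap φ y = 0 := by
      intro y
      rw [← hc.lift_eq_self hi y, c.lift_apply, map_sum]
      refine Finset.sum_eq_zero fun s _ => ?_
      rw [map_smul, totMap_tot_pow (φ := φ) hφ, totMap_single, h0', Pi.single_zero, map_zero,
        smul_zero]
    refine Subtype.ext (funext fun k => LinearMap.ext fun v => ?_)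
    have h2 := congrFun ((totMap_single φ k v).symm.trans (h1 _)) k
    rwa [Pi.single_eq_same] at h2
  have hsurj : Function.Surjective f := by
    intro w
    have hw : (M.tot ^ l) (Pi.single i w) = 0 := by rw [hi.pow_eq_zero]; rfl
    let φ : ∀ k, Module.End ℂ (M.V k) := fun k =>
      LinearMap.proj k ∘ₗ c.lift (Pi.single i w) ∘ₗ LinearMap.single ℂ M.V k
    have hφ : ∀ k v, c.lift (Pi.single i w) (Pi.single k v) = Pi.single k (φ k v) := by
      intro k v
      obtain ⟨v', hv'⟩ := c.lift_single w k v
      change _ = Pi.single k (c.lift (Pi.single i w) (Pi.single k v) k)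
      rw [hv', Pi.single_eq_same]
    refine ⟨⟨φ, fun a b e v => ?_⟩, ?_⟩
    · apply Pi.single_injective (M := fun k => M.V k) b
      rw [← hφ, ← tot_single M e, c.lift_tot hw, hφ, tot_single M e]
    · change φ i u = w
      apply Pi.single_injective (M := fun k => M.V k) i
      rw [← hφ, c.lift_apply, Finset.sum_eq_single 0]
      · have := hc 0 0 hl hl
        rw [pow_zero, Module.End.one_apply, if_pos rfl] at this
        rw [this, one_smul]
        rfl
      · intro s hs hs0
        have := hc 0 s hl (Finset.mem_range.1 hs)
        rw [pow_zero, Module.End.one_apply, if_neg (Ne.symm hs0)] at this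
        rw [this, zero_smul]
      · intro hn
        exact absurd (Finset.mem_range.2 hl) hn
  rw [(LinearEquiv.ofBijective f ⟨hinj, hsurj⟩).finrank_eq]
  exact (congrFun h.dim_eq i).trans (congrFun (P_dim i l) i)

/-- Splitting off a cyclic summand of maximal order. -/
theorem IsIndec.exists_isIso_P (hM : M.IsNilp) (h : M.IsIndec) :
    ∃ i l, 0 < l ∧ M.IsIso (P i l) := by
  obtain ⟨hne, hdec⟩ := h
  have hnt : Nontrivial (∀ k, M.V k) := by
    rw [← Module.finrank_pos_iff (R := ℂ), finrank_tot]
    by_contra hcon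
    refine hne (funext fun k => ?_)
    exact Finset.sum_eq_zero_iff.1 (Nat.eq_zero_of_not_pos hcon) k (Finset.mem_univ k)
  have hnil := (isNilp_iff M).1 hM
  set l := nilpotencyClass M.tot with hldef
  have hl : 0 < l := pos_nilpotencyClass_iff.2 hnil
  have h0 : M.tot ^ l = 0 := pow_nilpotencyClass hnil
  have h1 : M.tot ^ (l - 1) ≠ 0 := pow_pred_nilpotencyClass hnil
  obtain ⟨i, u, hu⟩ : ∃ i u, (M.tot ^ (l - 1)) (Pi.single i u) ≠ 0 := by
    by_contra hcon
    push Not at hcon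
    refine h1 (LinearMap.ext fun y => ?_)
    rw [← Finset.univ_sum_single y, map_sum]
    exact Finset.sum_eq_zero fun k _ => hcon k _
  obtain ⟨c, hc⟩ := exists_coord hl h0 hu
  have hw : (M.tot ^ l) (Pi.single i u) = 0 := by rw [h0]; rfl
  -- Since l is the nilpotency order, e is an idempotent endomorphism; its fixed space A and its
  -- kernel K are complementary subobjects. A contains u, so indecomposability forces K = 0, and
  -- then the coordinates are injective.
  set e := c.lift (Pi.single i u) with he
  have hee : ∀ y, e (e y) = e y := by
    intro y
    rw [he, c.lift_apply _ (c.lift _ y), c.lift_apply _ y]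
    refine Finset.sum_congr rfl fun s hs => ?_
    rw [← c.lift_apply, Coord.IsDual.U_lift hc (Finset.mem_range.1 hs)]
  let A : ∀ k, Submodule ℂ (M.V k) := fun k =>
    LinearMap.ker ((e - 1) ∘ₗ LinearMap.single ℂ M.V k)
  let K : ∀ k, Submodule ℂ (M.V k) := fun k => LinearMap.ker (e ∘ₗ LinearMap.single ℂ M.V k)
  have hA : ∀ k v, v ∈ A k ↔ e (Pi.single k v) = Pi.single k v := fun k v => by
    change e (Pi.single k v) - Pi.single k v = 0 ↔ _
    rw [sub_eq_zero]
  have hK : ∀ k v, v ∈ K k ↔ e (Pi.single k v) = 0 := fun k v => Iff.rfl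
  have hAs : M.IsStable A := by
    intro a b f v hv
    rw [Submodule.mem_comap, hA, ← tot_single M f, c.lift_tot hw, (hA _ _).1 hv]
  have hKs : M.IsStable K := by
    intro a b f v hv
    rw [Submodule.mem_comap, hK, ← tot_single M f, c.lift_tot hw, (hK _ _).1 hv, map_zero]
  have hcompl : ∀ k, IsCompl (A k) (K k) := by
    intro k
    constructor
    · rw [Submodule.disjoint_def]
      intro v hv hv'
      apply Pi.single_injective (M := fun k => M.V k) k
      rw [Pi.single_zero, ← (hA k v).1 hv]
      exact hv'
    · rw [codisjoint_iff, eq_top_iff]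
      intro v _
      obtain ⟨v', hv'⟩ := c.lift_single u k v
      have h1 : e (Pi.single k v') = Pi.single k v' := by
        rw [← hv']
        exact hee _
      refine Submodule.mem_sup.2 ⟨v', (hA _ _).2 h1, v - v', (hK _ _).2 ?_, by simp⟩
      rw [Pi.single_sub, map_sub, h1]
      exact sub_eq_zero.2 hv'
  rcases hdec A K hAs hKs hcompl with hbot | hbot
  · exfalso
    have hu0 : u ∈ A i := by
      rw [hA, he, c.lift_apply, Finset.sum_eq_single 0]
      · have := hc 0 0 hl hl
        rw [pow_zero, Module.End.one_apply, if_pos rfl] at this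
        rw [this, one_smul]
        rfl
      · intro s hs hs0
        have := hc 0 s hl (Finset.mem_range.1 hs)
        rw [pow_zero, Module.End.one_apply, if_neg (Ne.symm hs0)] at this
        rw [this, zero_smul]
      · intro hn
        exact absurd (Finset.mem_range.2 hl) hn
    rw [hbot i, Submodule.mem_bot] at hu0
    rw [hu0, Pi.single_zero, map_zero] at hu
    exact hu rfl
  · have hi : c.Inj := by
      intro y hy
      funext k
      have : y k ∈ K k := by
        rw [hK, he, c.lift_apply]
        refine Finset.sum_eq_zero fun s hs => ?_
        have hUs : c.U s (Pi.single k (y k)) = 0 := by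
          by_cases hk : k = i + (s : ZMod N)
          · subst hk
            rw [← c.hom_apply]
            exact hy s (Finset.mem_range.1 hs)
          · exact c.hom _ _ _ hk
        rw [hUs, zero_smul]
      rw [hbot k, Submodule.mem_bot] at this
      exact this
    exact ⟨i, l, hl, isIso_P_of_coord c hi ((Coord.IsDual.inj_iff hc).1 hi)⟩

/-- Split the generator along a decomposition. On one of its two components t^(l-1) is nonzero; that
component generates all of P_{i,l}, so the other summand is zero. -/
theorem P_isIndec (i : ZMod N) {l : ℕ} (hl : 0 < l) : (P i l).IsIndec := by
  constructor
  · intro h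
    have := finrank_tot (P i l)
    rw [finrank_tot_P, h] at this
    simp at this
    omega
  · have key : ∀ (U W : ∀ k, Submodule ℂ ((P i l).V k)), (P i l).IsStable U →
        (∀ k, IsCompl (U k) (W k)) → ∀ u ∈ U i, ((P i l).tot ^ (l - 1)) (Pi.single i u) ≠ 0 →
        ∀ k, W k = ⊥ := by
      intro U W hU hUW u hu hne
      obtain ⟨c, hc⟩ := exists_coord hl (PCoord_inj i l).pow_eq_zero hne
      have hi : c.Inj := (Coord.IsDual.inj_iff hc).2 (finrank_tot_P i l)
      have hmem : ∀ s k, ((P i l).tot ^ s) (Pi.single i u) k ∈ U k := by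
        intro s
        induction s with
        | zero =>
          intro k
          rw [pow_zero, Module.End.one_apply]
          by_cases hk : k = i
          · subst hk
            rwa [Pi.single_eq_same]
          · rw [Pi.single_eq_of_ne hk]
            exact Submodule.zero_mem _
        | succ s ih =>
          intro k
          rw [pow_succ', Module.End.mul_apply]
          exact hU (k - 1) k ⟨(sub_add_cancel k 1).symm⟩ (ih (k - 1))
      intro k
      have htop : U k = ⊤ := by
        rw [eq_top_iff]
        intro v _
        have h1 := congrFun (Coord.IsDual.lift_eq_self hc hi (Pi.single k v)) k
        rw [Pi.single_eq_same, c.lift_apply, Finset.sum_apply] at h1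
        rw [← h1]
        exact Submodule.sum_mem _ fun s _ => Submodule.smul_mem _ _ (hmem s k)
      have h2 := (hUW k).inf_eq_bot
      rwa [htop, top_inf_eq] at h2
    intro U W hU hW hUW
    obtain ⟨u, hu, w, hw, huw⟩ := Submodule.mem_sup.1
      ((hUW i).sup_eq_top ▸ Submodule.mem_top : PGen i l ∈ U i ⊔ W i)
    by_cases hne : ((P i l).tot ^ (l - 1)) (Pi.single i u) = 0
    · left
      refine key W U hW (fun k => (hUW k).symm) w hw fun h0 => PGen_ne_zero i hl ?_
      rw [← huw, Pi.single_add, map_add, hne, h0, add_zero]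
    · right
      exact key U W hU hUW u hu hne

end QRep

end

noncomputable section

set_option linter.unusedSectionVars false

/-! ### Extensions of uniserial representations -/

namespace QRep

open CyclicQuiver

variable {N : ℕ} [NeZero N] {M : QRep (ZMod N)} {W : ∀ k, Submodule ℂ (M.V k)}
  {i j : ZMod N} {l m : ℕ}

/-- The inclusion of a subobject. -/
def subIncl (hW : M.IsStable W) (k : ZMod N) : (M.sub W hW).V k →ₗ[ℂ] M.V k := (W k).subtype

/-- The projection to a quotient. -/
def quotMk (hW : M.IsStable W) (k : ZMod N) : M.V k →ₗ[ℂ] (M.quot W hW).V k := (W k).mkQ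

theorem subIncl_hom (hW : M.IsStable W) (a b : ZMod N) (e : a ⟶ b) (v : (M.sub W hW).V a) :
    subIncl hW b ((M.sub W hW).map e v) = M.map e (subIncl hW a v) := rfl

theorem quotMk_hom (hW : M.IsStable W) (a b : ZMod N) (e : a ⟶ b) (v : M.V a) :
    quotMk hW b (M.map e v) = (M.quot W hW).map e (quotMk hW a v) := rfl

theorem totMap_subIncl_injective (hW : M.IsStable W) :
    Function.Injective (totMap (subIncl hW)) := fun _ _ h =>
  funext fun k => Subtype.ext (congrFun h k)

theorem totMap_subIncl_mem (hW : M.IsStable W) (y : ∀ k, (M.sub W hW).V k) (k : ZMod N) :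
    totMap (subIncl hW) y k ∈ W k := (y k).2

theorem exists_totMap_subIncl (hW : M.IsStable W) {y : ∀ k, M.V k} (hy : ∀ k, y k ∈ W k) :
    ∃ y', totMap (subIncl hW) y' = y := ⟨fun k => ⟨y k, hy k⟩, rfl⟩

theorem totMap_quotMk_eq_zero (hW : M.IsStable W) (y : ∀ k, M.V k) :
    totMap (quotMk hW) y = 0 ↔ ∀ k, y k ∈ W k := by
  rw [funext_iff]
  exact forall_congr' fun k => Submodule.Quotient.mk_eq_zero _

theorem sub_tot_pow_ne_zero (hW : M.IsStable W) (r : ℕ) (w : (M.sub W hW).V i) :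
    ((M.sub W hW).tot ^ r) (Pi.single i w) ≠ 0 ↔
      (M.tot ^ r) (Pi.single i (subIncl hW i w)) ≠ 0 := by
  rw [← totMap_single, ← totMap_tot_pow (subIncl_hom hW), Ne, Ne,
    map_eq_zero_iff _ (totMap_subIncl_injective hW)]

theorem quot_tot_pow_ne_zero (hW : M.IsStable W) (r : ℕ) (z : M.V j) :
    ((M.quot W hW).tot ^ r) (Pi.single j (quotMk hW j z)) ≠ 0 ↔
      ∃ k, (M.tot ^ r) (Pi.single j z) k ∉ W k := by
  rw [← totMap_single, ← totMap_tot_pow (quotMk_hom hW), Ne, totMap_quotMk_eq_zero]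
  push Not
  rfl

theorem tot_pow_single_mem (hW : M.IsStable W) {w : M.V i} (hw : w ∈ W i) (r : ℕ) (k : ZMod N) :
    (M.tot ^ r) (Pi.single i w) k ∈ W k := by
  have h : Pi.single i w = totMap (subIncl hW) (Pi.single i (⟨w, hw⟩ : (M.sub W hW).V i)) :=
    (totMap_single (subIncl hW) i (⟨w, hw⟩ : (M.sub W hW).V i)).symm
  rw [h, ← totMap_tot_pow (subIncl_hom hW)]
  exact totMap_subIncl_mem _ _ k

theorem IsNilp.sub (h : M.IsNilp) (hW : M.IsStable W) : (M.sub W hW).IsNilp := by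
  obtain ⟨n, hn⟩ := (isNilp_iff M).1 h
  refine (isNilp_iff _).2 ⟨n, LinearMap.ext fun y => totMap_subIncl_injective hW ?_⟩
  rw [totMap_tot_pow (subIncl_hom hW), hn]
  rfl

theorem IsNilp.quot (h : M.IsNilp) (hW : M.IsStable W) : (M.quot W hW).IsNilp := by
  obtain ⟨n, hn⟩ := (isNilp_iff M).1 h
  refine (isNilp_iff _).2 ⟨n, LinearMap.ext fun y => ?_⟩
  have hs : ∀ k, ∃ v : M.V k, quotMk hW k v = y k := fun k => Submodule.mkQ_surjective _ _
  choose v hv using hs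
  obtain rfl : totMap (quotMk hW) v = y := funext hv
  rw [← totMap_tot_pow (quotMk_hom hW), hn]
  exact map_zero _

/-- `W` is a subobject isomorphic to `P i l` with quotient isomorphic to `P j m`. -/
def IsExt (M : QRep (ZMod N)) (W : ∀ k, Submodule ℂ (M.V k)) (i : ZMod N) (l : ℕ) (j : ZMod N)
    (m : ℕ) : Prop :=
  ∃ hW : M.IsStable W, (M.sub W hW).IsIso (P i l) ∧ (M.quot W hW).IsIso (P j m)

theorem finrank_sub_add_quot (hW : M.IsStable W) :
    Module.finrank ℂ (∀ k, (M.sub W hW).V k) + Module.finrank ℂ (∀ k, (M.quot W hW).V k) =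
      Module.finrank ℂ (∀ k, M.V k) := by
  rw [finrank_tot, finrank_tot, finrank_tot, ← Finset.sum_add_distrib]
  refine Finset.sum_congr rfl fun k _ => ?_
  rw [add_comm]
  exact (W k).finrank_quotient_add_finrank

/-- For fixed dimensions the condition separates into a closed one on W (stability) and two open
ones, that t^(l-1) does not vanish on W_i and that t^(m-1) M_j is not contained in W. The topology
of the sets of extensions depends on this. -/
theorem isExt_iff (hM : M.IsNilp) (hl : 0 < l) (hm : 0 < m) : M.IsExt W i l j m ↔
    M.IsStable W ∧ ∑ k, Module.finrank ℂ (W k) = l ∧ ∑ k, M.dim k = l + m ∧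
      (∃ w ∈ W i, (M.tot ^ (l - 1)) (Pi.single i w) ≠ 0) ∧
      ∃ (z : M.V j) (k : ZMod N), (M.tot ^ (m - 1)) (Pi.single j z) k ∉ W k := by
  constructor
  · rintro ⟨hW, h1, h2⟩
    obtain ⟨h3, w, hw⟩ := (isIso_P_iff (hM.sub hW) hl).1 h1
    obtain ⟨h4, z', hz⟩ := (isIso_P_iff (hM.quot hW) hm).1 h2
    obtain ⟨z, rfl⟩ : ∃ z, quotMk hW j z = z' := Submodule.mkQ_surjective _ z'
    refine ⟨hW, ?_, ?_, ⟨w.1, w.2, (sub_tot_pow_ne_zero hW _ w).1 hw⟩, z,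
      (quot_tot_pow_ne_zero hW _ z).1 hz⟩
    · rw [← h3, finrank_tot]
      rfl
    · rw [← h3, ← h4, finrank_sub_add_quot, finrank_tot]
  · rintro ⟨hW, h1, h2, ⟨w, hwW, hw⟩, z, hz⟩
    have h3 : Module.finrank ℂ (∀ k, (M.sub W hW).V k) = l := by
      rw [finrank_tot, ← h1]
      rfl
    refine ⟨hW, (isIso_P_iff (hM.sub hW) hl).2 ⟨h3, ⟨w, hwW⟩,
      (sub_tot_pow_ne_zero hW _ _).2 hw⟩, (isIso_P_iff (hM.quot hW) hm).2 ⟨?_, quotMk hW j z,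
      (quot_tot_pow_ne_zero hW _ z).2 hz⟩⟩
    have := finrank_sub_add_quot hW
    rw [h3, finrank_tot M, h2] at this
    omega

theorem IsExt.pos_left_right (h : M.IsExt W i l j m) : Module.finrank ℂ (∀ k, M.V k) = l + m := by
  obtain ⟨hW, h1, h2⟩ := h
  rw [← finrank_sub_add_quot hW, finrank_tot, h1.dim_eq, ← finrank_tot, finrank_tot_P,
    finrank_tot (M.quot W hW), h2.dim_eq, ← finrank_tot, finrank_tot_P]

/-- Coordinates vanish on the wrong components. -/
theorem tot_pow_apply_add (M : QRep (ZMod N)) (x : ∀ k, M.V k) (i : ZMod N) (r : ℕ) :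
    (M.tot ^ r) (Pi.single i (x i)) =
      Pi.single (i + (r : ZMod N)) ((M.tot ^ r) x (i + (r : ZMod N))) := by
  have h1 : (M.tot ^ r) x (i + (r : ZMod N)) =
      (M.tot ^ r) (Pi.single i (x i)) (i + (r : ZMod N)) := by
    conv_lhs => rw [← Finset.univ_sum_single x, map_sum, Finset.sum_apply]
    refine Finset.sum_eq_single i (fun k _ hk => ?_) (by simp)
    obtain ⟨w, hw⟩ := tot_pow_single M k r (x k)
    rw [hw, Pi.single_eq_of_ne]
    exact fun h => hk (add_right_cancel h).symm
  obtain ⟨w, hw⟩ := tot_pow_single M i r (x i)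
  rw [h1, hw, Pi.single_eq_same]

/-- A homogeneous vector of a uniserial representation is an iterate of a generator. -/
theorem exists_eq_tot_pow (h : M.IsIso (P i l)) (hl : 0 < l) {κ : ZMod N} {y : M.V κ}
    (hy : y ≠ 0) : ∃ (k : ℕ) (w : M.V i), k < l ∧ κ = i + (k : ZMod N) ∧
      (M.tot ^ (l - 1)) (Pi.single i w) ≠ 0 ∧ (M.tot ^ k) (Pi.single i w) = Pi.single κ y := by
  obtain ⟨w, c, hc, hi⟩ := exists_gen_of_isIso_P h hl
  have hex : ∃ s, s < l ∧ c.U s (Pi.single κ y) ≠ 0 := by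
    by_contra hcon
    push Not at hcon
    have h1 := hi _ hcon
    rw [Pi.single_eq_zero_iff] at h1
    exact hy h1
  classical
  obtain ⟨k, ⟨hkl, hk⟩, hmin⟩ : ∃ k, (k < l ∧ c.U k (Pi.single κ y) ≠ 0) ∧
      ∀ s < k, ¬ (s < l ∧ c.U s (Pi.single κ y) ≠ 0) :=
    ⟨Nat.find hex, Nat.find_spec hex, fun s hs => Nat.find_min hex hs⟩
  have hκ : κ = i + (k : ZMod N) := by
    by_contra hne
    exact hk (c.hom _ _ _ hne)
  -- Let k be the first index at which y has a nonzero coordinate. Shifting all coordinates down by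
  -- k divides y by t^k.
  let x : ∀ k, M.V k :=
    ∑ s ∈ Finset.range (l - k), c.U (k + s) (Pi.single κ y) • (M.tot ^ s) (Pi.single i w)
  have hx : (M.tot ^ k) x = Pi.single κ y := by
    rw [← hc.lift_eq_self hi (Pi.single κ y), c.lift_apply, map_sum]
    obtain ⟨n, rfl⟩ := Nat.exists_eq_add_of_le hkl.le
    rw [Finset.sum_range_add, Nat.add_sub_cancel_left, Finset.sum_eq_zero (s := Finset.range k),
      zero_add]
    · refine Finset.sum_congr rfl fun s _ => ?_
      rw [map_smul, ← Module.End.mul_apply, ← pow_add]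
    · intro s hs
      have := hmin s (Finset.mem_range.1 hs)
      push Not at this
      rw [this (by have := Finset.mem_range.1 hs; omega), zero_smul]
  have hx' : (M.tot ^ k) (Pi.single i (x i)) = Pi.single κ y := by
    subst hκ
    rw [tot_pow_apply_add, hx, Pi.single_eq_same]
  -- t^(l-1) x = t^(l-1-k) y, whose last coordinate is the leading coordinate U_k(y) ≠ 0; so x has
  -- full order.
  refine ⟨k, x i, hkl, hκ, fun h0 => hk ?_, hx'⟩
  have h1 := c.pow_of_le (r := l - 1 - k) (s := l - 1) (by omega) (by omega) (Pi.single κ y)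
  rw [show l - 1 - (l - 1 - k) = k by omega] at h1
  rw [← h1, ← hx', ← Module.End.mul_apply, ← pow_add, show l - 1 - k + k = l - 1 by omega, h0,
    map_zero]

/-- Coordinates with nonzero leading value on some element of a uniserial representation are dual
to a homogeneous generator. -/
theorem Coord.exists_isDual (h : M.IsIso (P i l)) (hl : 0 < l) (d : Coord M i l) {w : M.V i}
    (hw : d.U 0 (Pi.single i w) ≠ 0) : d.Inj ∧ ∃ w' : M.V i, d.IsDual (Pi.single i w') := by
  have hM : M.IsNilp := h.symm.isNilp (P_isNilp i l)
  have hf : Module.finrank ℂ (∀ k, M.V k) = l := ((isIso_P_iff hM hl).1 h).1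
  have h0 := tot_pow_finrank hM
  rw [hf] at h0
  have hw1 : (M.tot ^ (l - 1)) (Pi.single i w) ≠ 0 := by
    intro h1
    have h2 := d.pow_of_le (r := l - 1) (s := l - 1) le_rfl (by omega) (Pi.single i w)
    rw [h1, map_zero, Nat.sub_self] at h2
    exact hw h2.symm
  obtain ⟨c, hc⟩ := exists_coord hl h0 hw1
  have hci : c.Inj := (Coord.IsDual.inj_iff hc).2 hf
  have hinj : d.Inj := by
    intro y hy
    refine hci _ fun s => ?_
    induction s using Nat.strong_induction_on with
    | _ s ih =>
      intro hs
      have h1 := hy s hs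
      rw [← Coord.IsDual.lift_eq_self hc hci y, c.lift_apply, map_sum,
        Finset.sum_eq_single s] at h1
      · rw [map_smul, d.pow_of_le le_rfl hs, Nat.sub_self, smul_eq_mul] at h1
        exact (mul_eq_zero.1 h1).resolve_right hw
      · intro r hr hrs
        rcases lt_or_gt_of_ne hrs with h | h
        · rw [ih r h (Finset.mem_range.1 hr), zero_smul, map_zero]
        · rw [map_smul, d.pow_of_lt h, smul_zero]
      · intro hn
        exact absurd (Finset.mem_range.2 hs) hn
  refine ⟨hinj, ?_⟩
  have hsurj : Function.Surjective d.toPi :=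
    (LinearMap.injective_iff_surjective_of_finrank_eq_finrank (by simpa using hf)).1
      (Coord.toPi_injective.1 hinj)
  obtain ⟨x, hx⟩ := hsurj fun s => if (s : ℕ) = 0 then 1 else 0
  have hx' : ∀ s, s < l → d.U s x = if s = 0 then 1 else 0 := fun s hs => congrFun hx ⟨s, hs⟩
  refine ⟨x i, ?_⟩
  have h1 : ∀ s, s < l → d.U s (Pi.single i (x i)) = if s = 0 then 1 else 0 := by
    intro s hs
    by_cases his : i = i + (s : ZMod N)
    · rw [← hx' s hs, d.hom_apply s x]
      exact congrArg (fun k => d.U s (Pi.single k (x k))) his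
    · rw [d.hom _ _ _ his, if_neg]
      rintro rfl
      simp at his
  intro r s hr hs
  rcases lt_or_ge s r with h | h
  · rw [d.pow_of_lt h, if_neg (by omega)]
  · rw [d.pow_of_le h hs, h1 _ (by omega)]
    congr 1
    apply propext
    omega

/-! ### Complements of cyclic summands -/

/-- The common kernel of the coordinates dual to `u`. -/
def Coord.ker (c : Coord M i l) (u : M.V i) (k : ZMod N) : Submodule ℂ (M.V k) :=
  LinearMap.ker (c.lift (Pi.single i u) ∘ₗ LinearMap.single ℂ M.V k)

theorem Coord.mem_ker (c : Coord M i l) {u : M.V i} {k : ZMod N} {v : M.V k} :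
    v ∈ c.ker u k ↔ c.lift (Pi.single i u) (Pi.single k v) = 0 := Iff.rfl

theorem Coord.IsDual.lift_eq_zero {c : Coord M i l} {u : ∀ k, M.V k} (h : c.IsDual u)
    {y : ∀ k, M.V k} : c.lift u y = 0 ↔ ∀ s, s < l → c.U s y = 0 := by
  constructor
  · intro h0 s hs
    rw [← h.U_lift hs, h0, map_zero]
  · intro h0
    rw [c.lift_apply]
    exact Finset.sum_eq_zero fun s hs => by rw [h0 s (Finset.mem_range.1 hs), zero_smul]

theorem Coord.ker_isStable (c : Coord M i l) {u : M.V i} (hu : (M.tot ^ l) (Pi.single i u) = 0) :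
    M.IsStable (c.ker u) := by
  intro a b f v hv
  rw [Submodule.mem_comap, c.mem_ker, ← tot_single M f, c.lift_tot hu, c.mem_ker.1 hv, map_zero]

theorem Coord.IsDual.lift_lift {c : Coord M i l} {u : ∀ k, M.V k} (h : c.IsDual u)
    (y : ∀ k, M.V k) : c.lift u (c.lift u y) = c.lift u y := by
  rw [c.lift_apply _ (c.lift _ y), c.lift_apply _ y]
  refine Finset.sum_congr rfl fun s hs => ?_
  rw [← c.lift_apply, h.U_lift (Finset.mem_range.1 hs)]

theorem Coord.IsDual.lift_gen {c : Coord M i l} {u : ∀ k, M.V k} (h : c.IsDual u)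
    (hu : (M.tot ^ l) u = 0) : c.lift u u = u := by
  rw [c.lift_apply]
  rcases Nat.eq_zero_or_pos l with rfl | hl
  · exact hu.symm
  · rw [Finset.sum_eq_single 0]
    · have := h 0 0 hl hl
      rw [pow_zero, Module.End.one_apply, if_pos rfl] at this
      rw [this, one_smul]
      rfl
    · intro s hs hs0
      have := h 0 s hl (Finset.mem_range.1 hs)
      rw [pow_zero, Module.End.one_apply, if_neg (Ne.symm hs0)] at this
      rw [this, zero_smul]
    · intro hn
      exact absurd (Finset.mem_range.2 hl) hn

theorem Coord.lift_single_eq (c : Coord M i l) (w : M.V i) (a : ZMod N) (v : M.V a) :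
    Pi.single a (c.lift (Pi.single i w) (Pi.single a v) a) =
      c.lift (Pi.single i w) (Pi.single a v) := by
  obtain ⟨v', hv'⟩ := c.lift_single w a v
  rw [hv', Pi.single_eq_same]

/-- The projection to the complement of a cyclic summand. -/
def Coord.projKer {c : Coord M i l} {u : M.V i} (h : c.IsDual (Pi.single i u))
    (hu : (M.tot ^ l) (Pi.single i u) = 0) (k : ZMod N) :
    M.V k →ₗ[ℂ] (M.sub (c.ker u) (c.ker_isStable hu)).V k :=
  LinearMap.codRestrict (c.ker u k)
    (LinearMap.id - LinearMap.proj k ∘ₗ c.lift (Pi.single i u) ∘ₗ LinearMap.single ℂ M.V k) (by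
      intro v
      rw [c.mem_ker]
      change c.lift _ (Pi.single k (v - c.lift (Pi.single i u) (Pi.single k v) k)) = 0
      rw [Pi.single_sub, map_sub, c.lift_single_eq, h.lift_lift, sub_self])

section projKer

variable {c : Coord M i l} {u : M.V i} (h : c.IsDual (Pi.single i u))
  (hu : (M.tot ^ l) (Pi.single i u) = 0)

include h hu

theorem Coord.subIncl_projKer (y : ∀ k, M.V k) :
    totMap (subIncl (c.ker_isStable hu)) (totMap (Coord.projKer h hu) y) =
      y - c.lift (Pi.single i u) y := by
  conv_lhs => rw [← Finset.univ_sum_single y]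
  conv_rhs => rw [← Finset.univ_sum_single y]
  simp only [map_sum, totMap_single]
  rw [← Finset.sum_sub_distrib]
  refine Finset.sum_congr rfl fun k _ => ?_
  rw [← c.lift_single_eq, ← Pi.single_sub]
  rfl

theorem Coord.projKer_hom (a b : ZMod N) (e : a ⟶ b) (v : M.V a) :
    Coord.projKer h hu b (M.map e v) = (M.sub _ (c.ker_isStable hu)).map e
      (Coord.projKer h hu a v) := by
  apply Pi.single_injective (M := fun k => (M.sub _ (c.ker_isStable hu)).V k) b
  apply totMap_subIncl_injective (c.ker_isStable hu)
  rw [← totMap_single, Coord.subIncl_projKer, ← tot_single _ e, ← tot_single _ e,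
    totMap_tot (subIncl_hom _), ← totMap_single, Coord.subIncl_projKer, map_sub, c.lift_tot hu]

theorem Coord.lift_subIncl (y : ∀ k, (M.sub _ (c.ker_isStable hu)).V k) :
    c.lift (Pi.single i u) (totMap (subIncl (c.ker_isStable hu)) y) = 0 := by
  rw [← Finset.univ_sum_single y, map_sum, map_sum]
  refine Finset.sum_eq_zero fun k _ => ?_
  rw [totMap_single]
  exact c.mem_ker.1 (y k).2

/-- The coordinates together with the projection to their common kernel form an isomorphism onto ℂ^l
times that kernel. -/
theorem Coord.finrank_ker : Module.finrank ℂ (∀ k, M.V k) =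
    l + Module.finrank ℂ (∀ k, (M.sub _ (c.ker_isStable hu)).V k) := by
  let f : (∀ k, M.V k) →ₗ[ℂ] (Fin l → ℂ) × (∀ k, (M.sub _ (c.ker_isStable hu)).V k) :=
    c.toPi.prod (totMap (Coord.projKer h hu))
  have hf : Function.Bijective f := by
    constructor
    · rw [← LinearMap.ker_eq_bot, Submodule.eq_bot_iff]
      intro y hy
      have h1 : c.toPi y = 0 := congrArg Prod.fst hy
      have h2 : totMap (Coord.projKer h hu) y = 0 := congrArg Prod.snd hy
      have h3 := Coord.subIncl_projKer h hu y
      rwa [h2, map_zero, h.lift_eq_zero.2 fun s hs => congrFun h1 ⟨s, hs⟩, sub_zero, eq_comm] at h3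
    · rintro ⟨g, y⟩
      obtain ⟨x, hx⟩ := h.toPi_surjective g
      refine ⟨c.lift (Pi.single i u) x + totMap (subIncl (c.ker_isStable hu)) y, Prod.ext ?_ ?_⟩
      · funext s
        change c.U s _ = g s
        rw [map_add, h.U_lift s.2, h.lift_eq_zero.1 (Coord.lift_subIncl h hu y) s s.2, add_zero,
          ← hx]
        rfl
      · apply totMap_subIncl_injective (c.ker_isStable hu)
        change totMap _ (totMap (Coord.projKer h hu) _) = totMap _ y
        rw [Coord.subIncl_projKer, map_add, h.lift_lift, Coord.lift_subIncl h hu]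
        abel
  rw [(LinearEquiv.ofBijective f hf).finrank_eq, Module.finrank_prod]
  simp

end projKer

/-- A decomposition of `M` as the sum of two cyclic subobjects. -/
structure CyclicPair (M : QRep (ZMod N)) (a : ZMod N) (p : ℕ) (b : ZMod N) (q : ℕ) where
  u : M.V a
  v : M.V b
  U : Coord M a p
  V : Coord M b q
  U_u : U.IsDual (Pi.single a u)
  V_v : V.IsDual (Pi.single b v)
  U_v : ∀ r s, U.U s ((M.tot ^ r) (Pi.single b v)) = 0
  V_u : ∀ r s, V.U s ((M.tot ^ r) (Pi.single a u)) = 0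
  inj : ∀ y, (∀ s, s < p → U.U s y = 0) → (∀ s, s < q → V.U s y = 0) → y = 0

/-- Exchange of the summands. -/
def CyclicPair.swap {a b : ZMod N} {p q : ℕ} (D : CyclicPair M a p b q) : CyclicPair M b q a p where
  u := D.v
  v := D.u
  U := D.V
  V := D.U
  U_u := D.V_v
  V_v := D.U_u
  U_v := D.V_u
  V_u := D.U_v
  inj y h h' := D.inj y h' h

/-- If the complement of a cyclic summand is uniserial, its coordinates, pulled back along the
projection, supply the second half of the data. -/
theorem exists_cyclicPair {c : Coord M i l} {u : M.V i} (h : c.IsDual (Pi.single i u))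
    (hu : (M.tot ^ l) (Pi.single i u) = 0)
    (hK : (M.sub _ (c.ker_isStable hu)).IsIso (P j m)) (hm : 0 < m) :
    Nonempty (CyclicPair M i l j m) := by
  obtain ⟨w, d, hd, hi⟩ := exists_gen_of_isIso_P hK hm
  have hw : ∀ r, (M.tot ^ r) (Pi.single j (subIncl (c.ker_isStable hu) j w)) =
      totMap (subIncl (c.ker_isStable hu)) (((M.sub _ (c.ker_isStable hu)).tot ^ r)
        (Pi.single j w)) := fun r => by
    rw [totMap_tot_pow (subIncl_hom _), totMap_single]
  have hproj : ∀ y, totMap (Coord.projKer h hu) (totMap (subIncl (c.ker_isStable hu)) y) = y := by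
    intro y
    apply totMap_subIncl_injective (c.ker_isStable hu)
    rw [Coord.subIncl_projKer, Coord.lift_subIncl h hu, sub_zero]
  refine ⟨⟨u, subIncl (c.ker_isStable hu) j w, c,
    d.comap (Coord.projKer h hu) (Coord.projKer_hom h hu), h, ?_, ?_, ?_, ?_⟩⟩
  · intro r s hr hs
    rw [hw]
    change d.U s (totMap (Coord.projKer h hu) _) = _
    rw [hproj, hd r s hr hs]
  · intro r s
    rw [hw]
    rcases lt_or_ge s l with hs | hs
    · exact h.lift_eq_zero.1 (Coord.lift_subIncl h hu _) s hs
    · exact c.zero_of_le _ _ hs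
  · intro r s
    change d.U s (totMap (Coord.projKer h hu) _) = _
    have h1 : totMap (Coord.projKer h hu) ((M.tot ^ r) (Pi.single i u)) = 0 := by
      apply totMap_subIncl_injective (c.ker_isStable hu)
      rw [Coord.subIncl_projKer, c.lift_tot_pow hu, map_zero, h.lift_gen hu, sub_self]
    rw [h1, map_zero]
  · intro y h1 h2
    have h3 : totMap (Coord.projKer h hu) y = 0 := hi _ h2
    have h4 := Coord.subIncl_projKer h hu y
    rwa [h3, map_zero, h.lift_eq_zero.2 h1, sub_zero, eq_comm] at h4

end QRep

end

/-! ### Extensions of uniserial representations have at most two cyclic summands -/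

noncomputable section

set_option linter.unusedSectionVars false

namespace QRep

open CyclicQuiver

variable {N : ℕ} [NeZero N] {M : QRep (ZMod N)} {W : ∀ k, Submodule ℂ (M.V k)}
  {i j : ZMod N} {l m : ℕ}

/-- An extension of uniserial representations is uniserial or a sum of two cyclic subobjects. -/
theorem IsExt.exists_cyclicPair (hM : M.IsNilp) (h : M.IsExt W i l j m) (hl : 0 < l) (hm : 0 < m) :
    (∃ k n, 0 < n ∧ M.IsIso (P k n)) ∨
      ∃ a p b q, 0 < p ∧ 0 < q ∧ Nonempty (CyclicPair M a p b q) := by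
  have hdim := h.pos_left_right
  obtain ⟨hW, h1, h2⟩ := h
  obtain ⟨z', d, hd, hdi⟩ := exists_gen_of_isIso_P h2 hm
  obtain ⟨z, rfl⟩ : ∃ z, quotMk hW j z = z' := Submodule.mkQ_surjective _ z'
  let c : Coord M j m := d.comap (quotMk hW) (quotMk_hom hW)
  have hcW : ∀ y, (∀ s, s < m → c.U s y = 0) ↔ ∀ k, y k ∈ W k := by
    intro y
    rw [← totMap_quotMk_eq_zero hW]
    refine ⟨fun h => hdi _ h, fun h s _ => ?_⟩
    change d.U s (totMap (quotMk hW) y) = 0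
    rw [h, map_zero]
  have hcz : ∀ z₁ : M.V j, (z₁ - z) ∈ W j → c.IsDual (Pi.single j z₁) := by
    intro z₁ hz₁ r s hr hs
    change d.U s (totMap (quotMk hW) _) = _
    have : quotMk hW j z₁ = quotMk hW j z := (Submodule.Quotient.eq (W j)).2 hz₁
    rw [totMap_tot_pow (quotMk_hom hW), totMap_single, this, hd r s hr hs]
  -- If some lift of the generator of the quotient already has order m in M, it generates a
  -- complement of W, which is the common kernel of the coordinates of the quotient.
  have split : ∀ z₁ : M.V j, (z₁ - z) ∈ W j → (M.tot ^ m) (Pi.single j z₁) = 0 →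
      ∃ a p b q, 0 < p ∧ 0 < q ∧ Nonempty (CyclicPair M a p b q) := by
    intro z₁ hz₁ h0
    refine ⟨j, m, i, l, hm, hl, ?_⟩
    have hK : W = c.ker z₁ := by
      funext k
      ext v
      rw [c.mem_ker, (hcz z₁ hz₁).lift_eq_zero, hcW]
      constructor
      · intro hv k'
        by_cases hk : k' = k
        · subst hk
          rwa [Pi.single_eq_same]
        · rw [Pi.single_eq_of_ne hk]
          exact Submodule.zero_mem _
      · intro hv
        have := hv k
        rwa [Pi.single_eq_same] at this
    have h1' : ∀ (W' : ∀ k, Submodule ℂ (M.V k)) (h' : M.IsStable W'), W = W' →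
        (M.sub W' h').IsIso (P i l) := by
      rintro _ _ rfl
      exact h1
    exact QRep.exists_cyclicPair (hcz z₁ hz₁) h0 (h1' _ _ hK) hl
  by_cases hz0 : (M.tot ^ m) (Pi.single j z) = 0
  · exact Or.inr (split z (by rw [sub_self]; exact Submodule.zero_mem _) hz0)
  obtain ⟨y, hy⟩ := tot_pow_single M j m z
  have hyW : y ∈ W (j + (m : ZMod N)) := by
    have := (hcW ((M.tot ^ m) (Pi.single j z))).1 (fun s hs => c.pow_of_lt hs _) (j + (m : ZMod N))
    rwa [hy, Pi.single_eq_same] at this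
  obtain ⟨y, rfl⟩ : ∃ y' : (M.sub W hW).V (j + (m : ZMod N)), subIncl hW _ y' = y :=
    ⟨⟨y, hyW⟩, rfl⟩
  have hy0 : y ≠ 0 := by
    intro h0
    rw [hy, h0, map_zero, Pi.single_zero] at hz0
    exact hz0 rfl
  -- The obstruction t^m z lies in W, so it equals t^k w for a generator w of W. The comparison of k
  -- with m decides between splitting by a change of z and a longer cyclic subobject.
  obtain ⟨k, w', hk, hκ, hw', hwy⟩ := exists_eq_tot_pow h1 hl hy0
  set w : M.V i := subIncl hW i w' with hw
  have hwW : w ∈ W i := w'.2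
  have hwne : (M.tot ^ (l - 1)) (Pi.single i w) ≠ 0 := (sub_tot_pow_ne_zero hW _ _).1 hw'
  have hwz : (M.tot ^ k) (Pi.single i w) = (M.tot ^ m) (Pi.single j z) := by
    have h3 := congrArg (totMap (subIncl hW)) hwy
    rw [totMap_tot_pow (subIncl_hom hW), totMap_single, totMap_single] at h3
    rw [hy]
    exact h3
  have hwl : ∀ y, (∀ k, y k ∈ W k) → (M.tot ^ l) y = 0 := by
    intro y hy
    obtain ⟨y', rfl⟩ := exists_totMap_subIncl hW hy
    have h3 := tot_pow_finrank (hM.sub hW)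
    rw [((isIso_P_iff (hM.sub hW) hl).1 h1).1] at h3
    rw [← totMap_tot_pow (subIncl_hom hW), h3]
    exact map_zero _
  have hsingleW : ∀ k v, v ∈ W k → ∀ k', (Pi.single k v : ∀ k, M.V k) k' ∈ W k' := by
    intro k v hv k'
    by_cases hk : k' = k
    · subst hk
      rwa [Pi.single_eq_same]
    · rw [Pi.single_eq_of_ne hk]
      exact Submodule.zero_mem _
  rcases le_or_gt m k with hmk | hmk
  · right
    obtain ⟨e, rfl⟩ := Nat.exists_eq_add_of_le hmk
    have hj : j = i + (e : ZMod N) := by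
      push_cast at hκ
      have h3 : j + (m : ZMod N) = (i + e) + m := by rw [hκ]; ring
      exact add_right_cancel h3
    subst hj
    have hx := tot_pow_single_mem hW hwW e
    obtain ⟨x, hx'⟩ := tot_pow_single M i e w
    -- For k = m + e the vector x = t^e w of W satisfies t^m x = t^m z, so z - x is a lift of order
    -- m.
    refine split (z - x) ?_ ?_
    · rw [sub_sub_cancel_left]
      have := hx (i + e)
      rw [hx', Pi.single_eq_same] at this
      exact Submodule.neg_mem _ this
    · rw [Pi.single_sub, map_sub, ← hx', ← Module.End.mul_apply, ← pow_add, hwz, sub_self]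
  -- For k < m the vector z has order p = m + l - k, which is also the nilpotency order of M, so the
  -- subobject generated by z is a summand. The complement has dimension k, and is zero precisely
  -- when M is uniserial.
  · set p := m + (l - k) with hp
    have hwl' := hwl _ (hsingleW i w hwW)
    have h0 : M.tot ^ p = 0 := by
      refine LinearMap.ext fun y => ?_
      have hyl : ∀ κ, (y - c.lift (Pi.single j z) y) κ ∈ W κ := by
        rw [← hcW]
        intro s hs
        rw [map_sub, Coord.IsDual.U_lift (hcz z (by rw [sub_self]; exact Submodule.zero_mem _)) hs,
          sub_self]
      have h3 : (M.tot ^ p) (y - c.lift (Pi.single j z) y) = 0 := by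
        rw [show p = (m - k) + l by omega, pow_add, Module.End.mul_apply, hwl _ hyl, map_zero]
      have h4 : (M.tot ^ p) (c.lift (Pi.single j z) y) = 0 := by
        rw [c.lift_apply, map_sum]
        refine Finset.sum_eq_zero fun s _ => ?_
        rw [map_smul, ← Module.End.mul_apply, ← pow_add, show p + s = (s + (l - k)) + m by omega,
          pow_add, Module.End.mul_apply, ← hwz, ← Module.End.mul_apply, ← pow_add,
          show s + (l - k) + k = s + l by omega, pow_add, Module.End.mul_apply, hwl', map_zero,
          smul_zero]
      rw [map_sub, h4, sub_zero] at h3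
      exact h3
    have hu : (M.tot ^ (p - 1)) (Pi.single j z) ≠ 0 := by
      rw [show p - 1 = (l - k - 1) + m by omega, pow_add, Module.End.mul_apply, ← hwz,
        ← Module.End.mul_apply, ← pow_add, show l - k - 1 + k = l - 1 by omega]
      exact hwne
    obtain ⟨U, hU⟩ := exists_coord (by omega) h0 hu
    have hU : U.IsDual (Pi.single j z) := hU
    have hu0 : (M.tot ^ p) (Pi.single j z) = 0 := by rw [h0]; rfl
    have hfin := Coord.finrank_ker hU hu0
    rw [hdim] at hfin
    rcases Nat.eq_zero_or_pos k with rfl | hk0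
    · left
      refine ⟨j, p, by omega, isIso_P_of_coord U (hU.inj_iff.2 (by omega)) (by omega)⟩
    · right
      refine ⟨j, p, i, k, by omega, hk0, QRep.exists_cyclicPair hU hu0 ?_ hk0⟩
      rw [isIso_P_iff (hM.sub _) hk0]
      refine ⟨by omega, Coord.projKer hU hu0 i w, fun hcon => ?_⟩
      rw [← totMap_single, ← totMap_tot_pow (Coord.projKer_hom hU hu0)] at hcon
      have h3 := Coord.subIncl_projKer hU hu0 ((M.tot ^ (k - 1)) (Pi.single i w))
      rw [hcon, map_zero, eq_comm, sub_eq_zero] at h3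
      -- compare the coordinates of both sides in the quotient
      have h4 : c.U (m - 1) ((M.tot ^ (k - 1)) (Pi.single i w)) = 0 :=
        (hcW _).2 (tot_pow_single_mem hW hwW (k - 1)) _ (by omega)
      have h5 : U.U (m - k) (Pi.single i w) = 1 := by
        have h6 := U.pow_of_le (r := k) (s := m) hmk.le (by omega) (Pi.single i w)
        rw [hwz, hU m m (by omega) (by omega), if_pos rfl] at h6
        exact h6.symm
      rw [h3, U.lift_tot_pow hu0, U.lift_apply, map_sum, map_sum,
        Finset.sum_eq_single (m - k)] at h4
      · rw [h5, one_smul, ← Module.End.mul_apply, ← pow_add,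
          show k - 1 + (m - k) = m - 1 by omega,
          hcz z (by rw [sub_self]; exact Submodule.zero_mem _) _ _ (by omega) (by omega),
          if_pos rfl] at h4
        exact one_ne_zero h4
      · intro s hs hsm
        rw [map_smul, map_smul, ← Module.End.mul_apply, ← pow_add]
        rcases lt_or_ge (k - 1 + s) m with h | h
        · rw [hcz z (by rw [sub_self]; exact Submodule.zero_mem _) _ _ h (by omega),
            if_neg (by omega), smul_zero]
        · rw [c.pow_of_lt (by omega), smul_zero]
      · intro hn
        exact absurd (Finset.mem_range.2 (by omega)) hn

end QRep

end

/-! ### Normalised generators of subobjects in a sum of two cyclic subobjects -/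

noncomputable section

set_option linter.unusedSectionVars false

namespace QRep

open CyclicQuiver

variable {N : ℕ} [NeZero N] {M : QRep (ZMod N)} {W : ∀ k, Submodule ℂ (M.V k)}
  {i j : ZMod N} {l m : ℕ}

theorem IsExt.exists_quot_coord (h : M.IsExt W i l j m) (hm : 0 < m) :
    ∃ (z : M.V j) (c : Coord M j m), c.IsDual (Pi.single j z) ∧
      ∀ y, (∀ k, y k ∈ W k) ↔ ∀ s, s < m → c.U s y = 0 := by
  obtain ⟨hW, -, h2⟩ := h
  obtain ⟨z', d, hd, hdi⟩ := exists_gen_of_isIso_P h2 hm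
  obtain ⟨z, rfl⟩ : ∃ z, quotMk hW j z = z' := Submodule.mkQ_surjective _ z'
  refine ⟨z, d.comap (quotMk hW) (quotMk_hom hW), fun r s hr hs => ?_, fun y => ?_⟩
  · change d.U s (totMap (quotMk hW) _) = _
    rw [totMap_tot_pow (quotMk_hom hW), totMap_single, hd r s hr hs]
  · rw [← totMap_quotMk_eq_zero hW]
    refine ⟨fun h s _ => ?_, fun h => hdi _ h⟩
    change d.U s (totMap (quotMk hW) y) = 0
    rw [h, map_zero]

theorem mem_iff_of_isIso_P {hW : M.IsStable W} (h : (M.sub W hW).IsIso (P i l)) (hl : 0 < l)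
    {w : M.V i} (hw : w ∈ W i) (hw0 : (M.tot ^ (l - 1)) (Pi.single i w) ≠ 0) (y : ∀ k, M.V k) :
    (∀ k, y k ∈ W k) ↔
      ∃ c : ℕ → ℂ, y = ∑ r ∈ Finset.range l, c r • (M.tot ^ r) (Pi.single i w) := by
  constructor
  · intro hy
    obtain ⟨w', rfl⟩ : ∃ w' : (M.sub W hW).V i, subIncl hW i w' = w := ⟨⟨w, hw⟩, rfl⟩
    obtain ⟨y', rfl⟩ := exists_totMap_subIncl hW hy
    have hM : (M.sub W hW).IsNilp := h.symm.isNilp (P_isNilp i l)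
    have hf := ((isIso_P_iff hM hl).1 h).1
    have h0 := tot_pow_finrank hM
    rw [hf] at h0
    obtain ⟨c, hc⟩ := exists_coord hl h0 ((sub_tot_pow_ne_zero hW _ w').2 hw0)
    refine ⟨fun s => c.U s y', ?_⟩
    conv_lhs => rw [← Coord.IsDual.lift_eq_self hc ((Coord.IsDual.inj_iff hc).2 hf) y', c.lift_apply,
      map_sum]
    refine Finset.sum_congr rfl fun s _ => ?_
    rw [map_smul, totMap_tot_pow (subIncl_hom hW), totMap_single]
  · rintro ⟨c, rfl⟩ k
    rw [Finset.sum_apply]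
    exact Submodule.sum_mem _ fun r _ => Submodule.smul_mem _ _ (tot_pow_single_mem hW hw r k)

theorem IsExt.exists_gen (hM : M.IsNilp) (h : M.IsExt W i l j m) (hl : 0 < l) (hm : 0 < m) :
    ∃ w ∈ W i, (M.tot ^ (l - 1)) (Pi.single i w) ≠ 0 := ((isExt_iff hM hl hm).1 h).2.2.2.1

theorem IsExt.tot_pow_eq_zero (hM : M.IsNilp) (h : M.IsExt W i l j m) (hl : 0 < l) {y : ∀ k, M.V k}
    (hy : ∀ k, y k ∈ W k) : (M.tot ^ l) y = 0 := by
  obtain ⟨hW, h1, -⟩ := h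
  obtain ⟨y', rfl⟩ := exists_totMap_subIncl hW hy
  have h3 := tot_pow_finrank (hM.sub hW)
  rw [((isIso_P_iff (hM.sub hW) hl).1 h1).1] at h3
  rw [← totMap_tot_pow (subIncl_hom hW), h3]
  exact map_zero _

theorem single_mem {w : M.V i} (hw : w ∈ W i) (k : ZMod N) :
    (Pi.single i w : ∀ k, M.V k) k ∈ W k := by
  by_cases hk : k = i
  · subst hk
    rwa [Pi.single_eq_same]
  · rw [Pi.single_eq_of_ne hk]
    exact Submodule.zero_mem _

/-- A stable subspace generated by `w` is an extension if some vector of degree `j` has order `m`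
modulo it. -/
theorem IsExt.of_generator (hM : M.IsNilp) (hl : 0 < l) (hm : 0 < m)
    (hdim : Module.finrank ℂ (∀ k, M.V k) = l + m) (hW : M.IsStable W)
    (hWl : ∑ k, Module.finrank ℂ (W k) = l) {w : M.V i} (hw : w ∈ W i)
    (hw0 : (M.tot ^ (l - 1)) (Pi.single i w) ≠ 0) (z : M.V j)
    (hz : ∀ c : ℕ → ℂ, (M.tot ^ (m - 1)) (Pi.single j z) ≠
      ∑ r ∈ Finset.range l, c r • (M.tot ^ r) (Pi.single i w)) : M.IsExt W i l j m := by
  rw [isExt_iff hM hl hm]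
  refine ⟨hW, hWl, by rw [← finrank_tot, hdim], ⟨w, hw, hw0⟩, z, ?_⟩
  by_contra hcon
  push Not at hcon
  have h1 : (M.sub W hW).IsIso (P i l) := by
    rw [isIso_P_iff (hM.sub hW) hl]
    refine ⟨by rw [finrank_tot, ← hWl]; rfl, ⟨w, hw⟩, (sub_tot_pow_ne_zero hW _ _).2 hw0⟩
  obtain ⟨c, hc⟩ := (mem_iff_of_isIso_P h1 hl hw hw0 _).1 hcon
  exact hz c hc

theorem IsExt.sum_finrank (h : M.IsExt W i l j m) : ∑ k, Module.finrank ℂ (W k) = l := by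
  obtain ⟨hW, h1, -⟩ := h
  rw [← finrank_tot_P i l, finrank_tot, ← h1.dim_eq]
  rfl

/-- If forms on M restrict to coordinates on W whose leading one is nonzero on some vector of W, a
generator of W can be chosen dual to them. This normalisation makes the parameter of W unique. -/
theorem exists_normal {hW : M.IsStable W} (h : (M.sub W hW).IsIso (P i l)) (hl : 0 < l)
    (c : Coord (M.sub W hW) i l) (f : ℕ → (∀ k, M.V k) →ₗ[ℂ] ℂ)
    (hcf : ∀ s, s < l → ∀ y, c.U s y = f s (totMap (subIncl hW) y)) {w : M.V i} (hw : w ∈ W i)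
    (hf : f 0 (Pi.single i w) ≠ 0) : ∃ w' ∈ W i, ∀ r s, r < l → s < l →
      f s ((M.tot ^ r) (Pi.single i w')) = if r = s then 1 else 0 := by
  obtain ⟨w, rfl⟩ : ∃ w' : (M.sub W hW).V i, subIncl hW i w' = w := ⟨⟨w, hw⟩, rfl⟩
  obtain ⟨-, w', hw'⟩ := Coord.exists_isDual h hl c (w := w) (by rwa [hcf 0 hl, totMap_single])
  refine ⟨subIncl hW i w', w'.2, fun r s hr hs => ?_⟩
  rw [← hw' r s hr hs, hcf s hs, totMap_tot_pow (subIncl_hom hW), totMap_single]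

namespace CyclicPair

variable {a b : ZMod N} {p q : ℕ} (D : CyclicPair M a p b q)

include D

theorem pow_u : (M.tot ^ p) (Pi.single a D.u) = 0 :=
  D.inj _ (fun _ hs => D.U.pow_of_lt hs _) fun _ _ => D.V_u _ _

theorem pow_v : (M.tot ^ q) (Pi.single b D.v) = 0 := D.swap.pow_u

theorem finrank_eq : Module.finrank ℂ (∀ k, M.V k) = p + q := by
  have hf : Function.Bijective (D.U.toPi.prod D.V.toPi) := by
    constructor
    · rw [← LinearMap.ker_eq_bot, Submodule.eq_bot_iff]
      intro y hy
      exact D.inj y (fun s hs => congrFun (congrArg Prod.fst hy) ⟨s, hs⟩)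
        fun s hs => congrFun (congrArg Prod.snd hy) ⟨s, hs⟩
    · rintro ⟨g, g'⟩
      obtain ⟨x, rfl⟩ := D.U_u.toPi_surjective g
      obtain ⟨x', rfl⟩ := D.V_v.toPi_surjective g'
      refine ⟨D.U.lift (Pi.single a D.u) x + D.V.lift (Pi.single b D.v) x', Prod.ext ?_ ?_⟩
      · funext s
        change D.U.U s _ = D.U.U s x
        rw [map_add, D.U_u.U_lift s.2, D.V.lift_apply, map_sum, Finset.sum_eq_zero, add_zero]
        intro r _
        rw [map_smul, D.U_v, smul_zero]
      · funext s
        change D.V.U s _ = D.V.U s x'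
        rw [map_add, D.V_v.U_lift s.2, D.U.lift_apply, map_sum, Finset.sum_eq_zero, zero_add]
        intro r _
        rw [map_smul, D.V_u, smul_zero]
  rw [(LinearEquiv.ofBijective _ hf).finrank_eq, Module.finrank_prod]
  simp

theorem tot_pow (hqp : q ≤ p) : M.tot ^ p = 0 := LinearMap.ext fun _ =>
  D.inj _ (fun _ hs => D.U.pow_of_lt hs _) fun _ hs => D.V.pow_of_lt (hs.trans_le hqp) _

/-- A generator of the subobject is not in the radical of `M`. -/
theorem head (hp : 0 < p) (hq : 0 < q) (h : M.IsExt W i l j m) (hl : 0 < l) (hm : 0 < m)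
    {w : M.V i} (hw : w ∈ W i) (hw0 : (M.tot ^ (l - 1)) (Pi.single i w) ≠ 0) :
    D.U.U 0 (Pi.single i w) ≠ 0 ∨ D.V.U 0 (Pi.single i w) ≠ 0 := by
  by_contra hcon
  push Not at hcon
  obtain ⟨z, c, hc, hcW⟩ := h.exists_quot_coord hm
  obtain ⟨hW, h1, -⟩ := h
  -- A form that kills tM and the generator of W factors through the one-dimensional top of the
  -- quotient, so it is a multiple of the leading coordinate of the quotient. The leading forms of
  -- the two summands are independent and cannot both be such multiples.
  have key : ∀ f : (∀ k, M.V k) →ₗ[ℂ] ℂ, (∀ y, f (M.tot y) = 0) → f (Pi.single i w) = 0 →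
      ∀ y, f y = c.U 0 y * f (Pi.single j z) := by
    intro f hf hfw y
    have hpow : ∀ r y, r ≠ 0 → f ((M.tot ^ r) y) = 0 := by
      intro r y hr
      obtain ⟨r, rfl⟩ := Nat.exists_eq_succ_of_ne_zero hr
      rw [pow_succ', Module.End.mul_apply, hf]
    have h2 : f (y - c.lift (Pi.single j z) y) = 0 := by
      obtain ⟨g, hg⟩ := (mem_iff_of_isIso_P h1 hl hw hw0 _).1
        ((hcW (y - c.lift (Pi.single j z) y)).2 fun s hs => by
          rw [map_sub, hc.U_lift hs, sub_self])
      rw [hg, map_sum]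
      refine Finset.sum_eq_zero fun r _ => ?_
      rcases eq_or_ne r 0 with rfl | hr
      · rw [map_smul, pow_zero, Module.End.one_apply, hfw, smul_zero]
      · rw [map_smul, hpow _ _ hr, smul_zero]
    rw [map_sub, sub_eq_zero] at h2
    rw [h2, c.lift_apply, map_sum, Finset.sum_eq_single 0]
    · rw [map_smul, pow_zero, Module.End.one_apply, smul_eq_mul]
    · intro s _ hs
      rw [map_smul, hpow _ _ hs, smul_zero]
    · intro hn
      exact absurd (Finset.mem_range.2 hm) hn
  have kU := key (D.U.U 0) D.U.zero hcon.1
  have kV := key (D.V.U 0) D.V.zero hcon.2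
  have e1 := (kU _).symm.trans (D.U_u 0 0 hp hp)
  have e2 := (kV _).symm.trans (D.V_u 0 0)
  have e3 := (kV _).symm.trans (D.V_v 0 0 hq hq)
  rw [if_pos rfl] at e1 e3
  rcases mul_eq_zero.1 e2 with h0 | h0
  · rw [h0, zero_mul] at e1
    exact zero_ne_one e1
  · rw [h0, mul_zero] at e3
    exact zero_ne_one e3

/-- The first type of extension. -/
theorem normal_left (hM : M.IsNilp) (hqp : q ≤ p) (hp : 0 < p) (h : M.IsExt W i l j m)
    (hl : 0 < l) {w : M.V i} (hw : w ∈ W i)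
    (hw0 : (M.tot ^ (l - 1)) (Pi.single i w) ≠ 0) (hU : D.U.U 0 (Pi.single i w) ≠ 0) :
    i = a ∧ l = p ∧ ∃ w' ∈ W i, D.U.IsDual (Pi.single i w') := by
  have hia : i = a := by
    by_contra hne
    exact hU (D.U.hom 0 i w (by simpa using hne))
  subst hia
  have hlp : l = p := by
    apply le_antisymm
    · by_contra hlt
      refine hw0 ?_
      rw [show l - 1 = (l - 1 - p) + p by omega, pow_add, D.tot_pow hqp, mul_zero]
      rfl
    · by_contra hlt
      have h1 := D.U.pow_of_le (r := p - 1) (s := p - 1) le_rfl (by omega) (Pi.single i w)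
      rw [show p - 1 = (p - 1 - l) + l by omega, pow_add, Module.End.mul_apply,
        h.tot_pow_eq_zero hM hl (single_mem hw), map_zero, map_zero, Nat.sub_self] at h1
      exact hU h1.symm
  subst hlp
  obtain ⟨hW, h1, -⟩ := h
  exact ⟨rfl, rfl, exists_normal h1 hl (D.U.comap (subIncl hW) (subIncl_hom hW)) D.U.U
    (fun _ _ _ => rfl) hw hU⟩

/-- The second and third type of extension. -/
theorem normal_right (hM : M.IsNilp) (hqp : q ≤ p) (hp : 0 < p) (hq : 0 < q)
    (h : M.IsExt W i l j m) (hl : 0 < l) (hm : 0 < m) {w : M.V i} (hw : w ∈ W i)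
    (hw0 : (M.tot ^ (l - 1)) (Pi.single i w) ≠ 0) (hU : D.U.U 0 (Pi.single i w) = 0) :
    i = b ∧
      ((l = q ∧ ∃ w' ∈ W i, D.V.IsDual (Pi.single i w') ∧
        ∀ s, s + q < p → D.U.U s (Pi.single i w') = 0) ∨
      ∃ k, 0 < k ∧ k + q < p ∧ l + k = p ∧ i = a + (k : ZMod N) ∧ ∃ w' ∈ W i,
        (∀ r s, r < l → s < l → D.U.U (k + s) ((M.tot ^ r) (Pi.single i w')) =
          if r = s then 1 else 0) ∧
        (∀ s, s < k → D.U.U s (Pi.single i w') = 0) ∧ D.V.U 0 (Pi.single i w') ≠ 0) := by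
  have hV : D.V.U 0 (Pi.single i w) ≠ 0 :=
    (D.head hp hq h hl hm hw hw0).resolve_left (not_not.2 hU)
  have hib : i = b := by
    by_contra hne
    exact hV (D.V.hom 0 i w (by simpa using hne))
  subst hib
  refine ⟨rfl, ?_⟩
  -- V_0(w) ≠ 0 says that t^(q-1) w has a nonzero last V-coordinate, whereas t^l w = 0.
  have hql : q ≤ l := by
    by_contra hlt
    have h1 := D.V.pow_of_le (r := q - 1) (s := q - 1) le_rfl (by omega) (Pi.single i w)
    rw [show q - 1 = (q - 1 - l) + l by omega, pow_add, Module.End.mul_apply,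
      h.tot_pow_eq_zero hM hl (single_mem hw), map_zero, map_zero, Nat.sub_self] at h1
    exact hV h1.symm
  have hUW : ∀ (y : ∀ k, M.V k), (∀ k, y k ∈ W k) → ∀ s, s + l < p → D.U.U s y = 0 := by
    intro y hy s hs
    rw [← D.U.pow (r := l) (s := s) (by omega), h.tot_pow_eq_zero hM hl hy, map_zero]
  rcases hql.eq_or_lt with rfl | hlt
  · left
    have h' := h
    obtain ⟨hW, h1, -⟩ := h'
    obtain ⟨w', hw', hd⟩ := exists_normal h1 hl (D.V.comap (subIncl hW) (subIncl_hom hW)) D.V.U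
      (fun _ _ _ => rfl) hw hV
    exact ⟨rfl, w', hw', hd, hUW _ (single_mem hw')⟩
  · right
    have hlp : l ≤ p := by
      by_contra hlt
      refine hw0 ?_
      rw [show l - 1 = (l - 1 - p) + p by omega, pow_add, D.tot_pow hqp, mul_zero]
      rfl
    obtain ⟨k, rfl⟩ := Nat.exists_eq_add_of_le hlp
    -- On W the coordinates U_s with s < k vanish because t^l W = 0. As l > q, the V-coordinates of
    -- t^(l-1) w vanish too; so U_k(w) = 0 would give t^(l-1) w = 0.
    have hUk : D.U.U k (Pi.single i w) ≠ 0 := by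
      intro h0
      refine hw0 (D.inj _ (fun s hs => ?_) fun s hs => D.V.pow_of_lt (by omega) _)
      rcases lt_or_ge s (l - 1) with h1 | h1
      · exact D.U.pow_of_lt h1 _
      · rw [D.U.pow_of_le h1 hs]
        rcases (show s - (l - 1) < k ∨ s - (l - 1) = k by omega) with h2 | h2
        · exact hUW _ (single_mem hw) _ (by omega)
        · rw [h2, h0]
    have hk0 : 0 < k := by
      rcases Nat.eq_zero_or_pos k with rfl | hk
      · exact absurd hU hUk
      · exact hk
    have hik : i = a + (k : ZMod N) := by
      by_contra hne
      exact hUk (D.U.hom k i w hne)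
    have h' := h
    obtain ⟨hW, h1, -⟩ := h'
    -- The coordinates U_k, U_(k+1), … restrict to coordinates on W. The leading one kills tW
    -- because U_k(ty) = U_(k-1)(y) = 0 for y in W.
    let c : Coord (M.sub W hW) i l :=
      { U := fun s => D.U.U (k + s) ∘ₗ totMap (subIncl hW)
        zero_of_le := fun s y hs => D.U.zero_of_le _ _ (by omega)
        zero := fun y => by
          rw [LinearMap.comp_apply, totMap_tot (subIncl_hom hW)]
          have e := D.U.succ (k - 1) (totMap (subIncl hW) y) (by omega)
          rw [Nat.sub_add_cancel hk0] at e
          exact e.trans (hUW _ (totMap_subIncl_mem hW y) _ (by omega))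
        succ := fun s y hs => by
          rw [LinearMap.comp_apply, totMap_tot (subIncl_hom hW), ← add_assoc,
            D.U.succ _ _ (by omega)]
          rfl
        hom := fun s κ v hκ => by
          rw [LinearMap.comp_apply, totMap_single]
          refine D.U.hom _ _ _ ?_
          rw [Nat.cast_add, ← add_assoc, ← hik]
          exact hκ }
    obtain ⟨w', hw', hd⟩ := exists_normal h1 hl c (fun s => D.U.U (k + s)) (fun _ _ _ => rfl) hw hUk
    refine ⟨k, hk0, by omega, rfl, hik, w', hw', hd, fun s hs => hUW _ (single_mem hw') _ (by omega),
      ?_⟩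
    refine (D.head hp hq h hl hm hw' fun h0 => ?_).resolve_left (not_not.2 ?_)
    · have h2 := hd (l - 1) (l - 1) (by omega) (by omega)
      rw [h0, map_zero, if_pos rfl] at h2
      exact zero_ne_one h2
    · exact hUW _ (single_mem hw') _ (by omega)

/-- The other generator has full order modulo a subobject of the first type. -/
theorem ne_sum_left (hq : 0 < q) {w : M.V i} (hw : D.U.IsDual (Pi.single i w)) (c : ℕ → ℂ) :
    (M.tot ^ (q - 1)) (Pi.single b D.v) ≠
      ∑ r ∈ Finset.range p, c r • (M.tot ^ r) (Pi.single i w) := by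
  intro h
  have h1 : ∀ s, s < p → c s = 0 := by
    intro s hs
    have h2 := congrArg (D.U.U s) h
    rw [D.U_v, map_sum, Finset.sum_eq_single s] at h2
    · rwa [map_smul, hw s s hs hs, if_pos rfl, smul_eq_mul, mul_one, eq_comm] at h2
    · intro r hr hrs
      rw [map_smul, hw r s (Finset.mem_range.1 hr) hs, if_neg hrs, smul_zero]
    · intro hn
      exact absurd (Finset.mem_range.2 hs) hn
  rw [Finset.sum_eq_zero fun r hr => by rw [h1 r (Finset.mem_range.1 hr), zero_smul]] at h
  have h2 := D.V_v (q - 1) (q - 1) (by omega) (by omega)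
  rw [h, map_zero, if_pos rfl] at h2
  exact zero_ne_one h2

/-- The first generator has large order modulo a subobject of the third type. -/
theorem ne_sum_shift (hq : 0 < q) {k : ℕ} (hk : k + q < l + k) (hlp : l + k = p) {w : M.V i}
    (hw : ∀ r s, r < l → s < l → D.U.U (k + s) ((M.tot ^ r) (Pi.single i w)) =
      if r = s then 1 else 0) (hV : D.V.U 0 (Pi.single i w) ≠ 0) (c : ℕ → ℂ) :
    (M.tot ^ (q + k - 1)) (Pi.single a D.u) ≠
      ∑ r ∈ Finset.range l, c r • (M.tot ^ r) (Pi.single i w) := by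
  intro h
  have h1 : ∀ s, s < l → c s = if s = q - 1 then 1 else 0 := by
    intro s hs
    have h2 := congrArg (D.U.U (k + s)) h
    rw [D.U_u _ _ (by omega) (by omega), map_sum, Finset.sum_eq_single s] at h2
    · rw [map_smul, hw s s hs hs, if_pos rfl, smul_eq_mul, mul_one] at h2
      rw [← h2]
      congr 1
      apply propext
      omega
    · intro r hr hrs
      rw [map_smul, hw r s (Finset.mem_range.1 hr) hs, if_neg hrs, smul_zero]
    · intro hn
      exact absurd (Finset.mem_range.2 hs) hn
  have h2 := congrArg (D.V.U (q - 1)) h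
  rw [D.V_u, map_sum, Finset.sum_eq_single (q - 1)] at h2
  · rw [map_smul, h1 _ (by omega), if_pos rfl, one_smul, D.V.pow_of_le le_rfl (by omega),
      Nat.sub_self] at h2
    exact hV h2.symm
  · intro r hr hrs
    rw [h1 r (Finset.mem_range.1 hr), if_neg hrs, zero_smul, map_zero]
  · intro hn
    exact absurd (Finset.mem_range.2 (by omega)) hn

/-- Classification of the extensions in a sum of two cyclic subobjects. -/
theorem classify (hM : M.IsNilp) (hqp : q ≤ p) (hq : 0 < q)
    (h : M.IsExt W i l j m) (hl : 0 < l) (hm : 0 < m) :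
    (i = a ∧ l = p ∧ j = b ∧ m = q) ∨ (i = b ∧ l = q ∧ j = a ∧ m = p) ∨
      ∃ k, 0 < k ∧ k + q < p ∧ l + k = p ∧ b = a + (k : ZMod N) ∧ i = b ∧ j = a ∧ m = q + k := by
  have hp : 0 < p := by omega
  have hdim := h.pos_left_right
  rw [D.finrank_eq] at hdim
  have hW := h.1
  have hWl := h.sum_finrank
  -- W determines its quotient, so it is enough to exhibit W as an extension with the expected
  -- quotient data.
  have huniq : ∀ {j' : ZMod N} {m' : ℕ}, M.IsExt W i l j' m' → j = j' ∧ m = m' := by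
    rintro j' m' ⟨_, _, h3⟩
    exact eq_of_isIso_P hm h.2.2 h3
  obtain ⟨w, hw, hw0⟩ := h.exists_gen hM hl hm
  by_cases hU : D.U.U 0 (Pi.single i w) = 0
  · obtain ⟨hib, ⟨hlq, w', hw', hd, -⟩ | ⟨k, hk, hkq, hlk, hik, w', hw', hd, -, hV⟩⟩ :=
      D.normal_right hM hqp hp hq h hl hm hw hw0 hU
    · right; left
      refine ⟨hib, hlq, huniq ?_⟩
      subst hlq
      refine IsExt.of_generator hM hl hp (by rw [D.finrank_eq, add_comm]) hW hWl hw' (fun h0 => ?_)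
        D.u (D.swap.ne_sum_left hp hd)
      have h2 := hd (l - 1) (l - 1) (by omega) (by omega)
      rw [h0, map_zero, if_pos rfl] at h2
      exact zero_ne_one h2
    · right; right
      have := huniq (j' := a) (m' := q + k) (IsExt.of_generator hM hl (by omega)
        (by rw [D.finrank_eq]; omega) hW hWl hw' (fun h0 => by
          have h2 := hd (l - 1) (l - 1) (by omega) (by omega)
          rw [h0, map_zero, if_pos rfl] at h2
          exact zero_ne_one h2) D.u (D.ne_sum_shift hq (by omega) hlk hd hV))
      exact ⟨k, hk, hkq, hlk, hib ▸ hik, hib, this⟩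
  · left
    obtain ⟨hia, hlp, w', hw', hd⟩ := D.normal_left hM hqp hp h hl hw hw0 hU
    refine ⟨hia, hlp, huniq ?_⟩
    subst hlp
    refine IsExt.of_generator hM hl hq D.finrank_eq hW hWl hw' (fun h0 => ?_) D.v
      (D.ne_sum_left hq hd)
    have h2 := hd (l - 1) (l - 1) (by omega) (by omega)
    rw [h0, map_zero, if_pos rfl] at h2
    exact zero_ne_one h2

end CyclicPair

end QRep

end

/-! ### Sets of extensions parametrised by normalised generators -/

noncomputable section

set_option linter.unusedSectionVars false

open QRep CyclicQuiver AlexanderSpanier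

variable {N : ℕ} [NeZero N] {γ α : ZMod N → ℕ}

/-- The subobjects of dimension vector `α` that are isomorphic to `P i l` and have quotient
isomorphic to `P j m`. -/
def extSet (x : RepSpace (ZMod N) γ) (α : ZMod N → ℕ) (i : ZMod N) (l : ℕ) (j : ZMod N) (m : ℕ) :
    Set (∀ k, Gr (α k) (Fin (γ k) → ℂ)) :=
  {W | (stdRep x).IsExt (fun k => (W k).1) i l j m}

theorem extSet_dim {x : RepSpace (ZMod N) γ} {i j : ZMod N} {l m : ℕ}
    {W : ∀ k, Gr (α k) (Fin (γ k) → ℂ)} (h : W ∈ extSet x α i l j m) : α = arc i l := by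
  obtain ⟨hW, h1, -⟩ := h
  rw [← P_dim, ← h1.dim_eq]
  funext k
  exact (W k).2.symm

/-- An enumeration of the `m < l` with `i + m = k`. -/
def arcEquiv (i : ZMod N) (l : ℕ) (k : ZMod N) :
    Fin (arc i l k) ≃ {m : Fin l // i + ((m : ℕ) : ZMod N) = k} :=
  (Fintype.equivFinOfCardEq (by
    rw [← P_dim i l]
    exact (Module.finrank_fintype_fun_eq_card ℂ).symm)).symm

section Family

variable {x : RepSpace (ZMod N) γ} {i j : ZMod N} {l m : ℕ} {S : Type} [Finite S]
  {w : (S → ℂ) → Fin (γ i) → ℂ} {C : ℕ → (∀ k, Fin (γ k) → ℂ) →ₗ[ℂ] ℂ}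

/-- The iterates of `w`, in degree `k`. -/
def iterFrame (x : RepSpace (ZMod N) γ) (i : ZMod N) (l : ℕ) (w : Fin (γ i) → ℂ) (k : ZMod N)
    (r : Fin (arc i l k)) : Fin (γ k) → ℂ :=
  ((stdRep x).tot ^ ((arcEquiv i l k r).1 : ℕ)) (Pi.single (M := (stdRep x).V) i w) k

theorem single_iterFrame (w : Fin (γ i) → ℂ) (k : ZMod N) (r : Fin (arc i l k)) :
    (Pi.single k (iterFrame x i l w k r) : ∀ k, (stdRep x).V k) =
      ((stdRep x).tot ^ ((arcEquiv i l k r).1 : ℕ)) (Pi.single (M := (stdRep x).V) i w) := by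
  obtain ⟨w', hw'⟩ := tot_pow_single (stdRep x) i ((arcEquiv i l k r).1 : ℕ) w
  have h : ∀ κ, i + (((arcEquiv i l k r).1 : ℕ) : ZMod N) = κ →
      Pi.single κ (((stdRep x).tot ^ ((arcEquiv i l k r).1 : ℕ))
        (Pi.single (M := (stdRep x).V) i w) κ) =
      ((stdRep x).tot ^ ((arcEquiv i l k r).1 : ℕ)) (Pi.single (M := (stdRep x).V) i w) := by
    rintro _ rfl
    rw [hw', Pi.single_eq_same]
  exact h k (arcEquiv i l k r).2

/-- The dual forms separate the iterates of w degree by degree. This gives independent frames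
depending continuously on w, and a chart containing all the spanned subspaces. -/
theorem C_iterFrame {w : Fin (γ i) → ℂ} (hC : ∀ r s, r < l → s < l → C s
      (((stdRep x).tot ^ r) (Pi.single (M := (stdRep x).V) i w)) = if r = s then 1 else 0)
    (k : ZMod N) (r s : Fin (arc i l k)) :
    C ((arcEquiv i l k s).1 : ℕ) (Pi.single k (iterFrame x i l w k r)) = if r = s then 1 else 0 := by
  refine (congrArg (C ((arcEquiv i l k s).1 : ℕ)) (single_iterFrame w k r)).trans ?_
  rw [hC _ _ (Fin.is_lt _) (Fin.is_lt _)]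
  congr 1
  rw [← Fin.ext_iff, ← Subtype.ext_iff, (arcEquiv i l k).injective.eq_iff]

theorem iterFrame_linearIndependent {w : Fin (γ i) → ℂ}
    (hC : ∀ r s, r < l → s < l → C s
      (((stdRep x).tot ^ r) (Pi.single (M := (stdRep x).V) i w)) = if r = s then 1 else 0)
    (k : ZMod N) : LinearIndependent ℂ (iterFrame x i l w k) := by
  rw [Fintype.linearIndependent_iff]
  intro g hg s
  have h1 := congrArg (fun y => C ((arcEquiv i l k s).1 : ℕ)
    (LinearMap.single ℂ (fun k => Fin (γ k) → ℂ) k y)) hg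
  simp only [map_sum, map_smul, map_zero] at h1
  rw [Finset.sum_eq_single s] at h1
  · have h2 := C_iterFrame hC k s s
    rw [if_pos rfl] at h2
    have h3 : C ((arcEquiv i l k s).1 : ℕ)
      (LinearMap.single ℂ (fun k => Fin (γ k) → ℂ) k (iterFrame x i l w k s)) = 1 := h2
    rwa [h3, smul_eq_mul, mul_one] at h1
  · intro r _ hr
    have h2 := C_iterFrame hC k r s
    rw [if_neg hr] at h2
    have h3 : C ((arcEquiv i l k s).1 : ℕ)
      (LinearMap.single ℂ (fun k => Fin (γ k) → ℂ) k (iterFrame x i l w k r)) = 0 := h2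
    rw [h3, smul_zero]
  · simp

/-- The graded subspace spanned by the iterates of `w`. -/
def iterGr {w : Fin (γ i) → ℂ}
    (hC : ∀ r s, r < l → s < l → C s
      (((stdRep x).tot ^ r) (Pi.single (M := (stdRep x).V) i w)) = if r = s then 1 else 0)
    (k : ZMod N) : Gr (arc i l k) (Fin (γ k) → ℂ) :=
  Gr.ofFrame _ _ ⟨iterFrame x i l w k, iterFrame_linearIndependent hC k⟩

section

variable {w : Fin (γ i) → ℂ} (hC : ∀ r s, r < l → s < l → C s
      (((stdRep x).tot ^ r) (Pi.single (M := (stdRep x).V) i w)) = if r = s then 1 else 0)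

theorem iter_mem_iterGr {r : ℕ} (hr : r < l) (k : ZMod N) :
    ((stdRep x).tot ^ r) (Pi.single (M := (stdRep x).V) i w) k ∈ (iterGr hC k).1 := by
  by_cases hk : i + (r : ZMod N) = k
  · refine Submodule.subset_span ⟨(arcEquiv i l k).symm ⟨⟨r, hr⟩, hk⟩, ?_⟩
    change iterFrame x i l w k _ = _
    rw [iterFrame, Equiv.apply_symm_apply]
  · obtain ⟨w', hw'⟩ := tot_pow_single (stdRep x) i r w
    rw [hw', Pi.single_eq_of_ne (Ne.symm hk)]
    exact Submodule.zero_mem _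

theorem mem_iterGr (hl : 0 < l) : w ∈ (iterGr hC i).1 := by
  have h := iter_mem_iterGr hC hl i
  have e : ((stdRep x).tot ^ 0) (Pi.single (M := (stdRep x).V) i w) i = w :=
    Pi.single_eq_same (M := (stdRep x).V) i w
  rw [e] at h
  exact h

theorem iterGr_isStable
    (h0 : ((stdRep x).tot ^ l) (Pi.single (M := (stdRep x).V) i w) = 0) :
    (stdRep x).IsStable fun k => (iterGr hC k).1 := by
  intro a b e
  refine Submodule.span_le.2 ?_
  rintro _ ⟨r, rfl⟩
  change (stdRep x).map e (iterFrame x i l w a r) ∈ (iterGr hC b).1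
  have h1 := tot_single (stdRep x) e (iterFrame x i l w a r)
  have h2 : (stdRep x).tot (Pi.single (M := (stdRep x).V) a (iterFrame x i l w a r)) =
      ((stdRep x).tot ^ (((arcEquiv i l a r).1 : ℕ) + 1))
        (Pi.single (M := (stdRep x).V) i w) := by
    rw [pow_succ', Module.End.mul_apply, ← single_iterFrame]
  have h3 := congrFun (h1.symm.trans h2) b
  rw [Pi.single_eq_same] at h3
  rw [h3]
  rcases lt_or_ge (((arcEquiv i l a r).1 : ℕ) + 1) l with h | h
  · exact iter_mem_iterGr hC h b
  · rw [show ((arcEquiv i l a r).1 : ℕ) + 1 = l by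
      have := (arcEquiv i l a r).1.2
      omega, h0]
    exact Submodule.zero_mem _

/-- A stable W of the right dimension containing w contains all its iterates, and these already fill
the dimension. -/
theorem eq_iterGr {W : ∀ k, Gr (arc i l k) (Fin (γ k) → ℂ)}
    (hW : (stdRep x).IsStable fun k => (W k).1) (hw : w ∈ (W i).1) : W = fun k => iterGr hC k := by
  funext k
  apply Subtype.ext
  symm
  refine Submodule.eq_of_le_of_finrank_eq ?_ ((iterGr hC k).2.trans (W k).2.symm)
  refine Submodule.span_le.2 ?_
  rintro _ ⟨r, rfl⟩
  exact tot_pow_single_mem (M := stdRep x) hW hw _ k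

end

/-- Euler characteristic of a set of extensions that is parametrized by normalized generators. -/
theorem hasChi_extSet_of_family (hx : (stdRep x).IsNilp) (hl : 0 < l) (hm : 0 < m)
    (hdim : Module.finrank ℂ (∀ k, (stdRep x).V k) = l + m) (hw : Continuous w)
    (hC : ∀ z r s, r < l → s < l → C s
      (((stdRep x).tot ^ r) (Pi.single (M := (stdRep x).V) i (w z))) = if r = s then 1 else 0)
    (h0 : ∀ z, ((stdRep x).tot ^ l) (Pi.single (M := (stdRep x).V) i (w z)) = 0)
    (D : S → (Fin (γ i) → ℂ) →ₗ[ℂ] ℂ) (hD : ∀ z s, D s (w z) = z s) (O : Set (S → ℂ))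
    (v : Fin (γ j) → ℂ)
    (hv : ∀ z ∈ O, ∀ c : ℕ → ℂ, ((stdRep x).tot ^ (m - 1)) (Pi.single (M := (stdRep x).V) j v) ≠
      ∑ r ∈ Finset.range l, c r • ((stdRep x).tot ^ r) (Pi.single (M := (stdRep x).V) i (w z)))
    (hO : ∀ W : ∀ k, Submodule ℂ ((stdRep x).V k), (stdRep x).IsExt W i l j m →
      ∃ z ∈ O, w z ∈ W i) {n : ℤ} (hn : HasChi O n) :
    HasChi (extSet x (arc i l) i l j m) n := by
  let Φ : (S → ℂ) → ∀ k, Gr (arc i l k) (Fin (γ k) → ℂ) := fun z k => iterGr (hC z) k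
  have hΦ : Continuous Φ := by
    refine continuous_pi fun k => ?_
    refine Gr.continuous_ofFrame (b := fun z => iterFrame x i l (w z) k) ?_ _
    refine continuous_pi fun r => ?_
    let L : (Fin (γ i) → ℂ) →ₗ[ℂ] (Fin (γ k) → ℂ) :=
      LinearMap.proj (R := ℂ) (φ := (stdRep x).V) k ∘ₗ
        ((stdRep x).tot ^ ((arcEquiv i l k r).1 : ℕ)) ∘ₗ LinearMap.single ℂ (stdRep x).V i
    exact (LinearMap.continuous_of_finiteDimensional L).comp hw
  have hmem : ∀ z ∈ O, Φ z ∈ extSet x (arc i l) i l j m := by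
    intro z hz
    refine IsExt.of_generator (M := stdRep x) hx hl hm hdim (iterGr_isStable (hC z) (h0 z)) ?_
      (w := w z) ?_ ?_ v (hv z hz)
    · exact (Finset.sum_congr rfl fun k _ => (iterGr (hC z) k).2).trans (sum_arc i l)
    · exact mem_iterGr (hC z) hl
    · intro h
      have h1 := hC z (l - 1) (l - 1) (by omega) (by omega)
      rw [h] at h1
      exact zero_ne_one (((C (l - 1)).map_zero.symm.trans h1).trans (if_pos rfl))
  have hsurj : ∀ W ∈ extSet x (arc i l) i l j m, ∃ z ∈ O, Φ z = W := by
    intro W hW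
    obtain ⟨z, hz, hzW⟩ := hO _ hW
    exact ⟨z, hz, (eq_iterGr (hC z) hW.1 hzW).symm⟩
  -- the inverse
  let π : (Fin (γ i) → ℂ) →ₗ[ℂ] (Fin (arc i l i) → ℂ) := LinearMap.pi fun r =>
    C ((arcEquiv i l i r).1 : ℕ) ∘ₗ LinearMap.single ℂ (fun k => Fin (γ k) → ℂ) i
  have hπ : ∀ z, Φ z i ∈ Gr.chart π := by
    intro z y hy hy0
    obtain ⟨g, rfl⟩ := (Submodule.mem_span_range_iff_exists_fun ℂ).1 hy
    have : g = 0 := by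
      rw [← hy0, map_sum]
      funext s
      rw [Finset.sum_apply, Finset.sum_eq_single s]
      · rw [map_smul, Pi.smul_apply]
        have h2 := C_iterFrame (hC z) i s s
        rw [if_pos rfl] at h2
        exact (mul_one (g s)).symm.trans (congrArg (g s * ·) h2.symm)
      · intro r _ hr
        have h2 := C_iterFrame (hC z) i r s
        rw [if_neg hr] at h2
        rw [map_smul, Pi.smul_apply]
        exact (congrArg (g r * ·) h2).trans (mul_zero (g r))
      · simp
    simp [this]
  -- σ picks the vector of W_i with coordinates (1, 0, …, 0), which is the normalised generator.
  -- Applying D to it recovers the parameter continuously.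
  obtain ⟨σ, hσ⟩ := Gr.exists_section π fun r => if ((arcEquiv i l i r).1 : ℕ) = 0 then 1 else 0
  have hσw : ∀ z, σ (Φ z i) = w z := by
    intro z
    obtain ⟨-, h1, h2⟩ := hσ _ (hπ z)
    have h3 : w z ∈ (Φ z i).1 := mem_iterGr (hC z) hl
    rw [← sub_eq_zero]
    refine hπ z _ (Submodule.sub_mem _ h1 h3) ?_
    rw [map_sub, h2, sub_eq_zero]
    funext r
    have h4 := hC z 0 ((arcEquiv i l i r).1 : ℕ) hl (Fin.is_lt _)
    rw [pow_zero, Module.End.one_apply] at h4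
    exact ((if_congr eq_comm rfl rfl).trans h4.symm)
  let Ψ : (∀ k, Gr (arc i l k) (Fin (γ k) → ℂ)) → S → ℂ := fun W s => D s (σ (W i))
  have hΨ : ∀ z, Ψ (Φ z) = z := fun z => funext fun s => by
    change D s (σ (Φ z i)) = z s
    rw [hσw, hD]
  have hΨc : ∀ z, ContinuousAt Ψ (Φ z) := by
    intro z
    refine continuousAt_pi.2 fun s => ?_
    have h1 : ContinuousAt (fun W : ∀ k, Gr (arc i l k) (Fin (γ k) → ℂ) => σ (W i)) (Φ z) :=
      ContinuousAt.comp (f := fun W : ∀ k, Gr (arc i l k) (Fin (γ k) → ℂ) => W i)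
        (hσ _ (hπ z)).1 (continuous_apply i).continuousAt
    exact (LinearMap.continuous_of_finiteDimensional (D s)).continuousAt.comp h1
  refine hn.congr
    { toFun := fun z => ⟨Φ z.1, hmem z.1 z.2⟩
      invFun := fun W => ⟨Ψ W.1, by
        obtain ⟨z, hz, h⟩ := hsurj W.1 W.2
        rw [← h, hΨ]
        exact hz⟩
      left_inv := fun z => Subtype.ext (hΨ z.1)
      right_inv := fun W => Subtype.ext (by
        obtain ⟨z, hz, h⟩ := hsurj W.1 W.2
        change Φ (Ψ W.1) = W.1
        rw [← h, hΨ])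
      continuous_toFun := (hΦ.comp continuous_subtype_val).subtype_mk _
      continuous_invFun := by
        refine Continuous.subtype_mk (f := fun W : extSet x (arc i l) i l j m => Ψ W.1) ?_ _
        refine continuous_iff_continuousAt.2 fun W => ?_
        obtain ⟨z, hz, h⟩ := hsurj W.1 W.2
        refine ContinuousAt.comp (g := Ψ) ?_ continuous_subtype_val.continuousAt
        rw [← h]
        exact hΨc z }

end Family

end

/-! ### Euler characteristics of the sets of extensions -/

noncomputable section

set_option linter.unusedSectionVars false

open QRep CyclicQuiver AlexanderSpanier

namespace QRep

variable {N : ℕ} [NeZero N]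

theorem single_tot_pow_apply (M : QRep (ZMod N)) {b i : ZMod N} {r : ℕ} (h : b + (r : ZMod N) = i)
    (v : M.V b) : Pi.single i ((M.tot ^ r) (Pi.single b v) i) = (M.tot ^ r) (Pi.single b v) := by
  subst h
  obtain ⟨w', hw'⟩ := tot_pow_single M b r v
  rw [hw', Pi.single_eq_same]

section Uniserial

variable {M : QRep (ZMod N)} {W : ∀ k, Submodule ℂ (M.V k)} {i j k : ZMod N} {l m n : ℕ}

/-- In a uniserial M the quotient inherits the top of M, which gives j = k. Since t^l W = 0, the
coordinates of W below m vanish, so a generator of W lives at the vertex k + m. -/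
theorem IsExt.eq_of_isIso_P (h : M.IsExt W i l j m) (hl : 0 < l) (hm : 0 < m)
    (hP : M.IsIso (P k n)) : j = k ∧ i = k + (m : ZMod N) ∧ l + m = n := by
  have hn : l + m = n := by
    rw [← h.pos_left_right, finrank_tot, hP.dim_eq, ← finrank_tot, finrank_tot_P]
  have hM : M.IsNilp := hP.symm.isNilp (P_isNilp k n)
  obtain ⟨u, c, hc, hi⟩ := exists_gen_of_isIso_P hP (by omega)
  refine ⟨?_, ?_, hn⟩
  · obtain ⟨z, d, hd, -⟩ := h.exists_quot_coord hm
    by_contra hne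
    have h1 := hd 0 0 hm hm
    rw [pow_zero, Module.End.one_apply, ← hc.lift_eq_self hi (Pi.single j z), c.lift_apply, map_sum,
      if_pos rfl, Finset.sum_eq_zero] at h1
    · exact zero_ne_one h1
    · intro r _
      rw [map_smul]
      rcases Nat.eq_zero_or_pos r with rfl | hr
      · rw [pow_zero, Module.End.one_apply, d.hom 0 k u (by simpa using Ne.symm hne), smul_zero]
      · rw [d.pow_of_lt hr, smul_zero]
  · obtain ⟨w, hw, hw0⟩ := h.exists_gen hM hl hm
    by_contra hne
    refine hw0 (hi _ fun s hs => ?_)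
    rcases lt_or_ge s (l - 1) with h1 | h1
    · exact c.pow_of_lt h1 _
    · rw [c.pow_of_le h1 hs]
      rcases (show s - (l - 1) < m ∨ s - (l - 1) = m by omega) with h2 | h2
      · rw [← c.pow (r := l) (s := s - (l - 1)) (by omega),
          h.tot_pow_eq_zero hM hl (single_mem hw), map_zero]
      · rw [h2]
        exact c.hom _ _ _ hne

end Uniserial

namespace CyclicPair

variable {M : QRep (ZMod N)} {a b : ZMod N} {p q : ℕ} (D : CyclicPair M a p b q)

/-- A perturbation of `w` by iterates of the second generator. -/
def pert (i : ZMod N) (l : ℕ) (w : M.V i)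
    (z : {s : Fin q // b + ((s : ℕ) : ZMod N) = i ∧ q ≤ l + s} → ℂ) : M.V i :=
  w + ∑ s, z s • (M.tot ^ (s.1 : ℕ)) (Pi.single b D.v) i

variable {i : ZMod N} {l : ℕ} (w : M.V i)
  (z : {s : Fin q // b + ((s : ℕ) : ZMod N) = i ∧ q ≤ l + s} → ℂ)

theorem single_pert : (Pi.single i (D.pert i l w z) : ∀ k, M.V k) =
    Pi.single i w + ∑ s, z s • (M.tot ^ (s.1 : ℕ)) (Pi.single b D.v) := by
  rw [pert, Pi.single_add]
  congr 1
  have h := map_sum (LinearMap.single ℂ M.V i)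
    (fun s => z s • (M.tot ^ (s.1 : ℕ)) (Pi.single b D.v) i) Finset.univ
  refine h.trans (Finset.sum_congr rfl fun s _ => ?_)
  rw [map_smul]
  congr 1
  exact single_tot_pow_apply M s.2.1 D.v

theorem apply_tot_pow_pert (f : (∀ k, M.V k) →ₗ[ℂ] ℂ)
    (hf : ∀ r, f ((M.tot ^ r) (Pi.single b D.v)) = 0) (r : ℕ) :
    f ((M.tot ^ r) (Pi.single i (D.pert i l w z))) = f ((M.tot ^ r) (Pi.single i w)) := by
  rw [single_pert, map_add, map_add, map_sum, map_sum, Finset.sum_eq_zero, add_zero]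
  intro s _
  rw [map_smul, map_smul, ← Module.End.mul_apply, ← pow_add, hf, smul_zero]

theorem V_pert (hw : ∀ s, D.V.U s (Pi.single i w) = 0)
    (s : {s : Fin q // b + ((s : ℕ) : ZMod N) = i ∧ q ≤ l + s}) :
    D.V.U s.1 (Pi.single i (D.pert i l w z)) = z s := by
  rw [single_pert, map_add, hw, zero_add, map_sum, Finset.sum_eq_single s]
  · rw [map_smul, D.V_v _ _ s.1.2 s.1.2, if_pos rfl, smul_eq_mul, mul_one]
  · intro r _ hr
    rw [map_smul, D.V_v _ _ r.1.2 s.1.2, if_neg, smul_zero]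
    exact fun h => hr (Subtype.ext (Fin.ext h))
  · simp

/-- The bound q ≤ l + s in the index set of the perturbations is exactly t^l t^s v = 0, so the order
of the generator is preserved. -/
theorem tot_pow_pert (hw : (M.tot ^ l) (Pi.single i w) = 0) :
    (M.tot ^ l) (Pi.single i (D.pert i l w z)) = 0 := by
  rw [single_pert, map_add, hw, zero_add, map_sum]
  refine Finset.sum_eq_zero fun s _ => ?_
  have := s.2.2
  rw [map_smul, ← Module.End.mul_apply, ← pow_add,
    show l + (s.1 : ℕ) = (l + s.1 - q) + q by omega, pow_add, Module.End.mul_apply, D.pow_v,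
    map_zero, smul_zero]

/-- The coefficients are the V-coordinates of w'. Those with b + s ≠ i vanish by homogeneity and
those with l + s < q by hypothesis, so exactly the indices of admissible perturbations remain. -/
theorem exists_pert_eq (hw : ∀ s, D.V.U s (Pi.single i w) = 0) {w' : M.V i}
    (hU : ∀ s, s < p → D.U.U s (Pi.single i w') = D.U.U s (Pi.single i w))
    (hV : ∀ s, l + s < q → D.V.U s (Pi.single i w') = 0) :
    ∃ z, D.pert i l w z = w' := by
  refine ⟨fun s => D.V.U s.1 (Pi.single i w'), ?_⟩
  apply Pi.single_injective (M := fun k => M.V k) i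
  rw [← sub_eq_zero]
  refine D.inj _ (fun s hs => ?_) fun s hs => ?_
  · have := D.apply_tot_pow_pert w (fun s : {s : Fin q // b + ((s : ℕ) : ZMod N) = i ∧ q ≤ l + s} =>
      D.V.U s.1 (Pi.single i w')) (D.U.U s) (fun r => D.U_v r s) 0
    rw [pow_zero, Module.End.one_apply, Module.End.one_apply] at this
    rw [map_sub, this, hU s hs, sub_self]
  · rw [map_sub]
    by_cases hs' : b + (s : ZMod N) = i ∧ q ≤ l + s
    · rw [sub_eq_zero]
      exact D.V_pert w _ hw ⟨⟨s, hs⟩, hs'⟩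
    · have h1 : D.V.U s (Pi.single i w') = 0 := by
        by_cases hb : b + (s : ZMod N) = i
        · exact hV s (by
            by_contra hlt
            exact hs' ⟨hb, not_lt.1 hlt⟩)
        · exact D.V.hom _ _ _ (Ne.symm hb)
      rw [h1, sub_zero, single_pert, map_add, hw, zero_add, map_sum]
      refine Finset.sum_eq_zero fun r _ => ?_
      rw [map_smul, D.V_v _ _ r.1.2 hs, if_neg, smul_zero]
      rintro rfl
      exact hs' r.2

end CyclicPair

end QRep

section Chi

variable {N : ℕ} [NeZero N] {γ : ZMod N → ℕ} {x : RepSpace (ZMod N) γ} {i j : ZMod N} {l m : ℕ}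

theorem hasChi_extSet_uniserial {k : ZMod N} {n : ℕ} (hP : (stdRep x).IsIso (P k n)) (hl : 0 < l)
    (hm : 0 < m) (hn : l + m = n) :
    HasChi (extSet x (arc (k + (m : ZMod N)) l) (k + (m : ZMod N)) l k m) 1 := by
  have hM : (stdRep x).IsNilp := hP.symm.isNilp (P_isNilp k n)
  obtain ⟨u, c, hc, hi⟩ := exists_gen_of_isIso_P hP (by omega)
  have hfin : Module.finrank ℂ (∀ k, (stdRep x).V k) = l + m := by
    rw [finrank_tot, hP.dim_eq, ← finrank_tot, finrank_tot_P, hn]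
  have hw := single_tot_pow_apply (stdRep x) (r := m) rfl u
  have hC : ∀ r s, r < l → s < l → c.U (m + s) (((stdRep x).tot ^ r)
      (Pi.single (k + (m : ZMod N)) (((stdRep x).tot ^ m) (Pi.single k u) (k + (m : ZMod N))))) =
        if r = s then 1 else 0 := by
    intro r s hr hs
    rw [hw, ← Module.End.mul_apply, ← pow_add, hc _ _ (by omega) (by omega)]
    congr 1
    apply propext
    omega
  -- The only subobject is generated by t^m u, so the parameter space is a point.
  refine hasChi_extSet_of_family (S := Fin 0)
    (w := fun _ => ((stdRep x).tot ^ m) (Pi.single k u) (k + (m : ZMod N)))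
    (C := fun s => c.U (m + s)) hM hl hm hfin continuous_const (fun _ => hC) (fun _ => ?_)
    (fun s => s.elim0) (fun _ s => s.elim0) Set.univ u (fun _ _ g h => ?_) (fun W hW => ?_)
    ((hasChi_pi_complex (Fin 0)).congr (Homeomorph.Set.univ _).symm)
  · rw [hw, ← Module.End.mul_apply, ← pow_add, hn, hi.pow_eq_zero]
    rfl
  · have h1 := congrArg (c.U (m - 1)) h
    rw [hc _ _ (by omega) (by omega), if_pos rfl, map_sum, Finset.sum_eq_zero] at h1
    · exact one_ne_zero h1
    · intro r _
      rw [hw, ← Module.End.mul_apply, ← pow_add, map_smul, c.pow_of_lt (by omega), smul_zero]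
  · refine ⟨0, Set.mem_univ _, ?_⟩
    obtain ⟨z, d, -, hd⟩ := hW.exists_quot_coord hm
    exact (hd (((stdRep x).tot ^ m) (Pi.single k u))).2 (fun s hs => d.pow_of_lt hs _) _

theorem hasChi_extSet_pert (hM : (stdRep x).IsNilp) {a b : ZMod N} {p q : ℕ}
    (D : CyclicPair (stdRep x) a p b q) (hl : 0 < l) (hm : 0 < m) (hpq : p + q = l + m)
    (w : (stdRep x).V i) (hw : ∀ s, D.V.U s (Pi.single i w) = 0)
    (hwl : ((stdRep x).tot ^ l) (Pi.single i w) = 0)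
    (C : ℕ → (∀ k, (stdRep x).V k) →ₗ[ℂ] ℂ)
    (hC : ∀ r s, r < l → s < l → C s (((stdRep x).tot ^ r) (Pi.single i w)) = if r = s then 1 else 0)
    (hCv : ∀ r s, C s (((stdRep x).tot ^ r) (Pi.single b D.v)) = 0)
    (O : Set ({s : Fin q // b + ((s : ℕ) : ZMod N) = i ∧ q ≤ l + s} → ℂ)) (v : (stdRep x).V j)
    (hv : ∀ z ∈ O, ∀ c : ℕ → ℂ, ((stdRep x).tot ^ (m - 1)) (Pi.single j v) ≠
      ∑ r ∈ Finset.range l, c r • ((stdRep x).tot ^ r) (Pi.single i (D.pert i l w z)))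
    (hO : ∀ W : ∀ k, Submodule ℂ ((stdRep x).V k), (stdRep x).IsExt W i l j m →
      ∃ w' ∈ W i, (∀ z, D.pert i l w z = w' → z ∈ O) ∧
        (∀ s, s < p → D.U.U s (Pi.single i w') = D.U.U s (Pi.single i w)) ∧
        ∀ s, l + s < q → D.V.U s (Pi.single i w') = 0) {n : ℤ} (hn : HasChi O n) :
    HasChi (extSet x (arc i l) i l j m) n := by
  refine hasChi_extSet_of_family (w := D.pert i l w) (C := C) hM hl hm
    (D.finrank_eq.trans hpq) ?_ (fun z r s hr hs => ?_) (fun z => D.tot_pow_pert w z hwl)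
    (fun s => D.V.U s.1 ∘ₗ LinearMap.single ℂ (stdRep x).V i) (fun z s => D.V_pert w z hw s)
    O v hv (fun W hW => ?_) hn
  · have key : ∀ {S : Type} [Fintype S] (w : Fin (γ i) → ℂ) (e : S → Fin (γ i) → ℂ),
        Continuous fun z : S → ℂ => w + ∑ s, z s • e s := by
      intros
      fun_prop
    exact key w _
  · exact (D.apply_tot_pow_pert w z (C s) (fun r => hCv r s) r).trans (hC r s hr hs)
  · obtain ⟨w', hw', h1, h2, h3⟩ := hO W hW
    obtain ⟨z, rfl⟩ := D.exists_pert_eq w hw h2 h3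
    exact ⟨z, h1 z rfl, hw'⟩

variable {a b : ZMod N} {p q : ℕ}

/-- All admissible perturbations of u generate subobjects of this type, and by hypothesis no others
occur; so the set is an affine space. -/
theorem hasChi_extSet_summand (hM : (stdRep x).IsNilp) (D : CyclicPair (stdRep x) a p b q)
    (hp : 0 < p) (hq : 0 < q)
    (hO : ∀ W : ∀ k, Submodule ℂ ((stdRep x).V k), (stdRep x).IsExt W a p b q →
      ∃ w' ∈ W a, D.U.IsDual (Pi.single a w') ∧ ∀ s, s + p < q → D.V.U s (Pi.single a w') = 0) :
    HasChi (extSet x (arc a p) a p b q) 1 := by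
  have hd : ∀ z : {s : Fin q // b + ((s : ℕ) : ZMod N) = a ∧ q ≤ p + s} → ℂ,
      D.U.IsDual (Pi.single a (D.pert a p D.u z)) := by
    intro z r s hr hs
    exact (D.apply_tot_pow_pert D.u z (D.U.U s) (fun r => D.U_v r s) r).trans (D.U_u r s hr hs)
  refine hasChi_extSet_pert hM D hp hq rfl D.u (fun s => D.V_u 0 s) D.pow_u D.U.U D.U_u D.U_v Set.univ
    D.v (fun z _ => D.ne_sum_left hq (hd z)) (fun W hW => ?_)
    ((hasChi_pi_complex _).congr (Homeomorph.Set.univ _).symm)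
  obtain ⟨w', hw', h1, h2⟩ := hO W hW
  refine ⟨w', hw', fun z _ => Set.mem_univ z, fun s hs => ?_, fun s hs => h2 s (by omega)⟩
  exact (h1 0 s hp hs).trans (D.U_u 0 s hp hs).symm

/-- When the summands are not isomorphic, a subobject of type (a, p) must have U_0 nonzero on a
generator, so it is a perturbed copy of the first summand. For isomorphic summands U_0 may vanish
and this single chart does not suffice. -/
theorem hasChi_extSet_left (hM : (stdRep x).IsNilp) (D : CyclicPair (stdRep x) a p b q)
    (hqp : q ≤ p) (hq : 0 < q) (hne : a = b → p ≠ q) :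
    HasChi (extSet x (arc a p) a p b q) 1 := by
  refine hasChi_extSet_summand hM D (by omega) hq fun W hW => ?_
  obtain ⟨w, hw, hw0⟩ := hW.exists_gen hM (by omega) hq
  by_cases hU : D.U.U 0 (Pi.single a w) = 0
  · obtain ⟨hab, ⟨hpq, -⟩ | ⟨k, hk, -, hpk, -⟩⟩ :=
      D.normal_right hM hqp (by omega) hq hW (by omega) hq hw hw0 hU
    · exact absurd hpq (hne hab)
    · omega
  · obtain ⟨-, -, w', hw', hd⟩ := D.normal_left hM hqp (by omega) hW (by omega) hw hw0 hU
    exact ⟨w', hw', hd, fun s hs => by omega⟩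

theorem hasChi_extSet_right (hM : (stdRep x).IsNilp) (D : CyclicPair (stdRep x) a p b q)
    (hqp : q ≤ p) (hq : 0 < q) (hne : a = b → p ≠ q) :
    HasChi (extSet x (arc b q) b q a p) 1 := by
  refine hasChi_extSet_summand hM D.swap hq (by omega) fun W hW => ?_
  obtain ⟨w, hw, hw0⟩ := hW.exists_gen hM hq (by omega)
  by_cases hU : D.U.U 0 (Pi.single b w) = 0
  · obtain ⟨-, ⟨-, w', hw', hd, h⟩ | ⟨k, hk, hkq, hqk, -⟩⟩ :=
      D.normal_right hM hqp (by omega) hq hW hq (by omega) hw hw0 hU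
    · exact ⟨w', hw', hd, h⟩
    · omega
  · obtain ⟨hba, hqp', -⟩ := D.normal_left hM hqp (by omega) hW hq hw hw0 hU
    exact absurd hqp'.symm (hne hba.symm)

/-- The normalised generators are t^k u plus a combination of the t^s v. The coefficient of v must
be nonzero, since W is not contained in the radical of M. This is an affine space minus a
hyperplane. -/
theorem hasChi_extSet_shift (hM : (stdRep x).IsNilp) {k : ℕ}
    (D : CyclicPair (stdRep x) a p (a + (k : ZMod N)) q) (hq : 0 < q) (hk : 0 < k) (hkq : k + q < p)
    (hlk : l + k = p) :
    HasChi (extSet x (arc (a + (k : ZMod N)) l) (a + (k : ZMod N)) l a (q + k)) 0 := by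
  have hw := single_tot_pow_apply (stdRep x) (r := k) rfl D.u
  set w := ((stdRep x).tot ^ k) (Pi.single a D.u) (a + (k : ZMod N)) with hwdef
  have hwV : ∀ s, D.V.U s (Pi.single (a + (k : ZMod N)) w) = 0 := fun s => by
    rw [hw]
    exact D.V_u k s
  have hC : ∀ r s, r < l → s < l → D.U.U (k + s) (((stdRep x).tot ^ r)
      (Pi.single (a + (k : ZMod N)) w)) = if r = s then 1 else 0 := by
    intro r s hr hs
    rw [hw, ← Module.End.mul_apply, ← pow_add, D.U_u _ _ (by omega) (by omega)]
    congr 1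
    apply propext
    omega
  -- The coordinate s = 0 is available because v lives at the same vertex a + k as t^k u, and q < l.
  let s₀ : {s : Fin q // a + (k : ZMod N) + ((s : ℕ) : ZMod N) = a + (k : ZMod N) ∧ q ≤ l + s} :=
    ⟨⟨0, hq⟩, by simp, by omega⟩
  refine hasChi_extSet_pert hM D (by omega) (by omega) (by omega) w hwV ?_
    (fun s => D.U.U (k + s)) hC (fun r s => D.U_v r _) {z | z s₀ ≠ 0} D.u
    (fun z hz => D.ne_sum_shift hq (by omega) hlk (fun r s hr hs => ?_) ?_) (fun W hW => ?_)
    (hasChi_pi_units s₀)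
  · rw [hw, ← Module.End.mul_apply, ← pow_add, hlk]
    exact D.pow_u
  · exact (D.apply_tot_pow_pert w z (D.U.U (k + s)) (fun r => D.U_v r _) r).trans (hC r s hr hs)
  · rw [show (0 : ℕ) = (s₀.1 : ℕ) from rfl, D.V_pert w z hwV s₀]
    exact hz
  · obtain ⟨w', hw', hw0⟩ := hW.exists_gen hM (by omega) (by omega)
    by_cases hU : D.U.U 0 (Pi.single (a + (k : ZMod N)) w') = 0
    · obtain ⟨-, ⟨hlq, -⟩ | ⟨k', hk', -, hlk', -, w'', hw'', h1, h2, h3⟩⟩ :=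
        D.normal_right hM (by omega) (by omega) hq hW (by omega) (by omega) hw' hw0 hU
      · omega
      · obtain rfl : k' = k := by omega
        refine ⟨w'', hw'', ?_, fun s hs => ?_, fun s hs => by omega⟩
        · rintro z rfl
          rw [Set.mem_ofPred_eq, ← D.V_pert w z hwV s₀]
          exact h3
        · rw [hw]
          rcases lt_or_ge s k' with h4 | h4
          · rw [h2 s h4, D.U.pow_of_lt h4]
          · obtain ⟨s, rfl⟩ := Nat.exists_eq_add_of_le h4
            rw [D.U_u _ _ (by omega) hs]
            have h5 := h1 0 s (by omega) (by omega)
            rw [pow_zero, Module.End.one_apply] at h5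
            rw [h5]
            congr 1
            apply propext
            omega
    · obtain ⟨-, h1, -⟩ := D.normal_left hM (by omega) (by omega) hW (by omega) hw' hw0 hU
      omega

end Chi

end

/-! ### Convolution of combinations of the E_{i,l} -/

noncomputable section

set_option linter.unusedSectionVars false

open QRep CyclicQuiver AlexanderSpanier

variable {N : ℕ} [NeZero N] {γ α : ZMod N → ℕ}

/-- Every nilpotent representation has a model on the standard spaces. -/
theorem exists_nilSpace {R : QRep (ZMod N)} (hR : R.IsNilp) (h : R.dim = α) :
    ∃ y : NilSpace α, y.rep.IsIso R := by
  have he : ∀ k, Nonempty ((Fin (α k) → ℂ) ≃ₗ[ℂ] R.V k) := fun k =>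
    FiniteDimensional.nonempty_linearEquiv_of_finrank_eq (by
      rw [Module.finrank_fin_fun, ← h]
      rfl)
  let e := fun k => (he k).some
  let y : RepSpace (ZMod N) α := fun a b f => (e b).symm.toLinearMap ∘ₗ R.map f ∘ₗ (e a).toLinearMap
  have hy : (stdRep y).IsIso R := ⟨e, fun a b f v => (e b).apply_symm_apply _⟩
  exact ⟨⟨y, hy.symm.isNilp hR⟩, hy⟩

/-- The combination `∑ a(i, l) E_{i,l}` in all degrees. -/
def comb (a : ZMod N → ℕ → ℂ) : HallFun (ZMod N) := fun α y =>
  if ∑ k, α k = 0 then 0 else ∑ i, a i (∑ k, α k) * charFun (P i (∑ k, α k)) α y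

theorem comb_of_isIso (a : ZMod N → ℕ → ℂ) {y : NilSpace α} {i : ZMod N} {l : ℕ} (hl : 0 < l)
    (hα : ∑ k, α k = l) (hy : y.rep.IsIso (P i l)) : comb a α y = a i l := by
  subst hα
  rw [comb, if_neg hl.ne', Finset.sum_eq_single i]
  · rw [charFun, if_pos hy, mul_one]
  · intro j _ hj
    rw [charFun, if_neg, mul_zero]
    exact fun h => hj (eq_of_isIso_P hl h hy).1
  · simp

theorem exists_isIso_of_comb_ne_zero {a : ZMod N → ℕ → ℂ} {y : NilSpace α} (h : comb a α y ≠ 0) :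
    0 < ∑ k, α k ∧ ∃ i, y.rep.IsIso (P i (∑ k, α k)) := by
  rw [comb] at h
  split_ifs at h with h0
  · exact absurd rfl h
  · refine ⟨Nat.pos_of_ne_zero h0, ?_⟩
    obtain ⟨i, -, hi⟩ := Finset.exists_ne_zero_of_sum_ne_zero h
    refine ⟨i, ?_⟩
    by_contra hcon
    rw [charFun, if_neg hcon, mul_zero] at hi
    exact hi rfl

theorem extSet_add {x : RepSpace (ZMod N) γ} {i j : ZMod N} {l m : ℕ}
    (h : (extSet x α i l j m).Nonempty) : γ = arc i l + arc j m := by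
  obtain ⟨W, hW, h1, h2⟩ := h
  rw [← P_dim i l, ← P_dim j m, ← h1.dim_eq, ← h2.dim_eq]
  funext k
  have h3 := (W k).1.finrank_quotient_add_finrank
  rw [Module.finrank_fin_fun, add_comm] at h3
  exact h3.symm

variable (x : NilSpace γ) (a b : ZMod N → ℕ → ℂ)

/-- A nonzero value forces both subobject and quotient to be uniserial, so the fibre is a union of
sets of extensions. The value c = 0 carries weight zero in the product and may be ignored. -/
theorem mem_hallFiber_comb {c : ℂ} (hc : c ≠ 0) (W : ∀ k, Gr (α k) (Fin (γ k) → ℂ)) :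
    W ∈ hallFiber (comb a) (comb b) α (γ - α) x c ↔
      0 < ∑ k, α k ∧ 0 < ∑ k, (γ - α) k ∧ ∃ i j, W ∈ extSet x.1 α i (∑ k, α k) j (∑ k, (γ - α) k) ∧
        a i (∑ k, α k) * b j (∑ k, (γ - α) k) = c := by
  constructor
  · rintro ⟨hW, y, z, hy, hz, h⟩
    have h0 : comb a α y ≠ 0 ∧ comb b (γ - α) z ≠ 0 := by
      rw [← mul_ne_zero_iff, h]
      exact hc
    obtain ⟨hl, i, hi⟩ := exists_isIso_of_comb_ne_zero h0.1
    obtain ⟨hm, j, hj⟩ := exists_isIso_of_comb_ne_zero h0.2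
    refine ⟨hl, hm, i, j, ⟨hW, hy.symm.trans hi, hz.symm.trans hj⟩, ?_⟩
    rw [← h, comb_of_isIso a hl rfl hi, comb_of_isIso b hm rfl hj]
  · rintro ⟨hl, hm, i, j, ⟨hW, h1, h2⟩, h⟩
    have hd1 : ((stdRep x.1).sub _ hW).dim = α := funext fun k => (W k).2
    have hd2 : ((stdRep x.1).quot _ hW).dim = γ - α := funext fun k => by
      have h3 := (W k).1.finrank_quotient_add_finrank
      rw [Module.finrank_fin_fun, (W k).2] at h3
      exact Nat.eq_sub_of_add_eq h3
    obtain ⟨y, hy⟩ := exists_nilSpace (IsNilp.sub (M := stdRep x.1) x.2 hW) hd1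
    obtain ⟨z, hz⟩ := exists_nilSpace (IsNilp.quot (M := stdRep x.1) x.2 hW) hd2
    refine ⟨hW, y, z, hy, hz, ?_⟩
    rw [comb_of_isIso a hl rfl (hy.trans h1), comb_of_isIso b hm rfl (hz.trans h2), h]

/-- The contribution of the subobjects of dimension `α` to `hallMul`. -/
def hallTerm (f g : HallFun (ZMod N)) (α : ZMod N → ℕ) : ℂ :=
  ∑ᶠ c : ℂ, c * (eulerCharC (hallFiber f g α (γ - α) x c) : ℂ)

theorem hallMul_eq (f g : HallFun (ZMod N)) :
    hallMul f g γ x = ∑ α ∈ Finset.Iic γ, hallTerm x f g α := rfl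

theorem hallTerm_eq_zero (h : ∑ k, α k = 0 ∨ ∑ k, (γ - α) k = 0) :
    hallTerm x (comb a) (comb b) α = 0 := by
  refine (finsum_congr fun c => ?_).trans finsum_zero
  rcases eq_or_ne c 0 with rfl | hc
  · rw [zero_mul]
  · have : hallFiber (comb a) (comb b) α (γ - α) x c = ∅ := by
      ext W
      rw [mem_hallFiber_comb x a b hc]
      simp only [Set.mem_empty_iff_false, iff_false]
      rintro ⟨h1, h2, -⟩
      omega
    rw [this, eulerCharC_empty, Int.cast_zero, mul_zero]

/-- The sum over values c becomes a sum over pairs of vertices. Different pairs may give the same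
value, which is why additivity is required for arbitrary finite unions of extension sets. -/
theorem hallTerm_eq_sum {l m : ℕ} (hl : ∑ k, α k = l) (hm : ∑ k, (γ - α) k = m)
    (hl0 : 0 < l) (hm0 : 0 < m) (n : ZMod N × ZMod N → ℤ)
    (hn : ∀ s : Finset (ZMod N × ZMod N),
      eulerCharC (⋃ p ∈ s, extSet x.1 α p.1 l p.2 m) = ∑ p ∈ s, n p) :
    hallTerm x (comb a) (comb b) α = ∑ p : ZMod N × ZMod N, a p.1 l * b p.2 m * (n p : ℂ) := by
  classical
  subst hl hm
  set v : ZMod N × ZMod N → ℂ := fun p => a p.1 (∑ k, α k) * b p.2 (∑ k, (γ - α) k) with hv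
  have h1 : ∀ c : ℂ, c * (eulerCharC (hallFiber (comb a) (comb b) α (γ - α) x c) : ℂ) =
      ∑ p with v p = c, v p * (n p : ℂ) := by
    intro c
    have h2 : ∑ p with v p = c, v p * (n p : ℂ) = c * ∑ p with v p = c, (n p : ℂ) := by
      rw [Finset.mul_sum]
      exact Finset.sum_congr rfl fun p hp => by rw [(Finset.mem_filter.1 hp).2]
    rw [h2]
    rcases eq_or_ne c 0 with rfl | hc
    · rw [zero_mul, zero_mul]
    · have h3 : hallFiber (comb a) (comb b) α (γ - α) x c = ⋃ p ∈ Finset.univ.filter fun p => v p = c,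
          extSet x.1 α p.1 (∑ k, α k) p.2 (∑ k, (γ - α) k) := by
        ext W
        rw [mem_hallFiber_comb x a b hc]
        simp only [Set.mem_iUnion, Finset.mem_filter, Finset.mem_univ, true_and, exists_prop,
          Prod.exists]
        constructor
        · rintro ⟨-, -, i, j, h, h'⟩
          exact ⟨i, j, h', h⟩
        · rintro ⟨i, j, h', h⟩
          exact ⟨hl0, hm0, i, j, h, h'⟩
      rw [h3, hn]
      push_cast
      rfl
  rw [hallTerm, finsum_congr h1, finsum_eq_sum_of_support_subset (s := Finset.univ.image v)]
  · exact Finset.sum_fiberwise_of_maps_to (fun p _ => Finset.mem_image_of_mem v (Finset.mem_univ p)) _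
  · intro c hc
    rw [Finset.mem_coe, Finset.mem_image]
    obtain ⟨p, hp, -⟩ := Finset.exists_ne_zero_of_sum_ne_zero hc
    exact ⟨p, Finset.mem_univ p, (Finset.mem_filter.1 hp).2⟩

/-- Additivity of the Euler characteristic over the isomorphism types of subobject and quotient. -/
theorem eulerCharC_biUnion_extSet (hα : α ≤ γ) {l m : ℕ} (hl : ∑ k, α k = l)
    (hm : ∑ k, (γ - α) k = m) (hl0 : 0 < l) (hm0 : 0 < m) (n : ZMod N × ZMod N → ℤ)
    (hn : ∀ p, HasChi (extSet x.1 α p.1 l p.2 m) (n p)) (s : Finset (ZMod N × ZMod N)) :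
    eulerCharC (⋃ p ∈ s, extSet x.1 α p.1 l p.2 m) = ∑ p ∈ s, n p := by
  -- The open half of `isExt_iff`. Inside the closed set C of stable subspaces, O p cuts out
  -- precisely the extensions of type p; so these sets separate one another and their unions are
  -- locally closed.
  let O : ZMod N × ZMod N → Set (∀ k, Gr (α k) (Fin (γ k) → ℂ)) := fun p =>
    {W | ∃ k, ∃ w ∈ (W p.1).1, ((stdRep x.1).tot ^ (l - 1))
      (Pi.single (M := (stdRep x.1).V) p.1 w) k ≠ 0} ∩
    {W | ∃ (z : Fin (γ p.2) → ℂ) (k : ZMod N), ((stdRep x.1).tot ^ (m - 1))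
      (Pi.single (M := (stdRep x.1).V) p.2 z) k ∉ (W k).1}
  have hO : ∀ p, IsOpen (O p) := by
    intro p
    refine IsOpen.inter ?_ ?_
    · have he : {W : ∀ k, Gr (α k) (Fin (γ k) → ℂ) | ∃ k, ∃ w ∈ (W p.1).1,
          ((stdRep x.1).tot ^ (l - 1)) (Pi.single (M := (stdRep x.1).V) p.1 w) k ≠ 0} =
          ⋃ k, {W | ∃ w ∈ (W p.1).1,
            ((stdRep x.1).tot ^ (l - 1)) (Pi.single (M := (stdRep x.1).V) p.1 w) k ≠ 0} :=
        Set.ofPred_exists _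
      rw [he]
      refine isOpen_iUnion fun k => ?_
      exact (Gr.isOpen_exists_ne_zero (d := α p.1) (n := γ p.1) (m := γ k)
        (LinearMap.proj (R := ℂ) (φ := (stdRep x.1).V) k ∘ₗ ((stdRep x.1).tot ^ (l - 1)) ∘ₗ
          LinearMap.single ℂ (stdRep x.1).V p.1)).preimage
        (continuous_apply (A := fun k => Gr (α k) (Fin (γ k) → ℂ)) p.1)
    · simp only [Set.ofPred_exists]
      refine isOpen_iUnion fun z => isOpen_iUnion fun k => ?_
      exact (Gr.isOpen_notMem (d := α k) (((stdRep x.1).tot ^ (m - 1))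
        (Pi.single (M := (stdRep x.1).V) p.2 z) k)).preimage
        (continuous_apply (A := fun k => Gr (α k) (Fin (γ k) → ℂ)) k)
  let C : Set (∀ k, Gr (α k) (Fin (γ k) → ℂ)) := {W | (stdRep x.1).IsStable fun k => (W k).1}
  have hC : IsClosed C := by
    have : C = ⋂ (a : ZMod N) (b : ZMod N) (f : a ⟶ b),
        {W | (W a).1 ≤ (W b).1.comap (x.1 a b f)} := by
      ext W
      simp only [Set.mem_iInter]
      rfl
    rw [this]
    exact isClosed_iInter fun a => isClosed_iInter fun b => isClosed_iInter fun f =>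
      Gr.isClosed_map_le _
  have hlm : ∑ k, (stdRep x.1).dim k = l + m := by
    have h1 : (stdRep x.1).dim = γ := funext fun k => Module.finrank_fin_fun ℂ
    rw [h1, ← hl, ← hm, ← Finset.sum_add_distrib]
    exact Finset.sum_congr rfl fun k _ => (Nat.add_sub_cancel' (hα k)).symm
  have hext : ∀ p, extSet x.1 α p.1 l p.2 m = C ∩ O p := by
    intro p
    ext W
    have h1 := isExt_iff (M := stdRep x.1) (W := fun k => (W k).1) (i := p.1) (j := p.2) x.2 hl0 hm0
    have h2 : ∑ k, Module.finrank ℂ (W k).1 = l := by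
      rw [← hl]
      exact Finset.sum_congr rfl fun k _ => (W k).2
    have h3 : (∃ w ∈ (W p.1).1, ((stdRep x.1).tot ^ (l - 1))
        (Pi.single (M := (stdRep x.1).V) p.1 w) ≠ 0) ↔ ∃ k, ∃ w ∈ (W p.1).1,
        ((stdRep x.1).tot ^ (l - 1)) (Pi.single (M := (stdRep x.1).V) p.1 w) k ≠ 0 := by
      simp only [Ne, funext_iff, not_forall]
      constructor
      · rintro ⟨w, hw, k, h⟩
        exact ⟨k, w, hw, h⟩
      · rintro ⟨k, w, hw, h⟩
        exact ⟨w, hw, k, h⟩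
    refine h1.trans ⟨fun h => ⟨h.1, h3.1 h.2.2.2.1, h.2.2.2.2⟩, fun h =>
      ⟨h.1, h2, hlm, h3.2 h.2.1, h.2.2⟩⟩
  have hdisj : ∀ p q, p ≠ q → Disjoint (extSet x.1 α p.1 l p.2 m) (O q) := by
    intro p q hpq
    rw [Set.disjoint_left]
    intro W hW hW'
    have hW2 : W ∈ extSet x.1 α q.1 l q.2 m := by
      rw [hext]
      exact ⟨hW.1, hW'⟩
    exact hpq (Prod.ext (eq_of_isIso_P hl0 hW.2.1 hW2.2.1).1 (eq_of_isIso_P hm0 hW.2.2 hW2.2.2).1)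
  refine eulerCharC_of_hasChi ?_ (hasChi_biUnion s _ O n hO
    (fun p => by rw [hext]; exact Set.inter_subset_right) hdisj fun p _ => hn p)
  have : (⋃ p ∈ s, extSet x.1 α p.1 l p.2 m) = C ∩ ⋃ p ∈ s, O p := by
    rw [Set.inter_iUnion₂]
    exact Set.iUnion₂_congr fun p _ => hext p
  rw [this]
  exact hC.isLocallyClosed.inter (isOpen_biUnion fun p _ => hO p).isLocallyClosed

end

/-! ### Products evaluated at uniserial and at other representations -/

noncomputable section

set_option linter.unusedSectionVars false

open QRep AlexanderSpanier

namespace CyclicQuiver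

variable {N : ℕ}

theorem arc_zero (i : ZMod N) : arc i 0 = 0 := by
  funext k
  simp [arc]

theorem arc_succ (i : ZMod N) (l : ℕ) : arc i (l + 1) = arc i l + Pi.single (i + (l : ZMod N)) 1 := by
  funext k
  rw [arc, Finset.range_add_one, Finset.filter_insert, Pi.add_apply]
  split_ifs with h
  · rw [Finset.card_insert_of_notMem (by simp), h, Pi.single_eq_same]
    rfl
  · rw [Pi.single_eq_of_ne (Ne.symm h)]
    rfl

theorem arc_add (i : ZMod N) (l m : ℕ) : arc i (l + m) = arc i l + arc (i + (l : ZMod N)) m := by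
  induction m with
  | zero => rw [arc_zero, add_zero, add_zero]
  | succ m ih => rw [← add_assoc, arc_succ, ih, arc_succ, add_assoc, Nat.cast_add, add_assoc i]

end CyclicQuiver

open CyclicQuiver

section Product

variable {N : ℕ} [NeZero N] {γ : ZMod N → ℕ} (x : NilSpace γ) (a b : ZMod N → ℕ → ℂ)

theorem hasChi_extSet_empty {α : ZMod N → ℕ} {i j : ZMod N} {l m : ℕ} {x : RepSpace (ZMod N) γ}
    (h : ¬ (extSet x α i l j m).Nonempty) : HasChi (extSet x α i l j m) 0 := by
  have : IsEmpty (extSet x α i l j m) := Set.isEmpty_coe_sort.2 (Set.not_nonempty_iff_eq_empty.1 h)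
  exact hasChi_of_isEmpty

theorem sum_sub_of_le {α : ZMod N → ℕ} (hα : α ≤ γ) : ∑ k, α k + ∑ k, (γ - α) k = ∑ k, γ k := by
  rw [← Finset.sum_add_distrib]
  exact Finset.sum_congr rfl fun k _ => Nat.add_sub_cancel' (hα k)

/-- P_{k,n} has exactly one subobject of each length l. It is isomorphic to P_{k+m,l} with quotient
P_{k,m}, where m = n - l. The outcome is the coefficient formula for a product of loop matrices. -/
theorem hallMul_comb_uniserial {k : ZMod N} {n : ℕ} (hx : x.rep.IsIso (P k n)) :
    hallMul (comb a) (comb b) γ x = ∑ p ∈ Finset.HasAntidiagonal.antidiagonal n,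
      if 0 < p.1 ∧ 0 < p.2 then a (k + (p.2 : ZMod N)) p.1 * b k p.2 else 0 := by
  have hγ : γ = arc k n := by
    rw [← P_dim, ← hx.dim_eq]
    exact funext fun k => (Module.finrank_fin_fun ℂ).symm
  have hγn : ∑ k, γ k = n := by rw [hγ, sum_arc]
  have hterm : ∀ α ∈ Finset.Iic γ, hallTerm x (comb a) (comb b) α =
      ∑ p ∈ Finset.HasAntidiagonal.antidiagonal n, if arc (k + (p.2 : ZMod N)) p.1 = α then
        if 0 < p.1 ∧ 0 < p.2 then a (k + (p.2 : ZMod N)) p.1 * b k p.2 else 0 else 0 := by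
    intro α hα
    have hα := Finset.mem_Iic.1 hα
    obtain ⟨l, hl⟩ : ∃ l, ∑ k, α k = l := ⟨_, rfl⟩
    obtain ⟨m, hm⟩ : ∃ m, ∑ k, (γ - α) k = m := ⟨_, rfl⟩
    have hlm : l + m = n := by rw [← hl, ← hm, sum_sub_of_le hα, hγn]
    rw [Finset.sum_eq_single (l, m)]
    · by_cases h0 : 0 < l ∧ 0 < m
      · rw [if_pos h0]
        let n' : ZMod N × ZMod N → ℤ := fun p =>
          if arc (k + (m : ZMod N)) l = α ∧ p = (k + (m : ZMod N), k) then 1 else 0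
        have hn' : ∀ p, HasChi (extSet x.1 α p.1 l p.2 m) (n' p) := by
          rintro ⟨i, j⟩
          by_cases h : arc (k + (m : ZMod N)) l = α ∧ (i, j) = (k + (m : ZMod N), k)
          · obtain ⟨rfl, h⟩ := h
            obtain ⟨rfl, rfl⟩ := Prod.mk.inj h
            have := hasChi_extSet_uniserial hx h0.1 h0.2 hlm
            simpa [n'] using this
          · have hz : n' (i, j) = 0 := if_neg h
            rw [hz]
            refine hasChi_extSet_empty fun hne => h ?_
            obtain ⟨W, hW⟩ := hne
            obtain ⟨h1, h2, -⟩ := IsExt.eq_of_isIso_P hW h0.1 h0.2 hx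
            change j = k at h1
            change i = k + (m : ZMod N) at h2
            subst h1 h2
            exact ⟨(extSet_dim hW).symm, rfl⟩
        rw [hallTerm_eq_sum x a b hl hm h0.1 h0.2 n'
          (eulerCharC_biUnion_extSet x hα hl hm h0.1 h0.2 n' hn'),
          Finset.sum_eq_single (k + (m : ZMod N), k)]
        · split_ifs with h
          · have : n' (k + (m : ZMod N), k) = 1 := if_pos ⟨h, rfl⟩
            rw [this, Int.cast_one, mul_one]
          · have : n' (k + (m : ZMod N), k) = 0 := if_neg fun h' => h h'.1
            rw [this, Int.cast_zero, mul_zero]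
        · intro p _ hp
          have : n' p = 0 := if_neg fun h' => hp h'.2
          rw [this, Int.cast_zero, mul_zero]
        · simp
      · rw [if_neg h0, ite_self, hallTerm_eq_zero]
        omega
    · rintro ⟨l', m'⟩ hp hne
      rw [if_neg]
      intro h
      apply hne
      have h1 := sum_arc (k + (m' : ZMod N)) l'
      rw [show arc (k + (m' : ZMod N)) l' = α from h, hl] at h1
      rw [Finset.HasAntidiagonal.mem_antidiagonal] at hp
      simp only at hp
      exact Prod.ext h1.symm (by simp only; omega)
    · intro h
      exact absurd (Finset.HasAntidiagonal.mem_antidiagonal.2 hlm) h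
  rw [hallMul_eq, Finset.sum_congr rfl hterm, Finset.sum_comm]
  refine Finset.sum_congr rfl fun p hp => ?_
  rw [Finset.sum_ite_eq, if_pos]
  rw [Finset.mem_Iic, hγ, ← Finset.HasAntidiagonal.mem_antidiagonal.1 hp, add_comm p.1 p.2, arc_add]
  exact fun κ => Nat.le_add_left _ _

/-- Only the type with both subobject and quotient isomorphic to P_{e,p} occurs, so each product is
a(e,p) b(e,p) times the same number, whose value is irrelevant. -/
theorem hallMul_comb_comm_of_eq {p : ℕ} (hp : 0 < p) {e : ZMod N}
    (D : CyclicPair (stdRep x.1) e p e p) :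
    hallMul (comb a) (comb b) γ x = hallMul (comb b) (comb a) γ x := by
  rw [hallMul_eq, hallMul_eq]
  refine Finset.sum_congr rfl fun α _ => ?_
  obtain ⟨l, hl⟩ : ∃ l, ∑ k, α k = l := ⟨_, rfl⟩
  obtain ⟨m, hm⟩ : ∃ m, ∑ k, (γ - α) k = m := ⟨_, rfl⟩
  by_cases h0 : 0 < l ∧ 0 < m
  · have hcl : ∀ i j, (extSet x.1 α i l j m).Nonempty → i = e ∧ l = p ∧ j = e ∧ m = p := by
      rintro i j ⟨W, hW⟩
      rcases D.classify x.2 le_rfl hp hW h0.1 h0.2 with h | h | ⟨k, hk, hk', -⟩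
      · exact h
      · exact h
      · omega
    let n : ZMod N × ZMod N → ℤ := fun q =>
      if q = (e, e) then eulerCharC (extSet x.1 α e l e m) else 0
    have hn : ∀ s : Finset (ZMod N × ZMod N),
        eulerCharC (⋃ q ∈ s, extSet x.1 α q.1 l q.2 m) = ∑ q ∈ s, n q := by
      intro s
      rw [Finset.sum_ite_eq']
      have hU : (⋃ q ∈ s, extSet x.1 α q.1 l q.2 m) =
          if (e, e) ∈ s then extSet x.1 α e l e m else ∅ := by
        ext W
        rw [Set.mem_iUnion₂]
        constructor
        · rintro ⟨⟨i, j⟩, hq, hW⟩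
          obtain ⟨rfl, -, rfl, -⟩ := hcl i j ⟨W, hW⟩
          rwa [if_pos hq]
        · intro hW
          split_ifs at hW with h
          · exact ⟨_, h, hW⟩
          · exact absurd hW (Set.notMem_empty W)
      rw [hU]
      split_ifs
      · rfl
      · exact eulerCharC_empty
    rw [hallTerm_eq_sum x a b hl hm h0.1 h0.2 n hn, hallTerm_eq_sum x b a hl hm h0.1 h0.2 n hn]
    refine Finset.sum_congr rfl fun q _ => ?_
    by_cases hq : q = (e, e)
    · subst hq
      by_cases hne : (extSet x.1 α e l e m).Nonempty
      · obtain ⟨-, rfl, -, rfl⟩ := hcl e e hne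
        ring
      · have : n (e, e) = 0 := by
          refine (if_pos rfl).trans ?_
          rw [Set.not_nonempty_iff_eq_empty.1 hne, eulerCharC_empty]
        rw [this, Int.cast_zero, mul_zero, mul_zero]
    · have : n q = 0 := if_neg hq
      rw [this, Int.cast_zero, mul_zero, mul_zero]
  · rw [hallTerm_eq_zero, hallTerm_eq_zero] <;> omega

/-- The substitution α ↦ γ - α exchanges the first two types of extension, both of Euler
characteristic 1. The third type has no mirror image, but its Euler characteristic is 0. -/
theorem hallMul_comb_comm_of_ne {p q : ℕ} (hqp : q ≤ p) (hq : 0 < q) {e f : ZMod N}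
    (D : CyclicPair (stdRep x.1) e p f q) (hne : e = f → p ≠ q) :
    hallMul (comb a) (comb b) γ x = hallMul (comb b) (comb a) γ x := by
  let T : (ZMod N → ℕ) → ZMod N → ℕ → ZMod N → ℕ → Prop := fun α i l j m => α = arc i l ∧
    ((i = e ∧ l = p ∧ j = f ∧ m = q) ∨ (i = f ∧ l = q ∧ j = e ∧ m = p))
  have hpos : 0 < p := by omega
  -- An extension with these dimensions exists, because the corresponding set has Euler
  -- characteristic 1 and so is not empty.
  have hγ : γ = arc e p + arc f q := by
    have h1 := hasChi_extSet_left x.2 D hqp hq hne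
    by_contra hcon
    have : IsEmpty (extSet x.1 (arc e p) e p f q) := by
      rw [Set.isEmpty_coe_sort, ← Set.not_nonempty_iff_eq_empty]
      exact fun h => hcon (extSet_add h)
    exact one_ne_zero (h1.eulerChar_eq.symm.trans (eulerChar_of_isEmpty _))
  classical
  have hn : ∀ α i l j m, 0 < l → 0 < m →
      HasChi (extSet x.1 α i l j m) (if T α i l j m then 1 else 0) := by
    intro α i l j m hl hm
    split_ifs with h
    · obtain ⟨rfl, ⟨rfl, rfl, rfl, rfl⟩ | ⟨rfl, rfl, rfl, rfl⟩⟩ := h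
      · exact hasChi_extSet_left x.2 D hqp hq hne
      · exact hasChi_extSet_right x.2 D hqp hq hne
    · by_cases hemp : (extSet x.1 α i l j m).Nonempty
      · obtain ⟨W, hW⟩ := hemp
        obtain rfl := extSet_dim hW
        rcases D.classify x.2 hqp hq hW hl hm with h' | h' | ⟨k, hk, hkq, hlk, rfl, rfl, rfl, rfl⟩
        · exact absurd ⟨rfl, Or.inl h'⟩ h
        · exact absurd ⟨rfl, Or.inr h'⟩ h
        · exact hasChi_extSet_shift x.2 D hq hk hkq hlk
      · exact hasChi_extSet_empty hemp
  have hterm : ∀ a b : ZMod N → ℕ → ℂ, ∀ α ≤ γ, hallTerm x (comb a) (comb b) α =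
      ∑ r : ZMod N × ZMod N, a r.1 (∑ k, α k) * b r.2 (∑ k, (γ - α) k) *
        (if T α r.1 (∑ k, α k) r.2 (∑ k, (γ - α) k) then 1 else 0) := by
    intro a b α hα
    by_cases h0 : 0 < ∑ k, α k ∧ 0 < ∑ k, (γ - α) k
    · rw [hallTerm_eq_sum x a b rfl rfl h0.1 h0.2 _ (eulerCharC_biUnion_extSet x hα rfl rfl h0.1 h0.2
        (fun r => if T α r.1 (∑ k, α k) r.2 (∑ k, (γ - α) k) then 1 else 0)
        fun r => hn α r.1 _ r.2 _ h0.1 h0.2)]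
      push_cast
      rfl
    · rw [hallTerm_eq_zero x a b (by omega), Finset.sum_eq_zero]
      intro r _
      rw [if_neg, mul_zero]
      rintro ⟨-, h⟩
      omega
  rw [hallMul_eq, hallMul_eq]
  refine Finset.sum_nbij' (fun α => γ - α) (fun α => γ - α) ?_ ?_ ?_ ?_ ?_
  · intro α _
    exact Finset.mem_Iic.2 tsub_le_self
  · intro α _
    exact Finset.mem_Iic.2 tsub_le_self
  · intro α hα
    exact tsub_tsub_cancel_of_le (Finset.mem_Iic.1 hα)
  · intro α hα
    exact tsub_tsub_cancel_of_le (Finset.mem_Iic.1 hα)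
  · intro α hα
    have hα := Finset.mem_Iic.1 hα
    rw [hterm a b α hα, hterm b a (γ - α) tsub_le_self, tsub_tsub_cancel_of_le hα]
    refine Fintype.sum_equiv (Equiv.prodComm _ _) _ _ ?_
    rintro ⟨i, j⟩
    have hT : T α i (∑ k, α k) j (∑ k, (γ - α) k) ↔ T (γ - α) j (∑ k, (γ - α) k) i (∑ k, α k) := by
      constructor
      · rintro ⟨h1, h2⟩
        refine ⟨?_, by tauto⟩
        rcases h2 with ⟨rfl, h3, rfl, h4⟩ | ⟨rfl, h3, rfl, h4⟩
        · rw [h4, h1, h3, hγ, add_tsub_cancel_left]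
        · rw [h4, h1, h3, hγ, add_tsub_cancel_right]
      · rintro ⟨h1, h2⟩
        refine ⟨?_, by tauto⟩
        have h5 : α = γ - (γ - α) := (tsub_tsub_cancel_of_le hα).symm
        rcases h2 with ⟨rfl, h3, rfl, h4⟩ | ⟨rfl, h3, rfl, h4⟩
        · rw [h4]
          conv_lhs => rw [h5, h1, h3, hγ, add_tsub_cancel_left]
        · rw [h4]
          conv_lhs => rw [h5, h1, h3, hγ, add_tsub_cancel_right]
    change a i (∑ k, α k) * b j (∑ k, (γ - α) k) *
        (if T α i (∑ k, α k) j (∑ k, (γ - α) k) then 1 else 0) =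
      b j (∑ k, (γ - α) k) * a i (∑ k, α k) *
        (if T (γ - α) j (∑ k, (γ - α) k) i (∑ k, α k) then 1 else 0)
    by_cases h : T α i (∑ k, α k) j (∑ k, (γ - α) k)
    · rw [if_pos h, if_pos (hT.1 h)]
      ring
    · rw [if_neg h, if_neg (mt hT.2 h)]
      ring

/-- On representations that are not uniserial the products commute. -/
theorem hallMul_comb_comm (hx : ∀ k n, 0 < n → ¬ x.rep.IsIso (P k n)) :
    hallMul (comb a) (comb b) γ x = hallMul (comb b) (comb a) γ x := by
  by_cases h : ∃ a p b q, 0 < p ∧ 0 < q ∧ Nonempty (CyclicPair (stdRep x.1) a p b q)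
  · have h' : ∃ a p b q, q ≤ p ∧ 0 < q ∧ Nonempty (CyclicPair (stdRep x.1) a p b q) := by
      obtain ⟨e, p, f, q, hp, hq, ⟨D⟩⟩ := h
      rcases le_total q p with hqp | hqp
      · exact ⟨e, p, f, q, hqp, hq, ⟨D⟩⟩
      · exact ⟨f, q, e, p, hqp, hp, ⟨D.swap⟩⟩
    obtain ⟨e, p, f, q, hqp, hq, ⟨D⟩⟩ := h'
    by_cases hne : e = f ∧ p = q
    · obtain ⟨rfl, rfl⟩ := hne
      exact hallMul_comb_comm_of_eq x a b hq D
    · exact hallMul_comb_comm_of_ne x a b hqp hq D fun h1 h2 => hne ⟨h1, h2⟩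
  -- If x is neither uniserial nor a sum of two cyclic subobjects, it is not an extension of
  -- uniserial representations, and both products vanish.
  · have hzero : ∀ a b : ZMod N → ℕ → ℂ, hallMul (comb a) (comb b) γ x = 0 := by
      intro a b
      rw [hallMul_eq]
      refine Finset.sum_eq_zero fun α _ => ?_
      by_cases h0 : 0 < ∑ k, α k ∧ 0 < ∑ k, (γ - α) k
      · rw [hallTerm_eq_sum x a b rfl rfl h0.1 h0.2 (fun _ => 0)]
        · simp
        · intro s
          have : (⋃ p ∈ s, extSet x.1 α p.1 (∑ k, α k) p.2 (∑ k, (γ - α) k)) = ∅ := by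
            simp only [Set.iUnion_eq_empty]
            intro r _
            by_contra hne
            obtain ⟨W, hW⟩ := Set.nonempty_iff_ne_empty.2 hne
            rcases IsExt.exists_cyclicPair x.2 hW h0.1 h0.2 with ⟨k, n, hn, hP⟩ | h'
            · exact hx k n hn hP
            · exact h h'
          rw [this, eulerCharC_empty, Finset.sum_const_zero]
      · exact hallTerm_eq_zero x a b (by omega)
    rw [hzero, hzero]

end Product

end

noncomputable section

set_option linter.unusedSectionVars false

/-! ## The root system of the cyclic quiver -/

namespace CyclicQuiver

variable {N : ℕ} [NeZero N]

theorem eulerForm_eq (α β : ZMod N → ℕ) :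
    eulerForm α β = ∑ k, (α k : ℤ) * ((β k : ℤ) - β (k + 1)) := by
  rw [eulerForm]
  refine Finset.sum_congr rfl fun k _ => ?_
  simp only [eulerMatrix, card_hom, mul_assoc, ← Finset.mul_sum]
  congr 1
  simp [sub_mul, Finset.sum_sub_distrib]

theorem eulerForm_add_left (α α' β : ZMod N → ℕ) :
    eulerForm (α + α') β = eulerForm α β + eulerForm α' β := by
  simp only [eulerForm_eq, Pi.add_apply, Nat.cast_add, add_mul, Finset.sum_add_distrib]

/-- The contributions of consecutive vertices telescope along the arc, leaving its two ends. -/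
theorem eulerForm_arc (i : ZMod N) (l : ℕ) (β : ZMod N → ℕ) :
    eulerForm (arc i l) β = (β i : ℤ) - β (i + (l : ZMod N)) := by
  induction l with
  | zero => simp [arc_zero, eulerForm_eq]
  | succ l ih =>
    rw [arc_succ, eulerForm_add_left, ih, eulerForm_eq, Finset.sum_eq_single (i + (l : ZMod N))]
    · rw [Pi.single_eq_same, Nat.cast_succ, add_assoc]
      push_cast
      ring
    · intro k _ hk
      rw [Pi.single_eq_of_ne hk]
      simp
    · simp

/-- The difference `α_k - α_{k-1}`. -/
def jump (α : ZMod N → ℕ) (k : ZMod N) : ℤ := (α k : ℤ) - α (k - 1)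

theorem jump_add (α β : ZMod N → ℕ) (k : ZMod N) : jump (α + β) k = jump α k + jump β k := by
  simp only [jump, Pi.add_apply]
  push_cast
  ring

theorem jump_imag (n : ℕ) (k : ZMod N) : jump (imag N n) k = 0 := sub_self _

theorem sum_shift {A : Type} [AddCommMonoid A] (f : ZMod N → A) (c : ZMod N) :
    ∑ k, f (k - c) = ∑ k, f k :=
  Fintype.sum_equiv (Equiv.subRight c) _ _ fun _ => rfl

theorem sum_jump (α : ZMod N → ℕ) : ∑ k, jump α k = 0 := by
  simp only [jump, Finset.sum_sub_distrib]
  rw [sum_shift (fun k => (α k : ℤ)) 1, sub_self]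

/-- Written as a sum of squares of jumps, the form is visibly semidefinite with kernel spanned by δ,
and real roots are the vectors with one jump 1 and one jump -1. -/
theorem cartanForm_self (α : ZMod N → ℕ) : cartanForm α α = ∑ k, jump α k ^ 2 := by
  have h1 : cartanForm α α = 2 * eulerForm α α := by
    have h2 : cartanForm α α = eulerForm α α +
        ∑ i, ∑ j, (α i : ℤ) * eulerMatrix (ZMod N) j i * (α j : ℤ) := by
      simp only [cartanForm, cartan, eulerForm, mul_add, add_mul, Finset.sum_add_distrib]
    rw [h2, Finset.sum_comm, two_mul, eulerForm]
    congr 1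
    refine Finset.sum_congr rfl fun j _ => Finset.sum_congr rfl fun i _ => ?_
    ring
  have h3 : ∑ k, (α k : ℤ) * α (k + 1) = ∑ k, (α (k - 1) : ℤ) * α k := by
    rw [← sum_shift _ 1]
    simp
  have h4 : ∑ k, (α (k - 1) : ℤ) ^ 2 = ∑ k, (α k : ℤ) ^ 2 := sum_shift (fun k => (α k : ℤ) ^ 2) 1
  have h5 : ∀ k, jump α k ^ 2 = (α k : ℤ) ^ 2 + (α (k - 1) : ℤ) ^ 2 - 2 * ((α (k - 1) : ℤ) * α k) := by
    intro k
    rw [jump]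
    ring
  rw [h1, Finset.sum_congr rfl fun k _ => h5 k, Finset.sum_sub_distrib, Finset.sum_add_distrib, h4,
    ← Finset.mul_sum, eulerForm_eq, ← h3]
  simp only [mul_sub, Finset.sum_sub_distrib, ← sq]
  ring

theorem jump_single (i k : ZMod N) :
    jump (Pi.single i 1) k = (if k = i then 1 else 0) - if k = i + 1 then 1 else 0 := by
  simp only [jump, Pi.single_apply, sub_eq_iff_eq_add (a := k)]
  push_cast
  rfl

theorem jump_arc (i : ZMod N) (l : ℕ) (k : ZMod N) :
    jump (arc i l) k = (if k = i then 1 else 0) - if k = i + (l : ZMod N) then 1 else 0 := by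
  induction l with
  | zero => simp [arc_zero, jump]
  | succ l ih =>
    rw [arc_succ, jump_add, ih, jump_single, Nat.cast_succ, add_assoc]
    ring

theorem eq_of_jump_eq {α β : ZMod N → ℤ} (h : ∀ k, α k - α (k - 1) = β k - β (k - 1)) (k : ZMod N) :
    α k - β k = α 0 - β 0 := by
  have h1 : ∀ n : ℕ, α n - β n = α 0 - β 0 := by
    intro n
    induction n with
    | zero => simp
    | succ n ih =>
      have := h ((n : ZMod N) + 1)
      rw [add_sub_cancel_right] at this
      rw [Nat.cast_succ, ← ih]
      linarith
  rw [← ZMod.natCast_zmod_val k]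
  exact h1 _

theorem natCast_ne_zero_iff {l : ℕ} : (l : ZMod N) ≠ 0 ↔ ¬ N ∣ l :=
  (ZMod.natCast_eq_zero_iff l N).not

theorem arc_mul (i : ZMod N) (a : ℕ) : arc i (N * a) = imag N a := by
  have hconst : ∀ k, (arc i (N * a) k : ℤ) = arc i (N * a) 0 := by
    intro k
    have := eq_of_jump_eq (α := fun k => (arc i (N * a) k : ℤ)) (β := fun _ => 0) (fun k => by
      rw [sub_self]
      have := jump_arc i (N * a) k
      rw [Nat.cast_mul, ZMod.natCast_self, zero_mul, add_zero, sub_self] at this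
      exact this) k
    simpa using this
  have hsum := sum_arc i (N * a)
  have h0 : arc i (N * a) 0 = a := by
    rw [Finset.sum_congr rfl fun k _ => (Nat.cast_inj (R := ℤ)).1 (hconst k), Finset.sum_const,
      Finset.card_univ, ZMod.card, smul_eq_mul] at hsum
    exact Nat.eq_of_mul_eq_mul_left (Nat.pos_of_ne_zero (NeZero.ne N)) hsum
  funext k
  rw [(Nat.cast_inj (R := ℤ)).1 (hconst k), h0]
  rfl

theorem arc_small (i : ZMod N) {r d : ℕ} (hr : r ≤ N) (hd : d < N) :
    arc i r (i + (d : ZMod N)) = if d < r then 1 else 0 := by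
  rw [arc]
  have h : ∀ m ∈ Finset.range r, i + (m : ZMod N) = i + (d : ZMod N) ↔ m = d := by
    intro m hm
    rw [add_right_inj, ZMod.natCast_eq_natCast_iff', Nat.mod_eq_of_lt hd,
      Nat.mod_eq_of_lt ((Finset.mem_range.1 hm).trans_le hr)]
  rw [Finset.filter_congr h, Finset.filter_eq']
  simp only [Finset.mem_range]
  split_ifs <;> simp

theorem isRealRoot_arc (i : ZMod N) {l : ℕ} (hl : ¬ N ∣ l) : IsRealRoot (arc i l) := by
  have hne : i ≠ i + (l : ZMod N) := by
    rw [Ne, eq_comm, add_eq_left]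
    exact natCast_ne_zero_iff.2 hl
  rw [IsRealRoot, cartanForm_self]
  have h1 : ∀ k, jump (arc i l) k ^ 2 =
      (if k = i then 1 else 0) + if k = i + (l : ZMod N) then 1 else 0 := by
    intro k
    rw [jump_arc]
    by_cases h : k = i
    · subst h
      rw [if_pos rfl, if_neg hne]
      norm_num
    · rw [if_neg h]
      split_ifs <;> norm_num
  simp only [h1, Finset.sum_add_distrib]
  simp

/-- A sum-zero integer vector of norm two is a difference of basis vectors. -/
theorem exists_eq_sub_of_sum_sq {f : ZMod N → ℤ} (h0 : ∑ k, f k = 0) (h2 : ∑ k, f k ^ 2 = 2) :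
    ∃ a b, a ≠ b ∧ ∀ k, f k = (if k = a then 1 else 0) - if k = b then 1 else 0 := by
  have hne : ∃ k, f k ≠ 0 := by
    by_contra hcon
    push Not at hcon
    simp [hcon] at h2
  obtain ⟨a, ha⟩ : ∃ a, 0 < f a := by
    by_contra hcon
    push Not at hcon
    obtain ⟨k, hk⟩ := hne
    exact hk ((Finset.sum_eq_zero_iff_of_nonpos fun k _ => hcon k).1 h0 k (Finset.mem_univ k))
  obtain ⟨b, hb⟩ : ∃ b, f b < 0 := by
    by_contra hcon
    push Not at hcon
    exact ha.ne' ((Finset.sum_eq_zero_iff_of_nonneg fun k _ => hcon k).1 h0 a (Finset.mem_univ a))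
  have hab : a ≠ b := by
    rintro rfl
    omega
  have hbe : b ∈ Finset.univ.erase a := Finset.mem_erase.2 ⟨hab.symm, Finset.mem_univ b⟩
  have hsplit := h2
  rw [← Finset.add_sum_erase _ _ (Finset.mem_univ a), ← Finset.add_sum_erase _ _ hbe] at hsplit
  have hnn : ∀ k ∈ (Finset.univ.erase a).erase b, 0 ≤ f k ^ 2 := fun k _ => sq_nonneg _
  have hr := Finset.sum_nonneg hnn
  -- The two squares are each at least 1 and add up to at most 2; hence nothing is left for the
  -- other vertices.
  have h1 : f a = 1 := by nlinarith
  have h1' : f b = -1 := by nlinarith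
  rw [h1, h1'] at hsplit
  have hz : ∑ k ∈ (Finset.univ.erase a).erase b, f k ^ 2 = 0 := by linarith
  refine ⟨a, b, hab, fun k => ?_⟩
  by_cases hka : k = a
  · subst hka
    rw [if_pos rfl, if_neg hab, h1, sub_zero]
  · by_cases hkb : k = b
    · subst hkb
      rw [if_neg hka, if_pos rfl, h1', zero_sub]
    · rw [if_neg hka, if_neg hkb, sub_zero]
      have := (Finset.sum_eq_zero_iff_of_nonneg hnn).1 hz k
        (Finset.mem_erase.2 ⟨hkb, Finset.mem_erase.2 ⟨hka, Finset.mem_univ k⟩⟩)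
      exact pow_eq_zero_iff two_ne_zero |>.1 this

/-- The jumps determine α up to a multiple of δ. If they are at a and b, the short arc from a to b
misses b, so α_b is the number of full turns to be added. -/
theorem IsRealRoot.exists_arc {α : ZMod N → ℕ} (h : IsRealRoot α) :
    ∃ i l, ¬ N ∣ l ∧ arc i l = α := by
  rw [IsRealRoot, cartanForm_self] at h
  obtain ⟨a, b, hab, hf⟩ := exists_eq_sub_of_sum_sq (sum_jump α) h
  set r := (b - a).val with hr
  have hrb : a + (r : ZMod N) = b := by
    rw [hr, ZMod.natCast_zmod_val, add_sub_cancel]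
  have hrN : r < N := ZMod.val_lt _
  have hconst := eq_of_jump_eq (α := fun k => (α k : ℤ)) (β := fun k => (arc a r k : ℤ)) (fun k => by
    have h1 := hf k
    have h2 := jump_arc a r k
    rw [hrb, ← h1] at h2
    exact h2.symm)
  have hb : (arc a r b : ℤ) = 0 := by
    rw [← hrb, arc_small a hrN.le hrN, if_neg (lt_irrefl r)]
    rfl
  have hcb : (α b : ℤ) - arc a r b = α 0 - arc a r 0 := hconst b
  rw [hb] at hcb
  refine ⟨a, r + N * α b, ?_, ?_⟩
  · rw [← natCast_ne_zero_iff, Nat.cast_add, Nat.cast_mul, ZMod.natCast_self, zero_mul, add_zero,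
      hr, ZMod.natCast_zmod_val, sub_ne_zero]
    exact hab.symm
  · rw [arc_add, arc_mul]
    funext k
    have hk : (α k : ℤ) - arc a r k = α 0 - arc a r 0 := hconst k
    have h3 : (arc a r k : ℤ) + α b = α k := by linarith
    exact_mod_cast h3

theorem arc_injective {i j : ZMod N} {l m : ℕ} (hl : ¬ N ∣ l) (h : arc i l = arc j m) :
    i = j ∧ l = m := by
  have hlm : l = m := by rw [← sum_arc i l, h, sum_arc]
  subst hlm
  refine ⟨?_, rfl⟩
  have h1 := jump_arc i l i
  rw [h, jump_arc, if_pos rfl, if_neg (c := i = i + (l : ZMod N))] at h1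
  · by_contra hne
    rw [if_neg hne] at h1
    split_ifs at h1 <;> omega
  · rw [eq_comm, add_eq_left]
    exact natCast_ne_zero_iff.2 hl

theorem not_isRealRoot_imag (n : ℕ) : ¬ IsRealRoot (imag N n) := by
  rw [IsRealRoot, cartanForm_self]
  simp [jump_imag]

end CyclicQuiver

end

noncomputable section

set_option linter.unusedSectionVars false

/-! ## Loop matrices and the realisation of `𝔫^ε(C_N)` -/

namespace CyclicQuiver

open Polynomial

variable {N : ℕ} [NeZero N]

/-- The visits of the arc to the vertex l steps beyond its end correspond to the multiples of N in
the interval (l, m + l]. The lemma `arc_start_sub` counts from the other end. -/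
theorem arc_end_add (j : ZMod N) (m l : ℕ) :
    arc j m (j + (m : ZMod N) + (l : ZMod N)) + l / N = (m + l) / N := by
  induction m generalizing l with
  | zero => simp [arc_zero]
  | succ m ih =>
    have h1 := ih (l + 1)
    have h2 : j + (m : ZMod N) + ((l + 1 : ℕ) : ZMod N) =
        j + ((m + 1 : ℕ) : ZMod N) + (l : ZMod N) := by
      push_cast
      ring
    have h3 : (j + ((m + 1 : ℕ) : ZMod N) + (l : ZMod N) = j + (m : ZMod N)) ↔ N ∣ l + 1 := by
      rw [← h2, add_eq_left, ZMod.natCast_eq_zero_iff]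
    rw [h2, Nat.succ_div] at h1
    rw [arc_succ, Pi.add_apply, Pi.single_apply, show m + 1 + l = m + (l + 1) by ring, ← h1]
    simp only [h3]
    ring

theorem arc_start_sub (j : ZMod N) (m l : ℕ) :
    arc j m (j - ((l + 1 : ℕ) : ZMod N)) + l / N = (m + l) / N := by
  induction m with
  | zero => simp [arc_zero]
  | succ m ih =>
    have h3 : (j - ((l + 1 : ℕ) : ZMod N) = j + (m : ZMod N)) ↔ N ∣ m + l + 1 := by
      rw [sub_eq_iff_eq_add, eq_comm, add_assoc, add_eq_left, ← Nat.cast_add,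
        ZMod.natCast_eq_zero_iff, add_assoc]
    rw [arc_succ, Pi.add_apply, Pi.single_apply, show m + 1 + l = m + l + 1 by ring, Nat.succ_div,
      ← ih]
    simp only [h3]
    ring

theorem pred_div {l : ℕ} (hl : ¬ N ∣ l + 1) : (l + 1) / N = l / N := by
  rw [Nat.succ_div, if_neg hl, add_zero]

theorem add_natCast_eq_iff {i : ZMod N} {l : ℕ} : i + (l : ZMod N) = i ↔ N ∣ l := by
  rw [add_eq_left, ZMod.natCast_eq_zero_iff]

/-- `ε(α_{i,l}, α_{j,m})` when the second arc ends where the first one starts. -/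
theorem eps_arc_of_end (j : ZMod N) (l m : ℕ) :
    eps N (arc (j + (m : ZMod N)) l) (arc j m) = (-1) ^ (l / N + m / N + (m + l) / N) := by
  have h1 := arc_end_add j m l
  have h2 := arc_end_add j m 0
  simp only [Nat.cast_zero, add_zero, Nat.zero_div] at h2
  rw [eps, eulerForm_arc, h2, ← zpow_natCast]
  have h3 : (arc j m (j + (m : ZMod N) + (l : ZMod N)) : ℤ) = ((m + l) / N : ℕ) - (l / N : ℕ) := by
    rw [← h1]
    push_cast
    ring
  rw [h3, show ((m / N : ℕ) : ℤ) - (((m + l) / N : ℕ) - (l / N : ℕ)) =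
    ((l / N + m / N + (m + l) / N : ℕ) : ℤ) + 2 * (-((m + l) / N : ℕ)) by push_cast; ring,
    zpow_add₀ (by norm_num), zpow_mul]
  norm_num

/-- `ε(α_{i,l}, α_{j,m})` when the first arc ends where the second one starts, and the arcs do not
add up to an imaginary root. -/
theorem eps_arc_of_start (i : ZMod N) {l m : ℕ} (hl : ¬ N ∣ l) (hm : ¬ N ∣ m) (hlm : ¬ N ∣ l + m) :
    eps N (arc i l) (arc (i + (l : ZMod N)) m) = -(-1) ^ (l / N + m / N + (l + m) / N) := by
  have hN : 0 < N := Nat.pos_of_ne_zero (NeZero.ne N)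
  obtain ⟨l, rfl⟩ : ∃ l', l = l' + 1 := Nat.exists_eq_succ_of_ne_zero (by rintro rfl; simp at hl)
  obtain ⟨m, rfl⟩ : ∃ m', m = m' + 1 := Nat.exists_eq_succ_of_ne_zero (by rintro rfl; simp at hm)
  obtain ⟨n, rfl⟩ : ∃ n, N = n + 1 := Nat.exists_eq_succ_of_ne_zero hN.ne'
  have h1 := arc_start_sub (i + ((l + 1 : ℕ) : ZMod (n + 1))) (m + 1) l
  -- Going back N steps returns to the starting vertex, which is visited [m/N] + 1 times since N ∤
  -- m. The extra visit is the source of the minus sign.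
  have h2 := arc_start_sub (i + ((l + 1 : ℕ) : ZMod (n + 1))) (m + 1) n
  rw [add_sub_cancel_right, show m + 1 + l = l + m + 1 by ring,
    ← pred_div (show ¬ n + 1 ∣ l + m + 1 + 1 by rwa [show l + m + 1 + 1 = l + 1 + (m + 1) by ring]), ← pred_div hl] at h1
  rw [ZMod.natCast_self, sub_zero, Nat.div_eq_of_lt (Nat.lt_succ_self n), add_zero,
    show m + 1 + n = m + (n + 1) by ring, Nat.add_div_right _ hN, ← pred_div hm] at h2
  rw [eps, eulerForm_arc, h2, ← zpow_natCast, show l + 1 + (m + 1) = l + m + 1 + 1 by ring, ← h1]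
  set a := arc (i + ((l + 1 : ℕ) : ZMod (n + 1))) (m + 1) i
  set b := (l + 1) / (n + 1)
  set d := (m + 1) / (n + 1)
  rw [show (a : ℤ) - (d.succ : ℕ) = ((b + d + (a + b) : ℕ) : ℤ) + 2 * (-(b + d)) + (-1) by
    push_cast; ring, zpow_add₀ (by norm_num), zpow_add₀ (by norm_num), zpow_mul]
  norm_num

/-- If neither arc starts where the other one ends, no jump of one cancels a jump of the other, so
the squared norm is at least 2 + 2. The sum is then neither a real nor an imaginary root, matching
two matrix units whose products vanish. -/
theorem cartan_add_ge {i j : ZMod N} {l m : ℕ} (hl : ¬ N ∣ l) (hm : ¬ N ∣ m)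
    (h1 : i ≠ j + (m : ZMod N)) (h2 : j ≠ i + (l : ZMod N)) :
    4 ≤ cartanForm (arc i l + arc j m) (arc i l + arc j m) := by
  have ha := isRealRoot_arc i hl
  have hb := isRealRoot_arc j hm
  rw [IsRealRoot, cartanForm_self] at ha hb
  rw [cartanForm_self]
  have h3 : ∀ k, jump (arc i l + arc j m) k ^ 2 =
      jump (arc i l) k ^ 2 + jump (arc j m) k ^ 2 + 2 * (jump (arc i l) k * jump (arc j m) k) := by
    intro k
    rw [jump_add]
    ring
  rw [Finset.sum_congr rfl fun k _ => h3 k, Finset.sum_add_distrib, Finset.sum_add_distrib, ha, hb]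
  have h4 : 0 ≤ ∑ k, 2 * (jump (arc i l) k * jump (arc j m) k) := by
    refine Finset.sum_nonneg fun k _ => ?_
    rw [jump_arc, jump_arc]
    by_cases hki : k = i
    · subst hki
      rw [if_neg h1, if_pos rfl, if_neg fun h => hl (add_natCast_eq_iff.1 h.symm)]
      split_ifs <;> norm_num
    · by_cases hkl : k = i + (l : ZMod N)
      · subst hkl
        rw [if_neg h2.symm]
        split_ifs <;> norm_num
      · rw [if_neg hki, if_neg hkl]
        norm_num
  linarith

variable (N) in
/-- Square matrices, with rows and columns indexed by `ℤ/N`, over the polynomial ring. -/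
abbrev LoopMat : Type := Matrix (ZMod N) (ZMod N) ℂ[X]

/-- The matrix unit of degree `l` from the vertex `i` to the vertex `i + l`. -/
def unit (i : ZMod N) (l : ℕ) : LoopMat N := Matrix.single (i + (l : ZMod N)) i (X ^ l)

theorem unit_mul_unit (i j : ZMod N) (l m : ℕ) :
    unit i l * unit j m = if i = j + (m : ZMod N) then unit j (m + l) else 0 := by
  split_ifs with h
  · subst h
    rw [unit, unit, unit, Matrix.single_mul_single_same, ← pow_add, Nat.cast_add, add_assoc,
      add_comm m l]
  · rw [unit, unit, Matrix.single_mul_single_of_ne _ _ _ _ h]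

/-- The loop matrix attached to a real root. -/
def rootMat (α : {α : ZMod N → ℕ // IsRealRoot α}) : LoopMat N :=
  ((-1 : ℂ) ^ (α.2.exists_arc.choose_spec.choose / N)) •
    unit α.2.exists_arc.choose α.2.exists_arc.choose_spec.choose

theorem rootMat_arc (i : ZMod N) {l : ℕ} (hl : ¬ N ∣ l) :
    rootMat ⟨arc i l, isRealRoot_arc i hl⟩ = ((-1 : ℂ) ^ (l / N)) • unit i l := by
  have h := (isRealRoot_arc i hl).exists_arc.choose_spec.choose_spec
  obtain ⟨h1, h2⟩ := arc_injective h.1 h.2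
  have h3 : ∀ i' l', i' = i → l' = l →
      ((-1 : ℂ) ^ (l' / N)) • unit i' l' = ((-1 : ℂ) ^ (l / N)) • unit i l := by
    rintro _ _ rfl rfl
    rfl
  exact h3 _ _ h1 h2

/-- The loop matrix attached to `h(n)`, for `h ∈ ℂ[I]`. -/
def diagMat (n : ℕ) : (ZMod N → ℂ) →ₗ[ℂ] LoopMat N where
  toFun h := ((-1 : ℂ) ^ (n + 1)) • Matrix.diagonal fun k => C (h k - h (k - 1)) * X ^ (n * N)
  map_add' h h' := by
    rw [← smul_add, Matrix.diagonal_add]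
    congr 2
    funext k
    simp only [Pi.add_apply, ← add_mul, ← C_add]
    congr 2
    ring
  map_smul' c h := by
    rw [RingHom.id_apply, smul_comm c, ← Matrix.diagonal_smul c]
    congr 2
    funext k
    simp only [Pi.smul_apply, smul_eq_mul, ← mul_sub, C_mul, smul_eq_C_mul, mul_assoc]

theorem deltaLine_le_ker_diagMat (n : ℕ) : deltaLine N ≤ LinearMap.ker (diagMat (N := N) n) := by
  rw [deltaLine, Submodule.span_singleton_le_iff_mem, LinearMap.mem_ker]
  simp [diagMat]

/-- The loop matrices attached to the elements of degree `nδ`. -/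
def imagMat (n : ℕ+) : ((ZMod N → ℂ) ⧸ deltaLine N) →ₗ[ℂ] LoopMat N :=
  (deltaLine N).liftQ (diagMat n) (deltaLine_le_ker_diagMat n)

variable (N) in
/-- The realisation of `𝔫^ε(C_N)` by loop matrices. -/
def loopMap : NEps N →ₗ[ℂ] LoopMat N :=
  (Finsupp.linearCombination ℂ rootMat).coprod (Finsupp.lsum ℂ imagMat)

theorem loopMap_apply (x : NEps N) :
    loopMap N x = (x.1.sum fun α a => a • rootMat α) + x.2.sum fun n h => imagMat n h := by
  rfl

theorem loopMap_eTil_arc (i : ZMod N) {l : ℕ} (hl : ¬ N ∣ l) :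
    loopMap N (eTil N (arc i l)) = ((-1 : ℂ) ^ (l / N)) • unit i l := by
  rw [eTil, dif_pos (isRealRoot_arc i hl), loopMap_apply, ← rootMat_arc i hl]
  simp

theorem loopMap_imagIncl (n : ℕ+) (h : (ZMod N → ℂ) ⧸ deltaLine N) :
    loopMap N (imagIncl N n h) = imagMat n h := by
  rw [loopMap_apply]
  simp [imagIncl]

theorem loopMap_hEl (h : ZMod N → ℂ) (n : ℕ+) : loopMap N (hEl N h n) = diagMat n h := by
  rw [hEl, loopMap_imagIncl]
  rfl

end CyclicQuiver

end

noncomputable section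

set_option linter.unusedSectionVars false

/-! ## The realisation is a homomorphism -/

namespace CyclicQuiver

open Polynomial

variable {N : ℕ} [NeZero N]

attribute [local instance] LieRing.ofAssociativeRing

theorem neg_one_pow_mul_smul {M : Type} [AddCommGroup M] [Module ℂ M] (a b : ℕ) (x : M) :
    ((-1 : ℂ) ^ (a + b)) • ((-1 : ℂ) ^ b) • x = ((-1 : ℂ) ^ a) • x := by
  rw [smul_smul, pow_add, mul_assoc, ← mul_pow, neg_one_mul, neg_neg, one_pow, mul_one]

theorem arc_add_arc (i : ZMod N) (l m : ℕ) :
    arc i l + arc (i + (l : ZMod N)) m = arc i (l + m) := (arc_add i l m).symm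

/-- The cases are those of the commutator: both products nonzero (the sum is imaginary), exactly one
nonzero (the sum is a real root), or none (the sum is not a root). -/
theorem loopMap_bracketEE {i j : ZMod N} {l m : ℕ} (hl : ¬ N ∣ l) (hm : ¬ N ∣ m) :
    loopMap N (bracketEE N (arc i l) (arc j m)) =
      ((-1 : ℂ) ^ (l / N + m / N)) • ⁅unit i l, unit j m⁆ := by
  rw [Ring.lie_def, unit_mul_unit, unit_mul_unit]
  by_cases h1 : i = j + (m : ZMod N)
  · have hsum : arc i l + arc j m = arc j (m + l) := by
      rw [add_comm, h1, arc_add_arc]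
    rw [if_pos h1]
    by_cases h2 : N ∣ m + l
    · obtain ⟨n, hn⟩ := h2
      have hn0 : 0 < n := by
        rcases Nat.eq_zero_or_pos n with rfl | h
        · rw [mul_zero] at hn
          rw [(Nat.add_eq_zero_iff.1 hn).1] at hm
          exact absurd (dvd_zero N) hm
        · exact h
      have h3 : j = i + (l : ZMod N) := by
        rw [h1, add_assoc, ← Nat.cast_add, hn, Nat.cast_mul, ZMod.natCast_self, zero_mul, add_zero]
      have hsum' : arc i l + arc j m = imag N n := by rw [hsum, hn, arc_mul]
      have hex : ∃ k : ℕ+, arc i l + arc j m = imag N k := ⟨⟨n, hn0⟩, hsum'⟩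
      -- The multiple of δ chosen in the definition of the bracket is recovered from any of its
      -- coordinates.
      have hch : (hex.choose : ℕ) = n := by
        exact (congrFun (hsum'.symm.trans hex.choose_spec) 0).symm
      rw [if_pos h3, bracketEE, if_neg (by rw [hsum']; exact not_isRealRoot_imag n), dif_pos hex,
        map_smul, loopMap_hEl, hch]
      have heps := eps_arc_of_end j l m
      rw [← h1, hn, Nat.mul_div_cancel_left _ (Nat.pos_of_ne_zero (NeZero.ne N))] at heps
      rw [heps, diagMat, LinearMap.coe_mk, AddHom.coe_mk, pow_succ, mul_neg_one, neg_smul, smul_neg,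
        neg_one_pow_mul_smul, ← smul_neg]
      congr 1
      have hl' : ((l + m : ℕ) : ZMod N) = 0 := by
        rw [add_comm, hn, Nat.cast_mul, ZMod.natCast_self, zero_mul]
      have hij : i ≠ j := by
        rw [h3]
        exact fun h => hl (add_natCast_eq_iff.1 h.symm)
      rw [unit, unit, add_comm m l, hl', add_zero, add_zero, add_comm l m, hn, ← neg_sub, neg_inj]
      ext1 a b
      have hj : ((arc i l a : ℂ) - arc i l (a - 1)) =
          (if a = i then 1 else 0) - if a = j then 1 else 0 := by
        rw [h3]
        have := congrArg (Int.cast (R := ℂ)) (jump_arc i l a)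
        rw [jump] at this
        push_cast at this
        exact this
      simp only []
      rw [Matrix.diagonal_apply, Matrix.sub_apply, Matrix.single_apply, Matrix.single_apply,
        mul_comm n N, hj]
      by_cases hab : a = b
      · subst hab
        rw [if_pos rfl]
        by_cases hai : a = i
        · subst hai
          simp [hij, hij.symm]
        · by_cases haj : a = j
          · subst haj
            simp [hij, hij.symm]
          · simp [hai, haj, Ne.symm hai, Ne.symm haj]
      · rw [if_neg hab, if_neg fun h => hab (h.1.symm.trans h.2),
          if_neg fun h => hab (h.1.symm.trans h.2), sub_zero]
    · have h3 : j ≠ i + (l : ZMod N) := by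
        rw [h1, add_assoc, ← Nat.cast_add]
        exact fun h => h2 (add_natCast_eq_iff.1 h.symm)
      have heps := eps_arc_of_end j l m
      rw [← h1] at heps
      rw [if_neg h3, sub_zero, bracketEE, if_pos (by rw [hsum]; exact isRealRoot_arc j h2), map_smul,
        hsum, loopMap_eTil_arc j h2, heps, neg_one_pow_mul_smul]
  · rw [if_neg h1]
    by_cases h2 : j = i + (l : ZMod N)
    · have h3 : ¬ N ∣ l + m := by
        intro h3
        rw [← add_natCast_eq_iff (i := i), Nat.cast_add, ← add_assoc, ← h2] at h3
        exact h1 h3.symm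
      rw [if_pos h2, bracketEE, h2, arc_add_arc, if_pos (isRealRoot_arc i h3), map_smul,
        loopMap_eTil_arc i h3, eps_arc_of_start i hl hm h3, neg_smul, neg_one_pow_mul_smul, zero_sub,
        smul_neg]
    · have h4 := cartan_add_ge hl hm h1 h2
      rw [if_neg h2, sub_zero, smul_zero, bracketEE, if_neg, dif_neg, map_zero]
      · rintro ⟨k, hk⟩
        rw [hk, cartanForm_self] at h4
        simp [jump_imag] at h4
      · intro h
        rw [IsRealRoot] at h
        omega

/-- Summation by parts moves the jumps from the arc to h. The result is, up to sign, the difference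
of two diagonal entries by which the matrix of h commutes past a matrix unit. -/
theorem cartanLin_arc (h : ZMod N → ℂ) (j : ZMod N) (m : ℕ) :
    cartanLin N (arc j m) h =
      (h j - h (j - 1)) - (h (j + (m : ZMod N)) - h (j + (m : ZMod N) - 1)) := by
  have h1 : ∀ i, ∑ k, (cartan (ZMod N) i k : ℂ) * (arc j m k : ℂ) =
      (jump (arc j m) i - jump (arc j m) (i + 1) : ℤ) := by
    intro i
    have e2 : ∀ k : ZMod N, (i = k + 1) = (k = i - 1) := fun k => by
      rw [eq_sub_iff_add_eq, eq_comm (a := i)]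
    simp only [cartan, eulerMatrix, card_hom, jump, e2, add_sub_cancel_right]
    push_cast
    simp only [add_mul, sub_mul, Finset.sum_add_distrib, Finset.sum_sub_distrib, ite_mul, one_mul,
      zero_mul, Finset.sum_ite_eq, Finset.sum_ite_eq', Finset.mem_univ, if_true]
    ring
  rw [cartanLin]
  simp only [LinearMap.sum_apply, LinearMap.smul_apply, LinearMap.proj_apply, smul_eq_mul, h1]
  have h2 : ∑ i, ((jump (arc j m) (i + 1) : ℤ) : ℂ) * h i =
      ∑ i, ((jump (arc j m) i : ℤ) : ℂ) * h (i - 1) := by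
    rw [← sum_shift (fun i => ((jump (arc j m) (i + 1) : ℤ) : ℂ) * h i) 1]
    simp
  push_cast
  simp only [sub_mul, Finset.sum_sub_distrib]
  rw [h2, ← Finset.sum_sub_distrib]
  simp only [jump_arc, ← mul_sub]
  push_cast
  simp only [sub_mul, Finset.sum_sub_distrib, ite_mul, one_mul, zero_mul, Finset.sum_ite_eq',
    Finset.mem_univ, if_true]

theorem loopMap_bracketHE (n : ℕ+) (h : (ZMod N → ℂ) ⧸ deltaLine N) (j : ZMod N) {m : ℕ}
    (hm : ¬ N ∣ m) : loopMap N (bracketHE N n h (arc j m)) =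
      ((-1 : ℂ) ^ (m / N)) • ⁅imagMat n h, unit j m⁆ := by
  obtain ⟨h, rfl⟩ := Submodule.Quotient.mk_surjective _ h
  have hN := Nat.pos_of_ne_zero (NeZero.ne N)
  have hadd : arc j m + imag N n = arc j (m + N * n) := by
    rw [← arc_add_arc, arc_mul]
  -- δ is a closed arc, so its two ends contribute the same value to the Euler form and no sign
  -- arises.
  have heps : eps N (imag N n) (arc j m) = 1 := by
    rw [eps, ← arc_mul j, eulerForm_arc, Nat.cast_mul, ZMod.natCast_self, zero_mul, add_zero,
      sub_self, zpow_zero]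
  have hdvd : ¬ N ∣ m + N * n := fun h => hm ((Nat.dvd_add_left (dvd_mul_right N n)).1 h)
  have hdiag : imagMat n (Submodule.Quotient.mk h) = diagMat n h := rfl
  rw [bracketHE, heps, one_mul, Submodule.liftQ_apply, map_smul, hadd, loopMap_eTil_arc j hdvd,
    cartanLin_arc, Nat.add_mul_div_left _ _ hN, hdiag, diagMat, LinearMap.coe_mk, AddHom.coe_mk,
    smul_lie, smul_smul, smul_smul, ← pow_add]
  have h0 : ((m + N * n : ℕ) : ZMod N) = m := by
    rw [Nat.cast_add, Nat.cast_mul, ZMod.natCast_self, zero_mul, add_zero]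
  have h1 : ⁅Matrix.diagonal fun k => C (h k - h (k - 1)) * (X : ℂ[X]) ^ ((n : ℕ) * N), unit j m⁆ =
      (h (j + (m : ZMod N)) - h (j + (m : ZMod N) - 1) - (h j - h (j - 1))) • unit j (m + N * n) := by
    rw [Ring.lie_def, unit, unit, h0]
    ext1 a b
    rw [Matrix.sub_apply, Matrix.diagonal_mul, Matrix.mul_diagonal, Matrix.smul_apply,
      Matrix.single_apply, Matrix.single_apply]
    split_ifs with hab
    · obtain ⟨rfl, rfl⟩ := hab
      rw [smul_eq_C_mul, pow_add, mul_comm N]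
      simp only [C_sub]
      ring
    · simp
  rw [h1, smul_smul]
  congr 1
  ring

theorem imagMat_commute (n n' : ℕ+) (h h' : (ZMod N → ℂ) ⧸ deltaLine N) :
    ⁅imagMat n h, imagMat n' h'⁆ = 0 := by
  obtain ⟨h, rfl⟩ := Submodule.Quotient.mk_surjective _ h
  obtain ⟨h', rfl⟩ := Submodule.Quotient.mk_surjective _ h'
  have hdiag : ∀ (n : ℕ+) (h : ZMod N → ℂ),
      imagMat n (Submodule.Quotient.mk h) = diagMat n h := fun _ _ => rfl
  rw [hdiag, hdiag, diagMat, diagMat, LinearMap.coe_mk, AddHom.coe_mk, LinearMap.coe_mk,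
    AddHom.coe_mk, smul_lie, lie_smul, Ring.lie_def, Matrix.diagonal_mul_diagonal,
    Matrix.diagonal_mul_diagonal, sub_eq_zero.2, smul_zero, smul_zero]
  congr 1
  funext k
  ring

theorem loopMap_bracketEE' (α β : {α : ZMod N → ℕ // IsRealRoot α}) :
    loopMap N (bracketEE N α.1 β.1) = ⁅rootMat α, rootMat β⁆ := by
  obtain ⟨α, hα⟩ := α
  obtain ⟨β, hβ⟩ := β
  obtain ⟨i, l, hl, rfl⟩ := hα.exists_arc
  obtain ⟨j, m, hm, rfl⟩ := hβ.exists_arc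
  rw [loopMap_bracketEE hl hm, rootMat_arc i hl, rootMat_arc j hm, smul_lie, lie_smul, smul_smul,
    pow_add]

theorem loopMap_bracketHE' (n : ℕ+) (h : (ZMod N → ℂ) ⧸ deltaLine N)
    (β : {α : ZMod N → ℕ // IsRealRoot α}) :
    loopMap N (bracketHE N n h β.1) = ⁅imagMat n h, rootMat β⁆ := by
  obtain ⟨β, hβ⟩ := β
  obtain ⟨j, m, hm, rfl⟩ := hβ.exists_arc
  rw [loopMap_bracketHE n h j hm, rootMat_arc j hm, lie_smul]

theorem loopMap_bracketEps (x y : NEps N) :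
    loopMap N (bracketEps N x y) = ⁅loopMap N x, loopMap N y⁆ := by
  rw [loopMap_apply x, loopMap_apply y, bracketEps, map_sub, map_add]
  simp only [Finsupp.sum, map_sum, map_smul, loopMap_bracketEE', loopMap_bracketHE', add_lie, lie_add,
    sum_lie, lie_sum, imagMat_commute, smul_lie, lie_smul, Finset.sum_const_zero]
  have h1 : ∀ (n : ℕ+) (α : {α : ZMod N → ℕ // IsRealRoot α}),
      x.1 α • ⁅rootMat α, imagMat n (y.2 n)⁆ = -(x.1 α • ⁅imagMat n (y.2 n), rootMat α⁆) := by
    intro n α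
    rw [← smul_neg, lie_skew]
  simp only [smul_add, Finset.sum_add_distrib, Finset.smul_sum, h1, Finset.sum_neg_distrib, add_zero,
    smul_smul, ← sub_eq_add_neg]
  rw [Finset.sum_comm (s := x.1.support), Finset.sum_comm (s := x.2.support)]
  simp only [mul_comm]

end CyclicQuiver

end

noncomputable section

set_option linter.unusedSectionVars false

/-! ## Symbols of loop matrices, and the map to the Hall algebra -/

namespace CyclicQuiver

open Polynomial

variable {N : ℕ} [NeZero N]

attribute [local instance] LieRing.ofAssociativeRing

/-- The coefficient of `unit i l` in a loop matrix. -/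
def symb (i : ZMod N) (l : ℕ) : LoopMat N →ₗ[ℂ] ℂ where
  toFun A := (A (i + (l : ZMod N)) i).coeff l
  map_add' A B := by simp
  map_smul' c A := by simp

theorem symb_apply (i : ZMod N) (l : ℕ) (A : LoopMat N) :
    symb i l A = (A (i + (l : ZMod N)) i).coeff l := rfl

theorem symb_unit (i j : ZMod N) (l m : ℕ) :
    symb i l (unit j m) = if j = i ∧ m = l then 1 else 0 := by
  rw [symb_apply, unit, Matrix.single_apply]
  by_cases h : j = i ∧ m = l
  · obtain ⟨rfl, rfl⟩ := h
    simp
  · rw [if_neg h]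
    split_ifs with h'
    · rw [coeff_X_pow, if_neg fun e => h ⟨h'.2, e.symm⟩]
    · simp

theorem symb_diagMat (i : ZMod N) (l n : ℕ) (h : ZMod N → ℂ) :
    symb i l (diagMat n h) = if l = n * N then (-1) ^ (n + 1) * (h i - h (i - 1)) else 0 := by
  change symb i l (((-1 : ℂ) ^ (n + 1)) •
    Matrix.diagonal fun k => C (h k - h (k - 1)) * (X : ℂ[X]) ^ (n * N)) = _
  rw [map_smul, symb_apply, smul_eq_mul, Matrix.diagonal_apply]
  split_ifs with h1 h2 h2
  · rw [coeff_C_mul, coeff_X_pow, if_pos h2, mul_one, h1]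
  · rw [coeff_C_mul, coeff_X_pow, if_neg h2, mul_zero, mul_zero]
  · exact absurd (add_natCast_eq_iff.2 (h2 ▸ dvd_mul_left N n)) h1
  · rw [coeff_zero, mul_zero]

theorem symb_rootMat (i : ZMod N) {l : ℕ} (hl : ¬ N ∣ l) (α : {α : ZMod N → ℕ // IsRealRoot α}) :
    symb i l (rootMat α) = if α = ⟨arc i l, isRealRoot_arc i hl⟩ then (-1) ^ (l / N) else 0 := by
  obtain ⟨α, hα⟩ := α
  obtain ⟨j, m, hm, rfl⟩ := hα.exists_arc
  rw [rootMat_arc j hm, map_smul, symb_unit, smul_eq_mul]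
  by_cases h : j = i ∧ m = l
  · obtain ⟨rfl, rfl⟩ := h
    simp
  · rw [if_neg h, if_neg fun e => h (arc_injective hm (Subtype.ext_iff.1 e)), mul_zero]

theorem symb_rootMat_mul (i : ZMod N) (n : ℕ) (α : {α : ZMod N → ℕ // IsRealRoot α}) :
    symb i (n * N) (rootMat α) = 0 := by
  obtain ⟨α, hα⟩ := α
  obtain ⟨j, m, hm, rfl⟩ := hα.exists_arc
  rw [rootMat_arc j hm, map_smul, symb_unit, smul_eq_mul, if_neg, mul_zero]
  rintro ⟨-, rfl⟩
  exact hm (dvd_mul_left N n)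

theorem imagMat_mk (n : ℕ+) (h : ZMod N → ℂ) :
    imagMat n (Submodule.Quotient.mk h) = diagMat n h := rfl

theorem symb_loopMap (i : ZMod N) {l : ℕ} (hl : ¬ N ∣ l) (x : NEps N) :
    symb i l (loopMap N x) = (-1) ^ (l / N) * x.1 ⟨arc i l, isRealRoot_arc i hl⟩ := by
  have h : ∀ (n : ℕ+) (h : (ZMod N → ℂ) ⧸ deltaLine N), symb i l (imagMat n h) = 0 := by
    intro n h
    obtain ⟨h, rfl⟩ := Submodule.Quotient.mk_surjective _ h
    rw [imagMat_mk, symb_diagMat, if_neg]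
    rintro rfl
    exact hl (dvd_mul_left N n)
  rw [loopMap_apply]
  simp only [Finsupp.sum, map_add, map_sum, map_smul, symb_rootMat i hl, h, Finset.sum_const_zero,
    add_zero, smul_eq_mul, mul_ite, mul_zero, Finset.sum_ite_eq', Finsupp.mem_support_iff]
  split_ifs with h0
  · exact mul_comm _ _
  · rw [not_not.1 h0, mul_zero]

theorem symb_loopMap_mul (i : ZMod N) (n : ℕ+) (x : NEps N) :
    symb i (n * N) (loopMap N x) = symb i (n * N) (imagMat n (x.2 n)) := by
  rw [loopMap_apply, map_add]
  simp only [Finsupp.sum, map_sum, map_smul, symb_rootMat_mul, smul_zero, Finset.sum_const_zero,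
    zero_add]
  refine Finset.sum_eq_single n (fun m _ hm => ?_) fun hn => ?_
  · obtain ⟨h, hh⟩ := Submodule.Quotient.mk_surjective _ (x.2 m)
    rw [← hh, imagMat_mk, symb_diagMat, if_neg]
    intro e
    exact hm (PNat.coe_injective (Nat.eq_of_mul_eq_mul_right (Nat.pos_of_ne_zero (NeZero.ne N)) e.symm))
  · rw [Finsupp.notMem_support_iff.1 hn, map_zero, map_zero]

theorem eq_const_of_eq_shift {h : ZMod N → ℂ} (hh : ∀ k, h k = h (k - 1)) (k : ZMod N) :
    h k = h 0 := by
  have h1 : ∀ n : ℕ, h n = h 0 := by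
    intro n
    induction n with
    | zero => simp
    | succ n ih => rw [hh, Nat.cast_succ, add_sub_cancel_right, ih]
  rw [← ZMod.natCast_zmod_val k]
  exact h1 _

/-- Coefficients in degrees prime to the imaginary ones, that is N ∤ l, recover the real root part.
In degree nN they are ± (h_i - h_{i-1}), which vanish for all i only if h is constant, i.e. lies in
ℂδ. -/
theorem loopMap_injective : Function.Injective (loopMap N) := by
  rw [injective_iff_map_eq_zero]
  intro x hx
  refine Prod.ext (Finsupp.ext fun α => ?_) (Finsupp.ext fun n => ?_)
  · obtain ⟨α, hα⟩ := α
    obtain ⟨i, l, hl, rfl⟩ := hα.exists_arc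
    have := symb_loopMap i hl x
    rw [hx, map_zero] at this
    exact (mul_eq_zero.1 this.symm).resolve_left (pow_ne_zero _ (by norm_num))
  · obtain ⟨h, hh⟩ := Submodule.Quotient.mk_surjective _ (x.2 n)
    have h1 : ∀ i, h i = h (i - 1) := by
      intro i
      have := symb_loopMap_mul i n x
      rw [hx, map_zero, ← hh, imagMat_mk, symb_diagMat, if_pos rfl] at this
      exact sub_eq_zero.1 ((mul_eq_zero.1 this.symm).resolve_left (pow_ne_zero _ (by norm_num)))
    change x.2 n = 0
    rw [← hh, Submodule.Quotient.mk_eq_zero, deltaLine, Submodule.mem_span_singleton]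
    refine ⟨h 0, funext fun k => ?_⟩
    rw [eq_const_of_eq_shift h1 k, Pi.smul_apply, smul_eq_mul, mul_one]

variable (N) in
/-- The loop matrices that are combinations of the `unit i l` with `l ≥ 1`. -/
def gradedMat : Submodule ℂ (LoopMat N) where
  carrier := {A | ∀ i' i l, (A i' i).coeff l ≠ 0 → i' = i + (l : ZMod N) ∧ l ≠ 0}
  zero_mem' := fun i' i l h => by simp at h
  add_mem' {A B} hA hB i' i l h := by
    by_contra hcon
    rw [Matrix.add_apply, coeff_add, not_not.1 fun h => hcon (hA i' i l h),
      not_not.1 fun h => hcon (hB i' i l h), add_zero] at h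
    exact h rfl
  smul_mem' c A hA i' i l h := hA i' i l fun h0 => h (by
    rw [Matrix.smul_apply, coeff_smul, h0, smul_zero])

theorem unit_mem_gradedMat (i : ZMod N) {l : ℕ} (hl : l ≠ 0) : unit i l ∈ gradedMat N := by
  intro a b m h
  rw [unit, Matrix.single_apply] at h
  split_ifs at h with h1
  · rw [coeff_X_pow] at h
    split_ifs at h with h2
    · rw [h2, ← h1.2]
      exact ⟨h1.1.symm, hl⟩
    · exact absurd rfl h
  · exact absurd (coeff_zero m) h

theorem loopMap_mem_gradedMat (x : NEps N) : loopMap N x ∈ gradedMat N := by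
  rw [loopMap_apply]
  refine add_mem (sum_mem fun α _ => Submodule.smul_mem _ _ ?_) (sum_mem fun n _ => ?_)
  · refine Submodule.smul_mem _ _ (unit_mem_gradedMat _ ?_)
    intro h0
    have := α.2.exists_arc.choose_spec.choose_spec.1
    rw [h0] at this
    exact this (dvd_zero N)
  · obtain ⟨h, hh⟩ := Submodule.Quotient.mk_surjective _ (x.2 n)
    change imagMat n (x.2 n) ∈ _
    rw [← hh, imagMat_mk, diagMat]
    refine Submodule.smul_mem _ _ fun a b m hm => ?_
    rw [Matrix.diagonal_apply] at hm
    split_ifs at hm with hab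
    · rw [coeff_C_mul, coeff_X_pow] at hm
      split_ifs at hm with h2
      · rw [h2, hab, eq_comm, add_natCast_eq_iff]
        exact ⟨dvd_mul_left N n, (Nat.mul_pos n.2 (Nat.pos_of_ne_zero (NeZero.ne N))).ne'⟩
      · exact absurd (mul_zero _) hm
    · exact absurd (coeff_zero m) hm

/-- In a graded matrix the degree of an entry fixes its target vertex, so a single intermediate
vertex survives. This is the same formula as in `hallMul_comb_uniserial`. -/
theorem symb_mul (A : LoopMat N) {B : LoopMat N} (hB : B ∈ gradedMat N) (k : ZMod N) (n : ℕ) :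
    symb k n (A * B) = ∑ p ∈ Finset.HasAntidiagonal.antidiagonal n,
      symb (k + (p.2 : ZMod N)) p.1 A * symb k p.2 B := by
  rw [symb_apply, Matrix.mul_apply, finsetSum_coeff]
  simp only [coeff_mul]
  rw [Finset.sum_comm]
  refine Finset.sum_congr rfl fun p hp => ?_
  rw [Finset.sum_eq_single (k + (p.2 : ZMod N)), symb_apply, symb_apply, add_assoc, ← Nat.cast_add,
    add_comm p.2, Finset.HasAntidiagonal.mem_antidiagonal.1 hp]
  · intro j _ hj
    rw [not_not.1 fun h => hj (hB j k p.2 h).1, mul_zero]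
  · simp

theorem symb_zero {A : LoopMat N} (hA : A ∈ gradedMat N) (k : ZMod N) : symb k 0 A = 0 :=
  not_not.1 fun h => (hA _ _ _ h).2 rfl

variable (N) in
/-- The combination of the functions `E_{i,l}` with the same coefficients as a loop matrix. -/
def hallMap : LoopMat N →ₗ[ℂ] HallFun (ZMod N) where
  toFun A := comb fun i l => symb i l A
  map_add' A B := by
    funext α y
    simp only [comb, map_add, add_mul, Finset.sum_add_distrib, Pi.add_apply]
    split_ifs <;> simp
  map_smul' c A := by
    funext α y
    simp only [comb, map_smul, smul_eq_mul, Finset.mul_sum, Pi.smul_apply, RingHom.id_apply,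
      mul_ite, mul_zero, mul_assoc]

theorem hallMap_apply (A : LoopMat N) : hallMap N A = comb fun i l => symb i l A := rfl

theorem sum_of_isIso_P {α : ZMod N → ℕ} {y : NilSpace α} {i : ZMod N} {l : ℕ}
    (h : y.rep.IsIso (P i l)) : ∑ k, α k = l := by
  have h1 : y.rep.dim = α := by
    funext k
    exact Module.finrank_fin_fun ℂ
  rw [← h1, h.dim_eq, P_dim, sum_arc]

/-- On uniserial representations convolution is the matrix product; on all others the two
convolutions agree and both sides vanish. The map need not be multiplicative, only compatible with
commutators. Gradedness removes the degree-zero terms, which have no counterpart among the E_{i,l}.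
-/
theorem hallMap_lie {A B : LoopMat N} (hA : A ∈ gradedMat N) (hB : B ∈ gradedMat N) :
    hallMap N ⁅A, B⁆ = hallBracket (hallMap N A) (hallMap N B) := by
  have key : ∀ A B : LoopMat N, A ∈ gradedMat N → B ∈ gradedMat N → ∀ (k : ZMod N) (n : ℕ),
      (∑ p ∈ Finset.HasAntidiagonal.antidiagonal n, if 0 < p.1 ∧ 0 < p.2 then
        symb (k + (p.2 : ZMod N)) p.1 A * symb k p.2 B else 0) = symb k n (A * B) := by
    intro A B hA hB k n
    rw [symb_mul A hB]
    refine Finset.sum_congr rfl fun p _ => ?_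
    split_ifs with h
    · rfl
    · rcases Nat.eq_zero_or_pos p.1 with h1 | h1
      · rw [h1, symb_zero hA, zero_mul]
      · rw [Nat.eq_zero_of_not_pos fun h2 => h ⟨h1, h2⟩, symb_zero hB, mul_zero]
  funext γ x
  rw [hallBracket, Pi.sub_apply, Pi.sub_apply, hallMap_apply, hallMap_apply, hallMap_apply]
  by_cases hx : ∃ k n, 0 < n ∧ x.rep.IsIso (P k n)
  · obtain ⟨k, n, hn, hx⟩ := hx
    rw [comb_of_isIso _ hn (sum_of_isIso_P hx) hx, hallMul_comb_uniserial x _ _ hx,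
      hallMul_comb_uniserial x _ _ hx, key A B hA hB, key B A hB hA, Ring.lie_def, map_sub]
  · push Not at hx
    rw [hallMul_comb_comm x _ _ hx, sub_self]
    by_contra hne
    obtain ⟨h1, i, h2⟩ := exists_isIso_of_comb_ne_zero hne
    exact hx _ _ h1 h2

theorem hallMap_unit (i : ZMod N) {l : ℕ} (hl : l ≠ 0) : hallMap N (unit i l) = E i l := by
  rw [hallMap_apply]
  funext α y
  by_cases hy : ∃ j, 0 < ∑ k, α k ∧ y.rep.IsIso (P j (∑ k, α k))
  · obtain ⟨j, hj, hy⟩ := hy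
    rw [comb_of_isIso _ hj rfl hy, symb_unit, E, charFun]
    by_cases h : i = j ∧ l = ∑ k, α k
    · rw [if_pos h, if_pos]
      rwa [h.1, h.2]
    · rw [if_neg h, if_neg]
      intro h'
      exact h (QRep.eq_of_isIso_P (Nat.pos_of_ne_zero hl) h' hy)
  · rw [E, charFun, if_neg]
    · by_contra hne
      obtain ⟨h1, j, h2⟩ := exists_isIso_of_comb_ne_zero hne
      exact hy ⟨j, h1, h2⟩
    · intro h
      have h1 := sum_of_isIso_P h
      refine hy ⟨i, ?_, ?_⟩
      · rw [h1]
        exact Nat.pos_of_ne_zero hl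
      · rwa [h1]

end CyclicQuiver

end

noncomputable section

set_option linter.unusedSectionVars false

/-! ## The homomorphism from the Serre presentation -/

namespace CyclicQuiver

open Polynomial

variable {N : ℕ} [NeZero N]

attribute [local instance] LieRing.ofAssociativeRing

variable (N) in
/-- The homomorphism from the free Lie algebra sending `e_i` to the matrix unit of degree one. -/
def rhoFree : FreeLieAlgebra ℂ (ZMod N) →ₗ⁅ℂ⁆ LoopMat N :=
  FreeLieAlgebra.lift ℂ fun i => unit i 1

theorem rhoFree_of (i : ZMod N) : rhoFree N (FreeLieAlgebra.of ℂ i) = unit i 1 :=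
  FreeLieAlgebra.lift_of_apply _ i

theorem rhoFree_ad_pow (x y : FreeLieAlgebra ℂ (ZMod N)) (k : ℕ) :
    rhoFree N ((LieAlgebra.ad ℂ _ x ^ k) y) =
      (LieAlgebra.ad ℂ (LoopMat N) (rhoFree N x) ^ k) (rhoFree N y) := by
  induction k with
  | zero => rfl
  | succ k ih =>
    rw [pow_succ', pow_succ', Module.End.mul_apply, Module.End.mul_apply, LieAlgebra.ad_apply,
      LieAlgebra.ad_apply, LieHom.map_lie, ih]

theorem ne_add_one (hN : 2 ≤ N) (i : ZMod N) : i ≠ i + 1 := by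
  intro h
  have := (add_natCast_eq_iff (i := i) (l := 1)).1 (by rw [Nat.cast_one]; exact h.symm)
  have := Nat.le_of_dvd one_pos this
  omega

theorem unit_one_mul_unit_one (i j : ZMod N) :
    unit i 1 * unit j 1 = if i = j + 1 then unit j 2 else 0 := by
  rw [unit_mul_unit, Nat.cast_one]

/-- The square of u_{i,1} is zero, and each missing arrow between i and j kills one of the two mixed
products. The exponent is 1 plus the number of arrows joining i and j; it is 3 only for N = 2. -/
theorem ad_pow_unit (hN : 2 ≤ N) {i j : ZMod N} (hij : i ≠ j) :
    (LieAlgebra.ad ℂ (LoopMat N) (unit i 1) ^ (1 - cartan (ZMod N) i j).toNat) (unit j 1) = 0 := by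
  have hk : (1 - cartan (ZMod N) i j).toNat =
      1 + (if j = i + 1 then 1 else 0) + (if i = j + 1 then 1 else 0) := by
    rw [cartan, eulerMatrix, eulerMatrix, card_hom, card_hom, if_neg hij, if_neg hij.symm]
    split_ifs <;> rfl
  have huu : unit i 1 * unit i 1 = 0 := by
    rw [unit_one_mul_unit_one, if_neg (ne_add_one hN i)]
  have huu' : ∀ A : LoopMat N, unit i 1 * (unit i 1 * A) = 0 := fun A => by
    rw [← mul_assoc, huu, zero_mul]
  have huv := unit_one_mul_unit_one i j
  have hvu := unit_one_mul_unit_one j i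
  rw [hk]
  by_cases h1 : j = i + 1
  · by_cases h2 : i = j + 1
    · rw [if_pos h1, if_pos h2]
      simp only [pow_succ, pow_zero, one_mul, Module.End.mul_apply, LieAlgebra.ad_apply, Ring.lie_def,
        mul_sub, sub_mul, mul_assoc, huu, huu', mul_neg, neg_mul,
        mul_zero, neg_zero, sub_zero, zero_sub]
    · rw [if_neg h2] at huv
      have huv' : ∀ A : LoopMat N, unit i 1 * (unit j 1 * A) = 0 := fun A => by
        rw [← mul_assoc, huv, zero_mul]
      rw [if_pos h1, if_neg h2]
      simp only [pow_succ, pow_zero, one_mul, Module.End.mul_apply, LieAlgebra.ad_apply, Ring.lie_def,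
        mul_sub, sub_mul, mul_assoc, huu, huv, huv', mul_zero, zero_mul, sub_zero]
  · rw [if_neg h1] at hvu
    by_cases h2 : i = j + 1
    · have hvu' : ∀ A : LoopMat N, unit j 1 * (unit i 1 * A) = 0 := fun A => by
        rw [← mul_assoc, hvu, zero_mul]
      rw [if_neg h1, if_pos h2]
      simp only [pow_succ, pow_zero, one_mul, Module.End.mul_apply, LieAlgebra.ad_apply, Ring.lie_def,
        mul_assoc, huu', hvu, mul_zero, sub_zero]
    · rw [if_neg h2] at huv
      rw [if_neg h1, if_neg h2]
      simp only [pow_succ, pow_zero, one_mul, LieAlgebra.ad_apply, Ring.lie_def, huv, hvu, sub_zero]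

theorem serreIdeal_le_ker (hN : 2 ≤ N) : serreIdeal (ZMod N) ≤ (rhoFree N).ker := by
  rw [serreIdeal, LieSubmodule.lieSpan_le]
  rintro z ⟨i, j, hij, rfl⟩
  rw [SetLike.mem_coe, LieHom.mem_ker, rhoFree_ad_pow, rhoFree_of, rhoFree_of, ad_pow_unit hN hij]

/-- The homomorphism from `𝔫(C_N)` to loop matrices. -/
def rho (hN : 2 ≤ N) : NSerre (ZMod N) →ₗ[ℂ] LoopMat N :=
  (serreIdeal (ZMod N)).toSubmodule.liftQ (rhoFree N : FreeLieAlgebra ℂ (ZMod N) →ₗ[ℂ] LoopMat N)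
    fun _ hx => serreIdeal_le_ker hN hx

theorem rho_mk (hN : 2 ≤ N) (x : FreeLieAlgebra ℂ (ZMod N)) :
    rho hN (LieSubmodule.Quotient.mk x) = rhoFree N x := rfl

theorem rho_gen (hN : 2 ≤ N) (i : ZMod N) : rho hN (NSerre.gen i) = unit i 1 := rhoFree_of i

theorem rho_lie (hN : 2 ≤ N) (x y : NSerre (ZMod N)) : rho hN ⁅x, y⁆ = ⁅rho hN x, rho hN y⁆ := by
  obtain ⟨x, rfl⟩ := LieSubmodule.Quotient.surjective_mk' _ x
  obtain ⟨y, rfl⟩ := LieSubmodule.Quotient.surjective_mk' _ y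
  rw [LieSubmodule.Quotient.mk'_apply, LieSubmodule.Quotient.mk'_apply,
    ← LieSubmodule.Quotient.mk_bracket, rho_mk, rho_mk, rho_mk, LieHom.map_lie]

/-- A Lie subalgebra containing the images of the generators receives the whole map, because the map
from the free Lie algebra factors through it. -/
theorem rho_mem (hN : 2 ≤ N) (K : LieSubalgebra ℂ (LoopMat N)) (hK : ∀ i, unit i 1 ∈ K) (x : NSerre (ZMod N)) :
    rho hN x ∈ K := by
  obtain ⟨x, rfl⟩ := LieSubmodule.Quotient.surjective_mk' _ x
  have h : rhoFree N = K.incl.comp (FreeLieAlgebra.lift ℂ fun i => (⟨unit i 1, hK i⟩ : K)) := by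
    refine FreeLieAlgebra.hom_ext fun i => ?_
    rw [rhoFree_of, LieHom.comp_apply,
      FreeLieAlgebra.lift_of_apply]
    rfl
  rw [LieSubmodule.Quotient.mk'_apply, rho_mk, h, LieHom.comp_apply]
  exact Subtype.mem _

variable (N) in
/-- The image of `𝔫^ε(C_N)` in the loop matrices. -/
def loopRange : LieSubalgebra ℂ (LoopMat N) where
  __ := LinearMap.range (loopMap N)
  lie_mem' := by
    rintro _ _ ⟨x, rfl⟩ ⟨y, rfl⟩
    exact ⟨bracketEps N x y, loopMap_bracketEps x y⟩

theorem arc_one (i : ZMod N) : arc i 1 = Pi.single i 1 := by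
  rw [show 1 = 0 + 1 from rfl, arc_succ, arc_zero, zero_add, Nat.cast_zero, add_zero]

theorem not_dvd_one (hN : 2 ≤ N) : ¬ N ∣ 1 := fun h => by
  have := Nat.le_of_dvd one_pos h
  omega

theorem loopMap_eTil_single (hN : 2 ≤ N) (i : ZMod N) : loopMap N (eTil N (Pi.single i 1)) = unit i 1 := by
  rw [← arc_one, loopMap_eTil_arc i (not_dvd_one hN), Nat.div_eq_of_lt hN, pow_zero, one_smul]

theorem rho_mem_range (hN : 2 ≤ N) (x : NSerre (ZMod N)) : rho hN x ∈ LinearMap.range (loopMap N) :=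
  rho_mem hN (loopRange N) (fun i => ⟨_, loopMap_eTil_single hN i⟩) x

/-- The homomorphism `Ξ^ε`. -/
def xiEps (hN : 2 ≤ N) : NSerre (ZMod N) →ₗ[ℂ] NEps N :=
  (LinearEquiv.ofInjective (loopMap N) loopMap_injective).symm ∘ₗ
    (rho hN).codRestrict _ (rho_mem_range hN)

theorem loopMap_xiEps (hN : 2 ≤ N) (x : NSerre (ZMod N)) : loopMap N (xiEps hN x) = rho hN x :=
  congrArg Subtype.val ((LinearEquiv.ofInjective (loopMap N) loopMap_injective).apply_symm_apply
    ⟨rho hN x, rho_mem_range hN x⟩)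

theorem xiEps_gen (hN : 2 ≤ N) (i : ZMod N) : xiEps hN (NSerre.gen i) = eTil N (Pi.single i 1) :=
  loopMap_injective (by rw [loopMap_xiEps, rho_gen, loopMap_eTil_single hN])

theorem xiEps_lie (hN : 2 ≤ N) (x y : NSerre (ZMod N)) :
    xiEps hN ⁅x, y⁆ = bracketEps N (xiEps hN x) (xiEps hN y) :=
  loopMap_injective (by
    rw [loopMap_xiEps, rho_lie, loopMap_bracketEps, loopMap_xiEps, loopMap_xiEps])

theorem lie_mem_range_rho (hN : 2 ≤ N) {A B : LoopMat N} (hA : A ∈ LinearMap.range (rho hN))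
    (hB : B ∈ LinearMap.range (rho hN)) : ⁅A, B⁆ ∈ LinearMap.range (rho hN) := by
  obtain ⟨x, rfl⟩ := hA
  obtain ⟨y, rfl⟩ := hB
  exact ⟨⁅x, y⁆, rho_lie hN x y⟩

/-- Arcs are lengthened one step at a time by bracketing with a generator. When the arc closes up,
both products survive and only differences of neighbouring closed arcs are obtained; a further
bracket with a generator opens them again. -/
theorem unit_mem_range_rho (hN : 2 ≤ N) (l : ℕ) :
    (¬ N ∣ l + 1 → ∀ i, unit i (l + 1) ∈ LinearMap.range (rho hN)) ∧
    (N ∣ l + 1 → ∀ i, unit (i + 1) (l + 1) - unit i (l + 1) ∈ LinearMap.range (rho hN)) := by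
  have hgen : ∀ i, unit i 1 ∈ LinearMap.range (rho hN) := fun i => ⟨_, rho_gen hN i⟩
  induction l with
  | zero => exact ⟨fun _ => hgen, fun h => absurd h (not_dvd_one hN)⟩
  | succ l ih =>
    by_cases hl : N ∣ l + 1
    · have hl' : ((l + 1 : ℕ) : ZMod N) = 0 := (ZMod.natCast_eq_zero_iff _ _).2 hl
      refine ⟨fun _ i => ?_, fun h => absurd ((Nat.dvd_add_right hl).1 h) (not_dvd_one hN)⟩
      have h1 := lie_mem_range_rho hN (hgen i) (ih.2 hl (i - 1))
      rw [sub_add_cancel, Ring.lie_def, mul_sub, sub_mul, unit_mul_unit, unit_mul_unit, unit_mul_unit,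
        unit_mul_unit, hl', Nat.cast_one, add_zero, add_zero, if_pos rfl,
        if_neg (c := i = i - 1), if_neg (ne_add_one hN i), sub_zero, zero_sub, sub_neg_eq_add,
        add_comm 1] at h1
      -- The second product survives only if i - 1 = i + 1, that is for N = 2, and then doubles the
      -- result.
      · split_ifs at h1
        · rw [← two_smul ℂ] at h1
          exact ((Submodule.smul_mem_iff _ two_ne_zero).1 h1)
        · rwa [add_zero] at h1
      · intro h
        exact ne_add_one hN (i - 1) (by rw [sub_add_cancel]; exact h.symm)
    · have h1 := fun i => lie_mem_range_rho hN (hgen (i + ((l + 1 : ℕ) : ZMod N))) (ih.1 hl i)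
      simp only [Ring.lie_def, unit_mul_unit, if_true, Nat.cast_one] at h1
      refine ⟨fun h i => ?_, fun h i => ?_⟩
      · have h2 := h1 i
        rw [if_neg, sub_zero] at h2
        · exact h2
        · intro e
          refine h (add_natCast_eq_iff (i := i).1 ?_)
          rw [Nat.cast_succ, ← add_assoc]
          exact e.symm
      · have h2 := h1 (i + 1)
        have h3 : i + 1 + ((l + 1 : ℕ) : ZMod N) = i := by
          rw [add_assoc, add_comm 1, ← Nat.cast_succ]
          exact add_natCast_eq_iff.2 h
        rw [h3, if_pos rfl, add_comm 1] at h2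
        exact h2

theorem diagMat_single (n : ℕ) (i : ZMod N) : diagMat n (Pi.single i 1) =
    ((-1 : ℂ) ^ (n + 1)) • (unit i (n * N) - unit (i + 1) (n * N)) := by
  have h0 : ((n * N : ℕ) : ZMod N) = 0 := (ZMod.natCast_eq_zero_iff _ _).2 (dvd_mul_left N n)
  change ((-1 : ℂ) ^ (n + 1)) • (Matrix.diagonal fun k => C ((Pi.single i 1 : ZMod N → ℂ) k -
    (Pi.single i 1 : ZMod N → ℂ) (k - 1)) * (X : ℂ[X]) ^ (n * N)) = _
  congr 1
  rw [unit, unit, h0, add_zero, add_zero]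
  ext1 a b
  rw [Matrix.diagonal_apply, Matrix.sub_apply, Matrix.single_apply, Matrix.single_apply,
    Pi.single_apply, Pi.single_apply]
  by_cases hab : a = b
  · subst hab
    simp only [sub_eq_iff_eq_add, if_true, and_self, eq_comm (b := a)]
    split_ifs <;> simp
  · rw [if_neg hab, if_neg fun h => hab (h.1.symm.trans h.2),
      if_neg fun h => hab (h.1.symm.trans h.2), sub_zero]

theorem loopMap_mem_range_rho (hN : 2 ≤ N) (x : NEps N) : loopMap N x ∈ LinearMap.range (rho hN) := by
  have hpos : ∀ {l : ℕ}, l ≠ 0 → ∃ m, l = m + 1 := fun h => Nat.exists_eq_succ_of_ne_zero h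
  rw [loopMap_apply]
  refine add_mem (sum_mem fun α _ => Submodule.smul_mem _ _ ?_) (sum_mem fun n _ => ?_)
  · obtain ⟨α, hα⟩ := α
    obtain ⟨i, l, hl, rfl⟩ := hα.exists_arc
    rw [rootMat_arc i hl]
    obtain ⟨m, rfl⟩ := hpos (l := l) (by rintro rfl; exact hl (dvd_zero N))
    exact Submodule.smul_mem _ _ ((unit_mem_range_rho hN m).1 hl i)
  · obtain ⟨h, hh⟩ := Submodule.Quotient.mk_surjective _ (x.2 n)
    change imagMat n (x.2 n) ∈ _
    rw [← hh, imagMat_mk, LinearMap.pi_apply_eq_sum_univ]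
    refine sum_mem fun i _ => Submodule.smul_mem _ _ ?_
    rw [show (fun j => if i = j then (1 : ℂ) else 0) = Pi.single i 1 by
      funext j; rw [Pi.single_apply]; simp only [eq_comm], diagMat_single]
    obtain ⟨m, hm⟩ := hpos (l := n * N) (Nat.mul_pos n.2 (by omega)).ne'
    refine Submodule.smul_mem _ _ ?_
    rw [← neg_sub, hm]
    exact neg_mem ((unit_mem_range_rho hN m).2 (hm ▸ dvd_mul_left N n) i)

theorem xiEps_surjective (hN : 2 ≤ N) : Function.Surjective (xiEps hN) := by
  intro x
  obtain ⟨z, hz⟩ := loopMap_mem_range_rho hN x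
  exact ⟨z, loopMap_injective (by rw [loopMap_xiEps, hz])⟩

end CyclicQuiver

end

noncomputable section

set_option linter.unusedSectionVars false

/-! ## The map to the Hall algebra -/

section NStar

variable {I : Type} [Quiver.{0} I] [Fintype I] [DecidableEq I]

theorem charFun_eq_of_isIso {M M' : QRep I} (h : M.IsIso M') : charFun M = charFun M' := by
  funext α x
  by_cases hx : x.rep.IsIso M
  · rw [charFun, charFun, if_pos hx, if_pos (hx.trans h)]
  · rw [charFun, charFun, if_neg hx, if_neg fun h' => hx (h'.trans h.symm)]

theorem hallBracket_mem_nStar {f g : HallFun I} (hf : f ∈ nStar I) (hg : g ∈ nStar I) :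
    hallBracket f g ∈ nStar I := by
  rw [nStar, Submodule.mem_sInf] at *
  exact fun S hS => hS.2 f (hf S hS) g (hg S hS)

theorem charFun_simple_mem_nStar (i : I) : charFun (QRep.simple i) ∈ nStar I := (nStar.gen i).2

theorem nStar_le {S : Submodule ℂ (HallFun I)} (h1 : ∀ i, charFun (QRep.simple i) ∈ S)
    (h2 : ∀ f ∈ S, ∀ g ∈ S, hallBracket f g ∈ S) : nStar I ≤ S := sInf_le ⟨h1, h2⟩

end NStar

namespace CyclicQuiver

open Polynomial

variable {N : ℕ} [NeZero N]

attribute [local instance] LieRing.ofAssociativeRing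

theorem simple_isIso_P (i : ZMod N) : (QRep.simple i).IsIso (P i 1) := by
  have hdim : ∀ k, (QRep.simple i).dim k = if k = i then 1 else 0 := by
    intro k
    change Module.finrank ℂ (PLift (k = i) → ℂ) = _
    classical
    rw [Module.finrank_fintype_fun_eq_card]
    split_ifs with h
    · exact Fintype.card_eq_one_iff.2 ⟨⟨h⟩, fun _ => rfl⟩
    · exact Fintype.card_eq_zero_iff.2 ⟨fun x => h x.down⟩
  have hnil : (QRep.simple i).IsNilp := by
    refine ⟨1, fun a b p hp => ?_⟩
    cases p with
    | nil => simp at hp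
    | cons p h => exact LinearMap.zero_comp _
  refine (QRep.isIso_P_iff hnil one_pos).2 ⟨?_, fun _ => (1 : ℂ), fun h => ?_⟩
  · rw [QRep.finrank_tot]
    simp [hdim]
  · rw [Nat.sub_self, pow_zero, Module.End.one_apply] at h
    have h1 : (fun _ : PLift (i = i) => (1 : ℂ)) = 0 :=
      (Pi.single_eq_same (M := fun k => (QRep.simple i).V k) i _).symm.trans (congrFun h i)
    exact one_ne_zero (congrFun h1 ⟨rfl⟩)

theorem charFun_simple (i : ZMod N) : charFun (QRep.simple i) = hallMap N (unit i 1) := by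
  rw [hallMap_unit i one_ne_zero, E, charFun_eq_of_isIso (simple_isIso_P i)]

theorem hallMap_bracketEps (x y : NEps N) : hallMap N (loopMap N (bracketEps N x y)) =
    hallBracket (hallMap N (loopMap N x)) (hallMap N (loopMap N y)) := by
  rw [loopMap_bracketEps, hallMap_lie (loopMap_mem_gradedMat x) (loopMap_mem_gradedMat y)]

theorem hallMap_rho_mem (hN : 2 ≤ N) (z : NSerre (ZMod N)) : hallMap N (rho hN z) ∈ nStar (ZMod N) := by
  -- The intersection with the range of `loopMap` is needed because compatibility with brackets is
  -- known only for graded matrices.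
  let K : LieSubalgebra ℂ (LoopMat N) :=
    { LinearMap.range (loopMap N) ⊓ (nStar (ZMod N)).comap (hallMap N) with
      lie_mem' := by
        rintro _ _ ⟨⟨x, rfl⟩, hx⟩ ⟨⟨y, rfl⟩, hy⟩
        refine ⟨⟨bracketEps N x y, loopMap_bracketEps x y⟩, ?_⟩
        change hallMap N _ ∈ nStar (ZMod N)
        rw [← loopMap_bracketEps, hallMap_bracketEps]
        exact hallBracket_mem_nStar hx hy }
  refine (rho_mem hN K (fun i => ⟨⟨_, loopMap_eTil_single hN i⟩, ?_⟩) z).2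
  change hallMap N (unit i 1) ∈ nStar (ZMod N)
  rw [← charFun_simple]
  exact charFun_simple_mem_nStar i

theorem hallMap_loopMap_mem (hN : 2 ≤ N) (x : NEps N) : hallMap N (loopMap N x) ∈ nStar (ZMod N) := by
  obtain ⟨z, hz⟩ := loopMap_mem_range_rho hN x
  rw [← hz]
  exact hallMap_rho_mem hN z

/-- The homomorphism `Ξ^*`. -/
def xiStar (hN : 2 ≤ N) : NSerre (ZMod N) →ₗ[ℂ] nStar (ZMod N) :=
  (hallMap N ∘ₗ rho hN).codRestrict _ (hallMap_rho_mem hN)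

/-- The homomorphism `Ξ`. -/
def xiMap (hN : 2 ≤ N) : NEps N →ₗ[ℂ] nStar (ZMod N) :=
  (hallMap N ∘ₗ loopMap N).codRestrict _ (hallMap_loopMap_mem hN)

theorem xiStar_coe (hN : 2 ≤ N) (z : NSerre (ZMod N)) :
    (xiStar hN z : HallFun (ZMod N)) = hallMap N (rho hN z) := rfl

theorem xiMap_coe (hN : 2 ≤ N) (x : NEps N) :
    (xiMap hN x : HallFun (ZMod N)) = hallMap N (loopMap N x) := rfl

theorem xiMap_comp (hN : 2 ≤ N) : xiMap hN ∘ₗ xiEps hN = xiStar hN :=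
  LinearMap.ext fun z => Subtype.ext (by
    rw [LinearMap.comp_apply, xiMap_coe, loopMap_xiEps, xiStar_coe])

theorem xiStar_gen (hN : 2 ≤ N) (i : ZMod N) : xiStar hN (NSerre.gen i) = nStar.gen i :=
  Subtype.ext (by rw [xiStar_coe, rho_gen, ← charFun_simple]; rfl)

theorem xiMap_bracketEps (hN : 2 ≤ N) (x y : NEps N) :
    (xiMap hN (bracketEps N x y) : HallFun (ZMod N)) =
      hallBracket (xiMap hN x).1 (xiMap hN y).1 := hallMap_bracketEps x y

theorem xiStar_lie (hN : 2 ≤ N) (x y : NSerre (ZMod N)) :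
    (xiStar hN ⁅x, y⁆ : HallFun (ZMod N)) = hallBracket (xiStar hN x).1 (xiStar hN y).1 := by
  rw [← xiMap_comp, LinearMap.comp_apply, xiEps_lie, xiMap_bracketEps]
  rfl

/-- The image contains the E_i and is closed under the bracket, so it contains 𝔫* by minimality. -/
theorem xiMap_surjective (hN : 2 ≤ N) : Function.Surjective (xiMap hN) := by
  have h : nStar (ZMod N) ≤ LinearMap.range (hallMap N ∘ₗ loopMap N) := by
    refine nStar_le (fun i => ⟨eTil N (Pi.single i 1), ?_⟩) ?_
    · rw [LinearMap.comp_apply, loopMap_eTil_single hN, charFun_simple]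
    · rintro _ ⟨x, rfl⟩ _ ⟨y, rfl⟩
      exact ⟨bracketEps N x y, hallMap_bracketEps x y⟩
  rintro ⟨f, hf⟩
  obtain ⟨x, hx⟩ := h hf
  exact ⟨x, Subtype.ext hx⟩

end CyclicQuiver

/-! ## Constructibility -/

section Constructible

variable {I : Type} [Quiver.{0} I] {α : I → ℕ}

theorem isConstructibleSet_iUnion {κ : Type} (s : Finset κ) (S : κ → Set (RepSpace I α))
    (h : ∀ k ∈ s, IsConstructibleSet (S k)) : IsConstructibleSet (⋃ k ∈ s, S k) := by
  classical
  induction s using Finset.induction_on with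
  | empty =>
    simp only [Finset.notMem_empty, Set.iUnion_of_empty, Set.iUnion_empty]
    exact BooleanSubalgebra.bot_mem
  | insert k s hk ih =>
    rw [Finset.set_biUnion_insert]
    exact BooleanSubalgebra.sup_mem (h k (Finset.mem_insert_self k s))
      (ih fun j hj => h j (Finset.mem_insert_of_mem hj))

theorem IsConstructibleSet.compl {S : Set (RepSpace I α)} (h : IsConstructibleSet S) :
    IsConstructibleSet Sᶜ := BooleanSubalgebra.compl_mem h

end Constructible

namespace CyclicQuiver

variable {N : ℕ} [NeZero N] {α : ZMod N → ℕ}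

theorem ite_eq_single {κ : Type} [DecidableEq κ] (t : κ) :
    (fun j => if t = j then (1 : ℂ) else 0) = Pi.single t 1 := by
  funext j
  rw [Pi.single_apply]
  simp only [eq_comm]

theorem exists_eval_tot_pow (i : ZMod N) (r : Fin (α i)) (n : ℕ) (b : ZMod N) (s : Fin (α b)) :
    ∃ p : MvPolynomial (Σ a b : ZMod N, (a ⟶ b) × Fin (α b) × Fin (α a)) ℂ,
      ∀ x : RepSpace (ZMod N) α,
        (((stdRep x).tot ^ n) (Pi.single i (Pi.single r (1 : ℂ) : Fin (α i) → ℂ)) b :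
          Fin (α b) → ℂ) s = MvPolynomial.eval (entries x) p := by
  induction n generalizing b with
  | zero =>
    refine ⟨MvPolynomial.C ((Pi.single i (Pi.single r (1 : ℂ)) :
      ∀ k, Fin (α k) → ℂ) b s), fun x => ?_⟩
    rw [MvPolynomial.eval_C]
    rfl
  | succ n ih =>
    choose p hp using ih (b - 1)
    let h : (b - 1) ⟶ b := ⟨(sub_add_cancel b 1).symm⟩
    refine ⟨∑ t, p t * MvPolynomial.X ⟨b - 1, b, h, s, t⟩, fun x => ?_⟩
    rw [pow_succ', Module.End.mul_apply]
    set v : ∀ k, Fin (α k) → ℂ :=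
      ((stdRep x).tot ^ n) (Pi.single i (Pi.single r (1 : ℂ) : Fin (α i) → ℂ)) with hv
    change (x (b - 1) b h (v (b - 1))) s = _
    rw [LinearMap.pi_apply_eq_sum_univ (x (b - 1) b h), Finset.sum_apply, map_sum]
    refine Finset.sum_congr rfl fun t _ => ?_
    rw [map_mul, MvPolynomial.eval_X, ← hp t x, Pi.smul_apply, smul_eq_mul, entries]
    rw [ite_eq_single]

/-- By `isIso_P_iff` the class of P_{i,l} is cut out by the nonvanishing of some entry of t^(l-1),
and these entries are polynomials in the matrix entries. -/
theorem exists_constructible_isIso_P (i : ZMod N) (hα : 0 < ∑ k, α k) :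
    ∃ S : Set (RepSpace (ZMod N) α), IsConstructibleSet S ∧
      ∀ x : NilSpace α, x.rep.IsIso (P i (∑ k, α k)) ↔ x.1 ∈ S := by
  choose p hp using fun q : Fin (α i) × Σ b : ZMod N, Fin (α b) =>
    exists_eval_tot_pow i q.1 (∑ k, α k - 1) q.2.1 q.2.2
  refine ⟨⋃ q ∈ (Finset.univ : Finset (Fin (α i) × Σ b : ZMod N, Fin (α b))),
    {x | MvPolynomial.eval (entries x) (p q) = 0}ᶜ, ?_, fun x => ?_⟩
  · exact isConstructibleSet_iUnion _ _ fun q _ =>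
      IsConstructibleSet.compl (BooleanSubalgebra.subset_closure ⟨p q, rfl⟩)
  · have hx : x.rep.IsNilp := x.2
    rw [QRep.isIso_P_iff hx hα, QRep.finrank_tot]
    have hdim : ∑ k, x.rep.dim k = ∑ k, α k :=
      Finset.sum_congr rfl fun k _ => Module.finrank_fin_fun ℂ
    rw [hdim]
    simp only [true_and, Set.mem_iUnion, Finset.mem_univ, exists_prop, Set.mem_compl_iff,
      Set.mem_ofPred_eq, ← hp]
    constructor
    · rintro ⟨u, hu⟩
      by_contra hcon
      push Not at hcon
      refine hu ?_
      have hz : ∀ r : Fin (α i), (x.rep.tot ^ (∑ k, α k - 1))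
          (Pi.single i (Pi.single r (1 : ℂ) : Fin (α i) → ℂ)) = 0 := fun r =>
        funext fun b => funext fun s => hcon (r, ⟨b, s⟩)
      let L : (Fin (α i) → ℂ) →ₗ[ℂ] ∀ k, x.rep.V k :=
        (x.rep.tot ^ (∑ k, α k - 1)) ∘ₗ LinearMap.single ℂ (fun k => x.rep.V k) i
      refine (LinearMap.pi_apply_eq_sum_univ L u).trans ?_
      refine Finset.sum_eq_zero fun r _ => ?_
      rw [ite_eq_single]
      exact (congrArg _ (hz r)).trans (smul_zero _)
    · rintro ⟨⟨r, b, s⟩, h⟩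
      exact ⟨(Pi.single r (1 : ℂ) : Fin (α i) → ℂ), fun h0 => h (congrFun (congrFun h0 b) s)⟩

open Polynomial in
theorem finite_symb_ne_zero (A : LoopMat N) : {q : ZMod N × ℕ | symb q.1 q.2 A ≠ 0}.Finite := by
  refine (Finset.finite_toSet (Finset.univ ×ˢ (Finset.univ.biUnion fun i : ZMod N =>
    Finset.univ.biUnion fun j : ZMod N => (A j i).support))).subset ?_
  rintro ⟨i, l⟩ h
  simp only [Finset.coe_product, Set.mem_prod, Finset.mem_coe, Finset.mem_univ, true_and,
    Finset.mem_biUnion]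
  exact ⟨i, i + (l : ZMod N), mem_support_iff.2 h⟩

/-- Only finitely many degrees occur because a loop matrix has finitely many coefficients. Each
level set is a finite union of classes of uniserials or, for the value 0, the complement of one. -/
theorem hallMap_mem_hallSpace (A : LoopMat N) : hallMap N A ∈ hallSpace (ZMod N) := by
  have hval : ∀ (α : ZMod N → ℕ) (x : NilSpace α), hallMap N A α x ≠ 0 → 0 < ∑ k, α k ∧
      ∃ i, x.rep.IsIso (P i (∑ k, α k)) := fun α x h => exists_isIso_of_comb_ne_zero h
  have hiso : ∀ (α : ZMod N → ℕ) (x : NilSpace α) i, 0 < ∑ k, α k →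
      x.rep.IsIso (P i (∑ k, α k)) → hallMap N A α x = symb i (∑ k, α k) A :=
    fun α x i h0 h => comb_of_isIso _ h0 rfl h
  refine ⟨((finite_symb_ne_zero A).image fun q => arc q.1 q.2).subset ?_, ?_, fun α => ⟨?_, ?_⟩⟩
  · intro α h
    obtain ⟨x, hx⟩ := Function.ne_iff.1 h
    obtain ⟨h0, i, hi⟩ := hval α x hx
    rw [hiso α x i h0 hi] at hx
    refine ⟨(i, ∑ k, α k), hx, ?_⟩
    change arc i (∑ k, α k) = α
    rw [← P_dim, ← hi.dim_eq]
    exact funext fun k => Module.finrank_fin_fun ℂ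
  · intro α x y hxy
    by_cases hx : hallMap N A α x = 0
    · by_contra hne
      obtain ⟨h0, i, hi⟩ := hval α y (fun h => hne (hx.trans h.symm))
      exact hne ((hiso α x i h0 (hxy.trans hi)).trans (hiso α y i h0 hi).symm)
    · obtain ⟨h0, i, hi⟩ := hval α x hx
      rw [hiso α x i h0 hi, hiso α y i h0 (hxy.symm.trans hi)]
  · refine ((Set.finite_range fun i : ZMod N => symb i (∑ k, α k) A).insert 0).subset ?_
    rintro _ ⟨x, rfl⟩
    by_cases hx : hallMap N A α x = 0
    · exact Or.inl hx
    · obtain ⟨h0, i, hi⟩ := hval α x hx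
      exact Or.inr ⟨i, (hiso α x i h0 hi).symm⟩
  · intro c
    rcases Nat.eq_zero_or_pos (∑ k, α k) with h0 | h0
    · have hz : ∀ x : NilSpace α, hallMap N A α x = 0 := by
        intro x
        by_contra hx
        exact (hval α x hx).1.ne' h0
      by_cases hc : c = 0
      · exact ⟨Set.univ, BooleanSubalgebra.top_mem, fun x => by simp [hz, hc]⟩
      · exact ⟨∅, BooleanSubalgebra.bot_mem, fun x => by simp [hz, Ne.symm hc]⟩
    · choose S hS hSx using fun i => exists_constructible_isIso_P (α := α) i h0
      have hU : ∀ (p : ZMod N → Prop) [DecidablePred p],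
          IsConstructibleSet (⋃ i ∈ Finset.univ.filter p, S i) := fun p _ =>
        isConstructibleSet_iUnion _ _ fun i _ => hS i
      classical
      by_cases hc : c = 0
      · refine ⟨_, (hU fun i => symb i (∑ k, α k) A ≠ 0).compl, fun x => ?_⟩
        simp only [hc, Set.mem_compl_iff, Set.mem_iUnion, Finset.mem_filter, Finset.mem_univ,
          true_and, exists_prop, ← hSx]
        constructor
        · rintro hx ⟨i, hne, hi⟩
          exact hne (by rw [← hiso α x i h0 hi, hx])
        · intro h
          by_contra hx
          obtain ⟨-, i, hi⟩ := hval α x hx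
          exact h ⟨i, by rwa [← hiso α x i h0 hi], hi⟩
      · refine ⟨_, hU fun i => symb i (∑ k, α k) A = c, fun x => ?_⟩
        simp only [Set.mem_iUnion, Finset.mem_filter, Finset.mem_univ, true_and, exists_prop, ← hSx]
        constructor
        · intro hx
          obtain ⟨-, i, hi⟩ := hval α x (by rwa [hx])
          exact ⟨i, by rw [← hiso α x i h0 hi, hx], hi⟩
        · rintro ⟨i, hi, hx⟩
          rw [hiso α x i h0 hx, hi]

theorem nStar_subset_hallSpace (hN : 2 ≤ N) :
    (nStar (ZMod N) : Set (HallFun (ZMod N))) ⊆ hallSpace (ZMod N) := by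
  intro f hf
  obtain ⟨x, hx⟩ := xiMap_surjective hN ⟨f, hf⟩
  change (⟨f, hf⟩ : nStar (ZMod N)).1 ∈ _
  rw [← hx]
  exact hallMap_mem_hallSpace _

end CyclicQuiver

end

noncomputable section

set_option linter.unusedSectionVars false

/-! ## Signs and indecomposables of imaginary dimension -/

theorem QRep.IsIso.isIndec {I : Type} [Quiver.{0} I] {M M' : QRep I} (h : M.IsIso M')
    (hM : M'.IsIndec) : M.IsIndec := by
  refine ⟨h.dim_eq ▸ hM.1, fun U W hU hW hUW => ?_⟩
  obtain ⟨φ, hφ⟩ := h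
  have hst : ∀ U : ∀ i, Submodule ℂ (M.V i), M.IsStable U →
      M'.IsStable fun i => Submodule.orderIsoMapComap (φ i) (U i) := by
    rintro U hU a b f _ ⟨u, hu, rfl⟩
    exact ⟨M.map f u, hU a b f hu, hφ a b f u⟩
  rcases hM.2 _ _ (hst U hU) (hst W hW)
    (fun i => (Submodule.orderIsoMapComap (φ i)).isCompl_iff.1 (hUW i)) with h | h
  · exact Or.inl fun i => (map_eq_bot_iff (Submodule.orderIsoMapComap (φ i))).1 (h i)
  · exact Or.inr fun i => (map_eq_bot_iff (Submodule.orderIsoMapComap (φ i))).1 (h i)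

namespace CyclicQuiver

open Polynomial

variable {N : ℕ} [NeZero N]

theorem isIso_P_of_dim_eq_arc {M : QRep (ZMod N)} (hM : M.IsNilp) (h : M.IsIndec) {j : ZMod N} {m : ℕ}
    (hdim : M.dim = arc j m) : 0 < m ∧ ∃ i, M.IsIso (P i m) ∧ arc i m = arc j m := by
  obtain ⟨i, l, hl, hi⟩ := h.exists_isIso_P hM
  have h1 : arc i l = arc j m := by rw [← P_dim, ← hi.dim_eq, hdim]
  have h2 : l = m := by rw [← sum_arc i l, h1, sum_arc]
  subst h2
  exact ⟨hl, i, hi, h1⟩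

/-- The number (N - 1 + l)/N is l/N rounded up: the number of visits of the arc to its starting
vertex, and hence the dimension of the endomorphism space. -/
theorem xiSign_of_isIso_P {M : QRep (ZMod N)} {i : ZMod N} {l : ℕ} (hl : 0 < l)
    (h : M.IsIso (P i l)) : M.xiSign = (-1) ^ (1 + (N - 1 + l) / N) := by
  have hN : 0 < N := Nat.pos_of_ne_zero (NeZero.ne N)
  have h1 := arc_start_sub i l (N - 1)
  rw [Nat.sub_add_cancel hN, ZMod.natCast_self, sub_zero, Nat.div_eq_of_lt (by omega), add_zero,
    add_comm l] at h1
  rw [QRep.xiSign, QRep.finrank_endSpace h hl, h1]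

theorem xiSign_real {M : QRep (ZMod N)} {i : ZMod N} {l : ℕ} (hl : ¬ N ∣ l) (h : M.IsIso (P i l)) :
    M.xiSign = (-1) ^ (l / N) := by
  have hN : 0 < N := Nat.pos_of_ne_zero (NeZero.ne N)
  obtain ⟨l, rfl⟩ : ∃ m, l = m + 1 :=
    Nat.exists_eq_succ_of_ne_zero (by rintro rfl; exact hl (dvd_zero N))
  rw [xiSign_of_isIso_P l.succ_pos h, show N - 1 + (l + 1) = l + N by omega,
    Nat.add_div_right _ hN, pred_div hl, add_comm 1, add_assoc, pow_add]
  norm_num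

theorem xiSign_imag {M : QRep (ZMod N)} {i : ZMod N} (n : ℕ+) (h : M.IsIso (P i (n * N))) :
    M.xiSign = (-1) ^ ((n : ℕ) + 1) := by
  have hN : 0 < N := Nat.pos_of_ne_zero (NeZero.ne N)
  rw [xiSign_of_isIso_P (Nat.mul_pos n.2 hN) h, Nat.add_mul_div_right _ _ hN,
    Nat.div_eq_of_lt (by omega), zero_add, add_comm 1]
  rfl

theorem arc_imag (i : ZMod N) (n : ℕ) : arc i (n * N) = imag N n := by rw [mul_comm, arc_mul]

theorem exists_isIso_P_imag {M : QRep (ZMod N)} (hM : M.IsNilp) (h : M.IsIndec) (n : ℕ+)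
    (hdim : M.dim = imag N n) : ∃ i, M.IsIso (P i (n * N)) := by
  obtain ⟨-, i, hi, -⟩ := isIso_P_of_dim_eq_arc hM h (j := 0) (hdim.trans (arc_imag 0 n).symm)
  exact ⟨i, hi⟩

theorem xiSign_eq_of_dim_arc {M : QRep (ZMod N)} (hM : M.IsNilp) (h : M.IsIndec) {i : ZMod N} {l : ℕ}
    (hl : ¬ N ∣ l) (hdim : M.dim = arc i l) : M.xiSign = (-1) ^ (l / N) := by
  obtain ⟨-, j, hj, -⟩ := isIso_P_of_dim_eq_arc hM h hdim
  exact xiSign_real hl hj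

theorem dim_rep {α : ZMod N → ℕ} (x : NilSpace α) : x.rep.dim = α :=
  funext fun _ => Module.finrank_fin_fun ℂ

theorem isIndec_of_isIso_P {α : ZMod N → ℕ} {x : NilSpace α} {i : ZMod N} {l : ℕ} (hl : 0 < l)
    (h : x.rep.IsIso (P i l)) : x.rep.IsIndec := h.isIndec (QRep.P_isIndec i hl)

theorem mul_pos_imag (n : ℕ+) : 0 < (n : ℕ) * N :=
  Nat.mul_pos n.2 (Nat.pos_of_ne_zero (NeZero.ne N))

theorem exists_nilSpace_P (n : ℕ+) (i : ZMod N) :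
    ∃ y : NilSpace (imag N n), y.rep.IsIso (P i (n * N)) :=
  exists_nilSpace (P_isNilp i _) (by rw [P_dim, arc_imag])

/-- The vertex `i` with `M ≅ P i (n * N)`, for a class `[M]` of indecomposables. -/
def indecVertex (n : ℕ+) : IndecClass (imag N n) → ZMod N :=
  Quot.lift (fun x => (exists_isIso_P_imag x.1.2 x.2 n (dim_rep x.1)).choose) fun x y hxy =>
    (QRep.eq_of_isIso_P (mul_pos_imag n)
      (exists_isIso_P_imag x.1.2 x.2 n (dim_rep x.1)).choose_spec
      (hxy.trans (exists_isIso_P_imag y.1.2 y.2 n (dim_rep y.1)).choose_spec)).1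

theorem isIso_indecVertex (n : ℕ+) (x : {x : NilSpace (imag N n) // x.rep.IsIndec}) :
    x.1.rep.IsIso (P (indecVertex n (Quot.mk _ x)) (n * N)) :=
  (exists_isIso_P_imag x.1.2 x.2 n (dim_rep x.1)).choose_spec

/-- The indecomposables of dimension `nδ` are classified by the vertices. -/
def indecEquiv (n : ℕ+) : IndecClass (imag N n) ≃ ZMod N where
  toFun := indecVertex n
  invFun i := Quot.mk _ ⟨(exists_nilSpace_P n i).choose,
    isIndec_of_isIso_P (mul_pos_imag n) (exists_nilSpace_P n i).choose_spec⟩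
  left_inv := by
    rintro ⟨x⟩
    exact Quot.sound ((exists_nilSpace_P n _).choose_spec.trans (isIso_indecVertex n x).symm)
  right_inv i := (QRep.eq_of_isIso_P (mul_pos_imag n) (isIso_indecVertex n _)
    (exists_nilSpace_P n i).choose_spec).1

theorem extendIndec_imag (n : ℕ+) (φ : IndecClass (imag N n) → ℂ) :
    extendIndec (imag N n) φ = comb fun i l => if l = n * N then φ ((indecEquiv n).symm i) else 0 := by
  funext β x
  by_cases hx : ∃ i, x.rep.IsIso (P i (n * N))
  · obtain ⟨i, hi⟩ := hx
    obtain rfl : β = imag N n := by rw [← dim_rep x, hi.dim_eq, P_dim, arc_imag]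
    have hind := isIndec_of_isIso_P (mul_pos_imag n) hi
    rw [comb_of_isIso _ (mul_pos_imag n) (sum_of_isIso_P hi) hi, if_pos rfl, extendIndec,
      dif_pos ⟨rfl, hind⟩]
    refine congrArg φ ((Equiv.eq_symm_apply _).2 ?_)
    exact (QRep.eq_of_isIso_P (mul_pos_imag n) (isIso_indecVertex n ⟨x, hind⟩) hi).1
  · rw [extendIndec, dif_neg]
    · by_contra hne
      obtain ⟨h0, i, hi⟩ := exists_isIso_of_comb_ne_zero (Ne.symm hne)
      rw [comb_of_isIso _ h0 rfl hi] at hne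
      by_cases hl : ∑ k, β k = n * N
      · exact hx ⟨i, hl ▸ hi⟩
      · rw [if_neg hl] at hne
        exact hne rfl
    · rintro ⟨rfl, h⟩
      exact hx (exists_isIso_P_imag x.2 h n (dim_rep x))

/-- Take partial sums of g starting at the vertex 0. The hypothesis says exactly that they close up
after one turn, which is the case d = 0 below. -/
theorem exists_eq_sub_shift {g : ZMod N → ℂ} (hg : ∑ k, g k = 0) :
    ∃ h : ZMod N → ℂ, ∀ k, h k - h (k - 1) = g k := by
  have hval : ∑ m ∈ Finset.range N, g m = 0 := by
    rw [← hg]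
    refine Finset.sum_bij (fun m _ => (m : ZMod N)) (fun _ _ => Finset.mem_univ _) ?_ ?_ fun _ _ => rfl
    · intro a ha b hb hab
      rw [Finset.mem_range] at ha hb
      have := (ZMod.natCast_eq_natCast_iff' a b N).1 hab
      rwa [Nat.mod_eq_of_lt ha, Nat.mod_eq_of_lt hb] at this
    · intro b _
      exact ⟨b.val, Finset.mem_range.2 (ZMod.val_lt b), ZMod.natCast_zmod_val b⟩
  have hN : 0 < N := Nat.pos_of_ne_zero (NeZero.ne N)
  refine ⟨fun k => ∑ m ∈ Finset.range (k.val + 1), g m, fun k => ?_⟩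
  obtain ⟨d, hd, rfl⟩ : ∃ d, d < N ∧ (d : ZMod N) = k :=
    ⟨k.val, ZMod.val_lt k, ZMod.natCast_zmod_val k⟩
  beta_reduce
  rw [ZMod.val_natCast_of_lt hd]
  rcases Nat.eq_zero_or_pos d with rfl | hd0
  · have h1 : ((0 : ℕ) : ZMod N) - 1 = ((N - 1 : ℕ) : ZMod N) := by
      rw [Nat.cast_sub hN]
      simp
    rw [h1, ZMod.val_natCast_of_lt (by omega), Nat.sub_add_cancel hN, hval]
    simp
  · obtain ⟨d, rfl⟩ := Nat.exists_eq_succ_of_ne_zero hd0.ne'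
    rw [Nat.succ_eq_add_one, Nat.cast_add, Nat.cast_one, add_sub_cancel_right,
      ZMod.val_natCast_of_lt (by omega), Finset.sum_range_succ]
    simp

theorem hallMap_diagMat (n : ℕ) (h : ZMod N → ℂ) : hallMap N (diagMat n h) =
    comb fun i l => if l = n * N then (-1) ^ (n + 1) * (h i - h (i - 1)) else 0 := by
  simp only [hallMap_apply, symb_diagMat]

/-- The value of the image of h(n) at P_{i,nN} is (-1)^(n+1) (h_i - h_{i-1}). Such functions of i
have sum zero, and by `exists_eq_sub_shift` every function with sum zero is of this form. -/
theorem xiMap_imagIncl_range (hN : 2 ≤ N) (n : ℕ+) :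
    {f : HallFun (ZMod N) | ∃ h, (xiMap hN (imagIncl N n h) : HallFun (ZMod N)) = f} =
      {f : HallFun (ZMod N) | ∃ φ : IndecClass (imag N n) → ℂ,
        ∑ᶠ t, φ t = 0 ∧ f = extendIndec (imag N n) φ} := by
  have hsum : ∀ φ : IndecClass (imag N n) → ℂ,
      ∑ᶠ t, φ t = ∑ i, φ ((indecEquiv n).symm i) := by
    intro φ
    rw [← finsum_eq_sum_of_fintype]
    exact (finsum_comp_equiv (indecEquiv n).symm).symm
  ext f
  constructor
  · rintro ⟨h, rfl⟩
    obtain ⟨h, rfl⟩ := Submodule.Quotient.mk_surjective _ h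
    refine ⟨fun t => (-1) ^ ((n : ℕ) + 1) * (h (indecEquiv n t) - h (indecEquiv n t - 1)), ?_, ?_⟩
    · rw [hsum]
      simp only [Equiv.apply_symm_apply, ← Finset.mul_sum, Finset.sum_sub_distrib]
      rw [sum_shift h 1, sub_self, mul_zero]
    · rw [xiMap_coe, loopMap_imagIncl, imagMat_mk, hallMap_diagMat, extendIndec_imag]
      simp only [Equiv.apply_symm_apply]
  · rintro ⟨φ, hφ, rfl⟩
    rw [hsum] at hφ
    obtain ⟨h, hh⟩ := exists_eq_sub_shift
      (g := fun i => (-1) ^ ((n : ℕ) + 1) * φ ((indecEquiv n).symm i)) (by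
        rw [← Finset.mul_sum, hφ, mul_zero])
    refine ⟨Submodule.Quotient.mk h, ?_⟩
    rw [xiMap_coe, loopMap_imagIncl, imagMat_mk, hallMap_diagMat, extendIndec_imag]
    simp only [hh]
    congr 1
    funext i l
    rw [← mul_assoc, ← mul_pow, neg_one_mul, neg_neg, one_pow, one_mul]

end CyclicQuiver

end

open CyclicQuiver in
theorem mainTheorem8 (N : ℕ) [NeZero N] (hN : 2 ≤ N) :
    -- the positive real roots are the vectors `α_{i,l}` with `N ∤ l`, each exactly once
    (∀ (i : ZMod N) (l : ℕ), ¬ N ∣ l → IsRealRoot (arc i l)) ∧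
    (∀ α : ZMod N → ℕ, IsRealRoot α → ∃! p : ZMod N × ℕ, ¬ N ∣ p.2 ∧ arc p.1 p.2 = α) ∧
    -- the representations `P_{i,l}`
    (∀ (i : ZMod N) (l : ℕ), 0 < l →
      (P i l).IsNilp ∧ (P i l).IsIndec ∧ (P i l).dim = arc i l) ∧
    -- the values of the sign `ξ`
    (∀ (i : ZMod N) (l : ℕ), ¬ N ∣ l → ∀ M : QRep (ZMod N), M.IsNilp → M.IsIndec →
      M.dim = arc i l → M.xiSign = (-1) ^ (l / N)) ∧
    (∀ n : ℕ+, ∀ M : QRep (ZMod N), M.IsNilp → M.IsIndec →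
      M.dim = imag N n → M.xiSign = (-1) ^ ((n : ℕ) + 1)) ∧
    -- there are exactly `N` indecomposables of dimension `nδ`, namely the `P_{i,nN}`
    (∀ n : ℕ+, Nat.card (IndecClass (imag N n)) = N ∧
      (∀ i : ZMod N, (P i (n * N)).dim = imag N n) ∧
      ∀ M : QRep (ZMod N), M.IsNilp → M.IsIndec → M.dim = imag N n →
        ∃! i : ZMod N, M.IsIso (P i (n * N))) ∧
    -- `𝔫*(C_N)` consists of constructible invariant functions
    (nStar (ZMod N) : Set (HallFun (ZMod N))) ⊆ hallSpace (ZMod N) ∧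
    -- the homomorphisms `Ξ^ε` and `Ξ^*` on `𝔫(C_N)`
    ∃ (ΞEps : NSerre (ZMod N) →ₗ[ℂ] NEps N) (ΞStar : NSerre (ZMod N) →ₗ[ℂ] nStar (ZMod N)),
      (∀ i, ΞEps (NSerre.gen i) = eTil N (Pi.single i 1)) ∧
      (∀ x y, ΞEps ⁅x, y⁆ = bracketEps N (ΞEps x) (ΞEps y)) ∧
      Function.Surjective ΞEps ∧
      (∀ i, ΞStar (NSerre.gen i) = nStar.gen i) ∧
      (∀ x y, (ΞStar ⁅x, y⁆ : HallFun (ZMod N)) = hallBracket (ΞStar x).1 (ΞStar y).1) ∧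
      -- the homomorphism `Ξ = Ξ^* ∘ (Ξ^ε)⁻¹` (unique, since `Ξ^ε` is onto)
      ∃ Ξ : NEps N →ₗ[ℂ] nStar (ZMod N),
        Ξ ∘ₗ ΞEps = ΞStar ∧
        Function.Surjective Ξ ∧
        (∀ x y, (Ξ (bracketEps N x y) : HallFun (ZMod N)) = hallBracket (Ξ x).1 (Ξ y).1) ∧
        (∀ (i : ZMod N) (l : ℕ), ¬ N ∣ l →
          (Ξ (eTil N (arc i l)) : HallFun (ZMod N)) = ETilde i l ∧
          ETilde i l = (-1 : ℂ) ^ (l / N) • E i l) ∧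
        (∀ (i : ZMod N) (n : ℕ+),
          (Ξ (hEl N (Pi.single i 1) n) : HallFun (ZMod N)) =
            ETilde i (n * N) - ETilde (i + 1) (n * N)) ∧
        (∀ n : ℕ+,
          {f : HallFun (ZMod N) | ∃ h, (Ξ (imagIncl N n h) : HallFun (ZMod N)) = f} =
          {f : HallFun (ZMod N) | ∃ φ : IndecClass (imag N n) → ℂ,
            ∑ᶠ t, φ t = 0 ∧ f = extendIndec (imag N n) φ}) := by
  have hN0 : 0 < N := by omega
  have hPP : ∀ (i : ZMod N) (l : ℕ), (P i l).IsIso (P i l) := fun i l => QRep.IsIso.refl _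
  have hE : ∀ (i : ZMod N) (l : ℕ), ¬ N ∣ l → ETilde i l = (-1 : ℂ) ^ (l / N) • E i l :=
    fun i l hl => by rw [ETilde, xiSign_real hl (hPP i l)]
  refine ⟨fun i l hl => isRealRoot_arc i hl, fun α hα => ?_,
    fun i l hl => ⟨P_isNilp i l, QRep.P_isIndec i hl, P_dim i l⟩,
    fun i l hl M hM hI hd => xiSign_eq_of_dim_arc hM hI hl hd, fun n M hM hI hd => ?_,
    fun n => ⟨?_, fun i => by rw [P_dim, arc_imag], fun M hM hI hd => ?_⟩,
    nStar_subset_hallSpace hN, xiEps hN, xiStar hN, xiEps_gen hN, xiEps_lie hN,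
    xiEps_surjective hN, xiStar_gen hN, xiStar_lie hN, xiMap hN, xiMap_comp hN,
    xiMap_surjective hN, xiMap_bracketEps hN, fun i l hl => ⟨?_, hE i l hl⟩, fun i n => ?_,
    xiMap_imagIncl_range hN⟩
  · obtain ⟨i, l, hl, h⟩ := hα.exists_arc
    refine ⟨(i, l), ⟨hl, h⟩, ?_⟩
    rintro ⟨j, m⟩ ⟨hm, h'⟩
    obtain ⟨rfl, rfl⟩ := arc_injective hm (h'.trans h.symm)
    rfl
  · obtain ⟨i, hi⟩ := exists_isIso_P_imag hM hI n hd
    exact xiSign_imag n hi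
  · rw [Nat.card_congr (indecEquiv n), Nat.card_eq_fintype_card, ZMod.card]
  · obtain ⟨i, hi⟩ := exists_isIso_P_imag hM hI n hd
    exact ⟨i, hi, fun j hj => (QRep.eq_of_isIso_P (mul_pos_imag n) hj hi).1⟩
  · rw [hE i l hl, xiMap_coe, loopMap_eTil_arc i hl, map_smul,
      hallMap_unit i (by rintro rfl; exact hl (dvd_zero N))]
  · rw [xiMap_coe, loopMap_hEl, diagMat_single, map_smul, map_sub,
      hallMap_unit _ (mul_pos_imag n).ne', hallMap_unit _ (mul_pos_imag n).ne', smul_sub, ETilde,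
      ETilde, xiSign_imag n (hPP i _), xiSign_imag n (hPP (i + 1) _)]
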